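/- **Setting.** Let $G=(V,E)$ be a directed graph ($E\subseteq V\times V$) with real edge weights $w$, $n=|V|\ge 2$ vertices and $m=|E|\ge 1$ edges; an edge is negative if its weight is negative. A potential $\phi:V\to\mathbb R$ gives the new weights $w_\phi(u,v)=w(u,v)+\phi(u)-\phi(v)$; it is *valid* if $w_\phi(u,v)\ge 0$ for every edge with $w(u,v)\ge 0$. For $j\in\mathbb N$ let $d^j_\phi(s,t)\in\mathbb R\cup\{\infty\}$ be the minimum $w_\phi$-weight of an $s$–$t$ walk that uses at most $j$ edges that are negative under the original weights $w$ (negative edges are frozen, and counted with multiplicity). The $j$-hop degree-betweenness of $(s,t)$ under $\phi$ is $\sum\{\deg^+(v) : v\in V,\ d^j_\phi(s,v)+d^j_\phi(v,t)<0\}$, where $\deg^+$ is the out-degree. An SSSP oracle, given a directed graph with real edge weights and a source, either returns the distances from the source to all vertices ($\infty$ if unreachable) or reports a negative cycle; it reports a negative cycle only if the graph has one, and must report one if one is reachable from the source. The machine is a randomized real RAM with words of $O(\log(n+h))$ bits, fair random bits, and exact real arithmetic $+,-,\times,/$ and comparisons at unit cost. The input is the edge list of $G$ together with $n,m,h_0,h,\alpha$.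 **Lemma.** For every constant $c\in\mathbb N$ there is a randomized algorithm that, given such a graph $G$, integers $h\ge h_0\ge 1$, a real $0<\alpha\le 1$ and access to an SSSP oracle, either declares that $G$ contains a negative cycle (and then it does) or outputs a valid potential $\phi$, and such that, with probability at least $1-n^{-c}$, if it outputs a potential $\phi$, then * for all $s,t\in V$, the $2h_0$-hop degree-betweenness of $(s,t)$ under $\phi$ is at most $m/(h/h_0)^{1/\alpha}$, and * for all $s,t\in V$ and all integers $\eta\in[h_0,h]$, the $(\eta+h_0)$-hop degree-betweenness of $(s,t)$ under $\phi$ is at most $m/(h/\eta)$. The algorithm makes at most one oracle call, on an instance with $O(mh_0)$ edges and $O((h/h_0)^{1/\alpha}\log n)$ negative edges, and takes $\tilde O(mh)$ additional time, that is, at most $C\,mh\,(\log n)^k$ steps, an oracle call counting as one step. The constants $C$ and $k$ and those hidden in the $O(\cdot)$ depend only on $c$; the resource bounds, the correctness of a declared negative cycle and the validity of $\phi$ hold for all outcomes of the random bits. -/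

import Mathlib

open scoped ENNReal

noncomputable section

namespace HopBw

/-! ### Weighted directed graphs, hop distances, degree-betweenness -/

/-- A finite directed graph with real edge weights, given by a list of edges.  It is a simple
directed graph (`E ⊆ V × V`): self-loops are allowed, parallel edges are not. -/
structure WDigraph where
  /-- the number of vertices -/
  n : ℕ
  /-- the number of edges -/
  m : ℕ
  src : Fin m → Fin n
  dst : Fin m → Fin n
  wt : Fin m → ℝ
  simple : Function.Injective fun e => (src e, dst e)

namespace WDigraph

variable (G : WDigraph)

/-- The edge list `p` is a walk from `u` to `v` (the empty list is a walk from `u` to `u`). -/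
def IsWalk : Fin G.n → List (Fin G.m) → Fin G.n → Prop
  | u, [], v => u = v
  | u, e :: p, v => G.src e = u ∧ IsWalk (G.dst e) p v

/-- The set of negative edges. -/
def negEdges : Set (Fin G.m) := {e | G.wt e < 0}

/-- The number of negative edges of a graph. -/
def numNeg : ℕ := G.negEdges.ncard

open Classical in
/-- The number of negative edges on a walk, with multiplicity. -/
def hops (p : List (Fin G.m)) : ℕ := p.countP fun e => decide (e ∈ G.negEdges)

/-- The weight `w_φ(u, v) = w(u, v) + φ(u) - φ(v)` of an edge after reweighting by `φ`. -/
def rewt (φ : Fin G.n → ℝ) (e : Fin G.m) : ℝ := G.wt e + φ (G.src e) - φ (G.dst e)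

/-- A potential is valid if no non-negative edge becomes negative. -/
def Valid (φ : Fin G.n → ℝ) : Prop := ∀ e, 0 ≤ G.wt e → 0 ≤ G.rewt φ e

/-- There is a (simple, directed) cycle of negative weight. -/
def HasNegCycle : Prop :=
  ∃ (u : Fin G.n) (p : List (Fin G.m)),
    G.IsWalk u p u ∧ (p.map G.src).Nodup ∧ (p.map G.wt).sum < 0

/-- The distance from `s` to `t`: `⊤` if `t` is not reachable from `s`, and `⊥` if the walk weights
are unbounded below. -/
def dist (s t : Fin G.n) : EReal :=
  ⨅ (p : List (Fin G.m)) (_ : G.IsWalk s p t), (((p.map G.wt).sum : ℝ) : EReal)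

/-- The `h`-hop distance `d^h_φ(s, t)`: the least weight, with respect to `w_φ`, of a walk from `s`
to `t` with at most `h` negative edges (`⊤` if there is none).  The negative edges are frozen: they
are those of the original weights `w`. -/
def hopDist (φ : Fin G.n → ℝ) (h : ℕ) (s t : Fin G.n) : EReal :=
  ⨅ (p : List (Fin G.m)) (_ : G.IsWalk s p t ∧ G.hops p ≤ h),
    (((p.map (G.rewt φ)).sum : ℝ) : EReal)

/-- The out-degree of a vertex. -/
def outDeg (v : Fin G.n) : ℕ := {e | G.src e = v}.ncard

open Classical in
/-- The `h`-hop degree-betweenness of `(s, t)` after reweighting by `φ`: the sum of the out-degrees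
of all `v` with `d^h_φ(s, v) + d^h_φ(v, t) < 0`. -/
def degBetweenness (φ : Fin G.n → ℝ) (h : ℕ) (s t : Fin G.n) : ℕ :=
  ∑ v : Fin G.n with G.hopDist φ h s v + G.hopDist φ h v t < 0, G.outDeg v

end WDigraph

/-! ### Single-source shortest path oracles -/

/-- An oracle receives a graph and a source and answers either `none` ("negative cycle") or a
vector of distances. -/
abbrev Oracle := (H : WDigraph) → Fin H.n → Option (Fin H.n → EReal)

/-- The oracle solves single-source shortest paths: it reports a negative cycle only if there is
one, and a reported vector consists of the true distances from the source, none of which is `-∞`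
(so that it has to report a negative cycle if one is reachable from the source). -/
def Oracle.Correct (O : Oracle) : Prop :=
  ∀ (H : WDigraph) (s : Fin H.n),
    (O H s = none → H.HasNegCycle) ∧
    ∀ d, O H s = some d → ∀ v, d v = H.dist s v ∧ d v ≠ ⊥

/-! ### The machine: a randomized real RAM with an oracle

A program is a finite piece of code.  The memory has integer registers, real registers, integer
arrays and real arrays.  Integers stored by the program must fit into a machine word, real numbers
are handled exactly by `+`, `-`, `*`, `/` and `<` (no rounding of reals to integers), and random
bits are drawn one at a time.  Assignments, tests, coin flips and oracle calls take one step each.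
(Expressions have constant size in a fixed program.) -/

/-- A memory configuration. -/
structure State where
  /-- integer registers -/
  ireg : ℕ → ℕ
  /-- real registers -/
  rreg : ℕ → ℝ
  /-- integer arrays: `imem a i` is entry `i` of array `a` -/
  imem : ℕ → ℕ → ℕ
  /-- real arrays -/
  rmem : ℕ → ℕ → ℝ
  /-- the number of random bits used so far -/
  pos : ℕ
  /-- the graphs on which the oracle has been called so far -/
  calls : List WDigraph

/-- Write `k` to integer register `x`. -/
def State.setIReg (σ : State) (x k : ℕ) : State :=
  { σ with ireg := Function.update σ.ireg x k }

/-- Write `r` to real register `x`. -/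
def State.setRReg (σ : State) (x : ℕ) (r : ℝ) : State :=
  { σ with rreg := Function.update σ.rreg x r }

/-- Write `k` to entry `i` of integer array `a`. -/
def State.setIMem (σ : State) (a i k : ℕ) : State :=
  { σ with imem := Function.update σ.imem a (Function.update (σ.imem a) i k) }

/-- Write `r` to entry `i` of real array `a`. -/
def State.setRMem (σ : State) (a i : ℕ) (r : ℝ) : State :=
  { σ with rmem := Function.update σ.rmem a (Function.update (σ.rmem a) i r) }

/-- Integer expressions. -/
inductive IExpr where
  | const (c : ℕ)
  | reg (x : ℕ)
  | load (a : ℕ) (i : IExpr)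
  | add (e f : IExpr)
  | sub (e f : IExpr)
  | mul (e f : IExpr)
  | div (e f : IExpr)

/-- Values of integer expressions (`sub` is truncated subtraction, `div` rounds down). -/
def IExpr.eval (σ : State) : IExpr → ℕ
  | const c => c
  | reg x => σ.ireg x
  | load a i => σ.imem a (i.eval σ)
  | add e f => e.eval σ + f.eval σ
  | sub e f => e.eval σ - f.eval σ
  | mul e f => e.eval σ * f.eval σ
  | div e f => e.eval σ / f.eval σ

/-- Real expressions. -/
inductive RExpr where
  | ofInt (e : IExpr)
  | reg (x : ℕ)
  | load (a : ℕ) (i : IExpr)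
  | add (e f : RExpr)
  | sub (e f : RExpr)
  | mul (e f : RExpr)
  | div (e f : RExpr)

/-- Values of real expressions (a quotient by zero is zero). -/
def RExpr.eval (σ : State) : RExpr → ℝ
  | ofInt e => (e.eval σ : ℝ)
  | reg x => σ.rreg x
  | load a i => σ.rmem a (i.eval σ)
  | add e f => e.eval σ + f.eval σ
  | sub e f => e.eval σ - f.eval σ
  | mul e f => e.eval σ * f.eval σ
  | div e f => e.eval σ / f.eval σ

/-- Tests. -/
inductive BExpr where
  | ilt (e f : IExpr)
  | rlt (e f : RExpr)
  | not (b : BExpr)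
  | and (b c : BExpr)

/-- Truth of tests. -/
def BExpr.eval (σ : State) : BExpr → Prop
  | ilt e f => e.eval σ < f.eval σ
  | rlt e f => e.eval σ < f.eval σ
  | not b => ¬ b.eval σ
  | and b c => b.eval σ ∧ c.eval σ

/-- Programs. -/
inductive Cmd where
  | skip
  /-- assign to an integer register -/
  | iset (x : ℕ) (e : IExpr)
  /-- assign to entry `i` of an integer array -/
  | istore (a : ℕ) (i e : IExpr)
  /-- assign to a real register -/
  | rset (x : ℕ) (e : RExpr)
  /-- assign to entry `i` of a real array -/
  | rstore (a : ℕ) (i : IExpr) (e : RExpr)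
  /-- put a random bit into an integer register -/
  | flip (x : ℕ)
  /-- call the shortest path oracle -/
  | call
  | seq (c d : Cmd)
  | cond (b : BExpr) (c d : Cmd)
  | loop (b : BExpr) (c : Cmd)

/-- The query in memory is the graph `H` with source `s`: numbers of vertices and edges and the
source in integer registers 4, 5, 6, tails and heads of the edges in integer arrays 2, 3, and the
edge weights in real array 1. -/
structure State.Query (σ : State) (H : WDigraph) (s : Fin H.n) : Prop where
  hn : σ.ireg 4 = H.n
  hm : σ.ireg 5 = H.m
  hs : σ.ireg 6 = s
  hsrc : ∀ e : Fin H.m, σ.imem 2 e = H.src e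
  hdst : ∀ e : Fin H.m, σ.imem 3 e = H.dst e
  hwt : ∀ e : Fin H.m, σ.rmem 1 e = H.wt e

open Classical in
/-- The configuration after an oracle call on `H` with answer `r`.  Integer register 7 becomes 1 if
a negative cycle is reported and 0 otherwise.  In the latter case integer array 4 tells
which vertices are reachable and real array 2 holds the distances of the reachable vertices. -/
def State.answer (σ : State) (H : WDigraph) (r : Option (Fin H.n → EReal)) : State :=
  match r with
  | none => { σ with ireg := Function.update σ.ireg 7 1, calls := H :: σ.calls }
  | some d =>
    { σ with
      ireg := Function.update σ.ireg 7 0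
      imem := Function.update σ.imem 4 fun i =>
        if hi : i < H.n then (if d ⟨i, hi⟩ = ⊤ then 0 else 1) else σ.imem 4 i
      rmem := Function.update σ.rmem 2 fun i =>
        if hi : i < H.n then (d ⟨i, hi⟩).toReal else σ.rmem 2 i
      calls := H :: σ.calls }

/-- `Run O ω W c σ τ t`: with oracle `O`, random bits `ω` and largest machine word `W`, the program
`c` started in `σ` halts in `τ` after `t` steps.  A program that stores an integer above `W`, writes
to an address above `W`, or calls the oracle on something that is not a graph with a source gets
stuck (there is no `τ`). -/
inductive Run (O : Oracle) (ω : ℕ → Bool) (W : ℕ) : Cmd → State → State → ℕ → Prop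
  | skip (σ : State) : Run O ω W .skip σ σ 0
  | iset (σ : State) (x : ℕ) (e : IExpr) (he : e.eval σ ≤ W) :
      Run O ω W (.iset x e) σ (σ.setIReg x (e.eval σ)) 1
  | istore (σ : State) (a : ℕ) (i e : IExpr) (hi : i.eval σ ≤ W) (he : e.eval σ ≤ W) :
      Run O ω W (.istore a i e) σ (σ.setIMem a (i.eval σ) (e.eval σ)) 1
  | rset (σ : State) (x : ℕ) (e : RExpr) :
      Run O ω W (.rset x e) σ (σ.setRReg x (e.eval σ)) 1
  | rstore (σ : State) (a : ℕ) (i : IExpr) (e : RExpr) (hi : i.eval σ ≤ W) :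
      Run O ω W (.rstore a i e) σ (σ.setRMem a (i.eval σ) (e.eval σ)) 1
  | flip (σ : State) (x : ℕ) :
      Run O ω W (.flip x) σ { σ.setIReg x (ω σ.pos).toNat with pos := σ.pos + 1 } 1
  | call (σ : State) (H : WDigraph) (s : Fin H.n) (hq : σ.Query H s) :
      Run O ω W .call σ (σ.answer H (O H s)) 1
  | seq {c d : Cmd} {σ τ ρ : State} {t u : ℕ}
      (hc : Run O ω W c σ τ t) (hd : Run O ω W d τ ρ u) :
      Run O ω W (.seq c d) σ ρ (t + u)
  | condTrue {b : BExpr} {c d : Cmd} {σ τ : State} {t : ℕ}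
      (hb : b.eval σ) (hc : Run O ω W c σ τ t) :
      Run O ω W (.cond b c d) σ τ (t + 1)
  | condFalse {b : BExpr} {c d : Cmd} {σ τ : State} {t : ℕ}
      (hb : ¬ b.eval σ) (hd : Run O ω W d σ τ t) :
      Run O ω W (.cond b c d) σ τ (t + 1)
  | loopTrue {b : BExpr} {c : Cmd} {σ τ ρ : State} {t u : ℕ}
      (hb : b.eval σ) (hc : Run O ω W c σ τ t) (hl : Run O ω W (.loop b c) τ ρ u) :
      Run O ω W (.loop b c) σ ρ (t + u + 1)
  | loopFalse {b : BExpr} {c : Cmd} {σ : State} (hb : ¬ b.eval σ) :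
      Run O ω W (.loop b c) σ σ 1

/-- The distribution of an infinite sequence of independent fair coin flips. -/
def coins : MeasureTheory.Measure (ℕ → Bool) :=
  MeasureTheory.Measure.infinitePi fun _ => (PMF.uniformOfFintype Bool).toMeasure

/-! ### Input and output -/

/-- The input: `n`, `m`, `h₀`, `h` in integer registers 0 to 3, `α` in real register 0, tails and
heads of the edges in integer arrays 0 and 1, the edge weights in real array 0; everything else is
zero. -/
def input (G : WDigraph) (h₀ h : ℕ) (α : ℝ) : State where
  ireg x := if x = 0 then G.n else if x = 1 then G.m else if x = 2 then h₀ else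
    if x = 3 then h else 0
  rreg x := if x = 0 then α else 0
  imem a i := if hi : i < G.m then
      (if a = 0 then (G.src ⟨i, hi⟩ : ℕ) else if a = 1 then (G.dst ⟨i, hi⟩ : ℕ) else 0)
    else 0
  rmem a i := if hi : i < G.m then (if a = 0 then G.wt ⟨i, hi⟩ else 0) else 0
  pos := 0
  calls := []

/-- The output declares a negative cycle (integer register 8 is not zero). -/
def State.Declares (σ : State) : Prop := σ.ireg 8 ≠ 0

/-- The potential that is output (in real array 3) if no negative cycle is declared. -/
def State.potential (σ : State) (G : WDigraph) : Fin G.n → ℝ := fun v => σ.rmem 3 v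

/-- The two betweenness guarantees for the graph `G` reweighted by `φ`. -/
structure WDigraph.LowBetweenness (G : WDigraph) (h₀ h : ℕ) (α : ℝ) (φ : Fin G.n → ℝ) :
    Prop where
  first : ∀ s t, (G.degBetweenness φ (2 * h₀) s t : ℝ) ≤ G.m / ((h : ℝ) / h₀) ^ (1 / α)
  second : ∀ s t, ∀ η : ℕ, h₀ ≤ η → η ≤ h →
    (G.degBetweenness φ (η + h₀) s t : ℝ) ≤ G.m / ((h : ℝ) / η)

end HopBw

end

open HopBw

noncomputable section

namespace HopBw

/-! ### Reasoning about programs: frames, total correctness with a step bound, determinism -/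

section StateLemmas
variable (σ : State) (a x i k : ℕ) (r : ℝ)

/-! The program keeps a list of difference constraints `π v ≤ π u + w` ("edges") together with a
potential `π` that satisfies all of them; the restriction of `π` to the vertices of `G` is the
output. Every constraint follows from the edges of `G`: any potential of `G` without negative edges,
repeated periodically on the copies of the vertices, satisfies it (`SoundEdge`). So unsatisfiable
constraints prove that `G` has a negative cycle (`hasNegCycle_of_infeas`).

The constraints come in layered copies of `G` with layers `0, …, 2 L + 1`. A negative edge climbs
one layer, a nonnegative edge stays in its layer, each vertex may climb for free, and layer `L` is
identified with `G`. A walk with at most `L` negative edges thus lifts to a walk that starts or ends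
in the middle layer. For randomly drawn edges `e` a link of weight zero from layer `2 L` back to
layer `0` is added at the tail of `e`. If `p` leads from `s` to this tail and `q` from there to `t`,
each with at most `L` negative edges, then lifting `p`, climbing, using the link, climbing and
lifting `q` gives `π t ≤ π s + w(p) + w(q)`: no such walk through the tail of a drawn edge has
negative reduced weight (`HasCopy.cheap_disjoint`).

The degree-betweenness of `(s, t)` is at most the number of edges whose tail lies on a walk of
original weight below `π t - π s` (the set `cheap`). This set avoids the drawn edges, so it is small
if the drawn edges hit all large sets of this kind. The potential depends on the draws, but the set
depends on it only through the real number `π t - π s`, and it grows with that number. Hence each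
pair has at most one set of each cardinality, and a union bound over `n ^ 2 (m + 1)` sets suffices
(`coins_missed_le`).

Scale `0` has `L = 2 h₀` and about `(h / h₀) ^ (1 / α)` draws up to a logarithmic factor. That can
be too many for separate repairs, so all links are treated by one oracle call on a shifted copy in
which only the links are negative (`query_dist`). Scale `i ≥ 1` has `L = 2 h₀ 2 ^ i` and about `h /
L` draws. Its links are inserted one at a time, each followed by a run of Dijkstra's algorithm that
repairs `π` or shows that the constraints are unsatisfiable (`addEdge_spec`). A repair costs about
`m L`, so each scale costs about `m h`, and there are `O(log n)` scales. If `h ≥ m`, the budget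
allows inserting all edges of `G` in this way, and betweenness vanishes altogether.

Since `n` may exceed `m h`, no loop runs over the vertices: copies are built only at endpoints of
edges, and the queue is a tournament tree whose initial contents, all zero, are already correct. -/

@[simp] theorem State.setIReg_ireg (y : ℕ) :
    (σ.setIReg x k).ireg y = if y = x then k else σ.ireg y := by
  simp [State.setIReg, Function.update_apply]
@[simp] theorem State.setIReg_rreg : (σ.setIReg x k).rreg = σ.rreg := rfl
@[simp] theorem State.setIReg_imem : (σ.setIReg x k).imem = σ.imem := rfl
@[simp] theorem State.setIReg_rmem : (σ.setIReg x k).rmem = σ.rmem := rfl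
@[simp] theorem State.setIReg_pos : (σ.setIReg x k).pos = σ.pos := rfl
@[simp] theorem State.setIReg_calls : (σ.setIReg x k).calls = σ.calls := rfl
@[simp] theorem State.setRReg_ireg : (σ.setRReg x r).ireg = σ.ireg := rfl
@[simp] theorem State.setRReg_rreg (y : ℕ) :
    (σ.setRReg x r).rreg y = if y = x then r else σ.rreg y := by
  simp [State.setRReg, Function.update_apply]
@[simp] theorem State.setRReg_imem : (σ.setRReg x r).imem = σ.imem := rfl
@[simp] theorem State.setRReg_rmem : (σ.setRReg x r).rmem = σ.rmem := rfl
@[simp] theorem State.setRReg_pos : (σ.setRReg x r).pos = σ.pos := rfl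
@[simp] theorem State.setRReg_calls : (σ.setRReg x r).calls = σ.calls := rfl
@[simp] theorem State.setIMem_ireg : (σ.setIMem a i k).ireg = σ.ireg := rfl
@[simp] theorem State.setIMem_rreg : (σ.setIMem a i k).rreg = σ.rreg := rfl
@[simp] theorem State.setIMem_imem (b : ℕ) :
    (σ.setIMem a i k).imem b = if b = a then Function.update (σ.imem a) i k else σ.imem b := by
  simp [State.setIMem, Function.update_apply]
@[simp] theorem State.setIMem_rmem : (σ.setIMem a i k).rmem = σ.rmem := rfl
@[simp] theorem State.setIMem_pos : (σ.setIMem a i k).pos = σ.pos := rfl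
@[simp] theorem State.setIMem_calls : (σ.setIMem a i k).calls = σ.calls := rfl
@[simp] theorem State.setRMem_ireg : (σ.setRMem a i r).ireg = σ.ireg := rfl
@[simp] theorem State.setRMem_rreg : (σ.setRMem a i r).rreg = σ.rreg := rfl
@[simp] theorem State.setRMem_imem : (σ.setRMem a i r).imem = σ.imem := rfl
@[simp] theorem State.setRMem_rmem (b : ℕ) :
    (σ.setRMem a i r).rmem b = if b = a then Function.update (σ.rmem a) i r else σ.rmem b := by
  simp [State.setRMem, Function.update_apply]
@[simp] theorem State.setRMem_pos : (σ.setRMem a i r).pos = σ.pos := rfl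
@[simp] theorem State.setRMem_calls : (σ.setRMem a i r).calls = σ.calls := rfl

end StateLemmas

attribute [simp] IExpr.eval RExpr.eval BExpr.eval

/-! ### Syntactic conditions under which a program leaves a part of the memory alone -/

namespace Cmd

/-- The program does not write integer register `y`. -/
def keepsI (y : ℕ) : Cmd → Bool
  | iset x _ => !(x == y)
  | flip x => !(x == y)
  | call => !(7 == y)
  | seq c d => keepsI y c && keepsI y d
  | cond _ c d => keepsI y c && keepsI y d
  | loop _ c => keepsI y c
  | _ => true

/-- The program does not write real register `y`. -/
def keepsR (y : ℕ) : Cmd → Bool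
  | rset x _ => !(x == y)
  | seq c d => keepsR y c && keepsR y d
  | cond _ c d => keepsR y c && keepsR y d
  | loop _ c => keepsR y c
  | _ => true

/-- The program does not write integer array `y`. -/
def keepsIM (y : ℕ) : Cmd → Bool
  | istore x _ _ => !(x == y)
  | call => !(4 == y)
  | seq c d => keepsIM y c && keepsIM y d
  | cond _ c d => keepsIM y c && keepsIM y d
  | loop _ c => keepsIM y c
  | _ => true

/-- The program does not write real array `y`. -/
def keepsRM (y : ℕ) : Cmd → Bool
  | rstore x _ _ => !(x == y)
  | call => !(2 == y)
  | seq c d => keepsRM y c && keepsRM y d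
  | cond _ c d => keepsRM y c && keepsRM y d
  | loop _ c => keepsRM y c
  | _ => true

/-- The program draws no random bits. -/
def noFlip : Cmd → Bool
  | flip _ => false
  | seq c d => noFlip c && noFlip d
  | cond _ c d => noFlip c && noFlip d
  | loop _ c => noFlip c
  | _ => true

/-- The program does not call the oracle. -/
def noCall : Cmd → Bool
  | call => false
  | seq c d => noCall c && noCall d
  | cond _ c d => noCall c && noCall d
  | loop _ c => noCall c
  | _ => true

/-- The worst-case number of steps of a loop-free program. -/
def cost : Cmd → ℕ
  | skip => 0
  | seq c d => cost c + cost d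
  | cond _ c d => max (cost c) (cost d) + 1
  | loop _ _ => 0
  | _ => 1

end Cmd

/-- What a run of `c` from `σ` to `τ` leaves unchanged. -/
structure Frame (c : Cmd) (σ τ : State) : Prop where
  ireg : ∀ y, c.keepsI y = true → τ.ireg y = σ.ireg y
  rreg : ∀ y, c.keepsR y = true → τ.rreg y = σ.rreg y
  imem : ∀ y, c.keepsIM y = true → τ.imem y = σ.imem y
  rmem : ∀ y, c.keepsRM y = true → τ.rmem y = σ.rmem y
  pos : c.noFlip = true → τ.pos = σ.pos
  calls : c.noCall = true → τ.calls = σ.calls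

section Machine
variable {O : Oracle} {ω : ℕ → Bool} {W : ℕ}

/-- Specifications only have to mention what a program changes; everything else is transported by
this lemma, whose side conditions evaluate to `true` by `rfl` on concrete code. -/
theorem Run.frame {c : Cmd} {σ τ : State} {t : ℕ} (h : Run O ω W c σ τ t) : Frame c σ τ := by
  induction h with
  | skip σ => exact ⟨by simp, by simp, by simp, by simp, by simp, by simp⟩
  | iset σ x e he =>
    refine ⟨fun y hy => ?_, by simp, by simp, by simp, by simp, by simp⟩
    have : x ≠ y := by simpa [Cmd.keepsI] using hy
    simp [this.symm]
  | istore σ a i e hi he =>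
    refine ⟨by simp, by simp, fun y hy => ?_, by simp, by simp, by simp⟩
    have : a ≠ y := by simpa [Cmd.keepsIM] using hy
    simp [this.symm]
  | rset σ x e =>
    refine ⟨by simp, fun y hy => ?_, by simp, by simp, by simp, by simp⟩
    have : x ≠ y := by simpa [Cmd.keepsR] using hy
    simp [this.symm]
  | rstore σ a i e hi =>
    refine ⟨by simp, by simp, by simp, fun y hy => ?_, by simp, by simp⟩
    have : a ≠ y := by simpa [Cmd.keepsRM] using hy
    simp [this.symm]
  | flip σ x =>
    refine ⟨fun y hy => ?_, by simp, by simp, by simp, by simp [Cmd.noFlip], by simp⟩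
    have : x ≠ y := by simpa [Cmd.keepsI] using hy
    simp [this.symm]
  | call σ H s hq =>
    refine ⟨fun y hy => ?_, fun y _ => ?_, fun y hy => ?_, fun y hy => ?_, fun _ => ?_,
      by simp [Cmd.noCall]⟩
    · have : 7 ≠ y := by simpa [Cmd.keepsI] using hy
      unfold State.answer; split <;> simp [Function.update_of_ne this.symm]
    · unfold State.answer; split <;> rfl
    · have : 4 ≠ y := by simpa [Cmd.keepsIM] using hy
      unfold State.answer; split <;> simp [Function.update_of_ne this.symm]
    · have : 2 ≠ y := by simpa [Cmd.keepsRM] using hy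
      unfold State.answer; split <;> simp [Function.update_of_ne this.symm]
    · unfold State.answer; split <;> rfl
  | seq hc hd ihc ihd =>
    constructor <;> intros <;> simp_all [Cmd.keepsI, Cmd.keepsR, Cmd.keepsIM, Cmd.keepsRM,
      Cmd.noFlip, Cmd.noCall, ihc.ireg, ihc.rreg, ihc.imem, ihc.rmem, ihc.pos, ihc.calls,
      ihd.ireg, ihd.rreg, ihd.imem, ihd.rmem, ihd.pos, ihd.calls]
  | condTrue hb hc ih =>
    constructor <;> intros <;> simp_all [Cmd.keepsI, Cmd.keepsR, Cmd.keepsIM, Cmd.keepsRM,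
      Cmd.noFlip, Cmd.noCall, ih.ireg, ih.rreg, ih.imem, ih.rmem, ih.pos, ih.calls]
  | condFalse hb hc ih =>
    constructor <;> intros <;> simp_all [Cmd.keepsI, Cmd.keepsR, Cmd.keepsIM, Cmd.keepsRM,
      Cmd.noFlip, Cmd.noCall, ih.ireg, ih.rreg, ih.imem, ih.rmem, ih.pos, ih.calls]
  | loopTrue hb hc hl ihc ihl =>
    constructor <;> intros <;> simp_all [Cmd.keepsI, Cmd.keepsR, Cmd.keepsIM, Cmd.keepsRM,
      Cmd.noFlip, Cmd.noCall, ihc.ireg, ihc.rreg, ihc.imem, ihc.rmem, ihc.pos, ihc.calls,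
      ihl.ireg, ihl.rreg, ihl.imem, ihl.rmem, ihl.pos, ihl.calls]
  | loopFalse hb => exact ⟨by simp, by simp, by simp, by simp, by simp, by simp⟩

/-- The registers and arrays determine every field of the graph, so an oracle call is deterministic
although its rule mentions an arbitrary graph. -/
theorem State.Query.unique {σ : State} {H H' : WDigraph} {s : Fin H.n} {s' : Fin H'.n}
    (h : σ.Query H s) (h' : σ.Query H' s') (O : Oracle) :
    σ.answer H (O H s) = σ.answer H' (O H' s') := by
  obtain ⟨n, m, src, dst, wt, hs⟩ := H
  obtain ⟨n', m', src', dst', wt', hs'⟩ := H'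
  obtain rfl : n = n' := h.hn.symm.trans h'.hn
  obtain rfl : m = m' := h.hm.symm.trans h'.hm
  obtain rfl : src = src' := funext fun e => Fin.ext ((h.hsrc e).symm.trans (h'.hsrc e))
  obtain rfl : dst = dst' := funext fun e => Fin.ext ((h.hdst e).symm.trans (h'.hdst e))
  obtain rfl : wt = wt' := funext fun e => (h.hwt e).symm.trans (h'.hwt e)
  obtain rfl : s = s' := Fin.ext (h.hs.symm.trans h'.hs)
  rfl

/-- The failure event speaks of any halting run; determinism identifies it with the run constructed
in the correctness proof. -/
theorem Run.unique {c : Cmd} {σ τ : State} {t : ℕ} (h : Run O ω W c σ τ t) :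
    ∀ {τ' : State} {t' : ℕ}, Run O ω W c σ τ' t' → τ' = τ ∧ t' = t := by
  induction h with
  | skip σ => intro τ' t' h'; cases h'; exact ⟨rfl, rfl⟩
  | iset σ x e he => intro τ' t' h'; cases h'; exact ⟨rfl, rfl⟩
  | istore σ a i e hi he => intro τ' t' h'; cases h'; exact ⟨rfl, rfl⟩
  | rset σ x e => intro τ' t' h'; cases h'; exact ⟨rfl, rfl⟩
  | rstore σ a i e hi => intro τ' t' h'; cases h'; exact ⟨rfl, rfl⟩
  | flip σ x => intro τ' t' h'; cases h'; exact ⟨rfl, rfl⟩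
  | call σ H s hq =>
    intro τ' t' h'; cases h' with
    | call _ H' s' hq' => exact ⟨hq'.unique hq O, rfl⟩
  | seq hc hd ihc ihd =>
    intro τ' t' h'; cases h' with
    | seq hc' hd' =>
      obtain ⟨rfl, rfl⟩ := ihc hc'
      obtain ⟨rfl, rfl⟩ := ihd hd'
      exact ⟨rfl, rfl⟩
  | condTrue hb hc ih =>
    intro τ' t' h'; cases h' with
    | condTrue _ hc' => obtain ⟨rfl, rfl⟩ := ih hc'; exact ⟨rfl, rfl⟩
    | condFalse hb' _ => exact absurd hb hb'
  | condFalse hb hc ih =>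
    intro τ' t' h'; cases h' with
    | condFalse _ hc' => obtain ⟨rfl, rfl⟩ := ih hc'; exact ⟨rfl, rfl⟩
    | condTrue hb' _ => exact absurd hb' hb
  | loopTrue hb hc hl ihc ihl =>
    intro τ' t' h'; cases h' with
    | loopTrue _ hc' hl' =>
      obtain ⟨rfl, rfl⟩ := ihc hc'
      obtain ⟨rfl, rfl⟩ := ihl hl'
      exact ⟨rfl, rfl⟩
    | loopFalse hb' => exact absurd hb hb'
  | loopFalse hb =>
    intro τ' t' h'; cases h' with
    | loopTrue hb' _ _ => exact absurd hb' hb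
    | loopFalse _ => exact ⟨rfl, rfl⟩

/-- Total correctness: `c` started in `σ` halts within `T` steps in a state that satisfies `Q`. -/
def Spec (O : Oracle) (ω : ℕ → Bool) (W : ℕ) (c : Cmd) (σ : State) (T : ℕ) (Q : State → Prop) :
    Prop :=
  ∃ τ t, Run O ω W c σ τ t ∧ t ≤ T ∧ Q τ

variable {c d : Cmd} {b : BExpr} {σ : State} {Q R : State → Prop} {T U : ℕ}

theorem Spec.mono (h : Spec O ω W c σ T Q) (hT : T ≤ U) (hQ : ∀ τ, Q τ → R τ) :
    Spec O ω W c σ U R := by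
  obtain ⟨τ, t, hr, ht, hq⟩ := h
  exact ⟨τ, t, hr, ht.trans hT, hQ τ hq⟩

theorem Spec.frame (h : Spec O ω W c σ T Q) :
    Spec O ω W c σ T fun τ => Q τ ∧ Frame c σ τ := by
  obtain ⟨τ, t, hr, ht, hq⟩ := h
  exact ⟨τ, t, hr, ht, hq, hr.frame⟩

/-- Consequence with frame. -/
theorem Spec.conseq (h : Spec O ω W c σ T Q) (hT : T ≤ U)
    (hQ : ∀ τ, Q τ → Frame c σ τ → R τ) : Spec O ω W c σ U R :=
  h.frame.mono hT fun τ hτ => hQ τ hτ.1 hτ.2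

theorem Spec.seq (h : Spec O ω W c σ T Q)
    (h' : ∀ τ, Q τ → Frame c σ τ → Spec O ω W d τ U R) :
    Spec O ω W (.seq c d) σ (T + U) R := by
  obtain ⟨τ, t, hr, ht, hq⟩ := h
  obtain ⟨ρ, u, hr', hu, hR⟩ := h' τ hq hr.frame
  exact ⟨ρ, t + u, .seq hr hr', by omega, hR⟩

theorem Spec.after_run {τ : State} {t : ℕ} (hr : Run O ω W c σ τ t) (ht : t ≤ T)
    (h : Spec O ω W d τ U R) : Spec O ω W (.seq c d) σ (T + U) R := by
  obtain ⟨ρ, u, hr', hu, hR⟩ := h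
  exact ⟨ρ, t + u, .seq hr hr', by omega, hR⟩

theorem Spec.cond (h : b.eval σ → Spec O ω W c σ T Q) (h' : ¬ b.eval σ → Spec O ω W d σ T Q) :
    Spec O ω W (.cond b c d) σ (T + 1) Q := by
  by_cases hb : b.eval σ
  · obtain ⟨τ, t, hr, ht, hq⟩ := h hb
    exact ⟨τ, t + 1, .condTrue hb hr, by omega, hq⟩
  · obtain ⟨τ, t, hr, ht, hq⟩ := h' hb
    exact ⟨τ, t + 1, .condFalse hb hr, by omega, hq⟩

/-- Loops, with an invariant that keeps track of the remaining number of steps. -/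
theorem Spec.loop (I : ℕ → State → Prop)
    (hstep : ∀ B σ, I B σ → b.eval σ →
      ∃ T, Spec O ω W c σ T fun τ => ∃ B', T + B' + 1 ≤ B ∧ I B' τ)
    (hexit : ∀ B σ, I B σ → ¬ b.eval σ → 1 ≤ B ∧ Q σ) :
    ∀ B σ, I B σ → Spec O ω W (.loop b c) σ B Q := by
  intro B
  induction B using Nat.strong_induction_on with
  | _ B ih =>
    intro σ hI
    by_cases hb : b.eval σ
    · obtain ⟨T, τ, t, hr, ht, B', hB', hI'⟩ := hstep B σ hI hb
      obtain ⟨ρ, u, hr', hu, hQ⟩ := ih B' (by omega) τ hI'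
      exact ⟨ρ, t + u + 1, .loopTrue hb hr hr', by omega, hQ⟩
    · obtain ⟨h1, hQ⟩ := hexit B σ hI hb
      exact ⟨σ, 1, .loopFalse hb, h1, hQ⟩

/-- Loops with a counter. -/
theorem Spec.for (I : ℕ → State → Prop) (N T : ℕ)
    (hstep : ∀ i < N, ∀ σ, I i σ → b.eval σ ∧ Spec O ω W c σ T (I (i + 1)))
    (hexit : ∀ σ, I N σ → ¬ b.eval σ) (h0 : I 0 σ) :
    Spec O ω W (.loop b c) σ (N * (T + 1) + 1) (I N) := by
  refine Spec.loop (fun B σ => ∃ i ≤ N, I i σ ∧ B = (N - i) * (T + 1) + 1) ?_ ?_ _ _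
    ⟨0, Nat.zero_le _, h0, by simp⟩
  · rintro B σ ⟨i, hi, hI, rfl⟩ hb
    have hlt : i < N := lt_of_le_of_ne hi fun h => hexit σ (h ▸ hI) hb
    refine ⟨T, (hstep i hlt σ hI).2.mono le_rfl fun τ hτ => ⟨_, ?_, i + 1, hlt, hτ, rfl⟩⟩
    obtain ⟨k, rfl⟩ : ∃ k, N = i + 1 + k := ⟨N - (i + 1), by omega⟩
    have h1 : i + 1 + k - i = k + 1 := by omega
    have h2 : i + 1 + k - (i + 1) = k := by omega
    rw [h1, h2]; ring_nf; omega
  · rintro B σ ⟨i, hi, hI, rfl⟩ hb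
    refine ⟨by omega, ?_⟩
    rcases hi.lt_or_eq with hlt | rfl
    · exact absurd (hstep i hlt σ hI).1 hb
    · exact hI

/-- The weakest precondition of a loop-free program without oracle calls. -/
def wp (ω : ℕ → Bool) (W : ℕ) : Cmd → (State → Prop) → State → Prop
  | .skip, Q, σ => Q σ
  | .iset x e, Q, σ => e.eval σ ≤ W ∧ Q (σ.setIReg x (e.eval σ))
  | .istore a i e, Q, σ => i.eval σ ≤ W ∧ e.eval σ ≤ W ∧ Q (σ.setIMem a (i.eval σ) (e.eval σ))
  | .rset x e, Q, σ => Q (σ.setRReg x (e.eval σ))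
  | .rstore a i e, Q, σ => i.eval σ ≤ W ∧ Q (σ.setRMem a (i.eval σ) (e.eval σ))
  | .flip x, Q, σ => Q { σ.setIReg x (ω σ.pos).toNat with pos := σ.pos + 1 }
  | .call, _, _ => False
  | .seq c d, Q, σ => wp ω W c (wp ω W d Q) σ
  | .cond b c d, Q, σ => (b.eval σ → wp ω W c Q σ) ∧ (¬ b.eval σ → wp ω W d Q σ)
  | .loop _ _, _, _ => False

theorem Spec.of_wp : ∀ {c : Cmd} {Q : State → Prop} {σ : State}, wp ω W c Q σ →
    Spec O ω W c σ c.cost Q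
  | .skip, _, σ, h => ⟨σ, 0, .skip σ, le_rfl, h⟩
  | .iset x e, _, σ, h => ⟨_, 1, .iset σ x e h.1, le_rfl, h.2⟩
  | .istore a i e, _, σ, h => ⟨_, 1, .istore σ a i e h.1 h.2.1, le_rfl, h.2.2⟩
  | .rset x e, _, σ, h => ⟨_, 1, .rset σ x e, le_rfl, h⟩
  | .rstore a i e, _, σ, h => ⟨_, 1, .rstore σ a i e h.1, le_rfl, h.2⟩
  | .flip x, _, σ, h => ⟨_, 1, .flip σ x, le_rfl, h⟩
  | .call, _, _, h => h.elim
  | .seq _ _, _, _, h => Spec.seq (Spec.of_wp h) fun _ hτ _ => Spec.of_wp hτ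
  | .cond _ _ _, _, _, h =>
    Spec.cond (fun hb => (Spec.of_wp (h.1 hb)).mono (le_max_left _ _) fun _ => id)
      fun hb => (Spec.of_wp (h.2 hb)).mono (le_max_right _ _) fun _ => id
  | .loop _ _, _, _, h => h.elim

theorem Spec.of_wp' (h : wp ω W c Q σ) (hT : c.cost ≤ T) : Spec O ω W c σ T Q :=
  (Spec.of_wp h).mono hT fun _ => id

end Machine

infixr:60 " ⨾ " => Cmd.seq

/-! ### A tournament tree of real keys

Real array 5 holds a complete binary tree with `P = 2 ^ p` leaves (`P` is in integer register 10).
Leaf `v` is entry `P + v`, and an inner entry is the minimum of its children. -/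

/-- The entries of the tree are correct, except possibly at `j` and its ancestors. -/
def TreeExcept (P j : ℕ) (key : ℕ → ℝ) : Prop :=
  ∀ i, 1 ≤ i → i < P → (∀ k, j / 2 ^ k ≠ i) → key i = min (key (2 * i)) (key (2 * i + 1))

/-- Every inner entry of the tree is the minimum of its children. -/
def IsTree (P : ℕ) (key : ℕ → ℝ) : Prop :=
  ∀ i, 1 ≤ i → i < P → key i = min (key (2 * i)) (key (2 * i + 1))

theorem IsTree.root_le {P : ℕ} {key : ℕ → ℝ} (h : IsTree P key) :
    ∀ j, 1 ≤ j → j < 2 * P → key 1 ≤ key j := by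
  intro j
  induction j using Nat.strong_induction_on with
  | _ j ih =>
    intro h1 h2
    rcases h1.eq_or_lt with rfl | h1
    · exact le_rfl
    · refine (ih (j / 2) (by omega) (by omega) (by omega)).trans ?_
      rw [h (j / 2) (by omega) (by omega)]
      rcases Nat.even_or_odd' j with ⟨i, rfl | rfl⟩
      · rw [show 2 * i / 2 = i by omega]; exact min_le_left _ _
      · rw [show (2 * i + 1) / 2 = i by omega]; exact min_le_right _ _

/-- A leaf enters only the equation of its parent, so this is the one equation that can fail. -/
theorem IsTree.update {P j : ℕ} {key : ℕ → ℝ} (h : IsTree P key) (hj : P ≤ j) (x : ℝ) :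
    TreeExcept P (j / 2) (Function.update key j x) := by
  intro i h1 h2 h3
  have := h3 0
  simp only [pow_zero, Nat.div_one] at this
  rw [Function.update_of_ne (by omega), Function.update_of_ne (by omega),
    Function.update_of_ne (by omega)]
  exact h i h1 h2

/-- Repairing entry `j` passes the possible defect on to its parent: the proper ancestors of `j` are
`j / 2` and the ancestors of `j / 2`. -/
theorem TreeExcept.update {P j : ℕ} {key : ℕ → ℝ} (h : TreeExcept P j key) (hj : 1 ≤ j) {x : ℝ}
    (hx : x = min (key (2 * j)) (key (2 * j + 1))) :
    TreeExcept P (j / 2) (Function.update key j x) := by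
  intro i h1 h2 h3
  have h0 := h3 0
  simp only [pow_zero, Nat.div_one] at h0
  by_cases hij : i = j
  · subst hij
    rw [Function.update_self, Function.update_of_ne (by omega), Function.update_of_ne (by omega),
      hx]
  · rw [Function.update_of_ne hij, Function.update_of_ne (by omega),
      Function.update_of_ne (by omega)]
    refine h i h1 h2 fun k => ?_
    cases k with
    | zero => simpa using Ne.symm hij
    | succ k => rw [pow_succ', ← Nat.div_div_eq_div_mul]; exact h3 k

/-- Correct the entries of the tree at the index in register 25 and above. -/
def climb : Cmd :=
  .loop (.ilt (.const 0) (.reg 25))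
    (.cond (.rlt (.load 5 (.add (.mul (.const 2) (.reg 25)) (.const 1)))
        (.load 5 (.mul (.const 2) (.reg 25))))
      (.rstore 5 (.reg 25) (.load 5 (.add (.mul (.const 2) (.reg 25)) (.const 1))))
      (.rstore 5 (.reg 25) (.load 5 (.mul (.const 2) (.reg 25)))) ⨾
    .iset 25 (.div (.reg 25) (.const 2)))

/-- Store the value of real register 2 at the leaf whose index is in register 25. -/
def setKey : Cmd :=
  .rstore 5 (.reg 25) (.reg 2) ⨾ .iset 25 (.div (.reg 25) (.const 2)) ⨾ climb

/-- Find a leaf with minimal key; its index is put into register 25. -/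
def descend : Cmd :=
  .iset 25 (.const 1) ⨾
  .loop (.ilt (.reg 25) (.reg 10))
    (.cond (.rlt (.load 5 (.reg 25)) (.load 5 (.mul (.const 2) (.reg 25))))
      (.iset 25 (.add (.mul (.const 2) (.reg 25)) (.const 1)))
      (.iset 25 (.mul (.const 2) (.reg 25))))

section
variable {O : Oracle} {ω : ℕ → Bool} {W P p : ℕ}

theorem climb_spec (hW : P ≤ W) (σ : State) (hj : σ.ireg 25 < P) (hp : σ.ireg 25 < 2 ^ p)
    (ht : TreeExcept P (σ.ireg 25) (σ.rmem 5)) :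
    Spec O ω W climb σ (4 * p + 1) fun τ =>
      IsTree P (τ.rmem 5) ∧ ∀ i, P ≤ i → τ.rmem 5 i = σ.rmem 5 i := by
  refine Spec.loop (fun B τ => ∃ q, B = 4 * q + 1 ∧ τ.ireg 25 < P ∧ τ.ireg 25 < 2 ^ q ∧
    TreeExcept P (τ.ireg 25) (τ.rmem 5) ∧ ∀ i, P ≤ i → τ.rmem 5 i = σ.rmem 5 i) ?_ ?_ _ _
    ⟨p, rfl, hj, hp, ht, fun _ _ => rfl⟩
  · rintro B τ ⟨q, rfl, h1, h2, h3, h4⟩ hb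
    simp only [BExpr.eval, IExpr.eval] at hb
    obtain ⟨q, rfl⟩ : ∃ q', q = q' + 1 :=
      ⟨q - 1, by rcases q with _ | q <;> [simp at h2; simp]; omega⟩
    have hlt : τ.ireg 25 / 2 < 2 ^ q := by rw [pow_succ] at h2; omega
    refine ⟨3, Spec.of_wp' (c := _) ?_ (by simp [Cmd.cost])⟩
    simp only [wp, BExpr.eval, IExpr.eval, RExpr.eval]
    refine ⟨fun h => ⟨by omega, by simp; omega, ?_⟩, fun h => ⟨by omega, by simp; omega, ?_⟩⟩
    all_goals
      refine ⟨4 * q + 1, by omega, q, rfl, by simp; omega, by simpa using hlt, ?_, ?_⟩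
    · simpa using h3.update hb (min_eq_right h.le).symm
    · intro i hi
      simp [Function.update_of_ne (show i ≠ τ.ireg 25 by omega), h4 i hi]
    · simpa using h3.update hb (min_eq_left (not_lt.mp h)).symm
    · intro i hi
      simp [Function.update_of_ne (show i ≠ τ.ireg 25 by omega), h4 i hi]
  · rintro B τ ⟨q, rfl, h1, h2, h3, h4⟩ hb
    simp only [BExpr.eval, IExpr.eval, not_lt, Nat.le_zero] at hb
    -- The climb ends at index `0`, whose only ancestor is itself and which is not an entry of the
    -- tree, so no exception remains.
    refine ⟨by omega, fun i hi hi' => h3 i hi hi' fun k => ?_, h4⟩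
    rw [hb, Nat.zero_div]; omega

theorem setKey_spec (hP : P = 2 ^ p) (hW : 2 * P ≤ W) (σ : State) (v : ℕ) (hv : v < P)
    (hj : σ.ireg 25 = P + v) (ht : IsTree P (σ.rmem 5)) :
    Spec O ω W setKey σ (4 * p + 3) fun τ =>
      IsTree P (τ.rmem 5) ∧ ∀ u, τ.rmem 5 (P + u) =
        Function.update (fun u => σ.rmem 5 (P + u)) v (σ.rreg 2) u := by
  refine (Spec.seq (T := 1) (U := 4 * p + 2)
    (Q := fun τ => τ = σ.setRMem 5 (P + v) (σ.rreg 2)) (Spec.of_wp' ?_ le_rfl) ?_).mono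
    (by omega) fun τ h => h
  · simp only [wp, IExpr.eval, RExpr.eval, hj, and_true]; omega
  rintro τ rfl -
  refine (Spec.seq (T := 1) (U := 4 * p + 1)
    (Q := fun τ => τ = (σ.setRMem 5 (P + v) (σ.rreg 2)).setIReg 25 ((P + v) / 2))
    (Spec.of_wp' ?_ le_rfl) ?_).mono (by omega) fun τ h => h
  · simp only [wp, IExpr.eval, State.setRMem_ireg, hj, and_true]; omega
  rintro τ rfl -
  refine (climb_spec (P := P) (p := p) (by omega) _ ?_ ?_ ?_).mono le_rfl ?_
  · simp; omega
  · rw [← hP]; simp; omega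
  · simpa using ht.update (Nat.le_add_right P v) (σ.rreg 2)
  · rintro τ ⟨h1, h2⟩
    refine ⟨h1, fun u => ?_⟩
    rw [h2 _ (Nat.le_add_right P u)]
    simp [Function.update_apply]

theorem descend_spec (hP : P = 2 ^ p) (hW : 2 * P ≤ W) (σ : State)
    (h10 : σ.ireg 10 = P) (ht : IsTree P (σ.rmem 5)) :
    Spec O ω W descend σ (3 * p + 2) fun τ =>
      ∃ v < P, τ.ireg 25 = P + v ∧ σ.rmem 5 (P + v) = σ.rmem 5 1 := by
  refine (Spec.seq (T := 1) (U := 3 * p + 1)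
    (Q := fun τ => τ = σ.setIReg 25 1) (Spec.of_wp' ?_ le_rfl) ?_).mono
    (by omega) fun τ h => h
  · have : 0 < 2 ^ p := by positivity
    simp only [wp, IExpr.eval, and_true]; omega
  rintro τ rfl -
  -- After `q` steps the index is on level `q` and its key equals the key of the root; the test
  -- picks a child that attains the minimum.
  refine Spec.loop (fun B τ => ∃ q ≤ p, B = 3 * (p - q) + 1 ∧ 2 ^ q ≤ τ.ireg 25 ∧
    τ.ireg 25 < 2 ^ (q + 1) ∧ τ.ireg 10 = P ∧ τ.rmem 5 = σ.rmem 5 ∧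
    σ.rmem 5 (τ.ireg 25) = σ.rmem 5 1) ?_ ?_ _ _
    ⟨0, Nat.zero_le _, by simp, by simp, by simp, by simpa using h10, rfl, by simp⟩
  · rintro B τ ⟨q, hq, rfl, h1, h2, h3, h4, h5⟩ hb
    simp only [BExpr.eval, IExpr.eval, h3] at hb
    have hqp : q < p := by
      rw [hP] at hb
      exact (Nat.pow_lt_pow_iff_right (by norm_num)).1 (h1.trans_lt hb)
    have hle : 2 ^ (q + 1) ≤ P := hP ▸ Nat.pow_le_pow_right (by norm_num) hqp
    have hpos : 0 < 2 ^ q := by positivity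
    have htr := ht (τ.ireg 25) (by omega) hb
    have e1 : 2 ^ (q + 1) = 2 * 2 ^ q := by ring
    have e2 : 2 ^ (q + 1 + 1) = 4 * 2 ^ q := by ring
    refine ⟨2, Spec.of_wp' (c := _) ?_ (by simp [Cmd.cost])⟩
    simp only [wp, BExpr.eval, IExpr.eval, RExpr.eval, h4]
    refine ⟨fun h => ⟨by omega, ?_⟩, fun h => ⟨by omega, ?_⟩⟩
    · refine ⟨3 * (p - (q + 1)) + 1, by omega, q + 1, hqp, rfl, by simp; omega, by simp; omega,
        by simpa using h3, by simpa using h4, ?_⟩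
      simp only [State.setIReg_ireg, if_true]
      rw [← h5, htr, min_eq_right]
      by_contra hlt
      rw [htr, min_eq_left (not_le.mp hlt).le] at h
      exact lt_irrefl _ h
    · refine ⟨3 * (p - (q + 1)) + 1, by omega, q + 1, hqp, rfl, by simp; omega, by simp; omega,
        by simpa using h3, by simpa using h4, ?_⟩
      simp only [State.setIReg_ireg, if_true]
      rw [← h5]
      exact le_antisymm (not_lt.mp h) (htr ▸ min_le_left _ _)
  · rintro B τ ⟨q, hq, rfl, h1, h2, h3, h4, h5⟩ hb
    simp only [BExpr.eval, IExpr.eval, h3, not_lt] at hb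
    have hle : 2 ^ (q + 1) ≤ 2 * P := by
      rw [hP, ← pow_succ']; exact Nat.pow_le_pow_right (by norm_num) (by omega)
    refine ⟨by omega, τ.ireg 25 - P, by omega, by omega, ?_⟩
    rw [← h5]; congr 1; omega

end

/-! ### Adjacency lists -/

/-- One plus the last index below `c` whose entry in `gs` is `u`, or zero. -/
def lastIdx (gs : ℕ → ℕ) (u : ℕ) : ℕ → ℕ
  | 0 => 0
  | c + 1 => if gs c = u then c + 1 else lastIdx gs u c

/-- The number of indices below `c` whose entry in `gs` is `u`. -/
def cntIdx (gs : ℕ → ℕ) (u c : ℕ) : ℕ := ((Finset.range c).filter fun e => gs e = u).card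

theorem lastIdx_le (gs : ℕ → ℕ) (u c : ℕ) : lastIdx gs u c ≤ c := by
  induction c with
  | zero => exact le_rfl
  | succ c ih => rw [lastIdx]; split <;> omega

theorem lt_lastIdx {gs : ℕ → ℕ} {u c e : ℕ} (he : e < c) (hu : gs e = u) :
    e < lastIdx gs u c := by
  induction c with
  | zero => omega
  | succ c ih =>
    rw [lastIdx]; split
    · omega
    · rcases Nat.lt_succ_iff_lt_or_eq.1 he with h | rfl
      · exact ih h
      · contradiction

theorem cntIdx_succ (gs : ℕ → ℕ) (u c : ℕ) :
    cntIdx gs u (c + 1) = cntIdx gs u c + if gs c = u then 1 else 0 := by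
  unfold cntIdx
  rw [Finset.range_add_one, Finset.filter_insert]
  split
  · rw [Finset.card_insert_of_notMem (by simp)]
  · simp

/-- Entries are stored plus one so that zero ends a list. Following a link consumes exactly one
index with entry `u`, so `cntIdx` is the length of the remaining list and pays for scanning it. -/
theorem lastIdx_spec {gs : ℕ → ℕ} {u c : ℕ} (h : 0 < lastIdx gs u c) :
    gs (lastIdx gs u c - 1) = u ∧
      cntIdx gs u c = cntIdx gs u (lastIdx gs u c - 1) + 1 := by
  induction c with
  | zero => simp [lastIdx] at h
  | succ c ih =>
    rw [cntIdx_succ]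
    by_cases hc : gs c = u
    · simp [lastIdx, hc]
    · simp only [lastIdx, hc, if_false] at h ⊢
      simpa using ih h

theorem lastIdx_congr {gs gs' : ℕ → ℕ} {u c : ℕ} (h : ∀ e < c, gs e = gs' e) :
    lastIdx gs u c = lastIdx gs' u c := by
  induction c with
  | zero => rfl
  | succ c ih => rw [lastIdx, lastIdx, h c (by omega), ih fun e he => h e (by omega)]

/-! ### Constraint graphs

A constraint graph is held in memory as a growing list of weighted edges: integer register 11 is the
number of edges, integer arrays 9 and 5 hold tails and heads, real array 4 the weights.  The edges
leaving a vertex form a linked list, with first entries in integer array 7 and links in integer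
array 6.  Real array 3 holds a potential. -/

/-- A potential `π` satisfies the first `E` edges. -/
def Feasible (E : ℕ) (gs gd : ℕ → ℕ) (gw π : ℕ → ℝ) : Prop :=
  ∀ e < E, 0 ≤ gw e + π (gs e) - π (gd e)

/-- The data of a constraint graph with all vertices below `P`. -/
structure Held (P E : ℕ) (gs gd nx hd : ℕ → ℕ) (gw : ℕ → ℝ) (σ : State) : Prop where
  r10 : σ.ireg 10 = P
  r11 : σ.ireg 11 = E
  a9 : σ.imem 9 = gs
  a5 : σ.imem 5 = gd
  a6 : σ.imem 6 = nx
  a7 : σ.imem 7 = hd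
  b4 : σ.rmem 4 = gw

/-- The adjacency lists are correct. -/
structure Linked (P E : ℕ) (gs gd nx hd : ℕ → ℕ) : Prop where
  first : ∀ u, hd u = lastIdx gs u E
  next : ∀ e < E, nx e = lastIdx gs (gs e) e
  gs_lt : ∀ e < E, gs e < P
  gd_lt : ∀ e < E, gd e < P

theorem Held.frame {P E : ℕ} {gs gd nx hd : ℕ → ℕ} {gw : ℕ → ℝ} {σ τ : State} {c : Cmd}
    (h : Held P E gs gd nx hd gw σ) (hf : Frame c σ τ)
    (h10 : c.keepsI 10 = true := by rfl) (h11 : c.keepsI 11 = true := by rfl)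
    (h9 : c.keepsIM 9 = true := by rfl) (h5 : c.keepsIM 5 = true := by rfl)
    (h6 : c.keepsIM 6 = true := by rfl) (h7 : c.keepsIM 7 = true := by rfl)
    (h4 : c.keepsRM 4 = true := by rfl) : Held P E gs gd nx hd gw τ :=
  ⟨(hf.ireg _ h10).trans h.r10, (hf.ireg _ h11).trans h.r11, (hf.imem _ h9).trans h.a9,
    (hf.imem _ h5).trans h.a5, (hf.imem _ h6).trans h.a6, (hf.imem _ h7).trans h.a7,
    (hf.rmem _ h4).trans h.b4⟩

/-! ### The invariant of Dijkstra's algorithm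

Lowering the potential at the vertices with negative keys by these keys keeps all edges satisfied. -/

/-- The state of Dijkstra's algorithm, started from `s` with key `r` and potential `π₀`: `S` is the
set of settled vertices, `K` the last key; of the edges leaving `u`, those with index at least `c`
have been relaxed, unless `c = 0` and all edges have been relaxed. -/
structure DijkstraInv (E : ℕ) (gs gd : ℕ → ℕ) (gw π₀ : ℕ → ℝ) (s : ℕ) (r : ℝ) (U : Finset ℕ)
    (S : Finset ℕ) (K : ℝ) (u c : ℕ) (π key : ℕ → ℝ) : Prop where
  relaxed : ∀ e < E, (gs e = u → c ≤ e) → key (gd e) ≤ gw e + π (gs e) - π (gd e)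
  current : 0 < c → u ∈ S ∧ π u = π₀ u + K ∧ K < 0
  old : ∀ v, v ∉ S → π v = π₀ v
  settled : ∀ v, v ∈ S → key v = 0 ∧ π v ≤ π₀ v + K
  range : ∀ v, key v ≤ 0 ∧ K ≤ key v
  inU : ∀ v, key v < 0 → v ∈ U
  sub : S ⊆ U
  start : π s + key s ≤ π₀ s + r
  -- Every lowered value comes from a path that starts at `s` with value `π₀ s + r`. Along such a
  -- path `π - ψ` cannot fall below its value at the start, for any feasible `ψ`. This is what later
  -- certifies infeasibility.
  low : ∀ (ψ : ℕ → ℝ) (a : ℝ), Feasible E gs gd gw ψ → a ≤ π₀ s + r - ψ s →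
    (∀ v, key v < 0 → a ≤ π v + key v - ψ v) ∧ ∀ v, π v = π₀ v ∨ a ≤ π v - ψ v

section
variable {E : ℕ} {gs gd : ℕ → ℕ} {gw π₀ : ℕ → ℝ} {s : ℕ} {r : ℝ} {U S : Finset ℕ} {K : ℝ}
  {u c : ℕ} {π key : ℕ → ℝ}

theorem DijkstraInv.init (hf : Feasible E gs gd gw π₀) (hr : r < 0) (hs : s ∈ U) :
    DijkstraInv E gs gd gw π₀ s r U ∅ r u 0 π₀ (Function.update (fun _ => 0) s r) where
  relaxed e he _ := le_trans (by rw [Function.update_apply]; split <;> linarith) (hf e he)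
  current h := absurd h (lt_irrefl 0)
  old _ _ := rfl
  settled v hv := by simp at hv
  range v := by rw [Function.update_apply]; split <;> constructor <;> linarith
  inU v hv := by
    rw [Function.update_apply] at hv
    split at hv
    · subst v; exact hs
    · exact absurd hv (lt_irrefl _)
  sub := by simp
  start := by simp
  low ψ a _ ha := by
    refine ⟨fun v hv => ?_, fun _ => .inl rfl⟩
    rw [Function.update_apply] at hv ⊢
    split at hv
    · subst v; simpa using ha
    · exact absurd hv (lt_irrefl _)

/-- Settled vertices have key zero, so `u` is new. Lowering `u` can only spoil the edges leaving
`u`; the counter `E` exempts all of them until they are scanned. -/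
theorem DijkstraInv.pop {u' : ℕ} (h : DijkstraInv E gs gd gw π₀ s r U S K u' 0 π key)
    (hu : key u < 0) (hmin : ∀ v, key u ≤ key v) :
    u ∈ U ∧ u ∉ S ∧
    DijkstraInv E gs gd gw π₀ s r U (insert u S) (key u) u E
      (Function.update π u (π u + key u)) (Function.update key u 0) := by
  have huS : u ∉ S := fun hS => by rw [(h.settled u hS).1] at hu; exact lt_irrefl _ hu
  refine ⟨h.inU u hu, huS, ⟨fun e he hc => ?_, fun _ => ?_, fun v hv => ?_, fun v hv => ?_,
    fun v => ?_, fun v hv => ?_, ?_, ?_, fun ψ a h1 h2 => ?_⟩⟩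
  · have hne : gs e ≠ u := fun h => absurd (hc h) (by omega)
    have := h.relaxed e he fun _ => Nat.zero_le _
    rw [Function.update_of_ne hne, Function.update_apply, Function.update_apply]
    split
    · rename_i h'; rw [h'] at this; linarith
    · exact this
  · refine ⟨Finset.mem_insert_self _ _, ?_, hu⟩
    rw [Function.update_self, h.old u huS]
  · rw [Finset.mem_insert, not_or] at hv
    rw [Function.update_of_ne hv.1, h.old v hv.2]
  · by_cases hvu : v = u
    · subst hvu; simp [h.old v huS]
    · have hvS := (Finset.mem_insert.1 hv).resolve_left hvu
      rw [Function.update_of_ne hvu, Function.update_of_ne hvu]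
      exact ⟨(h.settled v hvS).1, (h.settled v hvS).2.trans (by linarith [(h.range u).2])⟩
  · rw [Function.update_apply]
    split
    · exact ⟨le_rfl, hu.le⟩
    · exact ⟨(h.range v).1, hmin v⟩
  · rw [Function.update_apply] at hv
    split at hv
    · exact absurd hv (lt_irrefl _)
    · exact h.inU v hv
  · exact Finset.insert_subset (h.inU u hu) h.sub
  · have := h.start
    by_cases hsu : s = u
    · subst hsu; simpa using this
    · rwa [Function.update_of_ne hsu, Function.update_of_ne hsu]
  · obtain ⟨h3, h4⟩ := h.low ψ a h1 h2
    refine ⟨fun v hv => ?_, fun v => ?_⟩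
    · rw [Function.update_apply] at hv
      split at hv
      · exact absurd hv (lt_irrefl _)
      · rename_i hvu
        rw [Function.update_of_ne hvu, Function.update_of_ne hvu]
        exact h3 v hv
    · by_cases hvu : v = u
      · subst hvu; right; rw [Function.update_self]; exact h3 v hu
      · rw [Function.update_of_ne hvu]; exact h4 v

theorem DijkstraInv.relax (h : DijkstraInv E gs gd gw π₀ s r U S K u c π key)
    (hf : Feasible E gs gd gw π₀) (hU : ∀ e < E, gd e ∈ U) {e c' : ℕ} (he : e < E) (hc : 0 < c)
    (hu : gs e = u) (hc' : ∀ e' < E, gs e' = u → c' ≤ e' → c ≤ e' ∨ e' = e) :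
    DijkstraInv E gs gd gw π₀ s r U S K u c' π
      (if gw e + π u - π (gd e) < key (gd e) then
        Function.update key (gd e) (gw e + π u - π (gd e)) else key) := by
  obtain ⟨huS, hπu, hK⟩ := h.current hc
  have hle : ∀ v, (if gw e + π u - π (gd e) < key (gd e) then
        Function.update key (gd e) (gw e + π u - π (gd e)) else key) v ≤ key v := by
    intro v
    split
    · rw [Function.update_apply]; split
      · subst v; linarith
      · exact le_rfl
    · exact le_rfl
  have hrel : ∀ e' < E, (gs e' = u → c' ≤ e') →
      (if gw e + π u - π (gd e) < key (gd e) then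
        Function.update key (gd e) (gw e + π u - π (gd e)) else key) (gd e') ≤
        gw e' + π (gs e') - π (gd e') := by
    intro e' he' hce
    by_cases hee : e' = e
    · subst hee
      rw [hu]
      split
      · simp
      · linarith
    · refine (hle _).trans (h.relaxed e' he' fun hg => ?_)
      exact (hc' e' he' hg (hce hg)).resolve_right hee
  by_cases hlt : gw e + π u - π (gd e) < key (gd e)
  · simp only [hlt, if_true] at hle hrel ⊢
    have hfe := hf e he
    rw [hu] at hfe
    -- A settled head has been lowered by at least `-K` and the tail by exactly `-K`, so the reduced
    -- weight is still nonnegative: a settled vertex never returns to the queue.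
    have hvS : gd e ∉ S := fun hS => by
      have := h.settled _ hS
      linarith
    have hold := h.old _ hvS
    refine ⟨hrel, fun _ => ⟨huS, hπu, hK⟩, h.old, fun v hv => ?_, fun v => ?_, fun v hv => ?_,
      h.sub, by linarith [hle s, h.start], fun ψ a h1 h2 => ?_⟩
    · have : v ≠ gd e := fun h' => hvS (h' ▸ hv)
      rw [Function.update_of_ne this]; exact h.settled v hv
    · refine ⟨(hle v).trans (h.range v).1, ?_⟩
      rw [Function.update_apply]; split
      · linarith
      · exact (h.range v).2
    · by_cases hve : v = gd e
      · exact hve ▸ hU e he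
      · rw [Function.update_of_ne hve] at hv; exact h.inU v hv
    · obtain ⟨h3, h4⟩ := h.low ψ a h1 h2
      refine ⟨fun v hv => ?_, h4⟩
      by_cases hve : v = gd e
      · subst hve
        rw [Function.update_self]
        -- The current vertex was lowered by `-K > 0`, which rules out the first alternative of
        -- `low`.
        have h5 : a ≤ π u - ψ u := (h4 u).resolve_left (by linarith)
        have h6 := h1 e he
        rw [hu] at h6
        linarith
      · rw [Function.update_of_ne hve] at hv ⊢; exact h3 v hv
  · simp only [hlt, if_false] at hrel ⊢
    exact ⟨hrel, fun _ => ⟨huS, hπu, hK⟩, h.old, h.settled, h.range, h.inU, h.sub, h.start, h.low⟩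

end

/-! ### The program -/

/-- Relax the edges leaving the vertex in register 27 that are on the list starting in
register 26. -/
def scan : Cmd :=
  .loop (.ilt (.const 0) (.reg 26))
    (.iset 28 (.load 5 (.sub (.reg 26) (.const 1))) ⨾
    .rset 2 (.sub (.add (.load 4 (.sub (.reg 26) (.const 1))) (.load 3 (.reg 27)))
      (.load 3 (.reg 28))) ⨾
    .cond (.rlt (.reg 2) (.load 5 (.add (.reg 10) (.reg 28))))
      (.iset 25 (.add (.reg 10) (.reg 28)) ⨾ setKey) .skip ⨾
    .iset 26 (.load 6 (.sub (.reg 26) (.const 1))))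

/-- Dijkstra's algorithm, with the queue given by the negative keys. -/
def dijkstra : Cmd :=
  .loop (.rlt (.load 5 (.const 1)) (.ofInt (.const 0)))
    (descend ⨾
    (.iset 27 (.sub (.reg 25) (.reg 10)) ⨾
    .rstore 3 (.reg 27) (.add (.load 3 (.reg 27)) (.load 5 (.reg 25))) ⨾
    .rset 2 (.ofInt (.const 0))) ⨾
    setKey ⨾
    .iset 26 (.load 7 (.reg 27)) ⨾
    scan)

section
variable {O : Oracle} {ω : ℕ → Bool} {W P p E : ℕ} {gs gd nx hd : ℕ → ℕ} {gw π₀ : ℕ → ℝ} {s : ℕ}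
  {r : ℝ} {U S : Finset ℕ} {K : ℝ}

theorem scan_spec (hP : P = 2 ^ p) (hW : 2 * P ≤ W) (hE : E ≤ W)
    (hl : Linked P E gs gd nx hd) (hfeas : Feasible E gs gd gw π₀) (hU : ∀ e < E, gd e ∈ U)
    (π : ℕ → ℝ) (u c : ℕ) (hc : c ≤ E) (σ : State) (hH : Held P E gs gd nx hd gw σ)
    (hπ : σ.rmem 3 = π) (h27 : σ.ireg 27 = u) (h26 : σ.ireg 26 = lastIdx gs u c)
    (ht : IsTree P (σ.rmem 5))
    (hI : DijkstraInv E gs gd gw π₀ s r U S K u c π fun v => σ.rmem 5 (P + v)) :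
    Spec O ω W scan σ ((4 * p + 9) * cntIdx gs u c + 1) fun τ =>
      IsTree P (τ.rmem 5) ∧
      DijkstraInv E gs gd gw π₀ s r U S K u 0 π fun v => τ.rmem 5 (P + v) := by
  refine Spec.loop (fun B τ => ∃ c ≤ E, B = (4 * p + 9) * cntIdx gs u c + 1 ∧
    Held P E gs gd nx hd gw τ ∧ τ.rmem 3 = π ∧ τ.ireg 27 = u ∧ τ.ireg 26 = lastIdx gs u c ∧
    IsTree P (τ.rmem 5) ∧
    DijkstraInv E gs gd gw π₀ s r U S K u c π fun v => τ.rmem 5 (P + v)) ?_ ?_ _ _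
    ⟨c, hc, rfl, hH, hπ, h27, h26, ht, hI⟩
  · clear hI ht h26 h27 hπ hH hc c σ
    rintro B σ ⟨c, hc, rfl, hH, hπ, h27, h26, ht, hI⟩ hb
    simp only [BExpr.eval, IExpr.eval, h26] at hb
    obtain ⟨hgs, hcnt⟩ := lastIdx_spec hb
    have hle := lastIdx_le gs u c
    set e := lastIdx gs u c - 1 with he
    have heE : e < E := by omega
    have hgd := hl.gd_lt e heE
    have hc0 : 0 < c := by omega
    -- The list runs through the edges leaving `u` by decreasing index, so between `e` and `c` there
    -- is no further such edge.
    have hI' := hI.relax hfeas hU (e := e) (c' := e) heE hc0 hgs (by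
      intro e' _ hg hce
      by_contra hcon
      push Not at hcon
      have h1 := lt_lastIdx hcon.1 hg
      omega)
    refine ⟨4 * p + 8, ?_⟩
    refine (Spec.seq (T := 1) (U := 4 * p + 7)
      (Q := fun τ => τ = σ.setIReg 28 (gd e)) (Spec.of_wp' ?_ le_rfl) ?_).mono
      (by omega) fun τ h => h
    · simp only [wp, IExpr.eval, h26, hH.a5, ← he, and_true]; omega
    rintro τ rfl -
    refine (Spec.seq (T := 1) (U := 4 * p + 6)
      (Q := fun τ => τ = (σ.setIReg 28 (gd e)).setRReg 2 (gw e + π u - π (gd e)))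
      (Spec.of_wp' ?_ le_rfl) ?_).mono (by omega) fun τ h => h
    · simp [wp, h26, hH.b4, hπ, h27, ← he]
    rintro τ rfl -
    refine (Spec.seq (T := 4 * p + 5) (U := 1) (Q := fun τ => IsTree P (τ.rmem 5) ∧
        DijkstraInv E gs gd gw π₀ s r U S K u e π fun v => τ.rmem 5 (P + v))
        ?_ ?_).mono (by omega) fun τ h => h
    · refine Spec.cond (T := 4 * p + 4) (fun hlt => ?_) (fun hlt => ?_)
      · simp only [BExpr.eval, RExpr.eval, IExpr.eval, State.setRReg_rreg, State.setRReg_ireg,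
          State.setIReg_ireg, State.setRReg_rmem, State.setIReg_rmem, if_true, hH.r10] at hlt
        norm_num [hH.r10] at hlt
        refine (Spec.seq (T := 1) (U := 4 * p + 3)
          (Q := fun τ => τ = ((σ.setIReg 28 (gd e)).setRReg 2
            (gw e + π u - π (gd e))).setIReg 25 (P + gd e)) (Spec.of_wp' ?_ le_rfl) ?_).mono
          (by omega) fun τ h => h
        · simp [wp, hH.r10]; omega
        rintro τ rfl -
        refine (setKey_spec hP hW _ (gd e) hgd (by simp) (by simpa using ht)).mono le_rfl ?_
        rintro τ ⟨h1, h2⟩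
        refine ⟨h1, ?_⟩
        rw [if_pos hlt] at hI'
        convert hI' using 1
        funext v
        simpa using h2 v
      · norm_num [hH.r10] at hlt
        rw [if_neg (not_lt.mpr hlt)] at hI'
        exact Spec.of_wp' (by simpa [wp] using ⟨ht, hI'⟩) (by simp [Cmd.cost])
    rintro τ ⟨ht', hD⟩ hf
    have hH1 : Held P E gs gd nx hd gw ((σ.setIReg 28 (gd e)).setRReg 2
        (gw e + π u - π (gd e))) :=
      ⟨by simpa using hH.r10, by simpa using hH.r11, hH.a9, hH.a5, hH.a6, hH.a7, hH.b4⟩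
    have hH2 : Held P E gs gd nx hd gw τ := hH1.frame hf
    have h26' : τ.ireg 26 = lastIdx gs u c := by
      rw [hf.ireg 26 rfl]; simpa using h26
    refine Spec.of_wp' ?_ (by simp [Cmd.cost])
    simp only [wp, IExpr.eval, h26', hH2.a6, ← he, hl.next e heE, hgs]
    have := lastIdx_le gs u e
    refine ⟨by omega, (4 * p + 9) * cntIdx gs u e + 1, ?_, e, by omega, rfl, ?_, ?_, ?_, ?_, ?_, ?_⟩
    · rw [hcnt]; ring_nf; omega
    · exact ⟨by simpa using hH2.r10, by simpa using hH2.r11, hH2.a9, hH2.a5, hH2.a6, hH2.a7,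
        hH2.b4⟩
    · simpa [hf.rmem 3 rfl] using hπ
    · simpa [hf.ireg 27 rfl] using h27
    · simp
    · simpa using ht'
    · simpa using hD
  · rintro B σ ⟨c, hc, rfl, hH, hπ, h27, h26, ht, hI⟩ hb
    simp only [BExpr.eval, IExpr.eval, h26, not_lt, Nat.le_zero] at hb
    refine ⟨by omega, ht, fun e he _ => hI.relaxed e he fun hg => ?_, fun h => absurd h (by omega),
      hI.old, hI.settled, hI.range, hI.inU, hI.sub, hI.start, hI.low⟩
    by_contra hlt
    have := lt_lastIdx (not_le.1 hlt) hg
    omega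

/-- The number of steps of Dijkstra's algorithm on `E` edges with a tree of height `p`. -/
def dijkstraCost (p E : ℕ) : ℕ := (7 * p + 11) * (2 * E + 1) + 1

/-- Every vertex is settled at most once because reduced weights of the old edges are nonnegative.
The algorithm ends with an empty queue, hence leaves the tree ready for the next repair without any
initialisation. -/
theorem dijkstra_spec (hP : P = 2 ^ p) (hW : 2 * P ≤ W) (hE : E ≤ W)
    (hl : Linked P E gs gd nx hd) (hfeas : Feasible E gs gd gw π₀) (hs : s < P) (hr : r < 0)
    (σ : State) (hH : Held P E gs gd nx hd gw σ) (hπ : σ.rmem 3 = π₀)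
    (ht : IsTree P (σ.rmem 5))
    (hk : ∀ v, σ.rmem 5 (P + v) = Function.update (fun _ => (0 : ℝ)) s r v) :
    Spec O ω W dijkstra σ (dijkstraCost p E) fun τ =>
      IsTree P (τ.rmem 5) ∧ (∀ v, τ.rmem 5 (P + v) = 0) ∧
      Feasible E gs gd gw (τ.rmem 3) ∧ τ.rmem 3 s ≤ π₀ s + r ∧
      ∀ ψ a, Feasible E gs gd gw ψ → a ≤ π₀ s + r - ψ s →
        ∀ v, τ.rmem 3 v = π₀ v ∨ a ≤ τ.rmem 3 v - ψ v := by
  classical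
  -- Only `s` and heads of edges can enter the queue. This bounds the number of settled vertices by
  -- `E + 1`, independently of the size `P` of the tree.
  set U : Finset ℕ := insert s ((Finset.range E).image gd) with hU
  have hUE : ∀ e < E, gd e ∈ U := fun e he =>
    Finset.mem_insert_of_mem (Finset.mem_image_of_mem _ (Finset.mem_range.2 he))
  have hUP : ∀ v ∈ U, v < P := by
    intro v hv
    rcases Finset.mem_insert.1 hv with rfl | hv
    · exact hs
    · obtain ⟨e, he, rfl⟩ := Finset.mem_image.1 hv
      exact hl.gd_lt e (Finset.mem_range.1 he)
  have hP0 : 0 < P := by rw [hP]; positivity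
  have hUcard : U.card ≤ E + 1 := (Finset.card_insert_le _ _).trans
    (Nat.succ_le_succ (Finset.card_image_le.trans (by simp)))
  -- The potential function for the running time: vertices that can still be settled plus edges that
  -- can still be scanned. Settling `u` pays for `u` and for its out-edges.
  let left : Finset ℕ → ℕ := fun S =>
    (U \ S).card + ((Finset.range E).filter fun e => gs e ∉ S).card
  refine (Spec.loop (fun B τ => ∃ S K u, B = (7 * p + 11) * left S + 1 ∧
    Held P E gs gd nx hd gw τ ∧ IsTree P (τ.rmem 5) ∧
    DijkstraInv E gs gd gw π₀ s r U S K u 0 (τ.rmem 3) fun v => τ.rmem 5 (P + v)) ?_ ?_ _ _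
    ⟨∅, r, 0, rfl, hH, ht, by
      rw [hπ, funext hk]; exact DijkstraInv.init hfeas hr (Finset.mem_insert_self _ _)⟩).mono
      ?_ fun τ h => h
  · clear hk ht hπ hH σ
    rintro B σ ⟨S, K, u', rfl, hH, ht, hI⟩ hb
    simp only [BExpr.eval, IExpr.eval, RExpr.eval, Nat.cast_zero] at hb
    obtain ⟨τ₁, t₁, hrun, ht₁, u, huP, h25, hroot⟩ :=
      descend_spec (O := O) (ω := ω) hP hW σ hH.r10 ht
    have hf₁ := hrun.frame
    refine ⟨3 * p + 2 + (3 + (4 * p + 3 + (1 + ((4 * p + 9) * cntIdx gs u E + 1)))),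
      Spec.after_run hrun ht₁ ?_⟩
    -- The tree compares only the leaves with `v < P`; all other numbers are outside `U` and have no
    -- negative key.
    have hmin : ∀ v, σ.rmem 5 (P + u) ≤ σ.rmem 5 (P + v) := by
      intro v
      by_cases hv : v < P
      · rw [hroot]; exact ht.root_le _ (by omega) (by omega)
      · have h0 : ¬ σ.rmem 5 (P + v) < 0 := fun h => hv (hUP v (hI.inU v h))
        rw [hroot]; linarith
    obtain ⟨huU, huS, hD⟩ := hI.pop (u := u) (by rw [hroot]; exact hb) hmin
    set k := σ.rmem 5 (P + u)
    refine Spec.seq (Spec.of_wp' (Q := fun τ => Held P E gs gd nx hd gw τ ∧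
      τ.rmem 3 = Function.update (σ.rmem 3) u (σ.rmem 3 u + k) ∧ τ.ireg 27 = u ∧
      τ.ireg 25 = P + u ∧ τ.rreg 2 = 0 ∧ τ.rmem 5 = σ.rmem 5) ?_ (by simp [Cmd.cost])) ?_
    · have h10 : τ₁.ireg 10 = P := (hf₁.ireg 10 rfl).trans hH.r10
      have hH' := hH.frame hf₁
      simp only [wp, IExpr.eval, RExpr.eval, State.setIReg_ireg, State.setIReg_rmem, h25, h10,
        Nat.add_sub_cancel_left, if_true]
      refine ⟨by omega, by omega, ⟨by simpa using h10, by simpa using hH'.r11, hH'.a9, hH'.a5,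
        hH'.a6, hH'.a7, by simpa using hH'.b4⟩, ?_, by simp, by simpa using h25, by simp,
        by simp [hf₁.rmem 5 rfl]⟩
      simp [hf₁.rmem 3 rfl, hf₁.rmem 5 rfl, k]
    rintro τ₂ ⟨hH₂, h3, h27, h25', h2, h5⟩ -
    refine Spec.seq (setKey_spec hP hW τ₂ u huP h25' (h5 ▸ ht)) ?_
    rintro τ₃ ⟨ht₃, hk₃⟩ hf₃
    have hH₃ := hH₂.frame hf₃
    have h27' : τ₃.ireg 27 = u := (hf₃.ireg 27 rfl).trans h27
    refine Spec.seq (Spec.of_wp' (T := 1)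
      (Q := fun τ => τ = τ₃.setIReg 26 (lastIdx gs u E)) ?_ (by simp [Cmd.cost])) ?_
    · have := lastIdx_le gs u E
      simp only [wp, IExpr.eval, h27', hH₃.a7, hl.first, and_true]; omega
    rintro τ₄ rfl -
    have hH₄ : Held P E gs gd nx hd gw (τ₃.setIReg 26 (lastIdx gs u E)) :=
      ⟨by simpa using hH₃.r10, by simpa using hH₃.r11, hH₃.a9, hH₃.a5, hH₃.a6, hH₃.a7, hH₃.b4⟩
    refine (scan_spec (u := u) (c := E) (U := U) (S := insert u S) (K := k) (s := s) (r := r)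
      hP hW hE hl hfeas hUE _ le_rfl _ hH₄ rfl (by simpa using h27') (by simp)
      (by simpa using ht₃) ?_).conseq le_rfl ?_
    · convert hD using 1
      · simp [hf₃.rmem 3 rfl, h3]
      · funext v
        simp only [State.setIReg_rmem, hk₃, h2, h5]
    · rintro τ₅ ⟨ht₅, hD₅⟩ hf₅
      refine ⟨(7 * p + 11) * left (insert u S) + 1, ?_, insert u S, k, u, rfl, hH₄.frame hf₅,
        ht₅, by rw [hf₅.rmem 3 rfl]; exact hD₅⟩
      have h1 : (U \ S).card = (U \ insert u S).card + 1 := by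
        have : U \ insert u S = (U \ S).erase u := by
          ext v; simp only [Finset.mem_sdiff, Finset.mem_insert, Finset.mem_erase]; tauto
        rw [this, Finset.card_erase_add_one (Finset.mem_sdiff.2 ⟨huU, huS⟩)]
      have h2 : ((Finset.range E).filter fun e => gs e ∉ S).card =
          ((Finset.range E).filter fun e => gs e ∉ insert u S).card + cntIdx gs u E := by
        unfold cntIdx
        rw [← Finset.card_union_of_disjoint]
        · congr 1
          ext e
          simp only [Finset.mem_filter, Finset.mem_union, Finset.mem_insert]
          by_cases hg : gs e = u
          · simp [hg, huS]
          · simp [hg]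
        · rw [Finset.disjoint_filter]
          intro e _ h1 h2
          exact h1 (by simp [h2])
      have h3 : left S = left (insert u S) + 1 + cntIdx gs u E := by
        simp only [left]; omega
      rw [h3]
      nlinarith [Nat.zero_le (p * cntIdx gs u E), Nat.zero_le (cntIdx gs u E)]
  · rintro B σ ⟨S, K, u, rfl, hH, ht, hI⟩ hb
    simp only [BExpr.eval, IExpr.eval, RExpr.eval, Nat.cast_zero, not_lt] at hb
    have hz : ∀ v, σ.rmem 5 (P + v) = 0 := fun v => by
      refine le_antisymm (hI.range v).1 (not_lt.1 fun h => ?_)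
      have := hUP v (hI.inU v h)
      exact h.not_ge (hb.trans (ht.root_le _ (by omega) (by omega)))
    refine ⟨by omega, ht, hz, fun e he => ?_, by simpa [hz s] using hI.start, fun ψ a h1 h2 => (hI.low ψ a h1 h2).2⟩
    have := hI.relaxed e he fun _ => Nat.zero_le _
    rwa [hz] at this
  · have h1 : left ∅ ≤ U.card + E := Nat.add_le_add (Finset.card_le_card Finset.sdiff_subset)
      ((Finset.card_filter_le _ _).trans (Finset.card_range E).le)
    replace h1 : left ∅ ≤ 2 * E + 1 := by omega
    exact Nat.succ_le_succ (Nat.mul_le_mul_left _ h1)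

end

/-! ### Adding edges to the constraint graph -/

/-- The memory holds a constraint graph with all vertices below `P`. -/
structure Graph (P : ℕ) (σ : State) : Prop where
  r10 : σ.ireg 10 = P
  linked : Linked P (σ.ireg 11) (σ.imem 9) (σ.imem 5) (σ.imem 6) (σ.imem 7)

/-- The constraint graph in memory has an edge from `u` to `v` of weight `w`. -/
def Has (σ : State) (u v : ℕ) (w : ℝ) : Prop :=
  ∃ e < σ.ireg 11, σ.imem 9 e = u ∧ σ.imem 5 e = v ∧ σ.rmem 4 e = w

/-- The potential `π` satisfies the constraint graph in memory. -/
def Feas (σ : State) (π : ℕ → ℝ) : Prop := ∀ u v w, Has σ u v w → 0 ≤ w + π u - π v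

theorem feas_iff {σ : State} {π : ℕ → ℝ} :
    Feas σ π ↔ Feasible (σ.ireg 11) (σ.imem 9) (σ.imem 5) (σ.rmem 4) π :=
  ⟨fun h e he => h _ _ _ ⟨e, he, rfl, rfl, rfl⟩, by
    rintro h _ _ _ ⟨e, he, rfl, rfl, rfl⟩; exact h e he⟩

/-- The queue is empty. -/
def Idle (P : ℕ) (σ : State) : Prop := IsTree P (σ.rmem 5) ∧ ∀ v, σ.rmem 5 (P + v) = 0

theorem Graph.congr {P : ℕ} {σ τ : State} (h : Graph P σ) (h10 : τ.ireg 10 = σ.ireg 10)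
    (h11 : τ.ireg 11 = σ.ireg 11) (h9 : τ.imem 9 = σ.imem 9) (h5 : τ.imem 5 = σ.imem 5)
    (h6 : τ.imem 6 = σ.imem 6) (h7 : τ.imem 7 = σ.imem 7) : Graph P τ :=
  ⟨h10.trans h.r10, by rw [h11, h9, h5, h6, h7]; exact h.linked⟩

theorem Graph.frame {P : ℕ} {σ τ : State} {c : Cmd} (h : Graph P σ) (hf : Frame c σ τ)
    (h10 : c.keepsI 10 = true := by rfl) (h11 : c.keepsI 11 = true := by rfl)
    (h9 : c.keepsIM 9 = true := by rfl) (h5 : c.keepsIM 5 = true := by rfl)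
    (h6 : c.keepsIM 6 = true := by rfl) (h7 : c.keepsIM 7 = true := by rfl) : Graph P τ :=
  h.congr (hf.ireg _ h10) (hf.ireg _ h11) (hf.imem _ h9) (hf.imem _ h5) (hf.imem _ h6)
    (hf.imem _ h7)

theorem has_congr {σ τ : State} (h11 : τ.ireg 11 = σ.ireg 11) (h9 : τ.imem 9 = σ.imem 9)
    (h5 : τ.imem 5 = σ.imem 5) (h4 : τ.rmem 4 = σ.rmem 4) : Has τ = Has σ := by
  funext u v w; unfold Has; rw [h11, h9, h5, h4]

theorem has_frame {σ τ : State} {c : Cmd} (hf : Frame c σ τ)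
    (h11 : c.keepsI 11 = true := by rfl) (h9 : c.keepsIM 9 = true := by rfl)
    (h5 : c.keepsIM 5 = true := by rfl) (h4 : c.keepsRM 4 = true := by rfl) : Has τ = Has σ :=
  has_congr (hf.ireg _ h11) (hf.imem _ h9) (hf.imem _ h5) (hf.rmem _ h4)

/-- Insert an edge from the vertex in register 23 to the vertex in register 24, with the weight in
real register 1. -/
def insertEdge : Cmd :=
  .istore 9 (.reg 11) (.reg 23) ⨾ .istore 5 (.reg 11) (.reg 24) ⨾ .rstore 4 (.reg 11) (.reg 1) ⨾
  .istore 6 (.reg 11) (.load 7 (.reg 23)) ⨾ .iset 11 (.add (.reg 11) (.const 1)) ⨾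
  .istore 7 (.reg 23) (.reg 11)

/-- Insert an edge and restore the validity of the potential, or declare a negative cycle. -/
def addEdge : Cmd :=
  .rset 2 (.sub (.add (.reg 1) (.load 3 (.reg 23))) (.load 3 (.reg 24))) ⨾
  .cond (.rlt (.reg 2) (.ofInt (.const 0)))
    (.iset 25 (.add (.reg 10) (.reg 24)) ⨾ setKey ⨾ dijkstra ⨾
      .cond (.rlt (.sub (.add (.reg 1) (.load 3 (.reg 23))) (.load 3 (.reg 24)))
        (.ofInt (.const 0))) (.iset 8 (.const 1)) .skip)
    .skip ⨾
  insertEdge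

section
variable {O : Oracle} {ω : ℕ → Bool} {W P p : ℕ}

theorem insertEdge_spec (hPW : P ≤ W) (σ : State) (hG : Graph P σ) (hE : σ.ireg 11 + 1 ≤ W)
    (hu : σ.ireg 23 < P) (hv : σ.ireg 24 < P) :
    Spec O ω W insertEdge σ 6 fun τ => Graph P τ ∧ τ.ireg 11 = σ.ireg 11 + 1 ∧
      ∀ u v w, Has τ u v w ↔
        Has σ u v w ∨ (u = σ.ireg 23 ∧ v = σ.ireg 24 ∧ w = σ.rreg 1) := by
  have hfirst := hG.linked.first (σ.ireg 23)
  have hlast := lastIdx_le (σ.imem 9) (σ.ireg 23) (σ.ireg 11)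
  refine Spec.of_wp' ?_ (by simp [insertEdge, Cmd.cost])
  simp only [insertEdge, wp, IExpr.eval, RExpr.eval]
  refine ⟨by omega, by omega, by simp; omega, by simp; omega, by simp; omega, by simp; omega,
    by simp; omega, by simp; omega, by simp; omega, by simp; omega, ?_, by simp, ?_⟩
  · refine ⟨by simpa using hG.r10, ?_⟩
    simp only [State.setIMem_ireg, State.setIReg_ireg, State.setRMem_ireg, State.setIMem_imem,
      State.setIReg_imem, State.setRMem_imem]
    norm_num
    have hgs : ∀ e < σ.ireg 11, σ.imem 9 e =
        Function.update (σ.imem 9) (σ.ireg 11) (σ.ireg 23) e := fun e he => by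
      rw [Function.update_of_ne (by omega)]
    refine ⟨fun u => ?_, fun e he => ?_, fun e he => ?_, fun e he => ?_⟩
    · rw [lastIdx, Function.update_self, ← lastIdx_congr hgs, Function.update_apply]
      by_cases huu : u = σ.ireg 23
      · simp [huu]
      · rw [if_neg huu, if_neg (Ne.symm huu), hG.linked.first]
    · rcases (show e ≤ σ.ireg 11 by omega).lt_or_eq with h | rfl
      · rw [Function.update_of_ne (by omega), Function.update_of_ne (by omega),
          hG.linked.next e h]
        exact lastIdx_congr fun e' he' => hgs e' (by omega)
      · rw [Function.update_self, Function.update_self, hfirst]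
        exact lastIdx_congr fun e' he' => hgs e' (by omega)
    · rw [Function.update_apply]; split
      · exact hu
      · exact hG.linked.gs_lt e (by omega)
    · rw [Function.update_apply]; split
      · exact hv
      · exact hG.linked.gd_lt e (by omega)
  · intro u v w
    simp only [Has, State.setIMem_ireg, State.setIReg_ireg, State.setRMem_ireg,
      State.setIMem_imem, State.setIReg_imem, State.setRMem_imem, State.setRMem_rmem,
      State.setIMem_rmem, State.setIReg_rmem]
    norm_num
    constructor
    · rintro ⟨e, he, h1, h2, h3⟩
      rcases (show e ≤ σ.ireg 11 by omega).lt_or_eq with h | rfl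
      · left
        rw [Function.update_of_ne (by omega)] at h1 h2 h3
        exact ⟨e, h, h1, h2, h3⟩
      · right
        rw [Function.update_self] at h1 h2 h3
        exact ⟨h1.symm, h2.symm, h3.symm⟩
    · rintro (⟨e, he, h1, h2, h3⟩ | ⟨rfl, rfl, rfl⟩)
      · refine ⟨e, by omega, ?_⟩
        rw [Function.update_of_ne (by omega), Function.update_of_ne (by omega),
          Function.update_of_ne (by omega)]
        exact ⟨h1, h2, h3⟩
      · exact ⟨σ.ireg 11, by omega, by simp, by simp, by simp⟩

/-- If the new edge has negative reduced weight `r`, its head is queued with key `r` and the forced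
decreases are propagated along the old edges. If the tail drops so far that the new edge is violated
again, the decreases have gone round a negative cycle; the bound `low` expresses this without
constructing the cycle. -/
theorem addEdge_spec (hP : P = 2 ^ p) (hPW : 2 * P ≤ W) (σ : State) (hG : Graph P σ)
    (hE : σ.ireg 11 + 1 ≤ W) (hu : σ.ireg 23 < P) (hv : σ.ireg 24 < P)
    (hI : Idle P σ) (hfeas : Feas σ (σ.rmem 3)) (h8 : σ.ireg 8 = 0) :
    Spec O ω W addEdge σ (dijkstraCost p (σ.ireg 11) + 4 * p + 16) fun τ =>
      Graph P τ ∧ τ.ireg 11 = σ.ireg 11 + 1 ∧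
      (∀ u v w, Has τ u v w ↔
        Has σ u v w ∨ (u = σ.ireg 23 ∧ v = σ.ireg 24 ∧ w = σ.rreg 1)) ∧ Idle P τ ∧
      ((τ.ireg 8 = 0 ∧ Feas τ (τ.rmem 3)) ∨ (τ.ireg 8 ≠ 0 ∧ ∀ ψ, ¬ Feas τ ψ)) := by
  set r := σ.rreg 1 + σ.rmem 3 (σ.ireg 23) - σ.rmem 3 (σ.ireg 24) with hr
  let good : State → Prop := fun τ => Idle P τ ∧ Feas σ (τ.rmem 3) ∧
    ((τ.ireg 8 = 0 ∧ 0 ≤ σ.rreg 1 + τ.rmem 3 (σ.ireg 23) - τ.rmem 3 (σ.ireg 24)) ∨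
      (τ.ireg 8 ≠ 0 ∧ ∀ ψ, Feas σ ψ → ¬ 0 ≤ σ.rreg 1 + ψ (σ.ireg 23) - ψ (σ.ireg 24)))
  refine (Spec.seq (T := 1) (U := dijkstraCost p (σ.ireg 11) + 4 * p + 15)
    (Q := fun τ => τ = σ.setRReg 2 r) (Spec.of_wp' ?_ le_rfl) ?_).mono (by omega) fun τ h => h
  · simp [wp, hr]
  rintro τ rfl -
  refine (Spec.seq (T := dijkstraCost p (σ.ireg 11) + 4 * p + 7) (U := 6) (Q := good) ?_
    ?_).mono (by omega) fun τ h => h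
  · refine (Spec.cond (T := dijkstraCost p (σ.ireg 11) + 4 * p + 6) (fun hlt => ?_)
      (fun hlt => ?_)).mono (by omega) fun τ h => h
    · simp only [BExpr.eval, RExpr.eval, IExpr.eval, State.setRReg_rreg, Nat.cast_zero,
        if_true] at hlt
      refine (Spec.seq (T := 1) (U := dijkstraCost p (σ.ireg 11) + 4 * p + 5)
        (Q := fun τ => τ = (σ.setRReg 2 r).setIReg 25 (P + σ.ireg 24)) (Spec.of_wp' ?_ le_rfl)
        ?_).mono (by omega) fun τ h => h
      · simp only [wp, IExpr.eval, State.setRReg_ireg, hG.r10, and_true]; omega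
      rintro τ rfl -
      refine (Spec.seq (T := 4 * p + 3) (U := dijkstraCost p (σ.ireg 11) + 2)
        (setKey_spec hP hPW _ (σ.ireg 24) hv (by simp) (by simpa using hI.1)) ?_).mono
        (by omega) fun τ h => h
      rintro τ ⟨hT, hk⟩ hf
      have hheld : Held P (σ.ireg 11) (σ.imem 9) (σ.imem 5) (σ.imem 6) (σ.imem 7) (σ.rmem 4)
          ((σ.setRReg 2 r).setIReg 25 (P + σ.ireg 24)) :=
        ⟨by simpa using hG.r10, by simp, rfl, rfl, rfl, rfl, rfl⟩
      have hheld' := hheld.frame hf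
      have hπ : τ.rmem 3 = σ.rmem 3 := hf.rmem 3 rfl
      refine Spec.seq (dijkstra_spec hP hPW (by omega) hG.linked (feas_iff.1 hfeas) hv hlt τ
        hheld' hπ hT fun v => ?_) ?_
      · rw [hk]; simp [Function.update_apply, hI.2]
      rintro ρ ⟨hT', hz, hF, hs, hlow⟩ hf'
      have e23 : ρ.ireg 23 = σ.ireg 23 := by rw [hf'.ireg 23 rfl, hf.ireg 23 rfl]; simp
      have e24 : ρ.ireg 24 = σ.ireg 24 := by rw [hf'.ireg 24 rfl, hf.ireg 24 rfl]; simp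
      have e8 : ρ.ireg 8 = 0 := by rw [hf'.ireg 8 rfl, hf.ireg 8 rfl]; simpa using h8
      have e1 : ρ.rreg 1 = σ.rreg 1 := by rw [hf'.rreg 1 rfl, hf.rreg 1 rfl]; simp
      refine Spec.of_wp' ?_ (by simp [Cmd.cost])
      simp only [wp, BExpr.eval, RExpr.eval, IExpr.eval, e23, e24, e1, Nat.cast_zero]
      refine ⟨fun hneg => ⟨by have := Nat.one_le_two_pow (n := p); omega, ⟨hT', hz⟩,
        feas_iff.2 hF, .inr ⟨by simp, ?_⟩⟩,
        fun hneg => ⟨⟨hT', hz⟩, feas_iff.2 hF, .inl ⟨e8, not_lt.1 hneg⟩⟩⟩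
      -- If the tail kept its potential, the decrease of the head by `-r` satisfies the new edge.
      -- Otherwise `π - ψ` at the tail is at least `π₀ + r - ψ` at the head, and the constraint for
      -- `ψ` again satisfies the new edge for `π`. Both contradict the failed test.
      intro ψ hψ hψe
      rcases hlow ψ (σ.rmem 3 (σ.ireg 24) + r - ψ (σ.ireg 24)) (feas_iff.1 hψ) le_rfl
        (σ.ireg 23) with h | h <;> linarith
    · simp only [BExpr.eval, RExpr.eval, IExpr.eval, State.setRReg_rreg, Nat.cast_zero,
        if_true, not_lt] at hlt
      exact Spec.of_wp' (by simpa [wp] using ⟨hI, hfeas, .inl ⟨h8, hlt⟩⟩)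
        (by simp [Cmd.cost])
  rintro τ ⟨hI', hfeas', h⟩ hf
  have e23 : τ.ireg 23 = σ.ireg 23 := by rw [hf.ireg 23 rfl]; simp
  have e24 : τ.ireg 24 = σ.ireg 24 := by rw [hf.ireg 24 rfl]; simp
  have e11 : τ.ireg 11 = σ.ireg 11 := by rw [hf.ireg 11 rfl]; simp
  have e1 : τ.rreg 1 = σ.rreg 1 := by rw [hf.rreg 1 rfl]; simp
  have hH : Has τ = Has σ := by rw [has_frame hf]; rfl
  have hG' : Graph P τ := (hG.congr (τ := σ.setRReg 2 r) rfl rfl rfl rfl rfl rfl).frame hf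
  refine (insertEdge_spec (by omega) τ hG' (by omega) (by omega) (by omega)).conseq le_rfl ?_
  rintro ρ ⟨hGρ, h11, hHρ⟩ hf'
  rw [hH, e23, e24, e1] at hHρ
  rw [hf'.ireg 8 rfl]
  refine ⟨hGρ, by omega, hHρ, ?_, ?_⟩
  · unfold Idle; rw [hf'.rmem 5 rfl]; exact hI'
  · rcases h with ⟨h0, hw⟩ | ⟨h1, hno⟩
    · refine .inl ⟨h0, fun u v w huvw => ?_⟩
      rw [hf'.rmem 3 rfl]
      rcases (hHρ u v w).1 huvw with h | ⟨rfl, rfl, rfl⟩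
      · exact hfeas' u v w h
      · exact hw
    · exact .inr ⟨h1, fun ψ hψ => hno ψ (fun u v w h => hψ u v w ((hHρ u v w).2 (.inl h)))
        (hψ _ _ _ ((hHρ _ _ _).2 (.inr ⟨rfl, rfl, rfl⟩)))⟩

end

/-! ### The input in memory -/

namespace WDigraph
variable (G : WDigraph)

/-- The tail of an edge, as a number. -/
def srcN (e : ℕ) : ℕ := if h : e < G.m then G.src ⟨e, h⟩ else 0
/-- The head of an edge, as a number. -/
def dstN (e : ℕ) : ℕ := if h : e < G.m then G.dst ⟨e, h⟩ else 0
/-- The weight of an edge, given by its number. -/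
def wtN (e : ℕ) : ℝ := if h : e < G.m then G.wt ⟨e, h⟩ else 0

variable {G}
theorem srcN_lt {e : ℕ} (h : e < G.m) : G.srcN e < G.n := by simp [srcN, h]
theorem dstN_lt {e : ℕ} (h : e < G.m) : G.dstN e < G.n := by simp [dstN, h]

theorem m_le (G : WDigraph) : G.m ≤ G.n ^ 2 := by
  have := Fintype.card_le_of_injective _ G.simple
  simpa [Fintype.card_prod, sq] using this

end WDigraph

/-- The input is in memory. -/
structure Inp (G : WDigraph) (h₀ h : ℕ) (α : ℝ) (σ : State) : Prop where
  r0 : σ.ireg 0 = G.n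
  r1 : σ.ireg 1 = G.m
  r2 : σ.ireg 2 = h₀
  r3 : σ.ireg 3 = h
  f0 : σ.rreg 0 = α
  a0 : σ.imem 0 = G.srcN
  a1 : σ.imem 1 = G.dstN
  b0 : σ.rmem 0 = G.wtN

theorem Inp.frame {G : WDigraph} {h₀ h : ℕ} {α : ℝ} {σ τ : State} {c : Cmd}
    (hI : Inp G h₀ h α σ) (hf : Frame c σ τ)
    (h0 : c.keepsI 0 = true := by rfl) (h1 : c.keepsI 1 = true := by rfl)
    (h2 : c.keepsI 2 = true := by rfl) (h3 : c.keepsI 3 = true := by rfl)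
    (h4 : c.keepsR 0 = true := by rfl) (h5 : c.keepsIM 0 = true := by rfl)
    (h6 : c.keepsIM 1 = true := by rfl) (h7 : c.keepsRM 0 = true := by rfl) : Inp G h₀ h α τ :=
  ⟨(hf.ireg _ h0).trans hI.r0, (hf.ireg _ h1).trans hI.r1, (hf.ireg _ h2).trans hI.r2,
    (hf.ireg _ h3).trans hI.r3, (hf.rreg _ h4).trans hI.f0, (hf.imem _ h5).trans hI.a0,
    (hf.imem _ h6).trans hI.a1, (hf.rmem _ h7).trans hI.b0⟩

theorem inp_input (G : WDigraph) (h₀ h : ℕ) (α : ℝ) : Inp G h₀ h α (input G h₀ h α) := by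
  refine ⟨rfl, rfl, rfl, rfl, rfl, ?_, ?_, ?_⟩ <;>
  · funext e
    simp [input, WDigraph.srcN, WDigraph.dstN, WDigraph.wtN]

/-! ### Logarithms and powers of two -/

/-- The number of binary digits of `n` (register 9). -/
def setLength : Cmd :=
  .iset 9 (.const 0) ⨾ .iset 10 (.const 1) ⨾
  .loop (.not (.ilt (.reg 0) (.reg 10)))
    (.iset 10 (.mul (.const 2) (.reg 10)) ⨾ .iset 9 (.add (.reg 9) (.const 1)))

/-- The size of the tournament tree (register 10). -/
def setTreeSize : Cmd :=
  .iset 10 (.const 1) ⨾ .iset 19 (.const 0) ⨾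
  .loop (.ilt (.reg 19) (.mul (.const 20) (.reg 9)))
    (.iset 10 (.mul (.const 2) (.reg 10)) ⨾ .iset 19 (.add (.reg 19) (.const 1)))

/-- The number of random bits for the choice of an edge (register 12). -/
def setBits : Cmd :=
  .iset 12 (.const 0) ⨾ .iset 13 (.const 1) ⨾
  .loop (.ilt (.reg 13) (.reg 1))
    (.iset 13 (.mul (.const 2) (.reg 13)) ⨾ .iset 12 (.add (.reg 12) (.const 1)))

section
variable {O : Oracle} {ω : ℕ → Bool} {W : ℕ}

theorem setLength_spec (σ : State) (n : ℕ) (h0 : σ.ireg 0 = n) (hW : 2 * n + 1 ≤ W) :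
    Spec O ω W setLength σ (3 * n.size + 3) fun τ => τ.ireg 9 = n.size := by
  have hsz : ∀ i, i < n.size → i ≤ n := fun i hi =>
    (Nat.lt_two_pow_self.le).trans (Nat.lt_size.1 hi)
  refine (Spec.seq (T := 1) (U := n.size * (2 + 1) + 1 + 1) (Q := fun τ => τ = σ.setIReg 9 0)
    (Spec.of_wp' ?_ le_rfl) ?_).mono (by omega) fun τ h => h
  · simp [wp]
  rintro τ rfl -
  refine (Spec.seq (T := 1) (U := n.size * (2 + 1) + 1)
    (Q := fun τ => τ = (σ.setIReg 9 0).setIReg 10 1)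
    (Spec.of_wp' ?_ le_rfl) ?_).mono (by omega) fun τ h => h
  · simp [wp]; omega
  rintro τ rfl -
  refine (Spec.for (fun i τ => τ.ireg 0 = n ∧ τ.ireg 9 = i ∧ τ.ireg 10 = 2 ^ i) n.size 2 ?_ ?_
    ?_).mono le_rfl fun τ h => h.2.1
  · rintro i hi τ ⟨h1, h2, h3⟩
    have := Nat.lt_size.1 hi
    have := hsz i hi
    refine ⟨by simp [h1, h3]; omega, Spec.of_wp' ?_ (by simp [Cmd.cost])⟩
    simp [wp, h1, h2, h3, pow_succ']
    omega
  · rintro τ ⟨h1, h2, h3⟩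
    simp [h1, h3, Nat.lt_size_self]
  · simp [h0]

theorem setTreeSize_spec (σ : State) (l : ℕ) (h0 : σ.ireg 9 = l) (hW : 2 ^ (20 * l) ≤ W) :
    Spec O ω W setTreeSize σ (60 * l + 3) fun τ => τ.ireg 10 = 2 ^ (20 * l) := by
  have h1W := Nat.one_le_two_pow (n := 20 * l)
  refine (Spec.seq (T := 1) (U := (20 * l) * (2 + 1) + 1 + 1) (Q := fun τ => τ = σ.setIReg 10 1)
    (Spec.of_wp' ?_ le_rfl) ?_).mono (by omega) fun τ h => h
  · simp [wp]; omega
  rintro τ rfl -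
  refine (Spec.seq (T := 1) (U := (20 * l) * (2 + 1) + 1)
    (Q := fun τ => τ = (σ.setIReg 10 1).setIReg 19 0)
    (Spec.of_wp' ?_ le_rfl) ?_).mono (by omega) fun τ h => h
  · simp [wp]
  rintro τ rfl -
  refine (Spec.for (fun i τ => τ.ireg 9 = l ∧ τ.ireg 19 = i ∧ τ.ireg 10 = 2 ^ i) (20 * l) 2 ?_ ?_
    ?_).mono le_rfl fun τ h => h.2.2
  · rintro i hi τ ⟨h1, h2, h3⟩
    have h4 : 2 ^ (i + 1) ≤ 2 ^ (20 * l) := Nat.pow_le_pow_right (by norm_num) hi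
    have h5 : i + 1 < 2 ^ (i + 1) := Nat.lt_two_pow_self
    refine ⟨by simp [h1, h2]; omega, Spec.of_wp' ?_ (by simp [Cmd.cost])⟩
    simp [wp, h1, h2, h3]
    rw [pow_succ] at h4 h5
    exact ⟨by omega, by omega, by ring⟩
  · rintro τ ⟨h1, h2, h3⟩
    simp [h1, h2]
  · simp [h0]

theorem setBits_spec (σ : State) (m : ℕ) (h1 : σ.ireg 1 = m) (hm : 1 ≤ m) (hW : 2 * m ≤ W) :
    Spec O ω W setBits σ (3 * Nat.clog 2 m + 3) fun τ => τ.ireg 12 = Nat.clog 2 m := by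
  have key : ∀ i, i < Nat.clog 2 m ↔ 2 ^ i < m := fun i => Nat.lt_clog_iff_pow_lt (by norm_num)
  refine (Spec.seq (T := 1) (U := Nat.clog 2 m * (2 + 1) + 1 + 1)
    (Q := fun τ => τ = σ.setIReg 12 0)
    (Spec.of_wp' ?_ le_rfl) ?_).mono (by omega) fun τ h => h
  · simp [wp]
  rintro τ rfl -
  refine (Spec.seq (T := 1) (U := Nat.clog 2 m * (2 + 1) + 1)
    (Q := fun τ => τ = (σ.setIReg 12 0).setIReg 13 1)
    (Spec.of_wp' ?_ le_rfl) ?_).mono (by omega) fun τ h => h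
  · simp [wp]; omega
  rintro τ rfl -
  refine (Spec.for (fun i τ => τ.ireg 1 = m ∧ τ.ireg 12 = i ∧ τ.ireg 13 = 2 ^ i)
    (Nat.clog 2 m) 2 ?_ ?_ ?_).mono le_rfl fun τ h => h.2.1
  · rintro i hi τ ⟨h1, h2, h3⟩
    have := (key i).1 hi
    have h5 : i < 2 ^ i := Nat.lt_two_pow_self
    refine ⟨by simpa [h1, h3] using this, Spec.of_wp' ?_ (by simp [Cmd.cost])⟩
    simp [wp, h1, h2, h3, pow_succ']
    omega
  · rintro τ ⟨h1, h2, h3⟩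
    have := (key (Nat.clog 2 m)).not.1 (lt_irrefl _)
    simpa [h1, h3] using this
  · simp [h1]

end

/-! ### Random edges -/

/-- The number with binary digits `ω s, …, ω (s + b - 1)`. -/
def bitVal (ω : ℕ → Bool) (s : ℕ) : ℕ → ℕ
  | 0 => 0
  | b + 1 => 2 * bitVal ω s b + (ω (s + b)).toNat

theorem bitVal_lt (ω : ℕ → Bool) (s b : ℕ) : bitVal ω s b < 2 ^ b := by
  induction b with
  | zero => simp [bitVal]
  | succ b ih =>
    have := Bool.toNat_le (ω (s + b))
    rw [bitVal, pow_succ]; omega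

/-- The random edge drawn with the `q`-th block of random bits. -/
def sampleAt (ω : ℕ → Bool) (m q : ℕ) : ℕ :=
  bitVal ω (q * Nat.clog 2 m) (Nat.clog 2 m) % m

/-- Draw a random edge (register 21). -/
def sample : Cmd :=
  .iset 30 (.const 0) ⨾ .iset 32 (.const 0) ⨾
  .loop (.ilt (.reg 32) (.reg 12))
    (.flip 31 ⨾ .iset 30 (.add (.mul (.const 2) (.reg 30)) (.reg 31)) ⨾
      .iset 32 (.add (.reg 32) (.const 1))) ⨾
  .iset 21 (.sub (.reg 30) (.mul (.div (.reg 30) (.reg 1)) (.reg 1)))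

theorem two_pow_clog_lt {m : ℕ} (hm : 1 ≤ m) : 2 ^ Nat.clog 2 m < 2 * m := by
  rcases hm.eq_or_lt with rfl | hm
  · simp
  · have := Nat.pow_pred_clog_lt_self (b := 2) (by norm_num) hm
    have hpos := Nat.clog_pos (b := 2) (by norm_num) hm
    obtain ⟨k, hk⟩ : ∃ k, Nat.clog 2 m = k + 1 := ⟨Nat.clog 2 m - 1, by omega⟩
    rw [hk] at this ⊢
    simp only [Nat.pred_succ] at this
    rw [pow_succ]; omega

theorem sample_spec {O : Oracle} {ω : ℕ → Bool} {W : ℕ} (σ : State) (m q : ℕ) (hm : 1 ≤ m)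
    (hW : 2 * m ≤ W) (h1 : σ.ireg 1 = m) (h12 : σ.ireg 12 = Nat.clog 2 m)
    (hpos : σ.pos = q * Nat.clog 2 m) :
    Spec O ω W sample σ (4 * Nat.clog 2 m + 4) fun τ =>
      τ.ireg 21 = sampleAt ω m q ∧ τ.pos = (q + 1) * Nat.clog 2 m := by
  have hlt := two_pow_clog_lt hm
  set β := Nat.clog 2 m with hβ
  refine (Spec.seq (T := 1) (U := β * (3 + 1) + 1 + 2)
    (Q := fun τ => τ = σ.setIReg 30 0)
    (Spec.of_wp' ?_ le_rfl) ?_).mono (by omega) fun τ h => h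
  · simp [wp]
  rintro τ rfl -
  refine (Spec.seq (T := 1) (U := β * (3 + 1) + 1 + 1)
    (Q := fun τ => τ = (σ.setIReg 30 0).setIReg 32 0)
    (Spec.of_wp' ?_ le_rfl) ?_).mono (by omega) fun τ h => h
  · simp [wp]
  rintro τ rfl -
  refine Spec.seq (T := β * (3 + 1) + 1) (U := 1) (Spec.for (fun i τ => τ.ireg 1 = m ∧
    τ.ireg 12 = β ∧ τ.ireg 32 = i ∧ τ.ireg 30 = bitVal ω (q * β) i ∧ τ.pos = q * β + i) β 3
    ?_ ?_ ?_) ?_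
  · rintro i hi τ ⟨h1, h2, h3, h4, h5⟩
    have hb := bitVal_lt ω (q * β) (i + 1)
    have hp : 2 ^ (i + 1) ≤ 2 ^ β := Nat.pow_le_pow_right (by norm_num) hi
    have h6 : i + 1 < 2 ^ (i + 1) := Nat.lt_two_pow_self
    refine ⟨by simpa [h2, h3] using hi, Spec.of_wp' ?_ (by simp [Cmd.cost])⟩
    rw [bitVal] at hb
    simp [wp, h1, h2, h3, h4, h5, bitVal]
    omega
  · rintro τ ⟨h1, h2, h3, h4, h5⟩
    simp [h2, h3]
  · simp [h1, h12, bitVal, hpos]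
  · rintro τ ⟨h1, h2, h3, h4, h5⟩ -
    have hb := bitVal_lt ω (q * β) β
    refine Spec.of_wp' ?_ le_rfl
    have hmod : bitVal ω (q * β) β - bitVal ω (q * β) β / m * m = bitVal ω (q * β) β % m := by
      have := Nat.div_add_mod (bitVal ω (q * β) β) m
      rw [mul_comm] at this; omega
    simp only [wp, IExpr.eval, h1, h4, hmod]
    have hlt' := Nat.mod_lt (bitVal ω (q * β) β) hm
    refine ⟨by omega, by simp [sampleAt, ← hβ], by simp [h5]; ring⟩

theorem sampleAt_lt (ω : ℕ → Bool) {m : ℕ} (hm : 1 ≤ m) (q : ℕ) : sampleAt ω m q < m :=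
  Nat.mod_lt _ hm

/-! ### The largest violation of the current potential -/

/-- Set real register 3 to a bound for the negative reduced weights. -/
def setViolation : Cmd :=
  .rset 3 (.ofInt (.const 0)) ⨾ .iset 19 (.const 0) ⨾
  .loop (.ilt (.reg 19) (.reg 1))
    (.rset 2 (.sub (.load 3 (.load 1 (.reg 19)))
      (.add (.load 0 (.reg 19)) (.load 3 (.load 0 (.reg 19))))) ⨾
    .cond (.rlt (.reg 3) (.reg 2)) (.rset 3 (.reg 2)) .skip ⨾
    .iset 19 (.add (.reg 19) (.const 1)))

/-- The number in real register 3 is the drop per layer: with it, an edge that climbs one layer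
becomes nonnegative. -/
theorem setViolation_spec {O : Oracle} {ω : ℕ → Bool} {W : ℕ} {G : WDigraph} {h₀ h : ℕ} {α : ℝ}
    (σ : State) (hI : Inp G h₀ h α σ) (hW : G.m ≤ W) :
    Spec O ω W setViolation σ (5 * G.m + 3) fun τ => 0 ≤ τ.rreg 3 ∧
      ∀ e < G.m, 0 ≤ G.wtN e + σ.rmem 3 (G.srcN e) - σ.rmem 3 (G.dstN e) + τ.rreg 3 := by
  refine (Spec.seq (T := 1) (U := G.m * (4 + 1) + 1 + 1)
    (Q := fun τ => τ = σ.setRReg 3 0)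
    (Spec.of_wp' ?_ le_rfl) ?_).mono (by omega) fun τ h => h
  · simp [wp]
  rintro τ rfl -
  refine (Spec.seq (T := 1) (U := G.m * (4 + 1) + 1)
    (Q := fun τ => τ = (σ.setRReg 3 0).setIReg 19 0)
    (Spec.of_wp' ?_ le_rfl) ?_).mono (by omega) fun τ h => h
  · simp [wp]
  rintro τ rfl -
  refine (Spec.for (fun i τ => Inp G h₀ h α τ ∧ τ.rmem 3 = σ.rmem 3 ∧ τ.ireg 19 = i ∧
    0 ≤ τ.rreg 3 ∧ ∀ e < i,
      0 ≤ G.wtN e + σ.rmem 3 (G.srcN e) - σ.rmem 3 (G.dstN e) + τ.rreg 3) G.m 4 ?_ ?_ ?_).mono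
    le_rfl fun τ h => ⟨h.2.2.2.1, h.2.2.2.2⟩
  · rintro i hi τ ⟨h1, h2, h3, h4, h5⟩
    refine ⟨by simpa [h1.r1, h3] using hi, Spec.conseq (Q := fun τ => τ.rmem 3 = σ.rmem 3 ∧
      τ.ireg 19 = i + 1 ∧ 0 ≤ τ.rreg 3 ∧ ∀ e < i + 1,
      0 ≤ G.wtN e + σ.rmem 3 (G.srcN e) - σ.rmem 3 (G.dstN e) + τ.rreg 3)
      (Spec.of_wp' ?_ (by simp [Cmd.cost])) le_rfl fun τ' hτ' hf => ⟨h1.frame hf, hτ'⟩⟩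
    simp [wp, h1.a0, h1.a1, h1.b0, h2, h3, h4]
    refine ⟨fun hlt => ⟨by omega, by linarith, fun e he => ?_⟩,
      fun hlt => ⟨by omega, fun e he => ?_⟩⟩
    all_goals
      rcases (show e ≤ i by omega).lt_or_eq with he | rfl
      · have := h5 e he; linarith
      · linarith
  · rintro τ ⟨h1, h2, h3, h4, h5⟩
    simp [h1.r1, h3]
  · refine ⟨⟨?_, ?_, ?_, ?_, ?_, hI.a0, hI.a1, hI.b0⟩, rfl, by simp, by simp, by simp⟩
    · simpa using hI.r0
    · simpa using hI.r1
    · simpa using hI.r2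
    · simpa using hI.r3
    · simpa using hI.f0

/-! ### The number of samples on the first scale -/

/-- Compute a number (register 14) between `(h / h₀) ^ (1 / α)` and four times that, cut off above
the number of edges. -/
def setBase : Cmd :=
  .cond (.ilt (.reg 2) (.reg 3)) (.rset 4 (.reg 0)) (.rset 4 (.ofInt (.const 1))) ⨾
  (.rset 6 (.div (.ofInt (.reg 3)) (.ofInt (.reg 2))) ⨾ .rset 5 (.reg 6) ⨾ .rset 7 (.reg 4)) ⨾
  .loop (.and (.rlt (.reg 7) (.ofInt (.const 1))) (.rlt (.reg 5) (.ofInt (.reg 1))))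
    (.rset 7 (.add (.reg 7) (.reg 4)) ⨾ .rset 5 (.mul (.reg 5) (.reg 6))) ⨾
  .cond (.rlt (.reg 7) (.ofInt (.const 1)))
    (.iset 14 (.add (.reg 1) (.const 1)))
    ((.rset 8 (.ofInt (.const 1)) ⨾ .iset 19 (.const 0)) ⨾
     .loop (.not (.rlt (.reg 5) (.mul (.ofInt (.const 2)) (.reg 8))))
      (.rset 8 (.mul (.ofInt (.const 2)) (.reg 8)) ⨾ .iset 19 (.add (.reg 19) (.const 1))) ⨾
     (.iset 14 (.const 2) ⨾ .rset 8 (.ofInt (.const 0))) ⨾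
     .loop (.rlt (.reg 8) (.ofInt (.reg 19)))
      (.rset 8 (.add (.reg 8) (.reg 7)) ⨾ .iset 14 (.mul (.const 2) (.reg 14))) ⨾
     .cond (.ilt (.add (.reg 1) (.const 1)) (.reg 14))
      (.iset 14 (.add (.reg 1) (.const 1))) .skip)

/-- Here `j` is the integer part of `log₂ p` and `r` is `j / q` rounded up. Both roundings together
cost at most a factor of four because `q ≥ 1` makes `(j + 1) / q ≤ r + 1`. -/
theorem rpow_bounds {p q : ℝ} {j r : ℕ} (hp : 1 ≤ p) (hq : 1 ≤ q) (h1 : (2 : ℝ) ^ j ≤ p)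
    (h2 : p < 2 * 2 ^ j) (h3 : (j : ℝ) ≤ r * q) (h4 : r = 0 ∨ ((r : ℝ) - 1) * q < j) :
    p ^ (1 / q) ≤ 2 ^ (r + 1) ∧ (2 : ℝ) ^ (r + 1) ≤ 4 * p ^ (1 / q) := by
  have hq0 : 0 < q := by linarith
  have hp0 : 0 ≤ p := by linarith
  constructor
  · have : p ^ (1 / q) ≤ ((2 : ℝ) ^ ((j : ℝ) + 1)) ^ (1 / q) := by
      refine Real.rpow_le_rpow hp0 ?_ (by positivity)
      rw [Real.rpow_add_one (by norm_num), Real.rpow_natCast]; linarith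
    refine this.trans ?_
    rw [← Real.rpow_mul (by norm_num), ← Real.rpow_natCast]
    refine Real.rpow_le_rpow_of_exponent_le (by norm_num) ?_
    rw [mul_one_div, div_le_iff₀ hq0]
    push_cast; linarith
  · rcases h4 with rfl | h4
    · have : (1 : ℝ) ≤ p ^ (1 / q) := Real.one_le_rpow hp (by positivity)
      rw [zero_add, pow_one]; linarith
    · have : ((2 : ℝ) ^ (j : ℝ)) ^ (1 / q) ≤ p ^ (1 / q) := by
        refine Real.rpow_le_rpow (by positivity) ?_ (by positivity)
        rw [Real.rpow_natCast]; exact h1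
      rw [← Real.rpow_mul (by norm_num), mul_one_div] at this
      have h5 : (2 : ℝ) ^ ((r : ℝ) - 1) ≤ 2 ^ ((j : ℝ) / q) := by
        refine Real.rpow_le_rpow_of_exponent_le (by norm_num) ?_
        rw [le_div_iff₀ hq0]; exact h4.le
      rw [Real.rpow_sub_one (by norm_num), Real.rpow_natCast] at h5
      rw [pow_succ]; linarith

/-- The machine has no roots or logarithms. The base and the exponent are first raised
simultaneously until the exponent is at least one, then `rpow_bounds` applies with loops that count
to `j` and `r`. The cutoff at `m + 1` keeps the number of draws within the step budget. -/
theorem setBase_spec {O : Oracle} {ω : ℕ → Bool} {W : ℕ} {G : WDigraph} {h₀ h : ℕ} {α : ℝ}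
    (σ : State) (hI : Inp G h₀ h α σ) (hm : 1 ≤ G.m) (hh₀ : 1 ≤ h₀) (hh : h₀ ≤ h) (hα : 0 < α)
    (hhm : h < G.m) (hW : 4 * (G.m * h) ≤ W) :
    Spec O ω W setBase σ (6 * h₀ * G.n.size + 24 * G.n.size + 50) fun τ =>
      1 ≤ τ.ireg 14 ∧ τ.ireg 14 ≤ G.m + 1 ∧
      (τ.ireg 14 : ℝ) ≤ 4 * ((h : ℝ) / h₀) ^ (1 / α) ∧
      (((h : ℝ) / h₀) ^ (1 / α) ≤ τ.ireg 14 ∨ G.m < τ.ireg 14) := by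
  set l := G.n.size with hl
  set x : ℝ := (h : ℝ) / h₀ with hx
  set X : ℝ := x ^ (1 / α) with hX
  have hh₀' : (0 : ℝ) < h₀ := by exact_mod_cast hh₀
  have hx1 : 1 ≤ x := by rw [hx, one_le_div hh₀']; exact_mod_cast hh
  have hxh : x ≤ h := div_le_self (by positivity) (by exact_mod_cast hh₀)
  have hX1 : 1 ≤ X := Real.one_le_rpow hx1 (by positivity)
  have hn2 : G.n < 2 ^ l := Nat.lt_size_self _
  have hm2 : G.m ≤ 2 ^ (2 * l) := by
    calc G.m ≤ G.n ^ 2 := G.m_le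
      _ ≤ (2 ^ l) ^ 2 := Nat.pow_le_pow_left hn2.le 2
      _ = _ := by ring
  have hmh4 : G.m * h ≤ 2 ^ (4 * l) := by
    calc G.m * h ≤ 2 ^ (2 * l) * 2 ^ (2 * l) := Nat.mul_le_mul hm2 (hhm.le.trans hm2)
      _ = _ := by ring
  have hm' : (1 : ℝ) ≤ G.m := by exact_mod_cast hm
  -- the exponent used by the program
  set a : ℝ := if h₀ < h then α else 1 with ha
  have ha0 : 0 < a := by rw [ha]; split <;> linarith
  have hXa : X = x ^ (1 / a) := by
    rw [ha]; split
    · rfl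
    · rename_i hlt
      have : h₀ = h := by omega
      have hx1 : x = 1 := by rw [hx, this]; exact div_self (by rw [← this]; positivity)
      simp [hX, hx1]
  -- Replacing `(x, a)` by `(x ^ i, i a)` does not change `X`; this is the invariant of the first
  -- loop.
  have hXpow : ∀ i : ℕ, X = (x ^ i) ^ (1 / (i * a)) ∨ i = 0 := by
    intro i
    rcases Nat.eq_zero_or_pos i with h0 | hi
    · exact .inr h0
    · left
      have : (0 : ℝ) < i := by exact_mod_cast hi
      rw [hXa, ← Real.rpow_natCast, ← Real.rpow_mul (by linarith)]
      congr 1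
      field_simp
  refine (Spec.seq (T := 2) (U := 6 * h₀ * l + 24 * l + 48)
    (Q := fun τ => Inp G h₀ h α τ ∧ τ.rreg 4 = a) ?_ ?_).mono (by omega) fun τ h => h
  · refine (Spec.of_wp' (Q := fun τ => τ.rreg 4 = a) ?_ (by simp [Cmd.cost])).conseq le_rfl
      fun τ hτ hf => ⟨hI.frame hf, hτ⟩
    simp [wp, hI.r2, hI.r3, hI.f0, ha]
    refine ⟨fun h => ?_, fun h => ?_⟩ <;> intro h' <;> omega
  rintro σ ⟨hI, h4⟩ -
  refine (Spec.seq (T := 3) (U := 6 * h₀ * l + 24 * l + 45)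
    (Q := fun τ => Inp G h₀ h α τ ∧ τ.rreg 4 = a ∧ τ.rreg 6 = x ∧ τ.rreg 5 = x ∧ τ.rreg 7 = a)
    ?_ ?_).mono (by omega) fun τ h => h
  · refine (Spec.of_wp' (Q := fun τ => τ.rreg 6 = x ∧ τ.rreg 5 = x ∧ τ.rreg 7 = a) ?_
      (by simp [Cmd.cost])).conseq le_rfl
      fun τ hτ hf => ⟨hI.frame hf, (hf.rreg 4 rfl).trans h4, hτ⟩
    simp [wp, hI.r2, hI.r3, h4, hx]
  rintro σ ⟨hI, h4, h6, h5, h7⟩ -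
  -- The last multiplication starts below `m` and multiplies by `x ≤ h`. The resulting bound `m * h`
  -- keeps the powers of two computed later within a machine word.
  refine (Spec.seq (T := 6 * h₀ * l + 1) (U := 24 * l + 41)
    (Q := fun τ => Inp G h₀ h α τ ∧ ∃ i : ℕ, 1 ≤ i ∧ τ.rreg 7 = i * a ∧ τ.rreg 5 = x ^ i ∧
      (x ^ i : ℝ) ≤ G.m * h ∧ (1 ≤ i * a ∨ (G.m : ℝ) ≤ x ^ i)) ?_ ?_).mono (by omega)
    fun τ h => h
  · refine Spec.loop (fun B τ => Inp G h₀ h α τ ∧ ∃ i : ℕ, 1 ≤ i ∧ i ≤ 2 * h₀ * l + 1 ∧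
      B = 3 * (2 * h₀ * l + 1 - i) + 1 ∧ τ.rreg 7 = i * a ∧ τ.rreg 5 = x ^ i ∧
      τ.rreg 4 = a ∧ τ.rreg 6 = x ∧ (x ^ i : ℝ) ≤ G.m * h) ?_ ?_ _ _ ?_
    · rintro B τ ⟨hI, i, hi1, hi2, rfl, h7, h5, h4, h6, hle⟩ hb
      simp only [BExpr.eval, RExpr.eval, IExpr.eval, h7, h5, hI.r1, Nat.cast_one] at hb
      -- For `h > h₀` one has `x ≥ 1 + 1 / h₀`, so `x ^ h₀ ≥ 2` by Bernoulli's inequality and `x ^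
      -- (2 h₀ l) ≥ 2 ^ (2 l) ≥ m`: the loop has stopped by then.
      have hi3 : i < 2 * h₀ * l + 1 := by
        by_contra hcon
        have hlt : h₀ < h := by
          by_contra hge
          rw [ha, if_neg hge] at hb
          have : (1 : ℝ) ≤ i := by exact_mod_cast hi1
          linarith [hb.1]
        have hx2 : (2 : ℝ) ≤ x ^ h₀ := by
          have h1 : 1 + 1 / (h₀ : ℝ) ≤ x := by
            rw [hx, ← sub_nonneg]
            have : (h₀ : ℝ) + 1 ≤ h := by exact_mod_cast hlt
            have : (h : ℝ) / h₀ - (1 + 1 / h₀) = (h - (h₀ + 1)) / h₀ := by field_simp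
            rw [this]; exact div_nonneg (by linarith) hh₀'.le
          calc (2 : ℝ) = 1 + h₀ * (1 / h₀) := by field_simp; norm_num
            _ ≤ (1 + 1 / h₀) ^ h₀ := one_add_mul_le_pow (by
              have : (0:ℝ) ≤ 1 / h₀ := by positivity
              linarith) _
            _ ≤ x ^ h₀ := pow_le_pow_left₀ (by positivity) h1 _
        have : (G.m : ℝ) ≤ x ^ i := by
          calc (G.m : ℝ) ≤ 2 ^ (2 * l) := by exact_mod_cast hm2
            _ ≤ (x ^ h₀) ^ (2 * l) := pow_le_pow_left₀ (by norm_num) hx2 _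
            _ = x ^ (2 * h₀ * l) := by rw [← pow_mul]; ring_nf
            _ ≤ x ^ i := pow_le_pow_right₀ hx1 (by omega)
        linarith [hb.2]
      refine ⟨2, (Spec.of_wp' (Q := fun τ => τ.rreg 7 = (i + 1 : ℕ) * a ∧
        τ.rreg 5 = x ^ (i + 1)) ?_ (by simp [Cmd.cost])).conseq le_rfl fun τ' hτ' hf =>
        ⟨3 * (2 * h₀ * l + 1 - (i + 1)) + 1, by omega, hI.frame hf, i + 1, by omega, hi3, rfl,
          hτ'.1, hτ'.2, (hf.rreg 4 rfl).trans h4, (hf.rreg 6 rfl).trans h6, ?_⟩⟩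
      · simp [wp, h7, h4, h5, h6]
        exact ⟨by ring, by ring⟩
      · rw [pow_succ]; exact mul_le_mul hb.2.le hxh (by linarith) (by positivity)
    · rintro B τ ⟨hI, i, hi1, hi2, rfl, h7, h5, h4, h6, hle⟩ hb
      simp only [BExpr.eval, RExpr.eval, IExpr.eval, h7, h5, hI.r1, Nat.cast_one] at hb
      refine ⟨by omega, hI, i, hi1, h7, h5, hle, ?_⟩
      by_contra hcon
      push Not at hcon
      exact hb hcon
    · refine ⟨hI, 1, le_rfl, by omega, by
        rw [Nat.add_sub_cancel]; ring, by simpa using h7, by simpa using h5, h4, h6, ?_⟩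
      rw [pow_one]
      calc x ≤ 1 * h := by linarith
        _ ≤ G.m * h := by gcongr
  rintro σ ⟨hI, i, hi, h7, h5, hle, hor⟩ -
  refine (Spec.cond (T := 24 * l + 40) (fun hb => ?_) (fun hb => ?_)).mono (by omega)
    fun τ h => h
  · simp only [BExpr.eval, RExpr.eval, IExpr.eval, h7, Nat.cast_one] at hb
    have hge := hor.resolve_left (not_le.2 hb)
    -- The exponent `i a` is still below one, so `X = x ^ (1 / a) ≥ x ^ i ≥ m` and the value `m + 1`
    -- is admissible.
    have hXge : (G.m : ℝ) ≤ X := by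
      refine hge.trans ?_
      rw [hXa, ← Real.rpow_natCast]
      refine Real.rpow_le_rpow_of_exponent_le hx1 ?_
      rw [le_div_iff₀ ha0]; exact hb.le
    have hmW : G.m + 1 ≤ W := by nlinarith
    refine Spec.of_wp' ?_ (by simp [Cmd.cost])
    simp [wp, hI.r1]
    exact ⟨hmW, by linarith⟩
  · simp only [BExpr.eval, RExpr.eval, IExpr.eval, h7, Nat.cast_one, not_lt] at hb
    have hp1 : 1 ≤ x ^ i := one_le_pow₀ hx1
    set q : ℝ := i * a with hq
    have hq1 : 1 ≤ q := hb
    set p : ℝ := x ^ i with hp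
    have hXp : X = p ^ (1 / q) := (hXpow i).resolve_right (by omega)
    refine (Spec.seq (T := 2) (U := 24 * l + 38) (Q := fun τ => Inp G h₀ h α τ ∧
      τ.rreg 8 = 1 ∧ τ.ireg 19 = 0 ∧ τ.rreg 7 = q ∧ τ.rreg 5 = p) ?_ ?_).mono (by omega)
      fun τ h => h
    · refine (Spec.of_wp' (Q := fun τ => τ.rreg 8 = 1 ∧ τ.ireg 19 = 0) (by simp [wp])
        (by simp [Cmd.cost])).conseq le_rfl fun τ hτ hf => ⟨hI.frame hf, hτ.1, hτ.2,
          (hf.rreg 7 rfl).trans h7, (hf.rreg 5 rfl).trans h5⟩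
    rintro σ ⟨hI, h8, h19, h7, h5⟩ -
    have hj4 : ∀ j : ℕ, (2 : ℝ) ^ j ≤ p → j ≤ 4 * l := by
      intro j hj
      have : (2 : ℝ) ^ j ≤ 2 ^ (4 * l) := hj.trans (hle.trans (by exact_mod_cast hmh4))
      exact (pow_le_pow_iff_right₀ (by norm_num)).1 this
    have hj4' : ∀ j : ℕ, (2 : ℝ) ^ j ≤ p → 2 ^ j ≤ G.m * h := by
      intro j hj
      exact_mod_cast hj.trans hle
    refine (Spec.seq (T := 12 * l + 1) (U := 12 * l + 37) (Q := fun τ => Inp G h₀ h α τ ∧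
      τ.rreg 7 = q ∧ ∃ j : ℕ, τ.ireg 19 = j ∧ (2 : ℝ) ^ j ≤ p ∧ p < 2 * 2 ^ j) ?_ ?_).mono
      (by omega) fun τ h => h
    · refine Spec.loop (fun B τ => Inp G h₀ h α τ ∧ τ.rreg 7 = q ∧ τ.rreg 5 = p ∧ ∃ j : ℕ,
        j ≤ 4 * l ∧ B = 3 * (4 * l - j) + 1 ∧ τ.ireg 19 = j ∧ τ.rreg 8 = 2 ^ j ∧
        (2 : ℝ) ^ j ≤ p) ?_ ?_ _ _ ⟨hI, h7, h5, 0, by omega, by simp; ring, h19, by simpa using h8,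
          by simpa using hp1⟩
      · rintro B τ ⟨hI, h7, h5, j, hj, rfl, h19, h8, hjp⟩ hb
        simp only [BExpr.eval, RExpr.eval, IExpr.eval, h5, h8, not_lt, Nat.cast_ofNat] at hb
        rw [← pow_succ'] at hb
        have hj' := hj4 _ hb
        have hj'' := hj4' _ hb
        have : j + 1 < 2 ^ (j + 1) := Nat.lt_two_pow_self
        refine ⟨2, (Spec.of_wp' (Q := fun τ => τ.ireg 19 = j + 1 ∧ τ.rreg 8 = 2 ^ (j + 1)) ?_
          (by simp [Cmd.cost])).conseq le_rfl fun τ' hτ' hf =>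
          ⟨3 * (4 * l - (j + 1)) + 1, by omega, hI.frame hf, (hf.rreg 7 rfl).trans h7,
            (hf.rreg 5 rfl).trans h5, j + 1, hj', rfl, hτ'.1, hτ'.2, hb⟩⟩
        simp [wp, h19, h8]
        exact ⟨by omega, by ring⟩
      · rintro B τ ⟨hI, h7, h5, j, hj, rfl, h19, h8, hjp⟩ hb
        simp only [BExpr.eval, RExpr.eval, IExpr.eval, h5, h8, not_lt, Nat.cast_ofNat] at hb
        exact ⟨by omega, hI, h7, j, h19, hjp, not_le.1 hb⟩
    rintro σ ⟨hI, h7, j, h19, hj1, hj2⟩ -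
    have hjl := hj4 j hj1
    have hjm := hj4' j hj1
    refine (Spec.seq (T := 2) (U := 12 * l + 35) (Q := fun τ => Inp G h₀ h α τ ∧
      τ.rreg 8 = 0 ∧ τ.ireg 14 = 2 ∧ τ.rreg 7 = q ∧ τ.ireg 19 = j) ?_ ?_).mono (by omega)
      fun τ h => h
    · refine (Spec.of_wp' (Q := fun τ => τ.rreg 8 = 0 ∧ τ.ireg 14 = 2) ?_
        (by simp [Cmd.cost])).conseq le_rfl fun τ hτ hf => ⟨hI.frame hf, hτ.1, hτ.2,
          (hf.rreg 7 rfl).trans h7, (hf.ireg 19 rfl).trans h19⟩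
      have := Nat.one_le_two_pow (n := j)
      simp [wp]; omega
    rintro σ ⟨hI, h8, h14, h7, h19⟩ -
    refine (Spec.seq (T := 12 * l + 4) (U := 2) (Q := fun τ => Inp G h₀ h α τ ∧
      ∃ r : ℕ, τ.ireg 14 = 2 ^ (r + 1) ∧ (j : ℝ) ≤ r * q ∧ (r = 0 ∨ ((r : ℝ) - 1) * q < j))
      ?_ ?_).mono (by omega) fun τ h => h
    · refine Spec.loop (fun B τ => Inp G h₀ h α τ ∧ τ.rreg 7 = q ∧ τ.ireg 19 = j ∧ ∃ r : ℕ,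
        r ≤ j ∧ B = 3 * (4 * l + 1 - r) + 1 ∧ τ.ireg 14 = 2 ^ (r + 1) ∧ τ.rreg 8 = r * q ∧
        (r = 0 ∨ ((r : ℝ) - 1) * q < j)) ?_ ?_ _ _
        ⟨hI, h7, h19, 0, Nat.zero_le _, by simp; ring, by simpa using h14, by simpa using h8,
          .inl rfl⟩
      · rintro B τ ⟨hI, h7, h19, r, hr, rfl, h14, h8, hrj⟩ hb
        simp only [BExpr.eval, RExpr.eval, IExpr.eval, h8, h19] at hb
        have hrj' : r + 1 ≤ j := by
          have h1 : (r : ℝ) ≤ r * q := le_mul_of_one_le_right (by positivity) hq1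
          have : (r : ℝ) < j := by linarith
          exact_mod_cast this
        have h2 : 2 ^ (r + 1) ≤ 2 ^ j := Nat.pow_le_pow_right (by norm_num) hrj'
        refine ⟨2, (Spec.of_wp' (Q := fun τ => τ.ireg 14 = 2 ^ (r + 1 + 1) ∧
          τ.rreg 8 = (r + 1 : ℕ) * q) ?_
          (by simp [Cmd.cost])).conseq le_rfl fun τ' hτ' hf =>
          ⟨3 * (4 * l + 1 - (r + 1)) + 1, by omega, hI.frame hf, (hf.rreg 7 rfl).trans h7,
            (hf.ireg 19 rfl).trans h19, r + 1, hrj', rfl, hτ'.1, hτ'.2,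
            .inr (by push_cast; linarith)⟩⟩
        simp [wp, h14, h8, h7]
        exact ⟨by omega, by ring, by ring⟩
      · rintro B τ ⟨hI, h7, h19, r, hr, rfl, h14, h8, hrj⟩ hb
        simp only [BExpr.eval, RExpr.eval, IExpr.eval, h8, h19, not_lt] at hb
        exact ⟨by omega, hI, r, h14, hb, hrj⟩
    rintro σ ⟨hI, r, h14, hr1, hr2⟩ -
    obtain ⟨hlow, hupp⟩ := rpow_bounds (r := r) hp1 hb hj1 hj2 hr1 hr2
    rw [← hXp] at hlow hupp
    have hmW : G.m + 1 ≤ W := by nlinarith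
    refine Spec.of_wp' ?_ (by simp [Cmd.cost])
    simp only [wp, BExpr.eval, IExpr.eval, hI.r1, h14]
    refine ⟨fun hlt => ⟨hmW, ?_⟩, fun hlt => ?_⟩
    · have : ((G.m : ℝ) + 1) < 2 ^ (r + 1) := by exact_mod_cast hlt
      simp; linarith
    · exact ⟨Nat.one_le_two_pow, by omega, by exact_mod_cast hupp, .inl (by exact_mod_cast hlow)⟩

/-! ### Layered copies

A layered copy of the graph has vertices `(j, v)` for `j ≤ 2 L + 1`, numbered `off + j n + v`.
A nonnegative edge stays in its layer and a negative edge goes to the next one.  Vertex `(L, v)` is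
identified with `v`.  Registers 16, 17, 18 hold `L`, `off`, `2 L + 1`. -/

/-- The number of vertex `v` in layer `j`. -/
def cid (n off j v : ℕ) : ℕ := off + j * n + v

theorem cid_mod {n off j v : ℕ} (hoff : n ∣ off) (hv : v < n) : cid n off j v % n = v := by
  obtain ⟨q, rfl⟩ := hoff
  rw [cid, mul_comm j n, ← mul_add, Nat.mul_add_mod, Nat.mod_eq_of_lt hv]

theorem cid_lt {n off j v N : ℕ} (hv : v < n) (hj : j < N) : cid n off j v < off + N * n := by
  have : (j + 1) * n ≤ N * n := Nat.mul_le_mul_right n hj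
  unfold cid; rw [Nat.succ_mul] at this; omega

theorem cid_div {n off j v : ℕ} (hv : v < n) : (cid n off j v - off) / n = j := by
  have : cid n off j v - off = v + n * j := by unfold cid; rw [mul_comm]; omega
  rw [this, Nat.add_mul_div_left _ _ (by omega), Nat.div_eq_of_lt hv, zero_add]

theorem cid_sub_mod {n off j v : ℕ} (hv : v < n) : (cid n off j v - off) % n = v := by
  have : cid n off j v - off = v + n * j := by unfold cid; rw [mul_comm]; omega
  rw [this, Nat.add_mul_mod_self_left, Nat.mod_eq_of_lt hv]

/-- The parameters of a layered copy are in memory. -/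
structure Par (L off : ℕ) (σ : State) : Prop where
  r16 : σ.ireg 16 = L
  r17 : σ.ireg 17 = off
  r18 : σ.ireg 18 = 2 * L + 1

theorem Par.frame {L off : ℕ} {σ τ : State} {c : Cmd} (h : Par L off σ) (hf : Frame c σ τ)
    (h16 : c.keepsI 16 = true := by rfl) (h17 : c.keepsI 17 = true := by rfl)
    (h18 : c.keepsI 18 = true := by rfl) : Par L off τ :=
  ⟨(hf.ireg _ h16).trans h.r16, (hf.ireg _ h17).trans h.r17, (hf.ireg _ h18).trans h.r18⟩

/-- Split the counter in register 19 into an edge (register 21) and a layer (register 22), where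
there are `N` layers. -/
def splitCounter (N : IExpr) : Cmd :=
  .iset 21 (.div (.reg 19) N) ⨾ .iset 22 (.sub (.reg 19) (.mul (.div (.reg 19) N) N))

/-- The potential of a layered copy. -/
def copyPot : Cmd :=
  .iset 19 (.const 0) ⨾
  .loop (.ilt (.reg 19) (.mul (.reg 1) (.add (.reg 18) (.const 1))))
    (splitCounter (.add (.reg 18) (.const 1)) ⨾
    .iset 23 (.add (.add (.reg 17) (.mul (.reg 22) (.reg 0))) (.load 0 (.reg 21))) ⨾
    .rstore 3 (.reg 23) (.add (.add (.load 3 (.load 0 (.reg 21)))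
      (.mul (.sub (.ofInt (.reg 16)) (.ofInt (.reg 22))) (.reg 3))) (.load 2 (.reg 23))) ⨾
    .iset 24 (.add (.add (.reg 17) (.mul (.reg 22) (.reg 0))) (.load 1 (.reg 21))) ⨾
    .rstore 3 (.reg 24) (.add (.add (.load 3 (.load 1 (.reg 21)))
      (.mul (.sub (.ofInt (.reg 16)) (.ofInt (.reg 22))) (.reg 3))) (.load 2 (.reg 24))) ⨾
    .iset 19 (.add (.reg 19) (.const 1)))

/-- Copy the potential of the middle layer to the original vertices. -/
def centerPot : Cmd :=
  .iset 19 (.const 0) ⨾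
  .loop (.ilt (.reg 19) (.reg 1))
    (.rstore 3 (.load 0 (.reg 19))
      (.load 3 (.add (.add (.reg 17) (.mul (.reg 16) (.reg 0))) (.load 0 (.reg 19)))) ⨾
    .rstore 3 (.load 1 (.reg 19))
      (.load 3 (.add (.add (.reg 17) (.mul (.reg 16) (.reg 0))) (.load 1 (.reg 19)))) ⨾
    .iset 19 (.add (.reg 19) (.const 1)))

/-- A vertex is written once for every incident edge. All writes store the value of the same
function `F`, so repetitions are harmless. -/
theorem update_agree {f F : ℕ → ℝ} {i x : ℕ} (h : f x = F x) :
    Function.update f i (F i) x = F x := by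
  rw [Function.update_apply]; split
  · rename_i h'; rw [h']
  · exact h

section
variable {O : Oracle} {ω : ℕ → Bool} {W : ℕ} {G : WDigraph} {h₀ h : ℕ} {α : ℝ} {L off : ℕ}

/-- The potential that a layered copy gets. -/
def copyVal (n L off : ℕ) (M : ℝ) (π d : ℕ → ℝ) (j v : ℕ) : ℝ :=
  π v + ((L : ℝ) - j) * M + d (cid n off j v)

theorem sub_div_mul (k N : ℕ) : k - k / N * N = k % N := by
  have := Nat.div_add_mod k N
  rw [mul_comm] at this; omega

/-- The counter runs over pairs of an edge and a layer, so isolated vertices cost nothing. The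
original potential is read below `off` and the copy is written from `off` on, so reads are not
disturbed. -/
theorem copyPot_spec (σ : State) (hI : Inp G h₀ h α σ) (hpar : Par L off σ) (hn : G.n ≤ off)
    (hW : off + (2 * L + 2) * G.n ≤ W) (hW' : G.m * (2 * L + 2) + 1 ≤ W) :
    Spec O ω W copyPot σ (8 * (G.m * (2 * L + 2)) + 2) fun τ =>
      (∀ x < off, τ.rmem 3 x = σ.rmem 3 x) ∧
      ∀ e < G.m, ∀ j < 2 * L + 2,
        τ.rmem 3 (cid G.n off j (G.srcN e)) =
          copyVal G.n L off (σ.rreg 3) (σ.rmem 3) (σ.rmem 2) j (G.srcN e) ∧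
        τ.rmem 3 (cid G.n off j (G.dstN e)) =
          copyVal G.n L off (σ.rreg 3) (σ.rmem 3) (σ.rmem 2) j (G.dstN e) := by
  set N := G.m * (2 * L + 2) with hN
  let F : ℕ → ℝ := fun x => copyVal G.n L off (σ.rreg 3) (σ.rmem 3) (σ.rmem 2)
    ((x - off) / G.n) ((x - off) % G.n)
  have hF : ∀ j v, v < G.n → F (cid G.n off j v) =
      copyVal G.n L off (σ.rreg 3) (σ.rmem 3) (σ.rmem 2) j v := fun j v hv => by
    simp only [F, cid_div hv, cid_sub_mod hv]
  refine (Spec.seq (T := 1) (U := N * (7 + 1) + 1) (Q := fun τ => τ = σ.setIReg 19 0)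
    (Spec.of_wp' ?_ le_rfl) ?_).mono (by omega) fun τ h => h
  · simp [wp]
  rintro τ rfl hf
  have hI₀ := hI.frame hf
  have hpar₀ := hpar.frame hf
  refine (Spec.for (fun i τ => Inp G h₀ h α τ ∧ Par L off τ ∧ τ.ireg 19 = i ∧
    τ.rreg 3 = σ.rreg 3 ∧ τ.rmem 2 = σ.rmem 2 ∧ (∀ x < off, τ.rmem 3 x = σ.rmem 3 x) ∧
    ∀ k < i, τ.rmem 3 (cid G.n off (k % (2 * L + 2)) (G.srcN (k / (2 * L + 2)))) =
      F (cid G.n off (k % (2 * L + 2)) (G.srcN (k / (2 * L + 2)))) ∧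
      τ.rmem 3 (cid G.n off (k % (2 * L + 2)) (G.dstN (k / (2 * L + 2)))) =
      F (cid G.n off (k % (2 * L + 2)) (G.dstN (k / (2 * L + 2))))) N 7 ?_ ?_ ?_).mono le_rfl ?_
  · rintro i hi τ ⟨h1, h2, h3, h4, h5, h6, h7⟩
    refine ⟨by simpa [h1.r1, h3, h2.r18, add_assoc] using hi, Spec.conseq (Q := fun τ =>
      τ.ireg 19 = i + 1 ∧ (∀ x < off, τ.rmem 3 x = σ.rmem 3 x) ∧
      ∀ k < i + 1, τ.rmem 3 (cid G.n off (k % (2 * L + 2)) (G.srcN (k / (2 * L + 2)))) =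
      F (cid G.n off (k % (2 * L + 2)) (G.srcN (k / (2 * L + 2)))) ∧
      τ.rmem 3 (cid G.n off (k % (2 * L + 2)) (G.dstN (k / (2 * L + 2)))) =
      F (cid G.n off (k % (2 * L + 2)) (G.dstN (k / (2 * L + 2)))))
      (Spec.of_wp' ?_ (by simp [splitCounter, Cmd.cost])) le_rfl fun τ' hτ' hf =>
        ⟨h1.frame hf, h2.frame hf, hτ'.1, (hf.rreg 3 rfl).trans h4, (hf.rmem 2 rfl).trans h5,
          hτ'.2⟩⟩
    have he : i / (2 * L + 2) < G.m := by
      rw [Nat.div_lt_iff_lt_mul (by omega)]; exact hi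
    have hj : i % (2 * L + 2) < 2 * L + 2 := Nat.mod_lt _ (by omega)
    set e := i / (2 * L + 2) with hedef
    set j := i % (2 * L + 2) with hjdef
    have hs := WDigraph.srcN_lt he
    have hd := WDigraph.dstN_lt he
    have hcs := cid_lt (off := off) hs hj
    have hcd := cid_lt (off := off) hd hj
    have hcs' : off ≤ cid G.n off j (G.srcN e) := by unfold cid; omega
    have hcd' : off ≤ cid G.n off j (G.dstN e) := by unfold cid; omega
    have hm2 : e ≤ i := Nat.div_le_self _ _
    have hm3 : j ≤ i := Nat.mod_le _ _
    have hFs := hF j _ hs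
    have hFd := hF j _ hd
    have e1 : off + j * G.n + G.srcN e = cid G.n off j (G.srcN e) := rfl
    have e2 : off + j * G.n + G.dstN e = cid G.n off j (G.dstN e) := rfl
    have e3 : (2 * L + 1 + 1 : ℕ) = 2 * L + 2 := rfl
    have v1 : σ.rmem 3 (G.srcN e) + ((L : ℝ) - j) * σ.rreg 3 +
        σ.rmem 2 (cid G.n off j (G.srcN e)) = F (cid G.n off j (G.srcN e)) := hFs.symm
    have v2 : σ.rmem 3 (G.dstN e) + ((L : ℝ) - j) * σ.rreg 3 +
        σ.rmem 2 (cid G.n off j (G.dstN e)) = F (cid G.n off j (G.dstN e)) := hFd.symm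
    simp only [splitCounter, wp, IExpr.eval, RExpr.eval, State.setIReg_ireg, State.setIReg_rreg,
      State.setIReg_imem, State.setIReg_rmem, State.setRMem_rmem, State.setRMem_ireg,
      State.setRMem_rreg, State.setRMem_imem, h3, h2.r18, e3, sub_div_mul, ← hedef,
      h1.a0, h1.a1, h1.r0, h2.r17, h2.r16, h4, h5]
    norm_num [h3, h2.r18, h2.r17, h2.r16, h1.r0, h6 _ (hs.trans_le hn), h6 _ (hd.trans_le hn),
      ← hjdef, ← hedef, e1, e2, v1, v2, e3, h4]
    rw [Function.update_of_ne (by omega), h6 _ (hd.trans_le hn), v2]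
    refine ⟨by omega, by omega, by omega, by omega, by omega, fun x hx => ?_, fun k hk => ?_⟩
    · rw [Function.update_of_ne (by omega), Function.update_of_ne (by omega), h6 x hx]
    · rcases (show k ≤ i by omega).lt_or_eq with hk | rfl
      · exact ⟨update_agree (update_agree (h7 k hk).1), update_agree (update_agree (h7 k hk).2)⟩
      · rw [← hjdef, ← hedef]
        exact ⟨update_agree (by simp), by simp⟩
  · rintro τ ⟨h1, h2, h3, -⟩
    simp [h1.r1, h3, h2.r18, hN, add_assoc]
  · exact ⟨hI₀, hpar₀, by simp, by simp, rfl, fun _ _ => rfl, by simp⟩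
  · rintro τ ⟨-, -, -, -, -, h6, h7⟩
    refine ⟨h6, fun e he j hj => ?_⟩
    have hk : e * (2 * L + 2) + j < N := by
      have : (e + 1) * (2 * L + 2) ≤ G.m * (2 * L + 2) := Nat.mul_le_mul_right _ he
      rw [Nat.succ_mul] at this; omega
    have h1 : (e * (2 * L + 2) + j) / (2 * L + 2) = e := by
      rw [mul_comm, Nat.mul_add_div (by omega), Nat.div_eq_of_lt hj, add_zero]
    have h2 : (e * (2 * L + 2) + j) % (2 * L + 2) = j := by
      rw [mul_comm, Nat.mul_add_mod, Nat.mod_eq_of_lt hj]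
    have := h7 _ hk
    rw [h1, h2, hF _ _ (WDigraph.srcN_lt he), hF _ _ (WDigraph.dstN_lt he)] at this
    exact this

theorem centerPot_spec (σ : State) (hI : Inp G h₀ h α σ) (hpar : Par L off σ) (hn : G.n ≤ off)
    (hW : G.n ≤ W) (hW' : G.m ≤ W) :
    Spec O ω W centerPot σ (4 * G.m + 2) fun τ =>
      (∀ x, τ.rmem 3 x = σ.rmem 3 x ∨ ∃ e < G.m, x = G.srcN e ∨ x = G.dstN e) ∧
      ∀ e < G.m, τ.rmem 3 (G.srcN e) = σ.rmem 3 (cid G.n off L (G.srcN e)) ∧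
        τ.rmem 3 (G.dstN e) = σ.rmem 3 (cid G.n off L (G.dstN e)) := by
  let F : ℕ → ℝ := fun x => σ.rmem 3 (cid G.n off L x)
  refine (Spec.seq (T := 1) (U := G.m * (3 + 1) + 1) (Q := fun τ => τ = σ.setIReg 19 0)
    (Spec.of_wp' ?_ le_rfl) ?_).mono (by omega) fun τ h => h
  · simp [wp]
  rintro τ rfl hf
  have hI₀ := hI.frame hf
  have hpar₀ := hpar.frame hf
  refine (Spec.for (fun i τ => Inp G h₀ h α τ ∧ Par L off τ ∧ τ.ireg 19 = i ∧
    (∀ x, τ.rmem 3 x = σ.rmem 3 x ∨ ∃ e < G.m, x = G.srcN e ∨ x = G.dstN e) ∧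
    ∀ e < i, τ.rmem 3 (G.srcN e) = F (G.srcN e) ∧ τ.rmem 3 (G.dstN e) = F (G.dstN e))
      G.m 3 ?_ ?_ ?_).mono le_rfl ?_
  · rintro i hi τ ⟨h1, h2, h3, h6, h7⟩
    refine ⟨by simpa [h1.r1, h3] using hi, Spec.conseq (Q := fun τ =>
      τ.ireg 19 = i + 1 ∧ (∀ x, τ.rmem 3 x = σ.rmem 3 x ∨ ∃ e < G.m, x = G.srcN e ∨ x = G.dstN e) ∧
      ∀ e < i + 1, τ.rmem 3 (G.srcN e) = F (G.srcN e) ∧ τ.rmem 3 (G.dstN e) = F (G.dstN e))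
      (Spec.of_wp' ?_ (by simp [Cmd.cost])) le_rfl fun τ' hτ' hf =>
        ⟨h1.frame hf, h2.frame hf, hτ'⟩⟩
    have hs := WDigraph.srcN_lt hi
    have hd := WDigraph.dstN_lt hi
    have hge : ∀ v, off ≤ off + L * G.n + v := fun v => by omega
    -- The middle layer lies above all original vertices, so the writes so far have not touched it.
    have hFv : ∀ v, τ.rmem 3 (off + L * G.n + v) = F v := fun v =>
      (h6 _).resolve_right fun hcon => by
        obtain ⟨e, he, h8⟩ := hcon
        have := hge v
        have := WDigraph.srcN_lt he
        have := WDigraph.dstN_lt he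
        omega
    simp only [wp, IExpr.eval, RExpr.eval, State.setRMem_rmem, State.setRMem_ireg,
      State.setRMem_imem, h3, h2.r17, h2.r16, h1.a0, h1.a1, h1.r0]
    norm_num [h3]
    rw [Function.update_of_ne (by omega), hFv, hFv]
    refine ⟨by omega, by omega, by omega, fun x => ?_, fun e he => ?_⟩
    · by_cases h8 : x = G.dstN i
      · exact .inr ⟨i, hi, .inr h8⟩
      · by_cases h9 : x = G.srcN i
        · exact .inr ⟨i, hi, .inl h9⟩
        · rw [Function.update_of_ne h8, Function.update_of_ne h9]; exact h6 x
    · rcases (show e ≤ i by omega).lt_or_eq with he | rfl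
      · exact ⟨update_agree (update_agree (h7 e he).1), update_agree (update_agree (h7 e he).2)⟩
      · exact ⟨update_agree (by simp), by simp⟩
  · rintro τ ⟨h1, h2, h3, -⟩
    simp [h1.r1, h3]
  · exact ⟨hI₀, hpar₀, by simp, fun _ => .inl rfl, by simp⟩
  · rintro τ ⟨-, -, -, h6, h7⟩
    exact ⟨h6, h7⟩

end

/-! ### The edges of a layered copy -/

/-- The edges within and between the layers of a layered copy. -/
def copyEdges : Cmd :=
  .iset 19 (.const 0) ⨾
  .loop (.ilt (.reg 19) (.mul (.reg 1) (.reg 18)))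
    (splitCounter (.reg 18) ⨾
    ((.iset 23 (.add (.add (.reg 17) (.mul (.reg 22) (.reg 0))) (.load 0 (.reg 21))) ⨾
      .cond (.rlt (.load 0 (.reg 21)) (.ofInt (.const 0)))
        (.iset 24 (.add (.add (.reg 17) (.mul (.add (.reg 22) (.const 1)) (.reg 0)))
          (.load 1 (.reg 21))))
        (.iset 24 (.add (.add (.reg 17) (.mul (.reg 22) (.reg 0))) (.load 1 (.reg 21)))) ⨾
      .rset 1 (.load 0 (.reg 21))) ⨾ insertEdge) ⨾
    .cond (.ilt (.reg 22) (.mul (.const 2) (.reg 16)))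
      ((.iset 23 (.add (.add (.reg 17) (.mul (.reg 22) (.reg 0))) (.load 0 (.reg 21))) ⨾
        .iset 24 (.add (.add (.reg 17) (.mul (.add (.reg 22) (.const 1)) (.reg 0)))
          (.load 0 (.reg 21))) ⨾
        .rset 1 (.ofInt (.const 0))) ⨾ insertEdge)
      .skip ⨾
    .iset 19 (.add (.reg 19) (.const 1)))

/-- The edges that identify the middle layer with the original vertices. -/
def centerEdges : Cmd :=
  .iset 19 (.const 0) ⨾
  .loop (.ilt (.reg 19) (.reg 1))
    (((.iset 23 (.load 0 (.reg 19)) ⨾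
      .iset 24 (.add (.add (.reg 17) (.mul (.reg 16) (.reg 0))) (.load 0 (.reg 19))) ⨾
      .rset 1 (.ofInt (.const 0))) ⨾ insertEdge) ⨾
    ((.iset 24 (.load 0 (.reg 19)) ⨾
      .iset 23 (.add (.add (.reg 17) (.mul (.reg 16) (.reg 0))) (.load 0 (.reg 19))) ⨾
      .rset 1 (.ofInt (.const 0))) ⨾ insertEdge) ⨾
    ((.iset 23 (.load 1 (.reg 19)) ⨾
      .iset 24 (.add (.add (.reg 17) (.mul (.reg 16) (.reg 0))) (.load 1 (.reg 19))) ⨾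
      .rset 1 (.ofInt (.const 0))) ⨾ insertEdge) ⨾
    ((.iset 24 (.load 1 (.reg 19)) ⨾
      .iset 23 (.add (.add (.reg 17) (.mul (.reg 16) (.reg 0))) (.load 1 (.reg 19))) ⨾
      .rset 1 (.ofInt (.const 0))) ⨾ insertEdge) ⨾
    .iset 19 (.add (.reg 19) (.const 1)))

/-- Edges from the last to the first layer at the tails of the marked edges. -/
def linkEdges : Cmd :=
  .iset 19 (.const 0) ⨾
  .loop (.ilt (.reg 19) (.reg 1))
    (.cond (.ilt (.const 0) (.load 8 (.reg 19)))
      ((.iset 23 (.add (.add (.reg 17) (.mul (.mul (.const 2) (.reg 16)) (.reg 0)))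
          (.load 0 (.reg 19))) ⨾
        .iset 24 (.add (.add (.reg 17) (.mul (.const 0) (.reg 0))) (.load 0 (.reg 19))) ⨾
        .rset 1 (.ofInt (.const 0))) ⨾ insertEdge)
      .skip ⨾
    .iset 19 (.add (.reg 19) (.const 1)))

/-- `τ` has the edges of `σ` and those that satisfy `New`. -/
def Adds (σ τ : State) (New : ℕ → ℕ → ℝ → Prop) : Prop :=
  ∀ u v w, Has τ u v w ↔ Has σ u v w ∨ New u v w

theorem Adds.trans {σ τ ρ : State} {A B : ℕ → ℕ → ℝ → Prop} (h : Adds σ τ A) (h' : Adds τ ρ B) :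
    Adds σ ρ fun u v w => A u v w ∨ B u v w := fun u v w => by
  rw [h' u v w, h u v w, or_assoc]

theorem adds_of_has_eq {σ τ : State} (h : Has τ = Has σ) : Adds σ τ fun _ _ _ => False :=
  fun u v w => by rw [h]; simp

theorem Adds.congr {σ τ : State} {A B : ℕ → ℕ → ℝ → Prop} (h : Adds σ τ A)
    (hAB : ∀ u v w, A u v w ↔ B u v w) : Adds σ τ B := fun u v w => by
  rw [h u v w, hAB]

/-- The edges of a layered copy with counter `k`. -/
def CopyEdge (G : WDigraph) (L off k u v : ℕ) (w : ℝ) : Prop :=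
  (u = cid G.n off (k % (2 * L + 1)) (G.srcN (k / (2 * L + 1))) ∧
    v = cid G.n off (if G.wtN (k / (2 * L + 1)) < 0 then k % (2 * L + 1) + 1
      else k % (2 * L + 1)) (G.dstN (k / (2 * L + 1))) ∧ w = G.wtN (k / (2 * L + 1))) ∨
  (k % (2 * L + 1) < 2 * L ∧ u = cid G.n off (k % (2 * L + 1)) (G.srcN (k / (2 * L + 1))) ∧
    v = cid G.n off (k % (2 * L + 1) + 1) (G.srcN (k / (2 * L + 1))) ∧ w = 0)

/-- The edges that identify the endpoints of edge `e` with vertices of the middle layer. -/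
def CenterEdge (G : WDigraph) (L off e u v : ℕ) (w : ℝ) : Prop :=
  ((u = G.srcN e ∧ v = cid G.n off L (G.srcN e) ∨ u = cid G.n off L (G.srcN e) ∧ v = G.srcN e) ∨
    (u = G.dstN e ∧ v = cid G.n off L (G.dstN e) ∨
      u = cid G.n off L (G.dstN e) ∧ v = G.dstN e)) ∧ w = 0

/-- The edge from the last to the first layer at the tail of edge `e`. -/
def LinkEdge (G : WDigraph) (L off e u v : ℕ) (w : ℝ) : Prop :=
  u = cid G.n off (2 * L) (G.srcN e) ∧ v = cid G.n off 0 (G.srcN e) ∧ w = 0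

section
variable {O : Oracle} {ω : ℕ → Bool} {W P : ℕ}

theorem prep_insert {c : Cmd} {σ : State} {a b T : ℕ} {r : ℝ} (hPW : P ≤ W) (hG : Graph P σ)
    (hE : σ.ireg 11 + 1 ≤ W) (ha : a < P) (hb : b < P)
    (hwp : wp ω W c (fun τ => τ.ireg 23 = a ∧ τ.ireg 24 = b ∧ τ.rreg 1 = r) σ)
    (hT : c.cost + 6 ≤ T)
    (h10 : c.keepsI 10 = true := by rfl) (h11 : c.keepsI 11 = true := by rfl)
    (h9 : c.keepsIM 9 = true := by rfl) (h5 : c.keepsIM 5 = true := by rfl)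
    (h6 : c.keepsIM 6 = true := by rfl) (h7 : c.keepsIM 7 = true := by rfl)
    (h4 : c.keepsRM 4 = true := by rfl) :
    Spec O ω W (c ⨾ insertEdge) σ T fun τ => Graph P τ ∧ τ.ireg 11 = σ.ireg 11 + 1 ∧
      Adds σ τ fun u v w => u = a ∧ v = b ∧ w = r := by
  refine (Spec.seq (Spec.of_wp hwp) ?_).mono hT fun τ h => h
  rintro τ ⟨h23, h24, hr⟩ hf
  have hG' := hG.frame hf h10 h11 h9 h5 h6 h7
  have e11 := hf.ireg 11 h11
  refine (insertEdge_spec hPW τ hG' (by omega) (by omega) (by omega)).mono le_rfl ?_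
  rintro ρ ⟨h1, h2, h3⟩
  refine ⟨h1, by omega, fun u v w => ?_⟩
  rw [h3, has_frame hf h11 h9 h5 h4, h23, h24, hr]

/-- The common pattern of the programs that generate edges: `J` is the part of the memory that the
body leaves alone, and each round adds the edges `New i`, at most `c` of them. -/
theorem insert_loop {b : BExpr} {body : Cmd} {J : State → Prop} {N T c : ℕ} {σ : State}
    (New : ℕ → ℕ → ℕ → ℝ → Prop)
    (hG : Graph P σ) (hJ0 : J (σ.setIReg 19 0))
    (hJ : ∀ τ ρ, J τ → Frame body τ ρ → J ρ) (hb : ∀ τ, J τ → (b.eval τ ↔ τ.ireg 19 < N))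
    (hstep : ∀ i < N, ∀ τ, J τ → Graph P τ → τ.ireg 19 = i → τ.ireg 11 ≤ σ.ireg 11 + c * i →
      Spec O ω W body τ T fun ρ => Graph P ρ ∧ ρ.ireg 19 = i + 1 ∧ ρ.ireg 11 ≤ τ.ireg 11 + c ∧
        Adds τ ρ (New i)) :
    Spec O ω W (.iset 19 (.const 0) ⨾ .loop b body) σ (N * (T + 1) + 2) fun τ =>
      Graph P τ ∧ τ.ireg 11 ≤ σ.ireg 11 + c * N ∧
      Adds σ τ fun u v w => ∃ i < N, New i u v w := by
  refine (Spec.seq (T := 1) (U := N * (T + 1) + 1) (Q := fun τ => τ = σ.setIReg 19 0)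
    (Spec.of_wp' ?_ le_rfl) ?_).mono (by omega) fun τ h => h
  · simp [wp]
  rintro τ rfl -
  refine (Spec.for (fun i τ => J τ ∧ Graph P τ ∧ τ.ireg 19 = i ∧ τ.ireg 11 ≤ σ.ireg 11 + c * i ∧
    Adds σ τ fun u v w => ∃ k < i, New k u v w) N T ?_ ?_ ?_).mono le_rfl ?_
  · rintro i hi τ ⟨h1, h2, h3, h4, h5⟩
    refine ⟨(hb τ h1).2 (by omega), (hstep i hi τ h1 h2 h3 h4).conseq le_rfl ?_⟩
    rintro ρ ⟨h6, h7, h8, h9⟩ hf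
    refine ⟨hJ τ ρ h1 hf, h6, h7, by rw [mul_add]; omega, (h5.trans h9).congr fun u v w => ?_⟩
    rw [Nat.exists_lt_succ_right]
  · rintro τ ⟨h1, h2, h3, -⟩
    rw [hb τ h1]; omega
  · exact ⟨hJ0, hG.congr (by simp) (by simp) rfl rfl rfl rfl, by simp, by simp,
      fun u v w => by simp [has_congr (σ := σ) (τ := σ.setIReg 19 0) (by simp) rfl rfl rfl]⟩
  · rintro τ ⟨-, h2, -, h4, h5⟩
    exact ⟨h2, h4, h5⟩

variable {G : WDigraph} {h₀ h : ℕ} {α : ℝ} {L off : ℕ}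

theorem copyEdges_spec (hPW : P ≤ W) (σ : State) (hI : Inp G h₀ h α σ) (hpar : Par L off σ)
    (hG : Graph P σ) (hP : off + (2 * L + 2) * G.n ≤ P)
    (hW : σ.ireg 11 + 2 * (G.m * (2 * L + 1)) + 1 ≤ W) :
    Spec O ω W copyEdges σ (G.m * (2 * L + 1) * 24 + 2) fun τ =>
      Graph P τ ∧ τ.ireg 11 ≤ σ.ireg 11 + 2 * (G.m * (2 * L + 1)) ∧
      Adds σ τ fun u v w => ∃ k < G.m * (2 * L + 1), CopyEdge G L off k u v w := by
  refine insert_loop (J := fun τ => Inp G h₀ h α τ ∧ Par L off τ) (T := 23) _ hG ?_ ?_ ?_ ?_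
  · have hf : Frame (.iset 19 (.const 0)) σ (σ.setIReg 19 0) :=
      (Run.iset (O := O) (ω := ω) (W := W) σ 19 (.const 0) (Nat.zero_le _)).frame
    exact ⟨hI.frame hf, hpar.frame hf⟩
  · rintro τ ρ ⟨h1, h2⟩ hf
    exact ⟨h1.frame hf, h2.frame hf⟩
  · rintro τ ⟨h1, h2⟩
    simp [h1.r1, h2.r18]
  rintro i hi τ ⟨h1, h2⟩ hGτ h19 h11
  have he : i / (2 * L + 1) < G.m := by rw [Nat.div_lt_iff_lt_mul (by omega)]; exact hi
  have hj : i % (2 * L + 1) < 2 * L + 1 := Nat.mod_lt _ (by omega)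
  set e := i / (2 * L + 1) with hedef
  set j := i % (2 * L + 1) with hjdef
  have hs := WDigraph.srcN_lt he
  have hd := WDigraph.dstN_lt he
  have hcs := cid_lt (off := off) hs (show j < 2 * L + 2 by omega)
  have hcd := cid_lt (off := off) hd (show j < 2 * L + 2 by omega)
  have hcs' := cid_lt (off := off) hs (show j + 1 < 2 * L + 2 by omega)
  have hcd' := cid_lt (off := off) hd (show j + 1 < 2 * L + 2 by omega)
  have hm2 : e ≤ i := Nat.div_le_self _ _
  have hm3 : j ≤ i := Nat.mod_le _ _
  refine (Spec.seq (T := 2) (U := 21) (Q := fun τ => τ.ireg 21 = e ∧ τ.ireg 22 = j)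
    (Spec.of_wp' ?_ le_rfl) ?_).mono (by omega) fun τ h => h
  · have hsub : i - e * (2 * L + 1) = j := sub_div_mul i (2 * L + 1)
    simp [splitCounter, wp, h19, h2.r18, ← hedef, hsub]
    omega
  rintro τ₁ ⟨h21, h22⟩ hf₁
  have hI₁ := h1.frame hf₁
  have hp₁ := h2.frame hf₁
  have hG₁ := hGτ.frame hf₁
  have e11 := hf₁.ireg 11 rfl
  have e19 := (hf₁.ireg 19 rfl).trans h19
  refine (Spec.seq (T := 10) (U := 11) (prep_insert (a := cid G.n off j (G.srcN e))
    (b := cid G.n off (if G.wtN e < 0 then j + 1 else j) (G.dstN e)) (r := G.wtN e)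
    hPW hG₁ (by omega) (by omega) (by split <;> omega) ?_ (by simp [Cmd.cost])) ?_).mono
    (by omega) fun τ h => h
  · simp [wp, h21, h22, hI₁.a0, hI₁.a1, hI₁.b0, hI₁.r0, hp₁.r17]
    unfold cid at *
    refine ⟨by omega, fun h => ⟨by omega, by simp [h]⟩, fun h => ⟨by omega, ?_⟩⟩
    rw [if_neg (not_lt.2 h)]
    exact ⟨rfl, rfl⟩
  rintro τ₂ ⟨hG₂, h11₂, hA₂⟩ hf₂
  have hI₂ := hI₁.frame hf₂
  have hp₂ := hp₁.frame hf₂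
  have e21 := (hf₂.ireg 21 rfl).trans h21
  have e22 := (hf₂.ireg 22 rfl).trans h22
  have e19₂ := (hf₂.ireg 19 rfl).trans e19
  have hA : Adds τ τ₂ fun u v w => u = cid G.n off j (G.srcN e) ∧
      v = cid G.n off (if G.wtN e < 0 then j + 1 else j) (G.dstN e) ∧ w = G.wtN e :=
    ((adds_of_has_eq (has_frame hf₁)).trans hA₂).congr fun u v w => by simp
  refine (Spec.seq (T := 10) (U := 1) (Q := fun ρ => Graph P ρ ∧ ρ.ireg 11 ≤ τ.ireg 11 + 2 ∧
    ρ.ireg 19 = i ∧ Adds τ ρ (CopyEdge G L off i)) ?_ ?_).mono (by omega) fun τ h => h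
  · refine Spec.cond (fun hb => ?_) (fun hb => ?_)
    · simp only [BExpr.eval, IExpr.eval, e22, hp₂.r16] at hb
      refine (prep_insert (T := 9) (a := cid G.n off j (G.srcN e))
        (b := cid G.n off (j + 1) (G.srcN e)) (r := 0) hPW hG₂ (by omega) (by omega) (by omega)
        ?_ (by simp [Cmd.cost])).conseq le_rfl ?_
      · simp [wp, e21, e22, hI₂.a0, hI₂.r0, hp₂.r17]
        unfold cid at *
        exact ⟨by omega, by omega⟩
      · rintro ρ ⟨h3, h4, h5⟩ hf
        refine ⟨h3, by omega, (hf.ireg 19 rfl).trans e19₂, (hA.trans h5).congr fun u v w => ?_⟩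
        simp only [CopyEdge, ← hjdef, ← hedef, hb, true_and]
    · simp only [BExpr.eval, IExpr.eval, e22, hp₂.r16] at hb
      refine Spec.of_wp' ?_ (by simp [Cmd.cost])
      simp only [wp]
      refine ⟨hG₂, by omega, e19₂, hA.congr fun u v w => ?_⟩
      simp only [CopyEdge, ← hjdef, ← hedef, hb, false_and, or_false]
  rintro ρ ⟨h3, h4, h5, h6⟩ -
  refine (Spec.of_wp' (Q := fun ρ' => ρ' = ρ.setIReg 19 (i + 1)) ?_ le_rfl).mono le_rfl ?_
  · simp only [wp, IExpr.eval, h5, and_true]; omega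
  · rintro _ rfl
    exact ⟨h3.congr (by simp) (by simp) rfl rfl rfl rfl, by simp, by simpa using h4,
      fun u v w => by
        rw [has_congr (σ := ρ) (τ := ρ.setIReg 19 _) (by simp) rfl rfl rfl]; exact h6 u v w⟩

theorem centerEdges_spec (hPW : P ≤ W) (σ : State) (hI : Inp G h₀ h α σ) (hpar : Par L off σ)
    (hG : Graph P σ) (hP : off + (2 * L + 2) * G.n ≤ P) (hn : G.n ≤ off)
    (hW : σ.ireg 11 + 4 * G.m + 1 ≤ W) :
    Spec O ω W centerEdges σ (G.m * 38 + 2) fun τ =>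
      Graph P τ ∧ τ.ireg 11 ≤ σ.ireg 11 + 4 * G.m ∧
      Adds σ τ fun u v w => ∃ e < G.m, CenterEdge G L off e u v w := by
  refine insert_loop (J := fun τ => Inp G h₀ h α τ ∧ Par L off τ) (T := 37) _ hG ?_ ?_ ?_ ?_
  · have hf : Frame (.iset 19 (.const 0)) σ (σ.setIReg 19 0) :=
      (Run.iset (O := O) (ω := ω) (W := W) σ 19 (.const 0) (Nat.zero_le _)).frame
    exact ⟨hI.frame hf, hpar.frame hf⟩
  · rintro τ ρ ⟨h1, h2⟩ hf
    exact ⟨h1.frame hf, h2.frame hf⟩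
  · rintro τ ⟨h1, h2⟩
    simp [h1.r1]
  rintro e he τ ⟨h1, h2⟩ hGτ h19 h11
  have hs := WDigraph.srcN_lt he
  have hd := WDigraph.dstN_lt he
  have hcs := cid_lt (off := off) hs (show L < 2 * L + 2 by omega)
  have hcd := cid_lt (off := off) hd (show L < 2 * L + 2 by omega)
  refine (Spec.seq (T := 9) (U := 28) (prep_insert (a := G.srcN e)
    (b := cid G.n off L (G.srcN e)) (r := 0)
    hPW hGτ (by omega) (by omega) (by omega) ?_ (by simp [Cmd.cost])) ?_).mono
    (by omega) fun τ h => h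
  · simp [wp, h19, h1.a0, h1.r0, h2.r17, h2.r16]
    unfold cid at *
    exact ⟨by omega, by omega, rfl⟩
  rintro τ₁ ⟨hG₁, h11₁, hA₁⟩ hf₁
  have hI₁ := h1.frame hf₁
  have hp₁ := h2.frame hf₁
  have e19₁ := (hf₁.ireg 19 rfl).trans h19
  refine (Spec.seq (T := 9) (U := 19) (prep_insert (a := cid G.n off L (G.srcN e))
    (b := G.srcN e) (r := 0)
    hPW hG₁ (by omega) (by omega) (by omega) ?_ (by simp [Cmd.cost])) ?_).mono
    (by omega) fun τ h => h
  · simp [wp, e19₁, hI₁.a0, hI₁.r0, hp₁.r17, hp₁.r16]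
    unfold cid at *
    exact ⟨by omega, by omega, rfl⟩
  rintro τ₂ ⟨hG₂, h11₂, hA₂⟩ hf₂
  have hI₂ := hI₁.frame hf₂
  have hp₂ := hp₁.frame hf₂
  have e19₂ := (hf₂.ireg 19 rfl).trans e19₁
  refine (Spec.seq (T := 9) (U := 10) (prep_insert (a := G.dstN e)
    (b := cid G.n off L (G.dstN e)) (r := 0)
    hPW hG₂ (by omega) (by omega) (by omega) ?_ (by simp [Cmd.cost])) ?_).mono
    (by omega) fun τ h => h
  · simp [wp, e19₂, hI₂.a1, hI₂.r0, hp₂.r17, hp₂.r16]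
    unfold cid at *
    exact ⟨by omega, by omega, rfl⟩
  rintro τ₃ ⟨hG₃, h11₃, hA₃⟩ hf₃
  have hI₃ := hI₂.frame hf₃
  have hp₃ := hp₂.frame hf₃
  have e19₃ := (hf₃.ireg 19 rfl).trans e19₂
  refine (Spec.seq (T := 9) (U := 1) (prep_insert (a := cid G.n off L (G.dstN e))
    (b := G.dstN e) (r := 0)
    hPW hG₃ (by omega) (by omega) (by omega) ?_ (by simp [Cmd.cost])) ?_).mono
    (by omega) fun τ h => h
  · simp [wp, e19₃, hI₃.a1, hI₃.r0, hp₃.r17, hp₃.r16]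
    unfold cid at *
    exact ⟨by omega, by omega, rfl⟩
  rintro ρ ⟨h3, h4, hA₄⟩ hf₄
  have h5 := (hf₄.ireg 19 rfl).trans e19₃
  have h6 : Adds τ ρ (CenterEdge G L off e) :=
    (((hA₁.trans hA₂).trans hA₃).trans hA₄).congr fun u v w => by
      unfold CenterEdge; tauto
  refine (Spec.of_wp' (Q := fun ρ' => ρ' = ρ.setIReg 19 (e + 1)) ?_ le_rfl).mono le_rfl ?_
  · simp only [wp, IExpr.eval, h5, and_true]; omega
  · rintro _ rfl
    refine ⟨h3.congr (by simp) (by simp) rfl rfl rfl rfl, by simp, ?_,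
      fun u v w => by
        rw [has_congr (σ := ρ) (τ := ρ.setIReg 19 _) (by simp) rfl rfl rfl]; exact h6 u v w⟩
    simp only [State.setIReg_ireg]; norm_num; omega

theorem linkEdges_spec (hPW : P ≤ W) (σ : State) (hI : Inp G h₀ h α σ) (hpar : Par L off σ)
    (hG : Graph P σ) (hP : off + (2 * L + 2) * G.n ≤ P)
    (hW : σ.ireg 11 + G.m + 1 ≤ W) :
    Spec O ω W linkEdges σ (G.m * 12 + 2) fun τ =>
      Graph P τ ∧ τ.ireg 11 ≤ σ.ireg 11 + 1 * G.m ∧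
      Adds σ τ fun u v w => ∃ e < G.m, 0 < σ.imem 8 e ∧ LinkEdge G L off e u v w := by
  refine insert_loop (J := fun τ => Inp G h₀ h α τ ∧ Par L off τ ∧ τ.imem 8 = σ.imem 8) (T := 11)
    (New := fun e u v w => 0 < σ.imem 8 e ∧ LinkEdge G L off e u v w) hG ?_ ?_ ?_ ?_
  · have hf : Frame (.iset 19 (.const 0)) σ (σ.setIReg 19 0) :=
      (Run.iset (O := O) (ω := ω) (W := W) σ 19 (.const 0) (Nat.zero_le _)).frame
    exact ⟨hI.frame hf, hpar.frame hf, rfl⟩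
  · rintro τ ρ ⟨h1, h2, h3⟩ hf
    exact ⟨h1.frame hf, h2.frame hf, (hf.imem 8 rfl).trans h3⟩
  · rintro τ ⟨h1, h2⟩
    simp [h1.r1]
  rintro e he τ ⟨h1, h2, h8⟩ hGτ h19 h11
  have hs := WDigraph.srcN_lt he
  have hcs := cid_lt (off := off) hs (show 2 * L < 2 * L + 2 by omega)
  have hcs' := cid_lt (off := off) hs (show 0 < 2 * L + 2 by omega)
  refine (Spec.seq (T := 10) (U := 1) (Q := fun ρ => Graph P ρ ∧ ρ.ireg 11 ≤ τ.ireg 11 + 1 ∧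
    ρ.ireg 19 = e ∧ Adds τ ρ fun u v w => 0 < σ.imem 8 e ∧ LinkEdge G L off e u v w) ?_ ?_).mono
    (by omega) fun τ h => h
  · refine Spec.cond (fun hb => ?_) (fun hb => ?_)
    · simp only [BExpr.eval, IExpr.eval, h19, h8] at hb
      refine (prep_insert (T := 9) (a := cid G.n off (2 * L) (G.srcN e))
        (b := cid G.n off 0 (G.srcN e)) (r := 0) hPW hGτ (by omega) (by omega) (by omega)
        ?_ (by simp [Cmd.cost])).conseq le_rfl ?_
      · simp [wp, h19, h1.a0, h1.r0, h2.r17, h2.r16]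
        unfold cid at *
        exact ⟨by omega, by omega, rfl, by omega⟩
      · rintro ρ ⟨h3, h4, h5⟩ hf
        refine ⟨h3, by omega, (hf.ireg 19 rfl).trans h19, h5.congr fun u v w => ?_⟩
        simp only [LinkEdge, hb, true_and]
    · simp only [BExpr.eval, IExpr.eval, h19, h8] at hb
      refine Spec.of_wp' ?_ (by simp [Cmd.cost])
      simp only [wp]
      refine ⟨hGτ, by omega, h19, (adds_of_has_eq rfl).congr fun u v w => ?_⟩
      simp only [hb, false_and]
  rintro ρ ⟨h3, h4, h5, h6⟩ -
  refine (Spec.of_wp' (Q := fun ρ' => ρ' = ρ.setIReg 19 (e + 1)) ?_ le_rfl).mono le_rfl ?_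
  · simp only [wp, IExpr.eval, h5, and_true]; omega
  · rintro _ rfl
    exact ⟨h3.congr (by simp) (by simp) rfl rfl rfl rfl, by simp, by simpa using h4,
      fun u v w => by
        rw [has_congr (σ := ρ) (τ := ρ.setIReg 19 _) (by simp) rfl rfl rfl]; exact h6 u v w⟩

end

/-! ### Soundness of the constraints and the contents of a layered copy -/

/-- An edge is sound if every potential of `G` without negative edges, repeated with period `n`,
satisfies it. -/
def SoundEdge (G : WDigraph) (u v : ℕ) (w : ℝ) : Prop :=
  ∀ ψ : ℕ → ℝ, (∀ e < G.m, 0 ≤ G.wtN e + ψ (G.srcN e) - ψ (G.dstN e)) →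
    0 ≤ w + ψ (u % G.n) - ψ (v % G.n)

/-- All edges of the constraint graph are sound and have ends below `off`. -/
def SoundBelow (G : WDigraph) (off : ℕ) (σ : State) : Prop :=
  ∀ u v w, Has σ u v w → u < off ∧ v < off ∧ SoundEdge G u v w

/-- The constraint graph contains a layered copy with links at the edges in `T`. -/
structure HasCopy (G : WDigraph) (L off : ℕ) (T : Set ℕ) (σ : State) : Prop where
  main : ∀ e < G.m, ∀ j < 2 * L + 1, Has σ (cid G.n off j (G.srcN e))
    (cid G.n off (if G.wtN e < 0 then j + 1 else j) (G.dstN e)) (G.wtN e)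
  stay : ∀ e < G.m, ∀ j < 2 * L, Has σ (cid G.n off j (G.srcN e))
    (cid G.n off (j + 1) (G.srcN e)) 0
  center : ∀ e < G.m, ∀ u v w, CenterEdge G L off e u v w → Has σ u v w
  link : ∀ e ∈ T, e < G.m → Has σ (cid G.n off (2 * L) (G.srcN e)) (cid G.n off 0 (G.srcN e)) 0

theorem HasCopy.mono {G : WDigraph} {L off : ℕ} {T : Set ℕ} {σ τ : State}
    (h : HasCopy G L off T σ) (hle : ∀ u v w, Has σ u v w → Has τ u v w) :
    HasCopy G L off T τ :=
  ⟨fun e he j hj => hle _ _ _ (h.main e he j hj), fun e he j hj => hle _ _ _ (h.stay e he j hj),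
    fun e he u v w hc => hle _ _ _ (h.center e he u v w hc),
    fun e he hm => hle _ _ _ (h.link e he hm)⟩

theorem HasCopy.insert {G : WDigraph} {L off e : ℕ} {T : Set ℕ} {σ : State}
    (h : HasCopy G L off T σ)
    (he : Has σ (cid G.n off (2 * L) (G.srcN e)) (cid G.n off 0 (G.srcN e)) 0) :
    HasCopy G L off (insert e T) σ :=
  ⟨h.main, h.stay, h.center, by
    rintro e' (rfl | he') hm
    · exact he
    · exact h.link e' he' hm⟩

theorem Adds.le {σ τ : State} {A : ℕ → ℕ → ℝ → Prop} (h : Adds σ τ A) :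
    ∀ u v w, Has σ u v w → Has τ u v w := fun u v w huv => (h u v w).2 (.inl huv)

/-- As `n` divides `off`, all copies of a vertex are congruent modulo `n`. A climbing edge of weight
zero therefore compares a value with itself, and the other edges repeat edges of `G`. -/
theorem soundEdge_copy {G : WDigraph} {L off k u v : ℕ} {w : ℝ} (hoff : G.n ∣ off)
    (hk : k < G.m * (2 * L + 1)) (h : CopyEdge G L off k u v w) :
    u < off + (2 * L + 2) * G.n ∧ v < off + (2 * L + 2) * G.n ∧ SoundEdge G u v w := by
  have he : k / (2 * L + 1) < G.m := by rw [Nat.div_lt_iff_lt_mul (by omega)]; exact hk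
  have hj : k % (2 * L + 1) < 2 * L + 1 := Nat.mod_lt _ (by omega)
  have hs := WDigraph.srcN_lt he
  have hd := WDigraph.dstN_lt he
  rcases h with ⟨rfl, rfl, rfl⟩ | ⟨hj2, rfl, rfl, rfl⟩
  · refine ⟨cid_lt hs (by omega), cid_lt hd (by split <;> omega), fun ψ hψ => ?_⟩
    rw [cid_mod hoff hs, cid_mod hoff hd]
    exact hψ _ he
  · refine ⟨cid_lt hs (by omega), cid_lt hs (by omega), fun ψ _ => ?_⟩
    rw [cid_mod hoff hs, cid_mod hoff hs]
    simp

theorem soundEdge_center {G : WDigraph} {L off e u v : ℕ} {w : ℝ} (hoff : G.n ∣ off)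
    (hn : G.n ≤ off) (he : e < G.m) (h : CenterEdge G L off e u v w) :
    u < off + (2 * L + 2) * G.n ∧ v < off + (2 * L + 2) * G.n ∧ SoundEdge G u v w := by
  have hs := WDigraph.srcN_lt he
  have hd := WDigraph.dstN_lt he
  have h1 := cid_lt (off := off) hs (show L < 2 * L + 2 by omega)
  have h2 := cid_lt (off := off) hd (show L < 2 * L + 2 by omega)
  obtain ⟨(⟨rfl, rfl⟩ | ⟨rfl, rfl⟩) | (⟨rfl, rfl⟩ | ⟨rfl, rfl⟩), rfl⟩ := h
  all_goals
    refine ⟨by omega, by omega, fun ψ _ => ?_⟩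
    simp [cid_mod hoff hs, cid_mod hoff hd, Nat.mod_eq_of_lt hs, Nat.mod_eq_of_lt hd]

theorem soundEdge_link {G : WDigraph} {L off e u v : ℕ} {w : ℝ} (hoff : G.n ∣ off)
    (he : e < G.m) (h : LinkEdge G L off e u v w) :
    u < off + (2 * L + 2) * G.n ∧ v < off + (2 * L + 2) * G.n ∧ SoundEdge G u v w := by
  have hs := WDigraph.srcN_lt he
  obtain ⟨rfl, rfl, rfl⟩ := h
  refine ⟨cid_lt hs (by omega), cid_lt hs (by omega), fun ψ _ => ?_⟩
  simp [cid_mod hoff hs]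

/-- Add a layered copy to the constraint graph. -/
def addCopy : Cmd := copyPot ⨾ centerPot ⨾ copyEdges ⨾ centerEdges

section
variable {O : Oracle} {ω : ℕ → Bool} {W P : ℕ} {G : WDigraph} {h₀ h : ℕ} {α : ℝ} {L off : ℕ}

theorem addCopy_run (hPW : P ≤ W) (σ : State) (hI : Inp G h₀ h α σ) (hpar : Par L off σ)
    (hG : Graph P σ) (hP : off + (2 * L + 2) * G.n ≤ P) (hn : G.n ≤ off) (hm : 1 ≤ G.m)
    (hW : σ.ireg 11 + 4 * (G.m * (2 * L + 2)) + 1 ≤ W) :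
    Spec O ω W addCopy σ (62 * (G.m * (2 * L + 2))) fun τ =>
      Graph P τ ∧ τ.ireg 11 ≤ σ.ireg 11 + 4 * (G.m * (2 * L + 2)) ∧
      Adds σ τ (fun u v w => (∃ k < G.m * (2 * L + 1), CopyEdge G L off k u v w) ∨
        ∃ e < G.m, CenterEdge G L off e u v w) ∧
      (∀ x < off, τ.rmem 3 x = σ.rmem 3 x ∨ ∃ e < G.m, x = G.srcN e ∨ x = G.dstN e) ∧
      ∀ e < G.m,
        (τ.rmem 3 (G.srcN e) =
          copyVal G.n L off (σ.rreg 3) (σ.rmem 3) (σ.rmem 2) L (G.srcN e) ∧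
        τ.rmem 3 (G.dstN e) =
          copyVal G.n L off (σ.rreg 3) (σ.rmem 3) (σ.rmem 2) L (G.dstN e)) ∧
        ∀ j < 2 * L + 2, τ.rmem 3 (cid G.n off j (G.srcN e)) =
            copyVal G.n L off (σ.rreg 3) (σ.rmem 3) (σ.rmem 2) j (G.srcN e) ∧
          τ.rmem 3 (cid G.n off j (G.dstN e)) =
            copyVal G.n L off (σ.rreg 3) (σ.rmem 3) (σ.rmem 2) j (G.dstN e) := by
  generalize hV : copyVal G.n L off (σ.rreg 3) (σ.rmem 3) (σ.rmem 2) = V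
  have hN : G.m * (2 * L + 2) = G.m * (2 * L + 1) + G.m := by ring
  have hN2 : 2 * G.m ≤ G.m * (2 * L + 2) := by
    rw [mul_comm 2]; exact Nat.mul_le_mul_left _ (by omega)
  refine (Spec.seq (T := 8 * (G.m * (2 * L + 2)) + 2) (U := 4 * G.m + 2 +
    (G.m * (2 * L + 1) * 24 + 2 + (G.m * 38 + 2)))
    (copyPot_spec σ hI hpar hn (by omega) (by omega)) ?_).mono (by omega) fun τ h => h
  rintro τ₁ ⟨hlow₁, hval₁⟩ hf₁
  rw [hV] at hval₁
  have hI₁ := hI.frame hf₁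
  have hp₁ := hpar.frame hf₁
  refine Spec.seq (centerPot_spec τ₁ hI₁ hp₁ hn (by omega) (by omega)) ?_
  rintro τ₂ ⟨hold₂, hval₂⟩ hf₂
  have hI₂ := hI₁.frame hf₂
  have hp₂ := hp₁.frame hf₂
  have hG₂ := (hG.frame hf₁).frame hf₂
  have e11 : τ₂.ireg 11 = σ.ireg 11 := (hf₂.ireg 11 rfl).trans (hf₁.ireg 11 rfl)
  refine Spec.seq (copyEdges_spec hPW τ₂ hI₂ hp₂ hG₂ hP (by omega)) ?_
  rintro τ₃ ⟨hG₃, h11₃, hA₃⟩ hf₃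
  refine (centerEdges_spec hPW τ₃ (hI₂.frame hf₃) (hp₂.frame hf₃) hG₃ hP hn
    (by omega)).conseq le_rfl ?_
  rintro τ₄ ⟨hG₄, h11₄, hA₄⟩ hf₄
  have hHas₂ : Has τ₂ = Has σ := (has_frame hf₂).trans (has_frame hf₁)
  have hπ : τ₄.rmem 3 = τ₂.rmem 3 := (hf₄.rmem 3 rfl).trans (hf₃.rmem 3 rfl)
  have hbig : ∀ x, G.n ≤ x → τ₂.rmem 3 x = τ₁.rmem 3 x := fun x hx =>
    (hold₂ x).resolve_right fun ⟨e, he, hcon⟩ => by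
      have := WDigraph.srcN_lt he
      have := WDigraph.dstN_lt he
      omega
  have hcge : ∀ j v, G.n ≤ cid G.n off j v := fun j v => by unfold cid; omega
  rw [hπ]
  refine ⟨hG₄, by omega, fun u v w => by rw [(hA₃.trans hA₄) u v w, hHas₂], fun x hx => ?_,
    fun e he => ⟨⟨?_, ?_⟩, fun j hj => ⟨?_, ?_⟩⟩⟩
  · rw [← hlow₁ x hx]; exact hold₂ x
  · rw [(hval₂ e he).1, (hval₁ e he L (by omega)).1]
  · rw [(hval₂ e he).2, (hval₁ e he L (by omega)).2]
  · rw [hbig _ (hcge _ _), (hval₁ e he j hj).1]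
  · rw [hbig _ (hcge _ _), (hval₁ e he j hj).2]

theorem exists_counter {m N e j : ℕ} (he : e < m) (hj : j < N) :
    ∃ k < m * N, k / N = e ∧ k % N = j := by
  refine ⟨e * N + j, ?_, ?_, ?_⟩
  · have : (e + 1) * N ≤ m * N := Nat.mul_le_mul_right _ he
    rw [Nat.succ_mul] at this; omega
  · rw [mul_comm, Nat.mul_add_div (by omega), Nat.div_eq_of_lt hj, add_zero]
  · rw [mul_comm, Nat.mul_add_mod, Nat.mod_eq_of_lt hj]

theorem hasCopy_of_adds {σ τ : State} (hA : Adds σ τ (fun u v w =>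
      (∃ k < G.m * (2 * L + 1), CopyEdge G L off k u v w) ∨
        ∃ e < G.m, CenterEdge G L off e u v w)) : HasCopy G L off ∅ τ := by
  refine ⟨fun e he j hj => ?_, fun e he j hj => ?_, fun e he u v w hc =>
    (hA u v w).2 (.inr (.inr ⟨e, he, hc⟩)), fun e he => absurd he (Set.notMem_empty e)⟩
  · obtain ⟨k, hk, h1, h2⟩ := exists_counter he hj
    refine (hA _ _ _).2 (.inr (.inl ⟨k, hk, .inl ?_⟩))
    rw [h1, h2]; exact ⟨rfl, rfl, rfl⟩
  · obtain ⟨k, hk, h1, h2⟩ := exists_counter he (show j < 2 * L + 1 by omega)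
    refine (hA _ _ _).2 (.inr (.inl ⟨k, hk, .inr ?_⟩))
    rw [h1, h2]; exact ⟨hj, rfl, rfl, rfl⟩

theorem soundBelow_of_adds {σ τ : State} (hoff : G.n ∣ off) (hn : G.n ≤ off)
    (hA : Adds σ τ (fun u v w => (∃ k < G.m * (2 * L + 1), CopyEdge G L off k u v w) ∨
        ∃ e < G.m, CenterEdge G L off e u v w)) (hS : SoundBelow G off σ) :
    SoundBelow G (off + (2 * L + 2) * G.n) τ := by
  intro u v w huv
  rcases (hA u v w).1 huv with h1 | ⟨k, hk, h1⟩ | ⟨e, he, h1⟩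
  · obtain ⟨h2, h3, h4⟩ := hS u v w h1
    exact ⟨by omega, by omega, h4⟩
  · exact soundEdge_copy hoff hk h1
  · exact soundEdge_center hoff hn he h1

/-- New edges are satisfied by the choice of `V`. Old edges lie below `off`, where the potential
changes only if the middle layer of `V` differs from it; that is allowed only while there are no old
edges, namely on the first scale. -/
theorem feas_of_adds {σ τ : State} {V : ℕ → ℕ → ℝ}
    (hA : Adds σ τ (fun u v w => (∃ k < G.m * (2 * L + 1), CopyEdge G L off k u v w) ∨
        ∃ e < G.m, CenterEdge G L off e u v w)) (hS : SoundBelow G off σ)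
    (hF : Feas σ (σ.rmem 3))
    (hmain : ∀ e < G.m, ∀ j < 2 * L + 1, 0 ≤ G.wtN e + V j (G.srcN e) -
      V (if G.wtN e < 0 then j + 1 else j) (G.dstN e))
    (hstay : ∀ e < G.m, ∀ j < 2 * L, V (j + 1) (G.srcN e) ≤ V j (G.srcN e))
    (hold : (∀ u v w, ¬ Has σ u v w) ∨ ∀ v < G.n, V L v = σ.rmem 3 v)
    (hlow : ∀ x < off, τ.rmem 3 x = σ.rmem 3 x ∨ ∃ e < G.m, x = G.srcN e ∨ x = G.dstN e)
    (hval : ∀ e < G.m, (τ.rmem 3 (G.srcN e) = V L (G.srcN e) ∧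
        τ.rmem 3 (G.dstN e) = V L (G.dstN e)) ∧
        ∀ j < 2 * L + 2, τ.rmem 3 (cid G.n off j (G.srcN e)) = V j (G.srcN e) ∧
          τ.rmem 3 (cid G.n off j (G.dstN e)) = V j (G.dstN e)) : Feas τ (τ.rmem 3) := by
  intro u v w huv
  rcases (hA u v w).1 huv with h1 | ⟨k, hk, h1⟩ | ⟨e, he, h1⟩
  · rcases hold with hno | hold
    · exact absurd h1 (hno u v w)
    · have hsame : ∀ x < off, τ.rmem 3 x = σ.rmem 3 x := fun x hx => by
        rcases hlow x hx with h2 | ⟨e, he, rfl | rfl⟩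
        · exact h2
        · rw [(hval e he).1.1, hold _ (WDigraph.srcN_lt he)]
        · rw [(hval e he).1.2, hold _ (WDigraph.dstN_lt he)]
      obtain ⟨h2, h3, -⟩ := hS u v w h1
      rw [hsame u h2, hsame v h3]
      exact hF u v w h1
  · have he : k / (2 * L + 1) < G.m := by rw [Nat.div_lt_iff_lt_mul (by omega)]; exact hk
    have hj : k % (2 * L + 1) < 2 * L + 1 := Nat.mod_lt _ (by omega)
    rcases h1 with ⟨rfl, rfl, rfl⟩ | ⟨hj2, rfl, rfl, rfl⟩
    · rw [((hval _ he).2 _ (by omega)).1, ((hval _ he).2 _ (by split <;> omega)).2]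
      exact hmain _ he _ hj
    · rw [((hval _ he).2 _ (by omega)).1, ((hval _ he).2 _ (by omega)).1]
      have := hstay _ he _ hj2
      linarith
  · have h2 := (hval e he).1
    have h3 := (hval e he).2 L (by omega)
    obtain ⟨(⟨rfl, rfl⟩ | ⟨rfl, rfl⟩) | (⟨rfl, rfl⟩ | ⟨rfl, rfl⟩), rfl⟩ := h1
    · rw [h2.1, h3.1]; simp
    · rw [h2.1, h3.1]; simp
    · rw [h2.2, h3.2]; simp
    · rw [h2.2, h3.2]; simp

theorem addCopy_spec (hPW : P ≤ W) (σ : State) (hI : Inp G h₀ h α σ) (hpar : Par L off σ)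
    (hG : Graph P σ) (hP : off + (2 * L + 2) * G.n ≤ P) (hn : G.n ≤ off) (hoff : G.n ∣ off)
    (hm : 1 ≤ G.m) (hW : σ.ireg 11 + 4 * (G.m * (2 * L + 2)) + 1 ≤ W)
    (hS : SoundBelow G off σ) (hF : Feas σ (σ.rmem 3)) {V : ℕ → ℕ → ℝ}
    (hV : V = copyVal G.n L off (σ.rreg 3) (σ.rmem 3) (σ.rmem 2))
    (hmain : ∀ e < G.m, ∀ j < 2 * L + 1, 0 ≤ G.wtN e + V j (G.srcN e) -
      V (if G.wtN e < 0 then j + 1 else j) (G.dstN e))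
    (hstay : ∀ e < G.m, ∀ j < 2 * L, V (j + 1) (G.srcN e) ≤ V j (G.srcN e))
    (hold : (∀ u v w, ¬ Has σ u v w) ∨ ∀ v < G.n, V L v = σ.rmem 3 v) :
    Spec O ω W addCopy σ (62 * (G.m * (2 * L + 2))) fun τ =>
      Graph P τ ∧ τ.ireg 11 ≤ σ.ireg 11 + 4 * (G.m * (2 * L + 2)) ∧
      (∀ u v w, Has σ u v w → Has τ u v w) ∧ HasCopy G L off ∅ τ ∧
      SoundBelow G (off + (2 * L + 2) * G.n) τ ∧ Feas τ (τ.rmem 3) ∧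
      (∀ e < G.m, ∀ j < 2 * L + 2,
        τ.rmem 3 (cid G.n off j (G.srcN e)) = V j (G.srcN e)) := by
  refine (addCopy_run hPW σ hI hpar hG hP hn hm hW).mono le_rfl ?_
  rintro τ ⟨h1, h2, h3, h4, h5⟩
  rw [← hV] at h5
  exact ⟨h1, h2, h3.le, hasCopy_of_adds h3, soundBelow_of_adds hoff hn h3 hS,
    feas_of_adds h3 hS hF hmain hstay hold h4 h5, fun e he j hj => ((h5 e he).2 j hj).1⟩

end

/-! ### One scale of the algorithm -/

/-- Add edges from the last to the first layer at the tails of random edges, until a negative cycle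
is found. -/
def drawLinks : Cmd :=
  .iset 20 (.mul (.reg 13) (.add (.div (.mul (.const 4) (.reg 3)) (.reg 16)) (.const 1))) ⨾
  .iset 29 (.const 0) ⨾
  .loop (.and (.ilt (.reg 8) (.const 1)) (.ilt (.reg 29) (.reg 20)))
    (sample ⨾
      (.iset 23 (.add (.add (.reg 17) (.mul (.mul (.const 2) (.reg 16)) (.reg 0)))
          (.load 0 (.reg 21))) ⨾
        .iset 24 (.add (.add (.reg 17) (.mul (.const 0) (.reg 0))) (.load 0 (.reg 21))) ⨾
        .rset 1 (.ofInt (.const 0))) ⨾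
      addEdge ⨾ .iset 29 (.add (.reg 29) (.const 1)))

theorem dijkstraCost_mono {p E E' : ℕ} (h : E ≤ E') : dijkstraCost p E ≤ dijkstraCost p E' := by
  unfold dijkstraCost
  gcongr

/-- The edges drawn with the blocks of random bits from `a` to `b - 1`. -/
def drawn (ω : ℕ → Bool) (m a b : ℕ) : Set ℕ := {e | ∃ q, a ≤ q ∧ q < b ∧ sampleAt ω m q = e}

theorem drawn_succ {ω : ℕ → Bool} {m a b : ℕ} (hab : a ≤ b) :
    drawn ω m a (b + 1) = insert (sampleAt ω m b) (drawn ω m a b) := by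
  ext e
  simp only [drawn, Set.mem_ofPred_eq, Set.mem_insert_iff]
  constructor
  · rintro ⟨q, h1, h2, rfl⟩
    rcases (show q ≤ b by omega).lt_or_eq with h | rfl
    · exact .inr ⟨q, h1, h, rfl⟩
    · exact .inl rfl
  · rintro (rfl | ⟨q, h1, h2, rfl⟩)
    · exact ⟨b, hab, by omega, rfl⟩
    · exact ⟨q, h1, by omega, rfl⟩

/-- The part of the memory that is needed on every scale. -/
structure Core (G : WDigraph) (h₀ h : ℕ) (α : ℝ) (P K L off : ℕ) (σ : State) : Prop where
  inp : Inp G h₀ h α σ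
  par : Par L off σ
  graph : Graph P σ
  idle : Idle P σ
  r12 : σ.ireg 12 = Nat.clog 2 G.m
  r13 : σ.ireg 13 = K

/-- No potential satisfies the constraint graph. -/
def Infeas (σ : State) : Prop := σ.ireg 8 ≠ 0 ∧ ∀ ψ, ¬ Feas σ ψ

section
variable {O : Oracle} {ω : ℕ → Bool} {W P p : ℕ} {G : WDigraph} {h₀ h : ℕ} {α : ℝ} {K L off : ℕ}

theorem Idle.frame {σ τ : State} {c : Cmd} (h : Idle P σ) (hf : Frame c σ τ)
    (h5 : c.keepsRM 5 = true := by rfl) : Idle P τ := by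
  unfold Idle; rw [hf.rmem 5 h5]; exact h

/-- Unless infeasibility is found, exactly `N` blocks of random bits are used. Hence the bits for
each scale have positions fixed in advance, which the union bound needs. -/
theorem drawLinks_spec (hP : P = 2 ^ p) (hPW : 2 * P ≤ W) (σ : State)
    (hC : Core G h₀ h α P K L off σ)
    (hoP : off + (2 * L + 2) * G.n ≤ P) (hoff : G.n ∣ off) (hm : 1 ≤ G.m) (hmW : 2 * G.m ≤ W)
    {N E a : ℕ} (hN : N = K * (4 * h / L + 1)) (hE : σ.ireg 11 + N ≤ E) (hEW : E + 1 ≤ W)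
    (hS : SoundBelow G (off + (2 * L + 2) * G.n) σ) (hF : Feas σ (σ.rmem 3)) (h8 : σ.ireg 8 = 0)
    (hcopy : HasCopy G L off ∅ σ) (hpos : σ.pos = a * Nat.clog 2 G.m) :
    Spec O ω W drawLinks σ
        (N * (4 * Nat.clog 2 G.m + dijkstraCost p E + 4 * p + 25) + 3) fun τ =>
      Core G h₀ h α P K L off τ ∧ τ.ireg 11 ≤ σ.ireg 11 + N ∧
      (∀ u v w, Has σ u v w → Has τ u v w) ∧ SoundBelow G (off + (2 * L + 2) * G.n) τ ∧
      (Infeas τ ∨ (τ.ireg 8 = 0 ∧ Feas τ (τ.rmem 3) ∧ τ.pos = (a + N) * Nat.clog 2 G.m ∧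
        HasCopy G L off (drawn ω G.m a (a + N)) τ)) := by
  set β := Nat.clog 2 G.m with hβ
  set T := 4 * β + dijkstraCost p E + 4 * p + 24 with hT
  refine (Spec.seq (T := 1) (U := 1 + (N * (T + 1) + 1)) (Q := fun τ => τ = σ.setIReg 20 N)
    (Spec.of_wp' ?_ le_rfl) ?_).mono (by
      have : N * (T + 1) = N * (4 * β + dijkstraCost p E + 4 * p + 25) := by rw [hT]
      omega) fun τ h => h
  · simp [wp, hC.r13, hC.inp.r3, hC.par.r16, ← hN]
    omega
  rintro τ rfl hf₁
  refine Spec.seq (Q := fun τ => τ = (σ.setIReg 20 N).setIReg 29 0)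
    (Spec.of_wp' ?_ le_rfl) ?_
  · simp [wp]
  rintro τ rfl hf₂
  let J : ℕ → State → Prop := fun i τ => Inp G h₀ h α τ ∧ Par L off τ ∧ Graph P τ ∧ Idle P τ ∧
    τ.ireg 12 = β ∧ τ.ireg 13 = K ∧ τ.ireg 20 = N ∧ τ.ireg 29 = i ∧ τ.ireg 11 = σ.ireg 11 + i ∧
    (∀ u v w, Has σ u v w → Has τ u v w) ∧ SoundBelow G (off + (2 * L + 2) * G.n) τ ∧
      (Infeas τ ∨ (τ.ireg 8 = 0 ∧ Feas τ (τ.rmem 3) ∧ τ.pos = (a + i) * β ∧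
        HasCopy G L off (drawn ω G.m a (a + i)) τ))
  refine Spec.loop (fun B τ => ∃ i ≤ N, J i τ ∧ B = (N - i) * (T + 1) + 1) ?_ ?_ _ _
    ⟨0, Nat.zero_le _, ?_, by simp⟩
  · rintro B τ ⟨i, hi, ⟨h1, h2, h3, h4, h5, h6, h7, h9, h10, h11, h12, h13⟩, rfl⟩ hb
    simp only [BExpr.eval, IExpr.eval, h7, h9] at hb
    obtain ⟨hb8, hiN⟩ := hb
    obtain ⟨h14, h15, h16, h17⟩ := h13.resolve_left fun hcon => hcon.1 (by omega)
    refine ⟨T, Spec.mono (R := fun ρ => ∃ B', T + B' + 1 ≤ (N - i) * (T + 1) + 1 ∧ ∃ i ≤ N,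
      J i ρ ∧ B' = (N - i) * (T + 1) + 1) (Q := J (i + 1)) ?_ le_rfl fun ρ hρ => ⟨_, ?_, i + 1, hiN, hρ, rfl⟩⟩
    swap
    · obtain ⟨k, rfl⟩ : ∃ k, N = i + 1 + k := ⟨N - (i + 1), by omega⟩
      have h1 : i + 1 + k - i = k + 1 := by omega
      have h2 : i + 1 + k - (i + 1) = k := by omega
      rw [h1, h2, Nat.succ_mul]; omega
    have hlt := sampleAt_lt ω hm (a + i)
    set e := sampleAt ω G.m (a + i) with he
    have hs := WDigraph.srcN_lt hlt
    have hc1 := cid_lt (off := off) hs (show 2 * L < 2 * L + 2 by omega)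
    have hc2 := cid_lt (off := off) hs (show 0 < 2 * L + 2 by omega)
    refine (Spec.seq (T := 4 * β + 4) (U := 3 + (dijkstraCost p E + 4 * p + 16 + 1))
      (sample_spec τ G.m (a + i) hm hmW h1.r1 h5 h16) ?_).mono (by omega) fun _ h => h
    rintro τ₁ ⟨k1, k2⟩ hf
    have i1 := h1.frame hf
    have i2 := h2.frame hf
    refine Spec.seq (Q := fun ρ => ρ.ireg 23 = cid G.n off (2 * L) (G.srcN e) ∧
      ρ.ireg 24 = cid G.n off 0 (G.srcN e) ∧ ρ.rreg 1 = 0) (Spec.of_wp' ?_ le_rfl) ?_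
    · simp only [wp, IExpr.eval, RExpr.eval, State.setIReg_ireg, State.setIReg_imem, State.setRReg_ireg,
        State.setRReg_rreg, k1, i1.a0, i1.r0, i2.r17, i2.r16, ← he]
      norm_num [i1.a0, i1.r0, i2.r17, i2.r16, k1, ← he]
      unfold cid at *
      exact ⟨by omega, by omega, rfl, by omega⟩
    rintro τ₂ ⟨k3, k4, k5⟩ hf'
    have j1 := i1.frame hf'
    have j2 := i2.frame hf'
    have j3 := (h3.frame hf).frame hf'
    have j4 := (h4.frame hf).frame hf'
    have j5 : τ₂.ireg 12 = β := ((hf'.ireg 12 rfl).trans (hf.ireg 12 rfl)).trans h5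
    have j6 : τ₂.ireg 13 = K := ((hf'.ireg 13 rfl).trans (hf.ireg 13 rfl)).trans h6
    have j7 : τ₂.ireg 20 = N := ((hf'.ireg 20 rfl).trans (hf.ireg 20 rfl)).trans h7
    have j8 : τ₂.ireg 8 = 0 := ((hf'.ireg 8 rfl).trans (hf.ireg 8 rfl)).trans h14
    have j9 : τ₂.ireg 29 = i := ((hf'.ireg 29 rfl).trans (hf.ireg 29 rfl)).trans h9
    have j11 : τ₂.ireg 11 = σ.ireg 11 + i :=
      ((hf'.ireg 11 rfl).trans (hf.ireg 11 rfl)).trans h10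
    have jpos : τ₂.pos = (a + i + 1) * β := (hf'.pos rfl).trans k2
    have jH : Has τ₂ = Has τ := (has_frame hf').trans (has_frame hf)
    have jF : Feas τ₂ (τ₂.rmem 3) := by
      rw [hf'.rmem 3 rfl, hf.rmem 3 rfl]; unfold Feas; rw [jH]; exact h15
    refine Spec.seq ((addEdge_spec hP hPW τ₂ j3 (by omega) (by omega) (by omega) j4 jF
      j8).mono (by have := dijkstraCost_mono (p := p) (show τ₂.ireg 11 ≤ E by omega); omega)
      fun _ h => h) ?_
    rintro τ₃ ⟨l1, l2, l3, l4, l5⟩ hf''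
    have m1 := j1.frame hf''
    have m2 := j2.frame hf''
    refine Spec.conseq (Q := fun ρ => ρ = τ₃.setIReg 29 (i + 1)) (Spec.of_wp' ?_ le_rfl) le_rfl ?_
    · simp only [wp, IExpr.eval, hf''.ireg 29 rfl, j9]
      exact ⟨by omega, trivial⟩
    rintro _ rfl hf₃
    have n11 : τ₃.ireg 11 = σ.ireg 11 + (i + 1) := by omega
    have nH : Has (τ₃.setIReg 29 (i + 1)) = Has τ₃ := has_frame hf₃
    rw [k3, k4, k5, jH] at l3
    have hle : ∀ u v w, Has τ u v w → Has τ₃ u v w := fun u v w h => (l3 u v w).2 (.inl h)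
    refine ⟨m1.frame hf₃, m2.frame hf₃, l1.frame hf₃, l4.frame hf₃, ?_, ?_, ?_, by simp, ?_,
      ?_, ?_, ?_⟩
    · rw [hf₃.ireg 12 rfl, hf''.ireg 12 rfl, j5]
    · rw [hf₃.ireg 13 rfl, hf''.ireg 13 rfl, j6]
    · rw [hf₃.ireg 20 rfl, hf''.ireg 20 rfl, j7]
    · rw [hf₃.ireg 11 rfl, n11]
    · rw [nH]; exact fun u v w huv => hle u v w (h11 u v w huv)
    · unfold SoundBelow; rw [nH]
      intro u v w huv
      rcases (l3 u v w).1 huv with huv | ⟨rfl, rfl, rfl⟩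
      · exact h12 u v w huv
      · exact soundEdge_link hoff hlt ⟨rfl, rfl, rfl⟩
    · rcases l5 with ⟨l6, l7⟩ | ⟨l6, l7⟩
      · right
        refine ⟨(hf₃.ireg 8 rfl).trans l6, ?_, ?_, ?_⟩
        · unfold Feas; rw [nH, hf₃.rmem 3 rfl]; exact l7
        · rw [hf₃.pos rfl, hf''.pos rfl, jpos]; rfl
        · rw [show a + (i + 1) = a + i + 1 from rfl, drawn_succ (by omega)]
          refine HasCopy.insert (h17.mono fun u v w huv => ?_) ?_
          · rw [nH]; exact hle u v w huv
          · rw [nH]; exact (l3 _ _ _).2 (.inr ⟨rfl, rfl, rfl⟩)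
      · left
        refine ⟨by rw [hf₃.ireg 8 rfl]; exact l6, fun ψ hψ => l7 ψ ?_⟩
        unfold Feas at hψ; rw [nH] at hψ; exact hψ
  · rintro B τ ⟨i, hi, ⟨h1, h2, h3, h4, h5, h6, h7, h9, h10, h11, h12, h13⟩, rfl⟩ hb
    simp only [BExpr.eval, IExpr.eval, h7, h9, not_and] at hb
    refine ⟨by omega, ⟨h1, h2, h3, h4, h5, h6⟩, by omega, h11, h12, ?_⟩
    rcases h13 with h13 | h13
    · exact .inl h13
    · obtain rfl : i = N := by have := hb (by omega); omega
      exact .inr h13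
  · have hH : Has ((σ.setIReg 20 N).setIReg 29 0) = Has σ :=
      (has_frame hf₂).trans (has_frame hf₁)
    refine ⟨(hC.inp.frame hf₁).frame hf₂, (hC.par.frame hf₁).frame hf₂,
      (hC.graph.frame hf₁).frame hf₂, (hC.idle.frame hf₁).frame hf₂, ?_, ?_, by simp, by simp,
      by simp, ?_, ?_, .inr ⟨by simpa using h8, ?_, by simpa using hpos, ?_⟩⟩
    · simpa using hC.r12
    · simpa using hC.r13
    · rw [hH]; exact fun _ _ _ h => h
    · unfold SoundBelow; rw [hH]; exact hS
    · unfold Feas; rw [hH]; exact hF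
    · have : drawn ω G.m a (a + 0) = ∅ := by
        ext e; simp only [drawn, Set.mem_ofPred_eq, Set.mem_empty_iff_false, iff_false]
        rintro ⟨q, h1, h2, -⟩; omega
      rw [this]
      exact hcopy.mono fun u v w h => by rw [hH]; exact h

end

/-- A potential that satisfies a layered copy is valid. -/
theorem HasCopy.valid {G : WDigraph} {L off : ℕ} {T : Set ℕ} {σ : State} {π : ℕ → ℝ}
    (h : HasCopy G L off T σ) (hF : Feas σ π) {e : ℕ} (he : e < G.m) (hw : 0 ≤ G.wtN e) :
    0 ≤ G.wtN e + π (G.srcN e) - π (G.dstN e) := by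
  have h1 := hF _ _ _ (h.main e he L (by omega))
  rw [if_neg (not_lt.2 hw)] at h1
  have h2 := hF _ _ _ (h.center e he _ _ _ ⟨.inl (.inl ⟨rfl, rfl⟩), rfl⟩)
  have h3 := hF _ _ _ (h.center e he _ _ _ ⟨.inr (.inr ⟨rfl, rfl⟩), rfl⟩)
  linarith

/-- Turn to the next scale. -/
def nextScale : Cmd :=
  .iset 17 (.add (.reg 17) (.mul (.add (.reg 18) (.const 1)) (.reg 0))) ⨾
  .iset 16 (.mul (.const 2) (.reg 16)) ⨾
  .iset 18 (.add (.mul (.const 2) (.reg 16)) (.const 1))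

/-- All later scales. -/
def scales : Cmd :=
  .loop (.and (.ilt (.reg 8) (.const 1)) (.ilt (.reg 16) (.mul (.const 4) (.reg 3))))
    (setViolation ⨾ addCopy ⨾ drawLinks ⨾ nextScale)

/-- The number of edges drawn on the first `i` scales. -/
def blocks (K B h h₀ : ℕ) : ℕ → ℕ
  | 0 => 0
  | 1 => K * B
  | i + 2 => blocks K B h h₀ (i + 1) + K * (4 * h / (2 * h₀ * 2 ^ (i + 1)) + 1)

/-- The constraint graph contains the layered copy of scale `i`, with links at the edges drawn. -/
def Covered (ω : ℕ → Bool) (G : WDigraph) (K B h h₀ i : ℕ) (σ : State) : Prop :=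
  ∃ off, HasCopy G (2 * h₀ * 2 ^ i) off
    (drawn ω G.m (blocks K B h h₀ i) (blocks K B h h₀ (i + 1))) σ

theorem Covered.mono {ω : ℕ → Bool} {G : WDigraph} {K B h h₀ i : ℕ} {σ τ : State}
    (hc : Covered ω G K B h h₀ i σ) (hle : ∀ u v w, Has σ u v w → Has τ u v w) :
    Covered ω G K B h h₀ i τ := by
  obtain ⟨off, h1⟩ := hc
  exact ⟨off, h1.mono hle⟩

/-- A bound for the number of steps on one scale. -/
def scaleCost (K p m h : ℕ) : ℕ :=
  (640 + 48 * K * (16 + K) * (7 * p + 12) + K * (16 * p + 50)) * (m * h)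

section
variable {O : Oracle} {ω : ℕ → Bool} {W P p : ℕ} {G : WDigraph} {h₀ h : ℕ} {α : ℝ} {K B L off : ℕ}

/-- There are `K (4 h / L + 1)` repairs on `O(K m L)` edges. Since `(4 h / L + 1) L ≤ 8 h`, the
factor `L` cancels. -/
theorem scale_cost_le {β m : ℕ} (hm : 1 ≤ m) (hL : 4 ≤ L) (hLh : L < 4 * h) (hβ : β ≤ p) :
    5 * m + 3 + (62 * (m * (2 * L + 2)) + ((K * (4 * h / L + 1)) *
      (4 * β + dijkstraCost p (2 * ((16 + K) * (m * L))) + 4 * p + 25) + 3 + 3)) ≤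
    scaleCost K p m h := by
  have hmh : m ≤ m * h := Nat.le_mul_of_pos_right _ (by omega)
  have hmL : m * L ≤ 4 * (m * h) := by
    calc m * L ≤ m * (4 * h) := Nat.mul_le_mul_left _ hLh.le
      _ = _ := by ring
  have hq : (4 * h / L + 1) * L ≤ 8 * h := by
    have := Nat.div_mul_le_self (4 * h) L
    rw [Nat.succ_mul]; omega
  have hq2 : 4 * h / L + 1 ≤ 2 * (m * h) := by
    have h1 : 4 * h / L ≤ h := Nat.div_le_of_le_mul (by gcongr)
    have h2 : h ≤ m * h := Nat.le_mul_of_pos_left _ hm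
    omega
  set q := 4 * h / L + 1 with hqdef
  set D := 16 + K with hD
  have hE1 : 1 ≤ D * (m * L) := Nat.mul_pos (by omega) (Nat.mul_pos hm (by omega))
  have hdc : dijkstraCost p (2 * (D * (m * L))) ≤ (7 * p + 12) * (6 * (D * (m * L))) := by
    unfold dijkstraCost
    calc (7 * p + 11) * (2 * (2 * (D * (m * L))) + 1) + 1
        ≤ (7 * p + 11) * (6 * (D * (m * L))) + 1 * (6 * (D * (m * L))) := by
          gcongr <;> omega
      _ = _ := by ring
  have h1 : K * q * dijkstraCost p (2 * (D * (m * L))) ≤ 48 * K * D * (7 * p + 12) * (m * h) := by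
    calc K * q * dijkstraCost p (2 * (D * (m * L)))
        ≤ K * q * ((7 * p + 12) * (6 * (D * (m * L)))) := by gcongr
      _ = 6 * K * D * (7 * p + 12) * m * (q * L) := by ring
      _ ≤ 6 * K * D * (7 * p + 12) * m * (8 * h) := by gcongr
      _ = _ := by ring
  have h2 : K * q * (4 * β + 4 * p + 25) ≤ K * (16 * p + 50) * (m * h) := by
    calc K * q * (4 * β + 4 * p + 25) ≤ K * (2 * (m * h)) * (4 * p + 4 * p + 25) := by gcongr
      _ = _ := by ring
  have h3 : 5 * m + 3 + 62 * (m * (2 * L + 2)) + 6 ≤ 640 * (m * h) := by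
    have : 62 * (m * (2 * L + 2)) = 124 * (m * L) + 124 * m := by ring
    have h4 : 4 * m ≤ m * L := by rw [mul_comm]; exact Nat.mul_le_mul_left _ hL
    omega
  have h4 : K * q * (4 * β + dijkstraCost p (2 * (D * (m * L))) + 4 * p + 25) =
    K * q * dijkstraCost p (2 * (D * (m * L))) + K * q * (4 * β + 4 * p + 25) := by ring
  have h5 : scaleCost K p m h = 640 * (m * h) + 48 * K * D * (7 * p + 12) * (m * h) +
    K * (16 * p + 50) * (m * h) := by unfold scaleCost; ring
  rw [h4, h5]
  omega

/-- The potential is extended to the new copy by `π v + (L - j) M` in layer `j`, with `M` at least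
every violation. It agrees with `π` in the middle layer, so the old constraints remain satisfied. -/
theorem scale_spec (hP : P = 2 ^ p) (hPW : 2 * P ≤ W) (σ : State)
    (hC : Core G h₀ h α P K L off σ) (hL : 4 ≤ L) (hLh : L < 4 * h) (hhm : h < G.m)
    (hoP : off + (2 * L + 2) * G.n ≤ P) (hn : G.n ≤ off) (hoff : G.n ∣ off)
    (hmW : (16 + K) * (G.m * (8 * h)) + 1 ≤ W) (hβ : Nat.clog 2 G.m ≤ p)
    (hE : σ.ireg 11 ≤ (16 + K) * (G.m * L)) {a : ℕ}
    (hzero : ∀ x, off ≤ x → σ.rmem 2 x = 0)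
    (hS : SoundBelow G off σ) (hF : Feas σ (σ.rmem 3)) (h8 : σ.ireg 8 = 0)
    {L₀ off₀ : ℕ} {T₀ : Set ℕ} (hold : HasCopy G L₀ off₀ T₀ σ)
    (hpos : σ.pos = a * Nat.clog 2 G.m) :
    Spec O ω W (setViolation ⨾ addCopy ⨾ drawLinks ⨾ nextScale) σ (scaleCost K p G.m h) fun τ =>
      Core G h₀ h α P K (2 * L) (off + (2 * L + 2) * G.n) τ ∧
      τ.ireg 11 ≤ (16 + K) * (G.m * (2 * L)) ∧ τ.rmem 2 = σ.rmem 2 ∧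
      (∀ u v w, Has σ u v w → Has τ u v w) ∧ SoundBelow G (off + (2 * L + 2) * G.n) τ ∧
      (Infeas τ ∨ (τ.ireg 8 = 0 ∧ Feas τ (τ.rmem 3) ∧
        τ.pos = (a + K * (4 * h / L + 1)) * Nat.clog 2 G.m ∧
        HasCopy G L off (drawn ω G.m a (a + K * (4 * h / L + 1))) τ)) := by
  have hm : 1 ≤ G.m := by omega
  have hP1 : 1 ≤ P := by rw [hP]; exact Nat.one_le_two_pow
  have hqm : 4 * h / L + 1 ≤ G.m := by
    have h1 : 4 * h / L ≤ h := Nat.div_le_of_le_mul (by gcongr)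
    omega
  have hmL : 4 * G.m ≤ G.m * L := by rw [mul_comm]; exact Nat.mul_le_mul_left _ hL
  have hN : K * (4 * h / L + 1) ≤ K * G.m := Nat.mul_le_mul_left _ hqm
  have hKm : K * G.m ≤ K * (G.m * L) := Nat.mul_le_mul_left _ (by omega)
  have hexp : (16 + K) * (G.m * L) = 16 * (G.m * L) + K * (G.m * L) := by ring
  have hexp2 : 4 * (G.m * (2 * L + 2)) = 8 * (G.m * L) + 8 * G.m := by ring
  have hE2 : 2 * ((16 + K) * (G.m * L)) + 1 ≤ W := by
    have : 2 * ((16 + K) * (G.m * L)) ≤ (16 + K) * (G.m * (8 * h)) := by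
      calc 2 * ((16 + K) * (G.m * L)) = (16 + K) * (G.m * (2 * L)) := by ring
        _ ≤ _ := Nat.mul_le_mul_left _ (Nat.mul_le_mul_left _ (by omega))
    omega
  refine (Spec.seq (setViolation_spec σ hC.inp (by omega)) ?_).mono
    (scale_cost_le (K := K) (p := p) hm hL hLh hβ) fun _ h => h
  rintro τ₁ ⟨hM, hviol⟩ hf₁
  have hH₁ : Has τ₁ = Has σ := has_frame hf₁
  have hπ₁ : τ₁.rmem 3 = σ.rmem 3 := hf₁.rmem 3 rfl
  have hd₁ : τ₁.rmem 2 = σ.rmem 2 := hf₁.rmem 2 rfl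
  have hr₁ : τ₁.ireg 11 = σ.ireg 11 := hf₁.ireg 11 rfl
  -- Real array 2 contributes nothing: beyond `off` it contains no distance from the oracle.
  have hcv : ∀ j v, copyVal G.n L off (τ₁.rreg 3) (τ₁.rmem 3) (τ₁.rmem 2) j v =
      σ.rmem 3 v + ((L : ℝ) - j) * τ₁.rreg 3 := fun j v => by
    unfold copyVal
    rw [hπ₁, hd₁, hzero _ (by unfold cid; omega), add_zero]
  have hF₁ : Feas τ₁ (τ₁.rmem 3) := by unfold Feas; rw [hH₁, hπ₁]; exact hF
  have hS₁ : SoundBelow G off τ₁ := by unfold SoundBelow; rw [hH₁]; exact hS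
  refine Spec.seq (addCopy_spec (by omega) τ₁ (hC.inp.frame hf₁) (hC.par.frame hf₁)
    (hC.graph.frame hf₁) hoP hn hoff hm (by omega) hS₁ hF₁ rfl ?_ ?_ ?_) ?_
  · intro e he j hj
    rw [hcv, hcv]
    split
    · have := hviol e he
      push_cast
      nlinarith
    -- A nonnegative edge stays in its layer, where the shift is constant; an earlier copy already
    -- forces it to have nonnegative reduced weight.
    · rename_i hneg
      have := hold.valid hF he (not_lt.1 hneg)
      linarith
  · intro e he j hj
    rw [hcv, hcv]; push_cast; nlinarith
  · right
    intro v hv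
    rw [hcv, hπ₁]; ring
  rintro τ₂ ⟨hG₂, hE₂, hle₂, hc₂, hS₂, hF₂, -⟩ hf₂
  have hC₂ : Core G h₀ h α P K L off τ₂ :=
    ⟨(hC.inp.frame hf₁).frame hf₂, (hC.par.frame hf₁).frame hf₂, hG₂,
      (hC.idle.frame hf₁).frame hf₂, ((hf₂.ireg 12 rfl).trans (hf₁.ireg 12 rfl)).trans hC.r12,
      ((hf₂.ireg 13 rfl).trans (hf₁.ireg 13 rfl)).trans hC.r13⟩
  refine Spec.seq (drawLinks_spec hP hPW τ₂ hC₂ hoP hoff hm (by omega) rfl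
    (E := 2 * ((16 + K) * (G.m * L))) (a := a) (by omega) hE2 hS₂ hF₂
    (((hf₂.ireg 8 rfl).trans (hf₁.ireg 8 rfl)).trans h8) hc₂
    (((hf₂.pos rfl).trans (hf₁.pos rfl)).trans hpos)) ?_
  rintro τ₃ ⟨hC₃, hE₃, hle₃, hS₃, hend⟩ hf₃
  have hr18 := hC₃.par.r18
  have hr16 := hC₃.par.r16
  have hr17 := hC₃.par.r17
  have hr0 := hC₃.inp.r0
  have h8h : 64 * h + 1 ≤ W := by
    have : 64 * h ≤ (16 + K) * (G.m * (8 * h)) := by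
      calc 64 * h = 8 * (1 * (8 * h)) := by ring
        _ ≤ _ := by gcongr; omega
    omega
  refine Spec.conseq (Q := fun ρ => Par (2 * L) (off + (2 * L + 2) * G.n) ρ)
    (Spec.of_wp' ?_ (by simp [nextScale, Cmd.cost])) le_rfl ?_
  · simp only [nextScale, wp, IExpr.eval, State.setIReg_ireg, hr18, hr16, hr17, hr0]
    norm_num
    exact ⟨by rw [show 2 * L + 1 + 1 = 2 * L + 2 from rfl]; omega, by omega, by omega,
      ⟨by simp, by simp, by simp⟩⟩
  rintro ρ hpar hf₄
  have hH₄ : Has ρ = Has τ₃ := has_frame hf₄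
  refine ⟨⟨hC₃.inp.frame hf₄, hpar, hC₃.graph.frame hf₄, hC₃.idle.frame hf₄,
    (hf₄.ireg 12 rfl).trans hC₃.r12, (hf₄.ireg 13 rfl).trans hC₃.r13⟩, ?_, ?_, ?_, ?_, ?_⟩
  · rw [hf₄.ireg 11 rfl]
    have : (16 + K) * (G.m * (2 * L)) = 2 * ((16 + K) * (G.m * L)) := by ring
    omega
  · rw [hf₄.rmem 2 rfl, hf₃.rmem 2 rfl, hf₂.rmem 2 rfl, hd₁]
  · rw [hH₄, ← hH₁]; exact fun u v w huv => hle₃ u v w (hle₂ u v w huv)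
  · unfold SoundBelow; rw [hH₄]; exact hS₃
  · rcases hend with hend | ⟨g1, g2, g3, g4⟩
    · left; unfold Infeas Feas at *; rw [hH₄, hf₄.ireg 8 rfl]; exact hend
    · refine .inr ⟨(hf₄.ireg 8 rfl).trans g1, ?_, (hf₄.pos rfl).trans g3,
        g4.mono (by rw [hH₄]; exact fun _ _ _ h => h)⟩
      unfold Feas; rw [hH₄, hf₄.rmem 3 rfl]; exact g2

theorem scales_spec (hP : P = 2 ^ p) (hPW : 2 * P ≤ W) (σ : State) (hh₀ : 1 ≤ h₀)
    (hC : Core G h₀ h α P K (2 * h₀ * 2 ^ 1) off σ) (hhm : h < G.m)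
    (hoP : off + 32 * (G.n * h) ≤ P) (hn : G.n ≤ off) (hoff : G.n ∣ off)
    (hmW : (16 + K) * (G.m * (8 * h)) + 1 ≤ W) (hβ : Nat.clog 2 G.m ≤ p)
    (hE : σ.ireg 11 ≤ (16 + K) * (G.m * (2 * h₀ * 2 ^ 1)))
    (hzero : ∀ x, off ≤ x → σ.rmem 2 x = 0)
    (hS : SoundBelow G off σ) {N : ℕ} (hN : ∀ i, 2 * h₀ * 2 ^ i < 4 * h → i < N)
    (hgood : Infeas σ ∨ (σ.ireg 8 = 0 ∧ Feas σ (σ.rmem 3) ∧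
      σ.pos = blocks K B h h₀ 1 * Nat.clog 2 G.m ∧ Covered ω G K B h h₀ 0 σ)) :
    Spec O ω W scales σ (N * (scaleCost K p G.m h + 1) + 1) fun τ =>
      (∃ off, SoundBelow G off τ) ∧
      (Infeas τ ∨ (τ.ireg 8 = 0 ∧ Feas τ (τ.rmem 3) ∧ Covered ω G K B h h₀ 0 τ ∧
        ∀ i, 2 * h₀ * 2 ^ i < 4 * h → Covered ω G K B h h₀ i τ)) := by
  set T := scaleCost K p G.m h with hT
  -- Since `L` doubles, the later copies made so far occupy at most `4 n L` numbers, a geometric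
  -- sum.
  let J : ℕ → State → Prop := fun i τ => ∃ o, Core G h₀ h α P K (2 * h₀ * 2 ^ i) o τ ∧
    off ≤ o ∧ o ≤ off + 4 * (G.n * (2 * h₀ * 2 ^ i)) ∧ G.n ∣ o ∧
    τ.ireg 11 ≤ (16 + K) * (G.m * (2 * h₀ * 2 ^ i)) ∧ τ.rmem 2 = σ.rmem 2 ∧ SoundBelow G o τ ∧
    (Infeas τ ∨ (τ.ireg 8 = 0 ∧ Feas τ (τ.rmem 3) ∧
      τ.pos = blocks K B h h₀ i * Nat.clog 2 G.m ∧ ∀ i' < i, Covered ω G K B h h₀ i' τ))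
  refine Spec.loop (fun b τ => ∃ i, 1 ≤ i ∧ J i τ ∧ (N - i) * (T + 1) + 1 ≤ b) ?_ ?_ _ _
    ⟨1, le_rfl, ⟨off, hC, le_rfl, by omega, hoff, hE, rfl, hS, ?_⟩, ?_⟩
  · rintro b τ ⟨i, hi, ⟨o, h1, h2, h2', h3, h4, h5, h6, h7⟩, hb⟩ hcond
    simp only [BExpr.eval, IExpr.eval, h1.par.r16, h1.inp.r3] at hcond
    obtain ⟨h8, hlt⟩ := hcond
    obtain ⟨g1, g2, g3, g4⟩ := h7.resolve_left fun hcon => hcon.1 (by omega)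
    obtain ⟨off₀, g5⟩ := g4 0 (by omega)
    have hiN := hN i hlt
    have h2i : 2 ≤ 2 ^ i := by
      calc 2 = 2 ^ 1 := rfl
        _ ≤ 2 ^ i := Nat.pow_le_pow_right (by norm_num) hi
    have hL4 : 4 ≤ 2 * h₀ * 2 ^ i := by
      calc 4 = 2 * 1 * 2 := rfl
        _ ≤ _ := by gcongr
    have hLs : 2 * (2 * h₀ * 2 ^ i) = 2 * h₀ * 2 ^ (i + 1) := by ring
    set L := 2 * h₀ * 2 ^ i with hL
    have hnL : (2 * L + 2) * G.n ≤ 4 * (G.n * L) := by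
      have : (2 * L + 2) * G.n ≤ (4 * L) * G.n := Nat.mul_le_mul_right _ (by omega)
      calc _ ≤ _ := this
        _ = _ := by ring
    have hnh : 8 * (G.n * L) ≤ 32 * (G.n * h) := by
      have : G.n * L ≤ G.n * (4 * h) := Nat.mul_le_mul_left _ hlt.le
      calc 8 * (G.n * L) ≤ 8 * (G.n * (4 * h)) := by omega
        _ = _ := by ring
    have hblk : blocks K B h h₀ (i + 1) = blocks K B h h₀ i + K * (4 * h / L + 1) := by
      obtain ⟨k, rfl⟩ : ∃ k, i = k + 1 := ⟨i - 1, by omega⟩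
      rw [blocks]
    refine ⟨T, (scale_spec hP hPW τ h1 hL4 hlt hhm (by omega) (by omega) h3 hmW hβ h4
      (fun x hx => by rw [h5]; exact hzero x (by omega)) h6 g2 g1 g5 g3).mono le_rfl ?_⟩
    rintro ρ ⟨k1, k2, k3, k4, k5, k6⟩
    refine ⟨(N - (i + 1)) * (T + 1) + 1, ?_, i + 1, by omega,
      ⟨o + (2 * L + 2) * G.n, ?_, by omega, ?_, ?_, ?_, k3.trans h5, k5, ?_⟩, le_rfl⟩
    · obtain ⟨k, rfl⟩ : ∃ k, N = i + 1 + k := ⟨N - (i + 1), by omega⟩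
      have e1 : i + 1 + k - i = k + 1 := by omega
      have e2 : i + 1 + k - (i + 1) = k := by omega
      rw [e1, Nat.succ_mul] at hb
      rw [e2]; omega
    · rw [← hLs]; exact k1
    · rw [← hLs]
      have : 4 * (G.n * (2 * L)) = 8 * (G.n * L) := by ring
      omega
    · exact dvd_add h3 (dvd_mul_left _ _)
    · rw [← hLs]; exact k2
    · rcases k6 with k6 | ⟨f1, f2, f3, f4⟩
      · exact .inl k6
      · refine .inr ⟨f1, f2, by rw [f3, hblk], fun i' hi' => ?_⟩
        rcases (show i' ≤ i by omega).lt_or_eq with hlt' | rfl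
        · exact (g4 i' hlt').mono k4
        · refine ⟨o, ?_⟩
          rw [hblk]; exact f4
  · rintro b τ ⟨i, hi, ⟨o, h1, h2, h2', h3, h4, h5, h6, h7⟩, hb⟩ hcond
    simp only [BExpr.eval, IExpr.eval, h1.par.r16, h1.inp.r3] at hcond
    refine ⟨by omega, ⟨o, h6⟩, ?_⟩
    rcases h7 with h7 | ⟨g1, g2, g3, g4⟩
    · exact .inl h7
    · refine .inr ⟨g1, g2, g4 0 (by omega), fun i' hi' => g4 i' ?_⟩
      have hge : ¬ 2 * h₀ * 2 ^ i < 4 * h := fun hcon => hcond ⟨by omega, hcon⟩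
      by_contra hcon
      have : 2 ^ i ≤ 2 ^ i' := Nat.pow_le_pow_right (by norm_num) (by omega)
      have : 2 * h₀ * 2 ^ i ≤ 2 * h₀ * 2 ^ i' := Nat.mul_le_mul_left _ this
      omega
  · rcases hgood with hg | ⟨g1, g2, g3, g4⟩
    · exact .inl hg
    · refine .inr ⟨g1, g2, g3, fun i' hi' => ?_⟩
      obtain rfl : i' = 0 := by omega
      exact g4
  · have : (N - 1) * (T + 1) ≤ N * (T + 1) := Nat.mul_le_mul_right _ (by omega)
    omega

end

/-! ### Walks and potentials -/

namespace WDigraph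
variable {G : WDigraph}

theorem isWalk_append {u v : Fin G.n} {p q : List (Fin G.m)} :
    G.IsWalk u (p ++ q) v ↔ ∃ x, G.IsWalk u p x ∧ G.IsWalk x q v := by
  induction p generalizing u with
  | nil => simp [IsWalk]
  | cons e p ih => simp only [List.cons_append, IsWalk, ih]; tauto

/-- `ψ` is a potential without negative edges. -/
def IsPotential (G : WDigraph) (ψ : Fin G.n → ℝ) : Prop := ∀ e, 0 ≤ G.wt e + ψ (G.src e) - ψ (G.dst e)

theorem IsPotential.walk {ψ : Fin G.n → ℝ} (h : G.IsPotential ψ) {u v : Fin G.n}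
    {p : List (Fin G.m)} (hp : G.IsWalk u p v) : ψ v ≤ ψ u + (p.map G.wt).sum := by
  induction p generalizing u with
  | nil => obtain rfl : u = v := hp; simp
  | cons e p ih =>
    obtain ⟨rfl, hp⟩ := hp
    have h1 := ih hp
    have h2 := h e
    simp only [List.map_cons, List.sum_cons]
    linarith

theorem IsPotential.not_hasNegCycle {ψ : Fin G.n → ℝ} (h : G.IsPotential ψ) : ¬ G.HasNegCycle := by
  rintro ⟨u, p, hp, -, hneg⟩
  have := h.walk hp
  linarith

/-- A repeated tail cuts out a closed walk `c`. Because `c` and `b` are nonempty, both `c` and the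
rest `a ++ b` are shorter than `p`, which drives the inductions below. -/
theorem exists_closed {u v : Fin G.n} {p : List (Fin G.m)} (hp : G.IsWalk u p v)
    (hdup : ¬ (p.map G.src).Nodup) : ∃ (a c b : List (Fin G.m)) (x : Fin G.n), p = a ++ (c ++ b) ∧
      c ≠ [] ∧ b ≠ [] ∧ G.IsWalk x c x ∧ G.IsWalk u (a ++ b) v := by
  induction p generalizing u with
  | nil => simp at hdup
  | cons e p ih =>
    obtain ⟨rfl, hp⟩ := hp
    rw [List.map_cons, List.nodup_cons, not_and_or, not_not] at hdup
    rcases hdup with hdup | hdup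
    · obtain ⟨e', he', hee⟩ := List.mem_map.1 hdup
      obtain ⟨a, b, rfl⟩ := List.append_of_mem he'
      obtain ⟨x, h1, h2, h3⟩ := isWalk_append.1 hp
      refine ⟨[], e :: a, e' :: b, G.src e, by simp, by simp, by simp, ⟨rfl, ?_⟩, ?_⟩
      · rw [← hee, h2]; exact h1
      · exact ⟨hee, h3⟩
    · obtain ⟨a, c, b, x, rfl, h1, h2, h3, h4⟩ := ih hp hdup
      exact ⟨e :: a, c, b, x, rfl, h1, h2, h3, rfl, h4⟩

theorem closed_nonneg (hG : ¬ G.HasNegCycle) : ∀ (k : ℕ) (u : Fin G.n) (p : List (Fin G.m)),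
    p.length ≤ k → G.IsWalk u p u → 0 ≤ (p.map G.wt).sum := by
  intro k
  induction k with
  | zero =>
    intro u p hk hp
    obtain rfl : p = [] := List.length_eq_zero_iff.1 (by omega)
    simp
  | succ k ih =>
    intro u p hk hp
    by_cases hdup : (p.map G.src).Nodup
    · by_contra hneg
      exact hG ⟨u, p, hp, hdup, not_le.1 hneg⟩
    · obtain ⟨a, c, b, x, rfl, h1, h2, h3, h4⟩ := exists_closed hp hdup
      have l1 := List.length_pos_iff.2 h1
      have l2 := List.length_pos_iff.2 h2
      simp only [List.length_append] at hk
      have e1 := ih x c (by omega) h3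
      have e2 := ih u (a ++ b) (by simp; omega) h4
      simp only [List.map_append, List.sum_append] at e2 ⊢
      linarith

/-- Cutting out closed walks, whose weight is nonnegative, does not increase the weight and leaves a
walk with distinct edges. -/
theorem walk_bounded (hG : ¬ G.HasNegCycle) : ∀ (k : ℕ) (u v : Fin G.n) (p : List (Fin G.m)),
    p.length ≤ k → G.IsWalk u p v → - ∑ e, |G.wt e| ≤ (p.map G.wt).sum := by
  intro k
  induction k with
  | zero =>
    intro u v p hk hp
    obtain rfl : p = [] := List.length_eq_zero_iff.1 (by omega)
    simpa using Finset.sum_nonneg fun e _ => abs_nonneg (G.wt e)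
  | succ k ih =>
    intro u v p hk hp
    by_cases hdup : (p.map G.src).Nodup
    · have hnd : p.Nodup := List.Nodup.of_map _ hdup
      rw [← List.sum_toFinset _ hnd, ← Finset.sum_neg_distrib]
      calc ∑ e, -|G.wt e| ≤ ∑ e ∈ p.toFinset, -|G.wt e| := by
            have := Finset.sum_le_sum_of_subset_of_nonneg (f := fun e => |G.wt e|)
              (Finset.subset_univ p.toFinset) fun e _ _ => abs_nonneg _
            simp only [Finset.sum_neg_distrib]; linarith
        _ ≤ _ := Finset.sum_le_sum fun e _ => neg_abs_le _
    · obtain ⟨a, c, b, x, rfl, h1, h2, h3, h4⟩ := exists_closed hp hdup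
      have l1 := List.length_pos_iff.2 h1
      simp only [List.length_append] at hk
      have e1 := closed_nonneg hG _ x c le_rfl h3
      have e2 := ih u v (a ++ b) (by simp; omega) h4
      simp only [List.map_append, List.sum_append] at e2 ⊢
      linarith

/-- The infimum of the weights of all walks ending in `v`, with arbitrary start, is finite and
satisfies the triangle inequality. -/
theorem exists_potential (hG : ¬ G.HasNegCycle) : ∃ ψ, G.IsPotential ψ := by
  let A : Fin G.n → Set ℝ := fun v => {r | ∃ u p, G.IsWalk u p v ∧ (p.map G.wt).sum = r}
  have hbdd : ∀ v, BddBelow (A v) := fun v => ⟨- ∑ e, |G.wt e|, by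
    rintro _ ⟨u, p, hp, rfl⟩
    exact walk_bounded hG _ u v p le_rfl hp⟩
  refine ⟨fun v => sInf (A v), fun e => ?_⟩
  have : sInf (A (G.dst e)) - G.wt e ≤ sInf (A (G.src e)) := by
    refine le_csInf ⟨0, G.src e, [], rfl, by simp⟩ ?_
    rintro _ ⟨u, p, hp, rfl⟩
    have := csInf_le (hbdd (G.dst e)) (show (p.map G.wt).sum + G.wt e ∈ A (G.dst e) from
      ⟨u, p ++ [e], isWalk_append.2 ⟨G.src e, hp, show G.IsWalk _ [e] _ from ⟨rfl, rfl⟩⟩, by simp⟩)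
    linarith
  linarith

/-- Without a negative cycle, `G` has a potential, and its periodic continuation would satisfy all
constraints. -/
theorem hasNegCycle_of_infeas {σ : State} {off : ℕ} (hn : 0 < G.n) (hS : SoundBelow G off σ)
    (hI : Infeas σ) : G.HasNegCycle := by
  by_contra hG
  obtain ⟨ψ, hψ⟩ := exists_potential hG
  refine hI.2 (fun x => ψ ⟨x % G.n, Nat.mod_lt _ hn⟩) fun u v w huv => ?_
  obtain ⟨-, -, h⟩ := hS u v w huv
  have := h (fun x => if hx : x < G.n then ψ ⟨x, hx⟩ else 0) fun e he => by
    simp only [srcN_lt he, dstN_lt he, dif_pos]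
    have := hψ ⟨e, he⟩
    simpa [srcN, dstN, wtN, he] using this
  simpa [Nat.mod_lt _ hn] using this

/-! ### Distances -/

theorem dist_self_le (s : Fin G.n) : G.dist s s ≤ 0 :=
  (iInf₂_le ([] : List (Fin G.m)) (show G.IsWalk s [] s from rfl)).trans (by simp)

theorem dist_edge_le (s : Fin G.n) (e : Fin G.m) (h1 : G.dist s (G.src e) ≠ ⊤)
    (h2 : G.dist s (G.src e) ≠ ⊥) (h3 : G.dist s (G.dst e) ≠ ⊥) :
    G.dist s (G.dst e) ≠ ⊤ ∧
      (G.dist s (G.dst e)).toReal ≤ (G.dist s (G.src e)).toReal + G.wt e := by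
  have key : G.dist s (G.dst e) - (G.wt e : EReal) ≤ G.dist s (G.src e) := by
    refine le_iInf₂ fun p hp => ?_
    refine EReal.sub_le_of_le_add ?_
    refine (iInf₂_le (p ++ [e]) (isWalk_append.2 ⟨G.src e, hp, show G.IsWalk _ [e] _ from ⟨rfl, rfl⟩⟩)).trans ?_
    simp
  have h4 : G.dist s (G.dst e) ≠ ⊤ := by
    intro h
    rw [h, EReal.top_sub_coe, top_le_iff] at key
    exact h1 key
  refine ⟨h4, ?_⟩
  lift G.dist s (G.dst e) to ℝ using ⟨h4, h3⟩ with x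
  lift G.dist s (G.src e) to ℝ using ⟨h1, h2⟩ with y
  rw [← EReal.coe_sub, EReal.coe_le_coe_iff] at key
  simp only [EReal.toReal_coe]
  linarith

/-! ### Degree-betweenness -/

theorem sum_rewt {φ : Fin G.n → ℝ} {u v : Fin G.n} {p : List (Fin G.m)} (hp : G.IsWalk u p v) :
    (p.map (G.rewt φ)).sum = (p.map G.wt).sum + φ u - φ v := by
  induction p generalizing u with
  | nil => obtain rfl : u = v := hp; simp
  | cons e p ih =>
    obtain ⟨rfl, hp⟩ := hp
    simp only [List.map_cons, List.sum_cons, ih hp, rewt]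
    ring

theorem hops_cons (e : Fin G.m) (p : List (Fin G.m)) :
    G.hops (e :: p) = G.hops p + if G.wt e < 0 then 1 else 0 := by
  by_cases h : G.wt e < 0 <;> simp [hops, negEdges, h]

theorem hops_nil : G.hops [] = 0 := by simp [hops]

/-- Under a valid potential only originally negative edges can have negative weight. So walks with a
bounded number of them have weights bounded below, and hop distances are never `⊥`. -/
theorem sum_rewt_ge {φ : Fin G.n → ℝ} (hφ : G.Valid φ) (p : List (Fin G.m)) :
    -(G.hops p * ∑ e, |G.rewt φ e|) ≤ (p.map (G.rewt φ)).sum := by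
  induction p with
  | nil => simp [hops_nil]
  | cons e p ih =>
    rw [hops_cons, List.map_cons, List.sum_cons]
    have h1 : |G.rewt φ e| ≤ ∑ e, |G.rewt φ e| :=
      Finset.single_le_sum (f := fun e => |G.rewt φ e|) (fun e _ => abs_nonneg _)
        (Finset.mem_univ e)
    have h2 := neg_abs_le (G.rewt φ e)
    split
    · push_cast; linarith
    · rename_i hneg
      have := hφ e (not_lt.1 hneg)
      push_cast; linarith

theorem hopDist_ne_bot {φ : Fin G.n → ℝ} (hφ : G.Valid φ) (j : ℕ) (s t : Fin G.n) :
    G.hopDist φ j s t ≠ ⊥ := by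
  have : ((-(j * ∑ e, |G.rewt φ e|) : ℝ) : EReal) ≤ G.hopDist φ j s t := by
    refine le_iInf₂ fun p hp => ?_
    rw [EReal.coe_le_coe_iff]
    refine le_trans ?_ (sum_rewt_ge hφ p)
    have h1 : (G.hops p : ℝ) ≤ j := by exact_mod_cast hp.2
    have h2 : 0 ≤ ∑ e, |G.rewt φ e| := Finset.sum_nonneg fun e _ => abs_nonneg _
    nlinarith
  intro h
  rw [h] at this
  exact absurd (le_bot_iff.1 this) (EReal.coe_ne_bot _)

/-- The edges with tails on walks from `s` to `t` of weight less than `c`, with at most `j` negative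
edges before and after the edge. -/
def cheap (G : WDigraph) (j : ℕ) (s t : Fin G.n) (c : ℝ) : Set ℕ :=
  {e | ∃ he : e < G.m, ∃ p q, G.IsWalk s p (G.src ⟨e, he⟩) ∧ G.IsWalk (G.src ⟨e, he⟩) q t ∧
    G.hops p ≤ j ∧ G.hops q ≤ j ∧ (p.map G.wt).sum + (q.map G.wt).sum < c}

theorem cheap_subset (j : ℕ) (s t : Fin G.n) (c : ℝ) : G.cheap j s t c ⊆ Finset.range G.m :=
  fun _ he => by simpa using he.1

theorem cheap_finite (j : ℕ) (s t : Fin G.n) (c : ℝ) : (G.cheap j s t c).Finite :=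
  (Finset.finite_toSet _).subset (cheap_subset j s t c)

/-- For fixed `s`, `t` and `j` the sets form a chain, hence each of them is determined by its
cardinality. The union bound rests on this. -/
theorem cheap_mono {j : ℕ} {s t : Fin G.n} {c c' : ℝ} (h : c ≤ c') :
    G.cheap j s t c ⊆ G.cheap j s t c' := by
  rintro e ⟨he, p, q, h1, h2, h3, h4, h5⟩
  exact ⟨he, p, q, h1, h2, h3, h4, by linarith⟩

theorem cheap_mono_hops {j j' : ℕ} {s t : Fin G.n} {c : ℝ} (h : j ≤ j') :
    G.cheap j s t c ⊆ G.cheap j' s t c := by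
  rintro e ⟨he, p, q, h1, h2, h3, h4, h5⟩
  exact ⟨he, p, q, h1, h2, h3.trans h, h4.trans h, h5⟩

theorem exists_walk_of_hopDist_lt {φ : Fin G.n → ℝ} {j : ℕ} {s t : Fin G.n} {r : ℝ}
    (h : G.hopDist φ j s t < r) :
    ∃ p, G.IsWalk s p t ∧ G.hops p ≤ j ∧ (p.map (G.rewt φ)).sum < r := by
  obtain ⟨p, hp⟩ := iInf_lt_iff.1 h
  obtain ⟨h1, h2⟩ := iInf_lt_iff.1 hp
  exact ⟨p, h1.1, h1.2, by exact_mod_cast h2⟩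

theorem exists_walks {φ : Fin G.n → ℝ} (hφ : G.Valid φ) {j : ℕ} {s v t : Fin G.n}
    (h : G.hopDist φ j s v + G.hopDist φ j v t < 0) :
    ∃ p q, G.IsWalk s p v ∧ G.IsWalk v q t ∧ G.hops p ≤ j ∧ G.hops q ≤ j ∧
      (p.map G.wt).sum + (q.map G.wt).sum < φ t - φ s := by
  have b1 := hopDist_ne_bot hφ j s v
  have b2 := hopDist_ne_bot hφ j v t
  -- In `EReal` the sum `⊤ + ⊥` is `⊥`, so excluding `⊥` is essential: an unreachable vertex must
  -- not count as being between `s` and `t`.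
  have t1 : G.hopDist φ j s v ≠ ⊤ := fun h' => by
    rw [h', EReal.top_add_of_ne_bot b2] at h; exact not_top_lt h
  have t2 : G.hopDist φ j v t ≠ ⊤ := fun h' => by
    rw [h', EReal.add_top_of_ne_bot b1] at h; exact not_top_lt h
  obtain ⟨x, hx⟩ : ∃ x : ℝ, (x : EReal) = G.hopDist φ j s v := by
    lift G.hopDist φ j s v to ℝ using ⟨t1, b1⟩ with x; exact ⟨x, rfl⟩
  obtain ⟨y, hy⟩ : ∃ y : ℝ, (y : EReal) = G.hopDist φ j v t := by
    lift G.hopDist φ j v t to ℝ using ⟨t2, b2⟩ with y; exact ⟨y, rfl⟩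
  rw [← hx, ← hy] at h
  have hxy : x + y < 0 := by exact_mod_cast h
  -- The infima need not be attained; half of the slack `-(x + y)` is allotted to each walk.
  obtain ⟨p, hp1, hp2, hp3⟩ := exists_walk_of_hopDist_lt (r := x - (x + y) / 2)
    (show G.hopDist φ j s v < _ by rw [← hx, EReal.coe_lt_coe_iff]; linarith)
  obtain ⟨q, hq1, hq2, hq3⟩ := exists_walk_of_hopDist_lt (r := y - (x + y) / 2)
    (show G.hopDist φ j v t < _ by rw [← hy, EReal.coe_lt_coe_iff]; linarith)
  rw [sum_rewt hp1] at hp3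
  rw [sum_rewt hq1] at hq3
  exact ⟨p, q, hp1, hq1, hp2, hq2, by linarith⟩

/-- Summing out-degrees counts edges by their tails. Along walks from `s` to `t` the reweighting
telescopes, so `φ` enters only through the threshold `φ t - φ s` for original weights. -/
theorem degBetweenness_le {φ : Fin G.n → ℝ} (hφ : G.Valid φ) (j : ℕ) (s t : Fin G.n) :
    G.degBetweenness φ j s t ≤ (G.cheap j s t (φ t - φ s)).ncard := by
  classical
  unfold degBetweenness outDeg
  have h1 : ∀ v, {e | G.src e = v}.ncard = (Finset.univ.filter fun e => G.src e = v).card :=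
    fun v => by rw [← Set.ncard_coe_finset]; congr 1; ext; simp
  simp only [h1]
  rw [← Finset.card_biUnion fun v _ w _ hvw => Finset.disjoint_filter.2 fun e _ h2 h3 =>
    hvw (h2.symm.trans h3), ← Finset.card_image_of_injective _ Fin.val_injective,
    ← Set.ncard_coe_finset]
  refine Set.ncard_le_ncard ?_ (cheap_finite _ _ _ _)
  intro x hx
  simp only [Finset.coe_image, Set.mem_image, Finset.mem_coe, Finset.mem_biUnion,
    Finset.mem_filter, Finset.mem_univ, true_and] at hx
  obtain ⟨e, ⟨v, hv, rfl⟩, rfl⟩ := hx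
  exact ⟨e.2, exists_walks hφ hv⟩

end WDigraph

/-! ### Lifting walks to a layered copy, and the effect of a link -/

section
variable {G : WDigraph} {L off : ℕ} {T : Set ℕ} {σ : State} {π : ℕ → ℝ}

/-- The lift of a walk climbs one layer per negative edge and may start in any layer from which it
stays within layer `2 L`. -/
theorem HasCopy.walk (h : HasCopy G L off T σ) (hF : Feas σ π) {u v : Fin G.n}
    {p : List (Fin G.m)} (hp : G.IsWalk u p v) {j : ℕ} (hj : j + G.hops p ≤ 2 * L) :
    π (cid G.n off (j + G.hops p) v) ≤ π (cid G.n off j u) + (p.map G.wt).sum := by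
  induction p generalizing u j with
  | nil => obtain rfl : u = v := hp; simp [WDigraph.hops_nil]
  | cons e p ih =>
    obtain ⟨rfl, hp⟩ := hp
    rw [WDigraph.hops_cons] at hj ⊢
    have h1 := hF _ _ _ (h.main e e.2 j (by omega))
    simp only [WDigraph.srcN, WDigraph.dstN, WDigraph.wtN, e.2, dif_pos, Fin.eta] at h1
    simp only [List.map_cons, List.sum_cons]
    split at h1
    · rename_i hneg
      rw [if_pos hneg] at hj ⊢
      have h2 := ih hp (j := j + 1) (by omega)
      rw [show j + 1 + G.hops p = j + (G.hops p + 1) by omega] at h2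
      linarith
    · rename_i hneg
      rw [if_neg hneg] at hj ⊢
      have h2 := ih hp (j := j) (by omega)
      rw [add_zero]
      linarith

theorem HasCopy.descend (h : HasCopy G L off T σ) (hF : Feas σ π) {e : ℕ} (he : e < G.m)
    {j j' : ℕ} (hj : j ≤ j') (hj' : j' ≤ 2 * L) :
    π (cid G.n off j' (G.srcN e)) ≤ π (cid G.n off j (G.srcN e)) := by
  induction j', hj using Nat.le_induction with
  | base => exact le_rfl
  | succ j' _ ih =>
    have h1 := hF _ _ _ (h.stay e he j' (by omega))
    have h2 := ih (by omega)
    linarith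

theorem HasCopy.center_eq (h : HasCopy G L off T σ) (hF : Feas σ π) {e : ℕ} (he : e < G.m) :
    π (cid G.n off L (G.srcN e)) = π (G.srcN e) ∧ π (cid G.n off L (G.dstN e)) = π (G.dstN e) := by
  have h1 := hF _ _ _ (h.center e he _ _ _ ⟨.inl (.inl ⟨rfl, rfl⟩), rfl⟩)
  have h2 := hF _ _ _ (h.center e he _ _ _ ⟨.inl (.inr ⟨rfl, rfl⟩), rfl⟩)
  have h3 := hF _ _ _ (h.center e he _ _ _ ⟨.inr (.inl ⟨rfl, rfl⟩), rfl⟩)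
  have h4 := hF _ _ _ (h.center e he _ _ _ ⟨.inr (.inr ⟨rfl, rfl⟩), rfl⟩)
  constructor <;> linarith

/-- Only endpoints of edges are identified with the middle layer. The start of a walk to the tail of
an edge is such an endpoint even if the walk is empty. -/
theorem HasCopy.center_start (h : HasCopy G L off T σ) (hF : Feas σ π) {u : Fin G.n}
    {e : Fin G.m} {p : List (Fin G.m)} (hp : G.IsWalk u p (G.src e)) :
    π (cid G.n off L u) = π u := by
  cases p with
  | nil =>
    obtain rfl : u = G.src e := hp
    simpa [WDigraph.srcN] using (h.center_eq hF e.2).1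
  | cons e' p =>
    obtain ⟨rfl, -⟩ := hp
    simpa [WDigraph.srcN] using (h.center_eq hF e'.2).1

theorem HasCopy.center_end (h : HasCopy G L off T σ) (hF : Feas σ π) {v : Fin G.n}
    {e : Fin G.m} {p : List (Fin G.m)} (hp : G.IsWalk (G.src e) p v) :
    π (cid G.n off L v) = π v := by
  rcases List.eq_nil_or_concat p with rfl | ⟨p', e', rfl⟩
  · obtain rfl : G.src e = v := hp
    simpa [WDigraph.srcN] using (h.center_eq hF e.2).1
  · rw [List.concat_eq_append] at hp
    obtain ⟨x, -, -, rfl⟩ := WDigraph.isWalk_append.1 hp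
    simpa [WDigraph.dstN] using (h.center_eq hF e'.2).2

/-- A potential that satisfies a layered copy leaves no cheap walk at a linked edge. -/
theorem HasCopy.cheap_disjoint (h : HasCopy G L off T σ) (hF : Feas σ π) (s t : Fin G.n) :
    Disjoint (G.cheap L s t (π t - π s)) T := by
  rw [Set.disjoint_left]
  rintro e ⟨he, p, q, hp, hq, hpj, hqj, hlt⟩ heT
  -- The closed chain of inequalities: lift `p` from layer `L`, climb to layer `2 L`, take the link
  -- to layer `0`, climb to layer `L - hops q`, and lift `q` so that it ends in layer `L`.
  have h1 := h.walk hF hp (j := L) (by omega)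
  have h2 := h.walk hF hq (j := L - G.hops q) (by omega)
  rw [Nat.sub_add_cancel hqj, h.center_end hF hq] at h2
  rw [h.center_start hF hp] at h1
  have h3 := h.descend hF he (show L + G.hops p ≤ 2 * L by omega) le_rfl
  have h4 := h.descend hF he (Nat.zero_le (L - G.hops q)) (by omega)
  have h5 := hF _ _ _ (h.link e heT he)
  simp only [WDigraph.srcN, he, dif_pos] at h3 h4 h5
  linarith

end

/-! ### The instance for the oracle

It consists of a layered copy whose last layer is joined to the first one, shifted by a multiple of
`M` per layer so that the edges of the copy become nonnegative.  The vertex `hub` has an edge to a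
vertex `hub + 1 + k` for every tail of an edge and every layer. -/

/-- The source of the oracle query. -/
def hub (G : WDigraph) (L off : ℕ) : ℕ := off + (2 * L + 2) * G.n

/-- The tails of the edges of the query. -/
def qsrc (G : WDigraph) (L off x : ℕ) : ℕ :=
  if x % 4 = 0 then hub G L off else if x % 4 = 2 then hub G L off + 1 + x / 4
  else cid G.n off (x / 4 % (2 * L + 1)) (G.srcN (x / 4 / (2 * L + 1)))

/-- The heads of the edges of the query. -/
def qdst (G : WDigraph) (L off x : ℕ) : ℕ :=
  if x % 4 < 2 then hub G L off + 1 + x / 4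
  else if x % 4 = 2 then cid G.n off (if x / 4 % (2 * L + 1) < 2 * L then x / 4 % (2 * L + 1) + 1
    else 0) (G.srcN (x / 4 / (2 * L + 1)))
  else cid G.n off (if G.wtN (x / 4 / (2 * L + 1)) < 0 then x / 4 % (2 * L + 1) + 1
    else x / 4 % (2 * L + 1)) (G.dstN (x / 4 / (2 * L + 1)))

/-- The weights of the edges of the query. -/
def qwt (G : WDigraph) (L : ℕ) (mark : ℕ → ℕ) (M : ℝ) (x : ℕ) : ℝ :=
  if x % 4 < 2 then 0
  else if x % 4 = 2 then
    if x / 4 % (2 * L + 1) < 2 * L then M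
    else if 0 < mark (x / 4 / (2 * L + 1)) then -(2 * L * M) else 0
  else if G.wtN (x / 4 / (2 * L + 1)) < 0 then G.wtN (x / 4 / (2 * L + 1)) + M
    else G.wtN (x / 4 / (2 * L + 1))

/-- Compute one edge of the query. -/
def queryEdge : Cmd :=
  (.iset 33 (.div (.reg 19) (.const 4)) ⨾ .iset 34 (.sub (.reg 19) (.mul (.reg 33) (.const 4))) ⨾
    .iset 21 (.div (.reg 33) (.reg 18)) ⨾
    .iset 22 (.sub (.reg 33) (.mul (.reg 21) (.reg 18)))) ⨾
  .cond (.ilt (.reg 34) (.const 1))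
    (.iset 23 (.reg 6) ⨾ .iset 24 (.add (.add (.reg 6) (.const 1)) (.reg 33)) ⨾
      .rset 1 (.ofInt (.const 0)))
    (.cond (.ilt (.reg 34) (.const 2))
      (.iset 23 (.add (.add (.reg 17) (.mul (.reg 22) (.reg 0))) (.load 0 (.reg 21))) ⨾
        .iset 24 (.add (.add (.reg 6) (.const 1)) (.reg 33)) ⨾ .rset 1 (.ofInt (.const 0)))
      (.cond (.ilt (.reg 34) (.const 3))
        (.iset 23 (.add (.add (.reg 6) (.const 1)) (.reg 33)) ⨾
          .cond (.ilt (.reg 22) (.mul (.const 2) (.reg 16)))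
            (.iset 24 (.add (.add (.reg 17) (.mul (.add (.reg 22) (.const 1)) (.reg 0)))
              (.load 0 (.reg 21))) ⨾ .rset 1 (.reg 3))
            (.iset 24 (.add (.add (.reg 17) (.mul (.const 0) (.reg 0))) (.load 0 (.reg 21))) ⨾
              .cond (.ilt (.const 0) (.load 8 (.reg 21)))
                (.rset 1 (.sub (.ofInt (.const 0))
                  (.mul (.mul (.ofInt (.const 2)) (.ofInt (.reg 16))) (.reg 3))))
                (.rset 1 (.ofInt (.const 0)))))
        (.iset 23 (.add (.add (.reg 17) (.mul (.reg 22) (.reg 0))) (.load 0 (.reg 21))) ⨾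
          .cond (.rlt (.load 0 (.reg 21)) (.ofInt (.const 0)))
            (.iset 24 (.add (.add (.reg 17) (.mul (.add (.reg 22) (.const 1)) (.reg 0)))
              (.load 1 (.reg 21))) ⨾ .rset 1 (.add (.load 0 (.reg 21)) (.reg 3)))
            (.iset 24 (.add (.add (.reg 17) (.mul (.reg 22) (.reg 0))) (.load 1 (.reg 21))) ⨾
              .rset 1 (.load 0 (.reg 21))))))

/-- Write the query to memory. -/
def buildQuery : Cmd :=
  .iset 6 (.add (.reg 17) (.mul (.add (.reg 18) (.const 1)) (.reg 0))) ⨾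
  .iset 5 (.mul (.const 4) (.mul (.reg 1) (.reg 18))) ⨾
  .iset 4 (.add (.add (.reg 6) (.const 1)) (.mul (.reg 1) (.reg 18))) ⨾
  .iset 19 (.const 0) ⨾
  .loop (.ilt (.reg 19) (.reg 5))
    (queryEdge ⨾ .istore 2 (.reg 19) (.reg 23) ⨾ .istore 3 (.reg 19) (.reg 24) ⨾
      .rstore 1 (.reg 19) (.reg 1) ⨾ .iset 19 (.add (.reg 19) (.const 1)))

section
variable {O : Oracle} {ω : ℕ → Bool} {W : ℕ} {G : WDigraph} {h₀ h : ℕ} {α : ℝ} {L off : ℕ}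

theorem counter_bounds {m x : ℕ} (hx : x < 4 * (m * (2 * L + 1))) :
    x / 4 < m * (2 * L + 1) ∧ x / 4 / (2 * L + 1) < m ∧ x / 4 % (2 * L + 1) < 2 * L + 1 := by
  have h1 : x / 4 < m * (2 * L + 1) := by omega
  refine ⟨h1, ?_, Nat.mod_lt _ (by omega)⟩
  rw [Nat.div_lt_iff_lt_mul (by omega)]; exact h1

theorem qsrc_lt {x : ℕ} (hx : x < 4 * (G.m * (2 * L + 1))) :
    qsrc G L off x < hub G L off + 1 + G.m * (2 * L + 1) := by
  obtain ⟨h1, h2, h3⟩ := counter_bounds hx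
  have := cid_lt (off := off) (WDigraph.srcN_lt h2) (show x / 4 % (2 * L + 1) < 2 * L + 2 by omega)
  unfold qsrc hub
  split
  · omega
  split <;> omega

theorem qdst_lt {x : ℕ} (hx : x < 4 * (G.m * (2 * L + 1))) :
    qdst G L off x < hub G L off + 1 + G.m * (2 * L + 1) := by
  obtain ⟨h1, h2, h3⟩ := counter_bounds hx
  have a1 := cid_lt (off := off) (WDigraph.srcN_lt h2)
    (show (if x / 4 % (2 * L + 1) < 2 * L then x / 4 % (2 * L + 1) + 1 else 0) < 2 * L + 2 by
      split <;> omega)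
  have a2 := cid_lt (off := off) (WDigraph.dstN_lt h2)
    (show (if G.wtN (x / 4 / (2 * L + 1)) < 0 then x / 4 % (2 * L + 1) + 1
      else x / 4 % (2 * L + 1)) < 2 * L + 2 by split <;> omega)
  unfold qdst hub
  split
  · omega
  split <;> omega

theorem queryEdge_spec (σ : State) (hI : Inp G h₀ h α σ) (hpar : Par L off σ)
    (h6 : σ.ireg 6 = hub G L off) {x : ℕ} (h19 : σ.ireg 19 = x)
    (hx : x < 4 * (G.m * (2 * L + 1))) (hW : hub G L off + 1 + 4 * (G.m * (2 * L + 1)) ≤ W) :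
    Spec O ω W queryEdge σ 12 fun τ => τ.ireg 23 = qsrc G L off x ∧ τ.ireg 24 = qdst G L off x ∧
      τ.rreg 1 = qwt G L (σ.imem 8) (σ.rreg 3) x := by
  have hs := qsrc_lt (off := off) hx
  have hd := qdst_lt (off := off) hx
  obtain ⟨h1, h2, h3⟩ := counter_bounds hx
  have ht : x % 4 < 4 := Nat.mod_lt _ (by norm_num)
  set k := x / 4 with hk
  set e := k / (2 * L + 1) with he
  set j := k % (2 * L + 1) with hj
  have hsub : x - k * 4 = x % 4 := sub_div_mul x 4
  have hsub2 : k - e * (2 * L + 1) = j := sub_div_mul k (2 * L + 1)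
  have hxk : k ≤ x := Nat.div_le_self _ _
  have hek : e ≤ k := Nat.div_le_self _ _
  refine (Spec.seq (T := 4) (U := 8) (Q := fun τ => τ.ireg 33 = k ∧ τ.ireg 34 = x % 4 ∧
    τ.ireg 21 = e ∧ τ.ireg 22 = j) (Spec.of_wp' ?_ le_rfl) ?_).mono (by omega) fun _ h => h
  · simp only [wp, IExpr.eval, State.setIReg_ireg, h19, hpar.r18]
    norm_num [h19, hpar.r18, ← hk, hsub, ← he, hsub2]
    omega
  rintro τ ⟨e33, e34, e21, e22⟩ hf
  have i1 := hI.frame hf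
  have i2 := hpar.frame hf
  have i6 := (hf.ireg 6 rfl).trans h6
  have i8 : τ.imem 8 = σ.imem 8 := hf.imem 8 rfl
  have i3 : τ.rreg 3 = σ.rreg 3 := hf.rreg 3 rfl
  unfold qsrc at hs ⊢
  unfold qdst at hd ⊢
  unfold qwt
  simp only [← hk, ← he, ← hj] at hs hd ⊢
  refine Spec.of_wp' ?_ (by simp [Cmd.cost])
  simp only [wp, BExpr.eval, IExpr.eval, RExpr.eval, State.setIReg_ireg, State.setIReg_imem,
    State.setIReg_rmem, State.setIReg_rreg, State.setRReg_ireg, State.setRReg_rreg, e33, e34,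
    i6, Nat.cast_zero]
  refine ⟨fun c1 => ?_, fun c1 => ⟨fun c2 => ?_, fun c2 => ⟨fun c3 => ?_, fun c3 => ?_⟩⟩⟩
  · have t0 : x % 4 = 0 := by omega
    norm_num [t0, i6, e33]
    omega
  · have t0 : x % 4 = 1 := by omega
    norm_num [t0, i6, e33, i2.r17, e22, i1.r0, i1.a0, e21] at hs ⊢
    refine ⟨?_, ?_, rfl⟩
    · unfold cid at hs; omega
    · omega
  · have t0 : x % 4 = 2 := by omega
    norm_num [t0, i6, e33, i2.r17, e22, i1.r0, i1.a0, e21, i2.r16, i8, i3] at hs hd ⊢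
    refine ⟨by omega, fun c4 => ?_, fun c4 => ?_⟩
    · simp only [if_pos c4] at hd ⊢
      exact ⟨by unfold cid at hd; omega, rfl, fun c5 => absurd c4 (by omega)⟩
    · simp only [if_neg (not_lt.2 c4)] at hd ⊢
      refine ⟨by unfold cid at hd; omega, fun c5 => ⟨?_, ?_⟩, fun c5 => ⟨?_, ?_⟩⟩
      · simp [cid]
      · rw [if_pos c5]
      · simp [cid]
      · rw [if_neg (by omega)]
  · have t0 : x % 4 = 3 := by omega
    norm_num [t0, i6, e33, i2.r17, e22, i1.r0, i1.a0, i1.a1, i1.b0, e21, i2.r16, i8, i3] at hs hd ⊢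
    refine ⟨by unfold cid at hs; omega, fun c4 => ?_, fun c4 => ?_⟩
    · simp only [if_pos c4] at hd ⊢
      exact ⟨by unfold cid at hd; omega, rfl, rfl, fun c5 => absurd c4 (not_lt.2 c5)⟩
    · simp only [if_neg (not_lt.2 c4)] at hd ⊢
      exact ⟨by unfold cid at hd; omega, rfl, rfl, fun c5 => absurd c5 (not_lt.2 c4)⟩

theorem buildQuery_spec (σ : State) (hI : Inp G h₀ h α σ) (hpar : Par L off σ)
    (hW : hub G L off + 1 + 4 * (G.m * (2 * L + 1)) ≤ W) :
    Spec O ω W buildQuery σ (68 * (G.m * (2 * L + 1)) + 5) fun τ =>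
      τ.ireg 4 = hub G L off + 1 + G.m * (2 * L + 1) ∧ τ.ireg 5 = 4 * (G.m * (2 * L + 1)) ∧
      τ.ireg 6 = hub G L off ∧ ∀ x < 4 * (G.m * (2 * L + 1)), τ.imem 2 x = qsrc G L off x ∧
        τ.imem 3 x = qdst G L off x ∧ τ.rmem 1 x = qwt G L (σ.imem 8) (σ.rreg 3) x := by
  set N := G.m * (2 * L + 1) with hN
  refine (Spec.seq (T := 1) (U := 3 + (4 * N * (16 + 1) + 1))
    (Q := fun τ => τ = σ.setIReg 6 (hub G L off)) (Spec.of_wp' ?_ le_rfl) ?_).mono (by omega)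
    fun _ h => h
  · simp only [wp, IExpr.eval, hpar.r17, hpar.r18, hI.r0]
    exact ⟨by unfold hub at hW; rw [show 2 * L + 1 + 1 = 2 * L + 2 from rfl]; omega, rfl⟩
  rintro τ rfl hf₁
  refine (Spec.seq (T := 1) (U := 2 + (4 * N * (16 + 1) + 1))
    (Q := fun τ => τ = (σ.setIReg 6 (hub G L off)).setIReg 5 (4 * N)) (Spec.of_wp' ?_ le_rfl)
    ?_).mono (by omega) fun _ h => h
  · have h1 := hI.r1
    have h2 := hpar.r18
    simp [wp, h1, h2, ← hN]; omega
  rintro τ rfl hf₂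
  refine (Spec.seq (T := 1) (U := 1 + (4 * N * (16 + 1) + 1))
    (Q := fun τ => τ = ((σ.setIReg 6 (hub G L off)).setIReg 5 (4 * N)).setIReg 4
      (hub G L off + 1 + N)) (Spec.of_wp' ?_ le_rfl) ?_).mono (by omega) fun _ h => h
  · have h1 := hI.r1
    have h2 := hpar.r18
    simp [wp, h1, h2, ← hN]; omega
  rintro τ rfl hf₃
  refine (Spec.seq (T := 1) (U := 4 * N * (16 + 1) + 1)
    (Q := fun τ => τ = (((σ.setIReg 6 (hub G L off)).setIReg 5 (4 * N)).setIReg 4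
      (hub G L off + 1 + N)).setIReg 19 0) (Spec.of_wp' ?_ le_rfl) ?_).mono (by omega) fun _ h => h
  · simp [wp]
  rintro τ rfl hf₄
  have hI₀ := (((hI.frame hf₁).frame hf₂).frame hf₃).frame hf₄
  have hp₀ := (((hpar.frame hf₁).frame hf₂).frame hf₃).frame hf₄
  refine (Spec.for (fun i τ => Inp G h₀ h α τ ∧ Par L off τ ∧
    τ.ireg 4 = hub G L off + 1 + N ∧ τ.ireg 5 = 4 * N ∧ τ.ireg 6 = hub G L off ∧ τ.ireg 19 = i ∧
    τ.imem 8 = σ.imem 8 ∧ τ.rreg 3 = σ.rreg 3 ∧ ∀ x < i, τ.imem 2 x = qsrc G L off x ∧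
        τ.imem 3 x = qdst G L off x ∧ τ.rmem 1 x = qwt G L (σ.imem 8) (σ.rreg 3) x)
    (4 * N) 16 ?_ ?_ ?_).mono le_rfl fun τ h => ⟨h.2.2.1, h.2.2.2.1, h.2.2.2.2.1,
      h.2.2.2.2.2.2.2.2⟩
  · rintro i hi τ ⟨h1, h2, h3, h4, h5, h6, h7, h8, h9⟩
    have hs := qsrc_lt (off := off) hi
    have hd := qdst_lt (off := off) hi
    refine ⟨by simpa [h6, h4] using hi, (Spec.seq (T := 12) (U := 4)
      (queryEdge_spec τ h1 h2 h5 h6 hi hW) ?_).mono (by omega) fun _ h => h⟩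
    rintro ρ ⟨k1, k2, k3⟩ hf
    have e19 := (hf.ireg 19 rfl).trans h6
    refine Spec.conseq (Q := fun ρ => ρ.ireg 19 = i + 1 ∧ ∀ x < i + 1,
      ρ.imem 2 x = qsrc G L off x ∧ ρ.imem 3 x = qdst G L off x ∧
      ρ.rmem 1 x = qwt G L (σ.imem 8) (σ.rreg 3) x) (Spec.of_wp' ?_ (by simp [Cmd.cost])) le_rfl ?_
    · simp only [wp, IExpr.eval, RExpr.eval, State.setIMem_ireg, State.setIMem_imem,
        State.setRMem_ireg, State.setRMem_imem, State.setRMem_rmem, State.setIReg_ireg,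
        State.setIReg_imem, State.setIReg_rmem, State.setIMem_rmem, State.setIMem_rreg, e19, k1, k2]
      norm_num
      refine ⟨by omega, by omega, by omega, by omega, by omega, by omega, fun x hx => ?_⟩
      rcases (show x ≤ i by omega).lt_or_eq with hlt | rfl
      · have hf2 : ρ.imem 2 = τ.imem 2 := hf.imem 2 rfl
        have hf3 : ρ.imem 3 = τ.imem 3 := hf.imem 3 rfl
        have hf1 : ρ.rmem 1 = τ.rmem 1 := hf.rmem 1 rfl
        rw [Function.update_of_ne (by omega), Function.update_of_ne (by omega),
          Function.update_of_ne (by omega), hf2, hf3, hf1]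
        exact h9 x hlt
      · rw [Function.update_self, Function.update_self, Function.update_self, k3, h7, h8]
        exact ⟨rfl, rfl, rfl⟩
    · rintro ρ' ⟨g1, g2⟩ hf'
      refine ⟨(h1.frame hf).frame hf', (h2.frame hf).frame hf', ?_, ?_, ?_, g1, ?_, ?_, g2⟩
      · rw [hf'.ireg 4 rfl, hf.ireg 4 rfl, h3]
      · rw [hf'.ireg 5 rfl, hf.ireg 5 rfl, h4]
      · rw [hf'.ireg 6 rfl, hf.ireg 6 rfl, h5]
      · rw [hf'.imem 8 rfl, hf.imem 8 rfl, h7]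
      · rw [hf'.rreg 3 rfl, hf.rreg 3 rfl, h8]
  · rintro τ ⟨h1, h2, h3, h4, h5, h6, h7⟩
    simp [h4, h6]
  · exact ⟨hI₀, hp₀, by simp, by simp, by simp, by simp, rfl, by simp, by simp⟩

end

theorem cid_inj {n off j v j' v' : ℕ} (hv : v < n) (hv' : v' < n)
    (h : cid n off j v = cid n off j' v') : j = j' ∧ v = v' :=
  ⟨by rw [← cid_div (off := off) (j := j) hv, h, cid_div hv'],
    by rw [← cid_sub_mod (off := off) (j := j) hv, h, cid_sub_mod hv']⟩

theorem WDigraph.edge_inj {G : WDigraph} {e e' : ℕ} (he : e < G.m) (he' : e' < G.m)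
    (hs : G.srcN e = G.srcN e') (hd : G.dstN e = G.dstN e') : e = e' := by
  simp only [srcN, dstN, he, he', dif_pos, Fin.val_inj] at hs hd
  have := @G.simple ⟨e, he⟩ ⟨e', he'⟩ (Prod.ext hs hd)
  simpa using this

section
variable (G : WDigraph) (L off : ℕ) (mark : ℕ → ℕ) (M : ℝ)

/-- A query must not have parallel edges, but edges of `G` with a common tail would give parallel
climbing edges; hence these are subdivided by a private vertex `hub + 1 + k`. The first three types
of edges reveal `k` by this vertex, and the last type is simple because `G` is. -/
theorem query_inj {x y : ℕ} (hx : x < 4 * (G.m * (2 * L + 1))) (hy : y < 4 * (G.m * (2 * L + 1)))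
    (hs : qsrc G L off x = qsrc G L off y) (hd : qdst G L off x = qdst G L off y) : x = y := by
  obtain ⟨hx1, hx2, hx3⟩ := counter_bounds hx
  obtain ⟨hy1, hy2, hy3⟩ := counter_bounds hy
  have hxs := WDigraph.srcN_lt hx2
  have hys := WDigraph.srcN_lt hy2
  have hxd := WDigraph.dstN_lt hx2
  have hyd := WDigraph.dstN_lt hy2
  have key : ∀ {z : ℕ}, z / 4 / (2 * L + 1) * (2 * L + 1) + z / 4 % (2 * L + 1) = z / 4 :=
    fun {z} => by have := Nat.div_add_mod (z / 4) (2 * L + 1); rw [mul_comm] at this; exact this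
  have kx := key (z := x)
  have ky := key (z := y)
  have lx : ∀ j < 2 * L + 2, ∀ v < G.n, cid G.n off j v < hub G L off := fun j hj v hv =>
    cid_lt hv hj
  have bxs := lx (x / 4 % (2 * L + 1)) (by omega) _ hxs
  have bys := lx (y / 4 % (2 * L + 1)) (by omega) _ hys
  have bxs' := lx (if x / 4 % (2 * L + 1) < 2 * L then x / 4 % (2 * L + 1) + 1 else 0)
    (by split <;> omega) _ hxs
  have bys' := lx (if y / 4 % (2 * L + 1) < 2 * L then y / 4 % (2 * L + 1) + 1 else 0)
    (by split <;> omega) _ hys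
  have bxd := lx (if G.wtN (x / 4 / (2 * L + 1)) < 0 then x / 4 % (2 * L + 1) + 1
    else x / 4 % (2 * L + 1)) (by split <;> omega) _ hxd
  have byd := lx (if G.wtN (y / 4 / (2 * L + 1)) < 0 then y / 4 % (2 * L + 1) + 1
    else y / 4 % (2 * L + 1)) (by split <;> omega) _ hyd
  have tx : x % 4 < 4 := Nat.mod_lt _ (by norm_num)
  have ty : y % 4 < 4 := Nat.mod_lt _ (by norm_num)
  unfold qsrc at hs
  unfold qdst at hd
  obtain t1 | t1 | t1 | t1 : x % 4 = 0 ∨ x % 4 = 1 ∨ x % 4 = 2 ∨ x % 4 = 3 := by omega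
  all_goals
    obtain t2 | t2 | t2 | t2 : y % 4 = 0 ∨ y % 4 = 1 ∨ y % 4 = 2 ∨ y % 4 = 3 := by omega
  all_goals
    simp only [t1, t2] at hs hd
    norm_num at hs hd
  all_goals first | omega | skip
  obtain ⟨h1, h2⟩ := cid_inj hxs hys hs
  obtain ⟨-, h3⟩ := cid_inj hxd hyd hd
  have h4 := WDigraph.edge_inj hx2 hy2 h2 h3
  rw [h1, h4, ky] at kx
  omega

/-- The graph of the oracle query. -/
def queryGraph : WDigraph where
  n := hub G L off + 1 + G.m * (2 * L + 1)
  m := 4 * (G.m * (2 * L + 1))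
  src x := ⟨qsrc G L off x, qsrc_lt x.2⟩
  dst x := ⟨qdst G L off x, qdst_lt x.2⟩
  wt x := qwt G L mark M x
  simple x y hxy := by
    simp only [Prod.mk.injEq, Fin.mk.injEq] at hxy
    exact Fin.ext (query_inj G L off x.2 y.2 hxy.1 hxy.2)

/-- The source of the oracle query. -/
def querySource : Fin (queryGraph G L off mark M).n :=
  ⟨hub G L off, by show _ < hub G L off + 1 + _; omega⟩

end

section
variable {G : WDigraph} {L off : ℕ} {mark : ℕ → ℕ} {M : ℝ}

/-- The shift by `M` per layer makes all edges nonnegative except the returns from layer `2 L` at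
marked edges, and each marked edge has one such return. -/
theorem numNeg_queryGraph_le (hM : 0 ≤ M) (hMv : ∀ e < G.m, 0 ≤ G.wtN e + M) :
    (queryGraph G L off mark M).numNeg ≤ ((Finset.range G.m).filter fun e => 0 < mark e).card := by
  rw [← Set.ncard_coe_finset]
  refine Set.ncard_le_ncard_of_injOn (fun x => x / 4 / (2 * L + 1)) ?_ ?_ (Finset.finite_toSet _)
  all_goals
    have key : ∀ x : Fin (queryGraph G L off mark M).m, x ∈ (queryGraph G L off mark M).negEdges →
        x.val / 4 / (2 * L + 1) < G.m ∧ x.val % 4 = 2 ∧ x.val / 4 % (2 * L + 1) = 2 * L ∧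
        0 < mark (x.val / 4 / (2 * L + 1)) := by
      intro x hx
      obtain ⟨h1, h2, h3⟩ := counter_bounds (m := G.m) (L := L) x.2
      refine ⟨h2, ?_⟩
      have hx' : qwt G L mark M x < 0 := hx
      have ht : x.val % 4 < 4 := Nat.mod_lt _ (by norm_num)
      have hv := hMv _ h2
      unfold qwt at hx'
      split at hx'
      · linarith
      split at hx'
      · split at hx'
        · linarith
        · split at hx'
          · exact ⟨by assumption, by omega, by assumption⟩
          · linarith
      · split at hx' <;> linarith
  · intro x hx
    obtain ⟨h1, h2, h3, h4⟩ := key x hx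
    simpa using ⟨h1, h4⟩
  · intro x hx y hy hxy
    obtain ⟨-, h2, h3, -⟩ := key x hx
    obtain ⟨-, h2', h3', -⟩ := key y hy
    have e1 := Nat.div_add_mod (x.val / 4) (2 * L + 1)
    have e2 := Nat.div_add_mod (y.val / 4) (2 * L + 1)
    simp only at hxy
    rw [h3, hxy] at e1
    rw [h3'] at e2
    exact Fin.ext (by omega)

/-- The shift `(L - j) M` is compensated in layer `j`, and a subdividing vertex takes the value of
its tail. Unmarked returns have additional slack `2 L M ≥ 0`. -/
theorem potential_queryGraph (hM : 0 ≤ M) (hoff : G.n ∣ off) {ψ : ℕ → ℝ}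
    (hψ : ∀ e < G.m, 0 ≤ G.wtN e + ψ (G.srcN e) - ψ (G.dstN e)) :
    ∃ χ, (queryGraph G L off mark M).IsPotential χ := by
  let f : ℕ → ℕ → ℝ := fun j v => ψ v - ((L : ℝ) - j) * M
  let g : ℕ → ℝ := fun x => if x < hub G L off then f ((x - off) / G.n) (x % G.n) else
    f ((x - hub G L off - 1) % (2 * L + 1)) (G.srcN ((x - hub G L off - 1) / (2 * L + 1)))
  have hg : ∀ j < 2 * L + 2, ∀ v < G.n, g (cid G.n off j v) = f j v := fun j hj v hv => by
    simp only [g]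
    rw [if_pos (show cid G.n off j v < hub G L off from cid_lt hv hj), cid_div hv, cid_mod hoff hv]
  have hg' : ∀ k, g (hub G L off + 1 + k) = f (k % (2 * L + 1)) (G.srcN (k / (2 * L + 1))) :=
    fun k => by
      simp only [g]
      rw [if_neg (by omega), show hub G L off + 1 + k - hub G L off - 1 = k by omega]
  -- The hub has only outgoing edges, of weight zero, so any upper bound of the other values serves
  -- as its value.
  obtain ⟨A, hA⟩ : ∃ A, ∀ x < hub G L off + 1 + G.m * (2 * L + 1), g x ≤ A := by
    refine ⟨∑ x ∈ Finset.range (hub G L off + 1 + G.m * (2 * L + 1)), |g x|, fun x hx => ?_⟩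
    exact (le_abs_self _).trans (Finset.single_le_sum (f := fun x => |g x|)
      (fun _ _ => abs_nonneg _) (Finset.mem_range.2 hx))
  refine ⟨fun x => if x.val = hub G L off then A else g x, fun x => ?_⟩
  obtain ⟨h1, h2, h3⟩ := counter_bounds (m := G.m) (L := L) x.2
  have hs := WDigraph.srcN_lt h2
  have hd := WDigraph.dstN_lt h2
  have hw := hψ _ h2
  have hne : ∀ j < 2 * L + 2, ∀ v < G.n, cid G.n off j v ≠ hub G L off := fun j hj v hv => by
    have := cid_lt (off := off) hv hj
    unfold hub; omega
  have ht : x.val % 4 < 4 := Nat.mod_lt _ (by norm_num)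
  have hmid : ∀ k, hub G L off + 1 + k ≠ hub G L off := fun k => by omega
  show 0 ≤ qwt G L mark M x + (if qsrc G L off x = hub G L off then A else g (qsrc G L off x)) -
    (if qdst G L off x = hub G L off then A else g (qdst G L off x))
  set k := x.val / 4 with hk
  set j := k % (2 * L + 1) with hj
  set e := k / (2 * L + 1) with he
  unfold qwt qsrc qdst
  simp only [← hk, ← hj, ← he]
  obtain t1 | t1 | t1 | t1 : x.val % 4 = 0 ∨ x.val % 4 = 1 ∨ x.val % 4 = 2 ∨ x.val % 4 = 3 := by
    omega
  all_goals
    simp only [t1]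
    norm_num
  · rw [if_neg (hmid k)]
    exact hA _ (by omega)
  · rw [if_neg (hmid k), if_neg (hne _ (by omega) _ hs), hg _ (by omega) _ hs, hg', ← hj, ← he]
  · rw [if_neg (hmid k), hg', ← hj, ← he]
    split
    · rw [if_neg (hne _ (by omega) _ hs), hg _ (by omega) _ hs]
      simp only [f]
      push_cast
      linarith
    · rw [if_neg (hne _ (by omega) _ hs), hg _ (by omega) _ hs]
      have hj2 : j = 2 * L := by omega
      simp only [f, hj2]
      have := mul_nonneg (Nat.cast_nonneg (α := ℝ) L) hM
      split <;> · push_cast; linarith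
  · rw [if_neg (hne _ (by omega) _ hs), hg _ (by omega) _ hs]
    split
    · rw [if_neg (hne _ (by omega) _ hd), hg _ (by omega) _ hd]
      simp only [f]
      push_cast
      linarith
    · rw [if_neg (hne _ (by omega) _ hd), hg _ (by omega) _ hd]
      simp only [f]
      linarith

theorem hasNegCycle_of_queryGraph (hM : 0 ≤ M) (hoff : G.n ∣ off)
    (h : (queryGraph G L off mark M).HasNegCycle) : G.HasNegCycle := by
  by_contra hG
  obtain ⟨ψ, hψ⟩ := WDigraph.exists_potential hG
  obtain ⟨χ, hχ⟩ := potential_queryGraph (L := L) (mark := mark) hM hoff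
    (ψ := fun x => if hx : x < G.n then ψ ⟨x, hx⟩ else 0) fun e he => by
      simp only [WDigraph.srcN_lt he, WDigraph.dstN_lt he, dif_pos]
      have := hψ ⟨e, he⟩
      simpa [WDigraph.srcN, WDigraph.dstN, WDigraph.wtN, he] using this
  exact hχ.not_hasNegCycle h

/-- The inequalities between the distances `D` that are found by the oracle. -/
theorem query_dist {d : Fin (queryGraph G L off mark M).n → EReal}
    (hd : ∀ v, d v = (queryGraph G L off mark M).dist (querySource G L off mark M) v ∧ d v ≠ ⊥)
    {D : ℕ → ℝ} (hD : ∀ v, D v.val = (d v).toReal) :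
    (∀ e < G.m, ∀ j < 2 * L, D (cid G.n off (j + 1) (G.srcN e)) ≤
      D (cid G.n off j (G.srcN e)) + M) ∧
    (∀ e < G.m, 0 < mark e → D (cid G.n off 0 (G.srcN e)) ≤
      D (cid G.n off (2 * L) (G.srcN e)) - 2 * L * M) ∧
    ∀ e < G.m, ∀ j < 2 * L + 1, D (cid G.n off (if G.wtN e < 0 then j + 1 else j) (G.dstN e)) ≤
      D (cid G.n off j (G.srcN e)) + (if G.wtN e < 0 then G.wtN e + M else G.wtN e) := by
  have step : ∀ x : Fin (queryGraph G L off mark M).m,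
      d ((queryGraph G L off mark M).src x) ≠ ⊤ → d ((queryGraph G L off mark M).dst x) ≠ ⊤ ∧
      D (qdst G L off x) ≤ D (qsrc G L off x) + qwt G L mark M x := by
    intro x hx
    have e1 := hD ((queryGraph G L off mark M).src x)
    have e2 := hD ((queryGraph G L off mark M).dst x)
    have b1 := (hd ((queryGraph G L off mark M).src x)).2
    have b2 := (hd ((queryGraph G L off mark M).dst x)).2
    rw [(hd _).1] at hx b1 b2 e1 e2
    obtain ⟨h1, h2⟩ := WDigraph.dist_edge_le _ x hx b1 b2
    rw [← e1, ← e2] at h2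
    exact ⟨by rw [(hd _).1]; exact h1, h2⟩
  have hS : d (querySource G L off mark M) ≠ ⊤ := by
    rw [(hd _).1]
    exact ne_top_of_le_ne_top EReal.zero_ne_top (WDigraph.dist_self_le _)
  let N := G.m * (2 * L + 1)
  have hidx : ∀ k < N, ∀ t < 4, 4 * k + t < (queryGraph G L off mark M).m := fun k hk t ht => by
    show 4 * k + t < 4 * N; omega
  have hmid : ∀ k < N, ∀ v : Fin (queryGraph G L off mark M).n, v.val = hub G L off + 1 + k →
      d v ≠ ⊤ := by
    intro k hk v hv
    have h1 : (queryGraph G L off mark M).src ⟨4 * k + 0, hidx k hk 0 (by norm_num)⟩ =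
        querySource G L off mark M := Fin.ext (by
      show qsrc G L off (4 * k + 0) = _
      simp [qsrc, querySource])
    have h2 : (queryGraph G L off mark M).dst ⟨4 * k + 0, hidx k hk 0 (by norm_num)⟩ = v :=
      Fin.ext (by
        show qdst G L off (4 * k + 0) = _
        simp [qdst, hv])
    have := (step ⟨4 * k + 0, hidx k hk 0 (by norm_num)⟩ (by rw [h1]; exact hS)).1
    rwa [h2] at this
  have hcoord : ∀ k t, t < 4 → (4 * k + t) % 4 = t ∧ (4 * k + t) / 4 = k := fun k t ht => by omega
  -- The returns to layer `0` are present at unmarked edges too, so that the tail copies in layers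
  -- `0` to `2 L` are reachable from the hub and have real distances.
  have hwrap : ∀ e < G.m, ∀ j < 2 * L + 1, ∀ v : Fin (queryGraph G L off mark M).n,
      v.val = cid G.n off (if j < 2 * L then j + 1 else 0) (G.srcN e) → d v ≠ ⊤ := by
    intro e he j hj v hv
    obtain ⟨k, hk, k1, k2⟩ := exists_counter he hj
    obtain ⟨t1, t2⟩ := hcoord k 2 (by norm_num)
    have h2 : (queryGraph G L off mark M).dst ⟨4 * k + 2, hidx k hk 2 (by norm_num)⟩ = v :=
      Fin.ext (by
        show qdst G L off (4 * k + 2) = _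
        unfold qdst
        rw [t1, t2, k1, k2, hv]; norm_num)
    have := (step ⟨4 * k + 2, hidx k hk 2 (by norm_num)⟩ (hmid k hk _ (by
      show qsrc G L off (4 * k + 2) = _
      unfold qsrc
      rw [t1, t2]; norm_num))).1
    rwa [h2] at this
  have hreach : ∀ e < G.m, ∀ j < 2 * L + 1, ∀ v : Fin (queryGraph G L off mark M).n,
      v.val = cid G.n off j (G.srcN e) → d v ≠ ⊤ := by
    intro e he j hj v hv
    rcases Nat.eq_zero_or_pos j with rfl | hpos
    · exact hwrap e he (2 * L) (by omega) v (by rw [if_neg (lt_irrefl _)]; exact hv)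
    · refine hwrap e he (j - 1) (by omega) v ?_
      rw [if_pos (by omega), Nat.sub_add_cancel hpos]; exact hv
  have hstep1 : ∀ e < G.m, ∀ j < 2 * L + 1, ∃ k < N, k / (2 * L + 1) = e ∧
      k % (2 * L + 1) = j ∧ D (hub G L off + 1 + k) ≤ D (cid G.n off j (G.srcN e)) := by
    intro e he j hj
    obtain ⟨k, hk, k1, k2⟩ := exists_counter he hj
    obtain ⟨t1, t2⟩ := hcoord k 1 (by norm_num)
    have h1 : qsrc G L off (4 * k + 1) = cid G.n off j (G.srcN e) := by
      unfold qsrc; rw [t1, t2, k1, k2]; norm_num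
    have h2 : qdst G L off (4 * k + 1) = hub G L off + 1 + k := by
      unfold qdst; rw [t1, t2]; norm_num
    have h3 : qwt G L mark M (4 * k + 1) = 0 := by unfold qwt; rw [t1]; norm_num
    have := (step ⟨4 * k + 1, hidx k hk 1 (by norm_num)⟩ (hreach e he j hj _ h1)).2
    simp only [h1, h2, h3, add_zero] at this
    exact ⟨k, hk, k1, k2, this⟩
  have hstep2 : ∀ k < N, D (cid G.n off (if k % (2 * L + 1) < 2 * L then k % (2 * L + 1) + 1
      else 0) (G.srcN (k / (2 * L + 1)))) ≤ D (hub G L off + 1 + k) +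
      qwt G L mark M (4 * k + 2) := by
    intro k hk
    obtain ⟨t1, t2⟩ := hcoord k 2 (by norm_num)
    have h1 : qsrc G L off (4 * k + 2) = hub G L off + 1 + k := by
      unfold qsrc; rw [t1, t2]; norm_num
    have h2 : qdst G L off (4 * k + 2) = cid G.n off (if k % (2 * L + 1) < 2 * L then
        k % (2 * L + 1) + 1 else 0) (G.srcN (k / (2 * L + 1))) := by
      unfold qdst; rw [t1, t2]; norm_num
    have := (step ⟨4 * k + 2, hidx k hk 2 (by norm_num)⟩ (hmid k hk _ h1)).2
    simpa only [h1, h2] using this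
  refine ⟨fun e he j hj => ?_, fun e he hm => ?_, fun e he j hj => ?_⟩
  · obtain ⟨k, hk, k1, k2, h1⟩ := hstep1 e he j (by omega)
    have h2 := hstep2 k hk
    obtain ⟨t1, t2⟩ := hcoord k 2 (by norm_num)
    unfold qwt at h2
    rw [t1, t2, k1, k2, if_pos hj] at h2
    norm_num [hj] at h2
    linarith
  · obtain ⟨k, hk, k1, k2, h1⟩ := hstep1 e he (2 * L) (by omega)
    have h2 := hstep2 k hk
    obtain ⟨t1, t2⟩ := hcoord k 2 (by norm_num)
    unfold qwt at h2
    rw [t1, t2, k1, k2, if_neg (lt_irrefl _)] at h2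
    norm_num [hm] at h2
    linarith
  · obtain ⟨k, hk, k1, k2⟩ := exists_counter he hj
    obtain ⟨t1, t2⟩ := hcoord k 3 (by norm_num)
    have h1 : qsrc G L off (4 * k + 3) = cid G.n off j (G.srcN e) := by
      unfold qsrc; rw [t1, t2, k1, k2]; norm_num
    have h2 : qdst G L off (4 * k + 3) =
        cid G.n off (if G.wtN e < 0 then j + 1 else j) (G.dstN e) := by
      unfold qdst; rw [t1, t2, k1, k2]; norm_num
    have h3 : qwt G L mark M (4 * k + 3) = if G.wtN e < 0 then G.wtN e + M else G.wtN e := by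
      unfold qwt; rw [t1, t2, k1]; norm_num
    have := (step ⟨4 * k + 3, hidx k hk 3 (by norm_num)⟩ (hreach e he j hj _ h1)).2
    simpa only [h1, h2, h3] using this

end

/-! ### The first scale -/

/-- Mark random edges. -/
def drawMarks : Cmd :=
  .iset 15 (.mul (.reg 13) (.reg 14)) ⨾ .iset 29 (.const 0) ⨾
  .loop (.ilt (.reg 29) (.reg 15))
    (sample ⨾ .istore 8 (.reg 21) (.const 1) ⨾ .iset 29 (.add (.reg 29) (.const 1)))

/-- All scales: the first one with the oracle, the later ones without. -/
def allScales : Cmd :=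
  drawMarks ⨾
  (.iset 16 (.mul (.const 2) (.reg 2)) ⨾ .iset 17 (.reg 0) ⨾
    .iset 18 (.add (.mul (.const 2) (.reg 16)) (.const 1))) ⨾
  setViolation ⨾ buildQuery ⨾ .call ⨾
  .cond (.ilt (.const 0) (.reg 7)) (.iset 8 (.const 1))
    (addCopy ⨾ linkEdges ⨾
      (.iset 17 (.mul (.reg 0) (.reg 4)) ⨾ .iset 16 (.mul (.const 2) (.reg 16)) ⨾
        .iset 18 (.add (.mul (.const 2) (.reg 16)) (.const 1))) ⨾ scales)

section
variable {O : Oracle} {ω : ℕ → Bool} {W P p : ℕ} {G : WDigraph} {h₀ h : ℕ} {α : ℝ} {K B L off : ℕ}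

theorem drawn_self {m a : ℕ} : drawn ω m a a = ∅ := by
  ext e; simp only [drawn, Set.mem_ofPred_eq, Set.mem_empty_iff_false, iff_false]
  rintro ⟨q, h1, h2, -⟩; omega

theorem drawn_ncard_le {m a b : ℕ} : (drawn ω m a b).Finite ∧ (drawn ω m a b).ncard ≤ b - a := by
  have : drawn ω m a b ⊆ ((Finset.Ico a b).image (sampleAt ω m) : Finset ℕ) := by
    rintro e ⟨q, h1, h2, rfl⟩
    exact Finset.mem_coe.2 (Finset.mem_image_of_mem _ (Finset.mem_Ico.2 ⟨h1, h2⟩))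
  refine ⟨(Finset.finite_toSet _).subset this, ?_⟩
  refine (Set.ncard_le_ncard this (Finset.finite_toSet _)).trans ?_
  rw [Set.ncard_coe_finset]
  exact Finset.card_image_le.trans (by simp)

theorem drawMarks_spec (σ : State) (hI : Inp G h₀ h α σ) (hm : 1 ≤ G.m) (hmW : 2 * G.m ≤ W)
    (h12 : σ.ireg 12 = Nat.clog 2 G.m) (h13 : σ.ireg 13 = K) (h14 : σ.ireg 14 = B)
    (hW : K * B ≤ W) (h8 : σ.imem 8 = fun _ => 0) (hpos : σ.pos = 0) :
    Spec O ω W drawMarks σ (K * B * (4 * Nat.clog 2 G.m + 7) + 3) fun τ =>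
      (∀ e, 0 < τ.imem 8 e ↔ e ∈ drawn ω G.m 0 (K * B)) ∧ τ.pos = K * B * Nat.clog 2 G.m := by
  set β := Nat.clog 2 G.m with hβ
  set N := K * B with hN
  refine (Spec.seq (T := 1) (U := 1 + (N * (4 * β + 7) + 1))
    (Q := fun τ => τ = σ.setIReg 15 N) (Spec.of_wp' ?_ le_rfl) ?_).mono (by omega) fun τ h => h
  · simp [wp, h13, h14, ← hN, hW]
  rintro τ rfl hf₁
  refine Spec.seq (Q := fun τ => τ = (σ.setIReg 15 N).setIReg 29 0)
    (Spec.of_wp' ?_ le_rfl) ?_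
  · simp [wp]
  rintro τ rfl hf₂
  refine (Spec.for (fun i τ => Inp G h₀ h α τ ∧ τ.ireg 12 = β ∧ τ.ireg 15 = N ∧ τ.ireg 29 = i ∧
    (∀ e, 0 < τ.imem 8 e ↔ e ∈ drawn ω G.m 0 i) ∧ τ.pos = i * β) N (4 * β + 6) ?_ ?_
    ?_).mono le_rfl fun τ h => h.2.2.2.2
  · rintro i hi τ ⟨h1, h2, h3, h4, h5, h6⟩
    refine ⟨by simpa [h3, h4] using hi, (Spec.seq (T := 4 * β + 4) (U := 2)
      (sample_spec τ G.m i hm hmW h1.r1 h2 h6) ?_).mono (by omega) fun _ h => h⟩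
    rintro ρ ⟨k1, k2⟩ hf
    have hlt := sampleAt_lt ω hm i
    have e29 := (hf.ireg 29 rfl).trans h4
    have e8 : ρ.imem 8 = τ.imem 8 := hf.imem 8 rfl
    refine Spec.conseq (Q := fun ρ' => ρ'.ireg 29 = i + 1 ∧
      ρ'.imem 8 = Function.update (τ.imem 8) (sampleAt ω G.m i) 1) (Spec.of_wp' ?_ le_rfl)
      le_rfl ?_
    · simp [wp, k1, e29, e8]
      omega
    · rintro ρ' ⟨g1, g2⟩ hf'
      refine ⟨(h1.frame hf).frame hf', ?_, ?_, g1, fun e => ?_, ?_⟩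
      · rw [hf'.ireg 12 rfl, hf.ireg 12 rfl, h2]
      · rw [hf'.ireg 15 rfl, hf.ireg 15 rfl, h3]
      · rw [g2, drawn_succ (Nat.zero_le _), Set.mem_insert_iff, ← h5 e, Function.update_apply]
        split
        · rename_i h; simp [h]
        · rename_i h; simp [h]
      · rw [hf'.pos rfl, k2]
  · rintro τ ⟨h1, h2, h3, h4, -⟩
    simp [h3, h4]
  · refine ⟨(hI.frame hf₁).frame hf₂, ?_, by simp, by simp, ?_, by simpa using hpos⟩
    · simpa using h12
    · intro e; simp [h8, drawn_self]

theorem call_spec {H : WDigraph} {s : Fin H.n} (σ : State) (hq : σ.Query H s) :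
    Spec O ω W .call σ 1 fun τ => τ = σ.answer H (O H s) :=
  ⟨_, 1, .call σ H s hq, le_rfl, rfl⟩

/-- The state before the first scale. -/
structure Ready (G : WDigraph) (h₀ h : ℕ) (α : ℝ) (P K B : ℕ) (σ : State) : Prop where
  inp : Inp G h₀ h α σ
  graph : Graph P σ
  idle : Idle P σ
  r8 : σ.ireg 8 = 0
  r11 : σ.ireg 11 = 0
  r12 : σ.ireg 12 = Nat.clog 2 G.m
  r13 : σ.ireg 13 = K
  r14 : σ.ireg 14 = B
  a8 : σ.imem 8 = fun _ => 0
  b2 : σ.rmem 2 = fun _ => 0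
  b3 : σ.rmem 3 = fun _ => 0
  pos : σ.pos = 0
  calls : σ.calls = []

/-- What is known about the state after the last scale. -/
structure Outcome (ω : ℕ → Bool) (G : WDigraph) (h₀ h K B : ℕ) (τ : State) : Prop where
  calls : τ.calls.length ≤ 1
  size : ∀ H ∈ τ.calls, H.m = 4 * (G.m * (4 * h₀ + 1)) ∧ H.numNeg ≤ K * B
  sound : τ.ireg 8 ≠ 0 → G.HasNegCycle
  feas : τ.ireg 8 = 0 → Feas τ (τ.rmem 3) ∧ Covered ω G K B h h₀ 0 τ ∧
    ∀ i, 2 * h₀ * 2 ^ i < 4 * h → Covered ω G K B h h₀ i τ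

theorem linkEdges_feas {σ τ : State} {V : ℕ → ℕ → ℝ} {mark : ℕ → ℕ} (hF : Feas σ (σ.rmem 3))
    (hπ : τ.rmem 3 = σ.rmem 3)
    (hval : ∀ e < G.m, ∀ j < 2 * L + 2, σ.rmem 3 (cid G.n off j (G.srcN e)) = V j (G.srcN e))
    (hV : ∀ e < G.m, 0 < mark e → V 0 (G.srcN e) ≤ V (2 * L) (G.srcN e))
    (hA : Adds σ τ fun u v w => ∃ e < G.m, 0 < mark e ∧ LinkEdge G L off e u v w) :
    Feas τ (τ.rmem 3) := by
  intro u v w huv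
  rw [hπ]
  rcases (hA u v w).1 huv with h1 | ⟨e, he, hm, rfl, rfl, rfl⟩
  · exact hF u v w h1
  · rw [hval e he _ (by omega), hval e he _ (by omega)]
    have := hV e he hm
    linarith

/-- A bound for the number of steps on all scales. -/
def totalCost (K p m h N : ℕ) : ℕ :=
  (K * (8 * p + 14) + 830) * (m * h) + N * (scaleCost K p m h + 1)

theorem total_cost_le {β m N : ℕ} (hm : 1 ≤ m) (hh₀ : 1 ≤ h₀) (hh : h₀ ≤ h) (hβ : β ≤ p)
    (hB : B ≤ m + 1) :
    K * B * (4 * β + 7) + 3 + (3 + (5 * m + 3 + (68 * (m * (2 * (2 * h₀) + 1)) + 5 + (1 +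
      (62 * (m * (2 * (2 * h₀) + 2)) + (m * 12 + 2 + (3 + (N * (scaleCost K p m h + 1) + 1))) +
        1))))) ≤
      totalCost K p m h N := by
  have h1 : m ≤ m * h := Nat.le_mul_of_pos_right _ (by omega)
  have h2 : m * h₀ ≤ m * h := Nat.mul_le_mul_left _ hh
  have h3 : K * B * (4 * β + 7) ≤ K * (8 * p + 14) * (m * h) := by
    calc K * B * (4 * β + 7) ≤ K * (2 * (m * h)) * (4 * p + 7) := by
          gcongr; omega
      _ = _ := by ring
  have h4 : 68 * (m * (2 * (2 * h₀) + 1)) = 272 * (m * h₀) + 68 * m := by ring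
  have h5 : 62 * (m * (2 * (2 * h₀) + 2)) = 248 * (m * h₀) + 124 * m := by ring
  have h6 : totalCost K p m h N = K * (8 * p + 14) * (m * h) + 830 * (m * h) +
    N * (scaleCost K p m h + 1) := by unfold totalCost; ring
  rw [h4, h5, h6]
  omega

/-- Before the first scale there are no constraints and the potential is zero, so the distances
found by the oracle can be installed directly, also on the original vertices. They satisfy the links
as well, which are therefore inserted without repairs. -/
theorem allScales_spec (hO : O.Correct) (hP : P = 2 ^ p) (hPW : 2 * P ≤ W) (σ : State)
    (hR : Ready G h₀ h α P K B σ) (hn2 : 2 ≤ G.n) (hh₀ : 1 ≤ h₀) (hh : h₀ ≤ h) (hhm : h < G.m)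
    (hB : B ≤ G.m + 1)
    (hoP : G.n * (hub G (2 * h₀) G.n + 1 + G.m * (4 * h₀ + 1)) + 32 * (G.n * h) ≤ P)
    (hmW : (16 + K) * (G.m * (8 * h)) + 1 ≤ W) (hβ : Nat.clog 2 G.m ≤ p)
    {N : ℕ} (hN : ∀ i, 2 * h₀ * 2 ^ i < 4 * h → i < N) :
    Spec O ω W allScales σ (totalCost K p G.m h N) (Outcome ω G h₀ h K B) := by
  have hm : 1 ≤ G.m := by omega
  set L := 2 * h₀ with hL
  -- This is the number of vertices of the query. The second copy starts at `n Z`, a multiple of `n`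
  -- beyond the array entries overwritten by the oracle.
  set Z := hub G L G.n + 1 + G.m * (4 * h₀ + 1) with hZ
  have hL1 : 2 * L + 1 = 4 * h₀ + 1 := by omega
  have hZ2 : 2 * Z ≤ G.n * Z := Nat.mul_le_mul_right _ hn2
  have hmL : G.m * (2 * L + 1) = G.m * (4 * h₀ + 1) := by rw [hL1]
  have hhubdef : hub G L G.n = G.n + (2 * L + 2) * G.n := rfl
  have hKB : K * B ≤ (16 + K) * (G.m * (8 * h)) := by
    calc K * B ≤ (16 + K) * (G.m * 2) := Nat.mul_le_mul (by omega) (by omega)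
      _ ≤ _ := Nat.mul_le_mul_left _ (Nat.mul_le_mul_left _ (by omega))
  have h128 : 128 * (G.m * h) ≤ (16 + K) * (G.m * (8 * h)) := by
    calc 128 * (G.m * h) = 16 * (G.m * (8 * h)) := by ring
      _ ≤ _ := Nat.mul_le_mul_right _ (by omega)
  have hmh : G.m ≤ G.m * h := Nat.le_mul_of_pos_right _ (by omega)
  have hhmh : h ≤ G.m * h := Nat.le_mul_of_pos_left _ hm
  have hmh₀ : G.m * h₀ ≤ G.m * h := Nat.mul_le_mul_left _ hh
  have hE0 : 4 * (G.m * (2 * L + 2)) = 16 * (G.m * h₀) + 8 * G.m := by rw [hL]; ring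
  refine (Spec.seq (drawMarks_spec σ hR.inp hm (by omega) hR.r12 hR.r13 hR.r14 (by omega) hR.a8
    hR.pos) ?_).mono (total_cost_le (K := K) hm hh₀ hh hβ hB) fun _ h => h
  rintro τ₁ ⟨hmark, hpos₁⟩ hf₁
  have hI₁ := hR.inp.frame hf₁
  refine Spec.seq (Q := Par L G.n) (Spec.of_wp' ?_ (by simp [Cmd.cost])) ?_
  · simp only [wp, IExpr.eval, State.setIReg_ireg, hI₁.r2, hI₁.r0]
    norm_num [hI₁.r2, hI₁.r0]
    exact ⟨by omega, by omega, by omega, ⟨by simp [hL], by simp, by simp [hL]⟩⟩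
  rintro τ₂ hp₂ hf₂
  have hI₂ := hI₁.frame hf₂
  refine Spec.seq (setViolation_spec τ₂ hI₂ (by omega)) ?_
  rintro τ₃ ⟨hM, hviol⟩ hf₃
  have hI₃ := hI₂.frame hf₃
  have hp₃ := hp₂.frame hf₃
  have z₂ : τ₂.rmem 3 = fun _ => 0 := by rw [hf₂.rmem 3 rfl, hf₁.rmem 3 rfl, hR.b3]
  have hviol' : ∀ e < G.m, 0 ≤ G.wtN e + τ₃.rreg 3 := fun e he => by
    have := hviol e he
    rw [z₂] at this; linarith
  refine Spec.seq (buildQuery_spec τ₃ hI₃ hp₃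
    (show hub G L G.n + 1 + 4 * (G.m * (2 * L + 1)) ≤ W by omega)) ?_
  rintro τ₄ ⟨q4, q5, q6, harr⟩ hf₄
  have hI₄ := hI₃.frame hf₄
  have hp₄ := hp₃.frame hf₄
  set mark := τ₃.imem 8 with hmarkdef
  set M := τ₃.rreg 3 with hMdef
  have hmark' : ∀ e, 0 < mark e ↔ e ∈ drawn ω G.m 0 (K * B) := fun e => by
    rw [hmarkdef, hf₃.imem 8 rfl, hf₂.imem 8 rfl]; exact hmark e
  set H := queryGraph G L G.n mark M with hH
  set s := querySource G L G.n mark M with hs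
  have hq : τ₄.Query H s :=
    ⟨q4, q5, q6, fun e => (harr e e.2).1, fun e => (harr e e.2).2.1, fun e => (harr e e.2).2.2⟩
  have hnum : H.numNeg ≤ K * B := by
    refine (numNeg_queryGraph_le hM hviol').trans ?_
    rw [← Set.ncard_coe_finset]
    have hd := drawn_ncard_le (ω := ω) (m := G.m) (a := 0) (b := K * B)
    refine (Set.ncard_le_ncard (fun e he => ?_) hd.1).trans hd.2
    exact (hmark' e).1 (Finset.mem_filter.1 (Finset.mem_coe.1 he)).2
  have hHm : H.m = 4 * (G.m * (4 * h₀ + 1)) := by rw [← hL1]; rfl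
  have hcalls₄ : τ₄.calls = [] := by
    rw [hf₄.calls rfl, hf₃.calls rfl, hf₂.calls rfl, hf₁.calls rfl, hR.calls]
  have e8₄ : τ₄.ireg 8 = 0 := by
    rw [hf₄.ireg 8 rfl, hf₃.ireg 8 rfl, hf₂.ireg 8 rfl, hf₁.ireg 8 rfl, hR.r8]
  have e11₄ : τ₄.ireg 11 = 0 := by
    rw [hf₄.ireg 11 rfl, hf₃.ireg 11 rfl, hf₂.ireg 11 rfl, hf₁.ireg 11 rfl, hR.r11]
  have e12₄ : τ₄.ireg 12 = Nat.clog 2 G.m := by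
    rw [hf₄.ireg 12 rfl, hf₃.ireg 12 rfl, hf₂.ireg 12 rfl, hf₁.ireg 12 rfl, hR.r12]
  have e13₄ : τ₄.ireg 13 = K := by
    rw [hf₄.ireg 13 rfl, hf₃.ireg 13 rfl, hf₂.ireg 13 rfl, hf₁.ireg 13 rfl, hR.r13]
  have z2₄ : τ₄.rmem 2 = fun _ => 0 := by
    rw [hf₄.rmem 2 rfl, hf₃.rmem 2 rfl, hf₂.rmem 2 rfl, hf₁.rmem 2 rfl, hR.b2]
  have z3₄ : τ₄.rmem 3 = fun _ => 0 := by
    rw [hf₄.rmem 3 rfl, hf₃.rmem 3 rfl, z₂]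
  have m8₄ : τ₄.imem 8 = mark := hf₄.imem 8 rfl
  have M₄ : τ₄.rreg 3 = M := hf₄.rreg 3 rfl
  have pos₄ : τ₄.pos = K * B * Nat.clog 2 G.m := by
    rw [hf₄.pos rfl, hf₃.pos rfl, hf₂.pos rfl, hpos₁]
  have hG₄ := (((hR.graph.frame hf₁).frame hf₂).frame hf₃).frame hf₄
  have hD₄ := (((hR.idle.frame hf₁).frame hf₂).frame hf₃).frame hf₄
  refine Spec.seq (call_spec τ₄ hq) ?_
  rintro τ₅ hτ₅ hf₅
  have hI₅ := hI₄.frame hf₅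
  have hp₅ := hp₄.frame hf₅
  have hG₅ := hG₄.frame hf₅
  have e8₅ : τ₅.ireg 8 = 0 := (hf₅.ireg 8 rfl).trans e8₄
  have e11₅ : τ₅.ireg 11 = 0 := (hf₅.ireg 11 rfl).trans e11₄
  cases hans : O H s with
  | none =>
    rw [hans] at hτ₅
    have e7 : τ₅.ireg 7 = 1 := by rw [hτ₅]; simp [State.answer]
    have ecalls : τ₅.calls = [H] := by rw [hτ₅]; simp [State.answer, hcalls₄]
    refine Spec.cond (fun _ => ?_) (fun hb => absurd ?_ hb)
    · refine Spec.of_wp' ?_ ?_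
      · simp only [wp, IExpr.eval]
        refine ⟨by omega, ⟨?_, ?_, fun _ => ?_, fun h => ?_⟩⟩
        · simp [ecalls]
        · intro H' hH'
          simp only [State.setIReg_calls, ecalls, List.mem_singleton] at hH'
          subst hH'
          exact ⟨hHm, hnum⟩
        · exact hasNegCycle_of_queryGraph hM dvd_rfl ((hO H s).1 hans)
        · simp at h
      · simp only [Cmd.cost]; omega
    · simp [e7]
  | some d =>
    rw [hans] at hτ₅
    have hd := (hO H s).2 d hans
    have e7 : τ₅.ireg 7 = 0 := by rw [hτ₅]; simp [State.answer]
    have ecalls : τ₅.calls = [H] := by rw [hτ₅]; simp [State.answer, hcalls₄]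
    have e2 : ∀ v : Fin H.n, τ₅.rmem 2 v.val = (d v).toReal := fun v => by
      rw [hτ₅]; simp [State.answer]
    have e2' : ∀ x, H.n ≤ x → τ₅.rmem 2 x = 0 := fun x hx => by
      rw [hτ₅]; simp [State.answer, not_lt.2 hx, z2₄]
    have M₅ : τ₅.rreg 3 = M := (hf₅.rreg 3 rfl).trans M₄
    have z3₅ : τ₅.rmem 3 = fun _ => 0 := (hf₅.rmem 3 rfl).trans z3₄
    obtain ⟨d1, d2, d3⟩ := query_dist hd (D := τ₅.rmem 2) e2
    have hnoedge : ∀ u v w, ¬ Has τ₅ u v w := by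
      rintro u v w ⟨e, he, -⟩; omega
    refine Spec.cond (fun hb => absurd hb (by simp [e7])) (fun _ => ?_)
    -- The term `(L - j) M` undoes the shift of the query: its distance inequalities become the
    -- constraints of the layered copy and of its links.
    have hcv : ∀ j v, copyVal G.n L G.n (τ₅.rreg 3) (τ₅.rmem 3) (τ₅.rmem 2) j v =
        ((L : ℝ) - j) * M + τ₅.rmem 2 (cid G.n G.n j v) := fun j v => by
      unfold copyVal; rw [z3₅, M₅, zero_add]
    refine Spec.seq (addCopy_spec (by omega) τ₅ hI₅ hp₅ hG₅ (by omega) le_rfl dvd_rfl hm (by omega)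
      (fun u v w h => absurd h (hnoedge u v w)) (fun u v w h => absurd h (hnoedge u v w)) rfl
      ?_ ?_ (.inl hnoedge)) ?_
    · intro e he j hj
      have := d3 e he j hj
      rw [hcv, hcv]
      split at this
      · rw [if_pos (by assumption)]; push_cast; linarith
      · rw [if_neg (by assumption)]; linarith
    · intro e he j hj
      have := d1 e he j hj
      rw [hcv, hcv]; push_cast; linarith
    rintro τ₆ ⟨hG₆, hE₆, -, hc₆, hS₆, hF₆, hval₆⟩ hf₆
    have hI₆ := hI₅.frame hf₆
    have hp₆ := hp₅.frame hf₆
    have m8₆ : τ₆.imem 8 = mark := by rw [hf₆.imem 8 rfl, hf₅.imem 8 rfl, m8₄]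
    refine Spec.seq (linkEdges_spec (by omega) τ₆ hI₆ hp₆ hG₆ (by omega) (by omega)) ?_
    rintro τ₇ ⟨hG₇, hE₇, hA₇⟩ hf₇
    rw [m8₆] at hA₇
    have hI₇ := hI₆.frame hf₇
    have hp₇ := hp₆.frame hf₇
    have hF₇ : Feas τ₇ (τ₇.rmem 3) := by
      refine linkEdges_feas hF₆ (hf₇.rmem 3 rfl) hval₆ (fun e he hm => ?_) hA₇
      have := d2 e he hm
      rw [hcv, hcv]; push_cast; linarith
    have hS₇ : SoundBelow G (G.n + (2 * L + 2) * G.n) τ₇ := by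
      intro u v w huv
      rcases (hA₇ u v w).1 huv with h1 | ⟨e, he, -, h1⟩
      · exact hS₆ u v w h1
      · exact soundEdge_link dvd_rfl he h1
    have hc₇ : HasCopy G L G.n (drawn ω G.m 0 (K * B)) τ₇ := by
      have h1 := hc₆.mono hA₇.le
      exact ⟨h1.main, h1.stay, h1.center, fun e he hm =>
        (hA₇ _ _ _).2 (.inr ⟨e, hm, (hmark' e).2 he, rfl, rfl, rfl⟩)⟩
    have e4₇ : τ₇.ireg 4 = Z := by
      rw [hf₇.ireg 4 rfl, hf₆.ireg 4 rfl, hf₅.ireg 4 rfl, q4, hmL]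
    refine Spec.seq (Q := Par (L * 2 ^ 1) (G.n * Z)) (Spec.of_wp' ?_ (by simp [Cmd.cost])) ?_
    · simp only [wp, IExpr.eval, State.setIReg_ireg, hp₇.r16, hI₇.r0, e4₇]
      norm_num [hp₇.r16, hI₇.r0, e4₇]
      exact ⟨by omega, by omega, by omega, ⟨by simp [mul_comm], by simp, by simp [mul_comm]⟩⟩
    rintro τ₈ hp₈ hf₈
    have hH₈ : Has τ₈ = Has τ₇ := has_frame hf₈
    have hS₈ : SoundBelow G (G.n * Z) τ₈ := by
      unfold SoundBelow; rw [hH₈]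
      intro u v w huv
      obtain ⟨a1, a2, a3⟩ := hS₇ u v w huv
      exact ⟨by omega, by omega, a3⟩
    have ecalls₈ : τ₈.calls = [H] := by
      rw [hf₈.calls rfl, hf₇.calls rfl, hf₆.calls rfl, ecalls]
    refine Spec.conseq (scales_spec (B := B) hP hPW τ₈ hh₀ ⟨hI₇.frame hf₈, hp₈, hG₇.frame hf₈,
      (((hD₄.frame hf₅).frame hf₆).frame hf₇).frame hf₈, ?_, ?_⟩ hhm hoP (by
        have : G.n * 1 ≤ G.n * Z := Nat.mul_le_mul_left _ (by omega)
        omega) (dvd_mul_right _ _) hmW hβ ?_ ?_ hS₈ hN (.inr ⟨?_, ?_, ?_, ?_⟩)) le_rfl ?_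
    · rw [hf₈.ireg 12 rfl, hf₇.ireg 12 rfl, hf₆.ireg 12 rfl, hf₅.ireg 12 rfl, e12₄]
    · rw [hf₈.ireg 13 rfl, hf₇.ireg 13 rfl, hf₆.ireg 13 rfl, hf₅.ireg 13 rfl, e13₄]
    · rw [hf₈.ireg 11 rfl]
      have h1 : (16 : ℕ) * (G.m * (2 * h₀ * 2 ^ 1)) ≤ (16 + K) * (G.m * (2 * h₀ * 2 ^ 1)) :=
        Nat.mul_le_mul_right _ (by omega)
      have h2 : (16 : ℕ) * (G.m * (2 * h₀ * 2 ^ 1)) = 64 * (G.m * h₀) := by ring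
      have h3 : G.m ≤ G.m * h₀ := Nat.le_mul_of_pos_right _ (by omega)
      omega
    · intro x hx
      rw [hf₈.rmem 2 rfl, hf₇.rmem 2 rfl, hf₆.rmem 2 rfl]
      refine e2' x ?_
      show hub G L G.n + 1 + G.m * (2 * L + 1) ≤ x
      omega
    · rw [hf₈.ireg 8 rfl, hf₇.ireg 8 rfl, hf₆.ireg 8 rfl, e8₅]
    · unfold Feas; rw [hH₈, hf₈.rmem 3 rfl]; exact hF₇
    · rw [hf₈.pos rfl, hf₇.pos rfl, hf₆.pos rfl, hf₅.pos rfl, pos₄]; rfl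
    · exact ⟨G.n, by
        rw [pow_zero, mul_one]
        exact hc₇.mono fun u v w h => by rw [hH₈]; exact h⟩
    · rintro ρ ⟨⟨o, hSρ⟩, hend⟩ hfρ
      have ecρ : ρ.calls = [H] := (hfρ.calls rfl).trans ecalls₈
      refine ⟨by simp [ecρ], fun H' hH' => ?_, fun h8 => ?_, fun h8 => ?_⟩
      · rw [ecρ, List.mem_singleton] at hH'
        subst hH'
        exact ⟨hHm, hnum⟩
      · rcases hend with hend | hend
        · exact WDigraph.hasNegCycle_of_infeas (by omega) hSρ hend
        · exact absurd hend.1 h8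
      · rcases hend with hend | ⟨-, g1, g2, g3⟩
        · exact absurd h8 hend.1
        · exact ⟨g1, g2, g3⟩

end

section

/-! ### Random edges hit every large set -/

open MeasureTheory ProbabilityTheory

instance : IsProbabilityMeasure coins := by unfold coins; infer_instance

theorem bitVal_congr {ω ω' : ℕ → Bool} {s b : ℕ} (h : ∀ i, s ≤ i → i < s + b → ω i = ω' i) :
    bitVal ω s b = bitVal ω' s b := by
  induction b with
  | zero => rfl
  | succ b ih =>
    rw [bitVal, bitVal, ih fun i h1 h2 => h i h1 (by omega), h (s + b) (by omega) (by omega)]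

theorem exists_bitVal (s b v : ℕ) (hv : v < 2 ^ b) : ∃ ω, bitVal ω s b = v := by
  induction b generalizing v with
  | zero => exact ⟨fun _ => false, by simp [bitVal]; omega⟩
  | succ b ih =>
    rw [pow_succ] at hv
    obtain ⟨ω, hω⟩ := ih (v / 2) (by omega)
    refine ⟨Function.update ω (s + b) (decide (v % 2 = 1)), ?_⟩
    rw [bitVal, bitVal_congr (ω' := ω) fun i h1 h2 => Function.update_of_ne (by omega) _ _, hω,
      Function.update_self]
    rcases Nat.mod_two_eq_zero_or_one v with h | h <;> simp [h] <;> omega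

theorem measurable_bitVal (s b : ℕ) : Measurable fun ω : ℕ → Bool => bitVal ω s b := by
  induction b with
  | zero => exact measurable_const
  | succ b ih =>
    have h1 : Measurable fun ω : ℕ → Bool => (ω (s + b)).toNat :=
      (measurable_of_finite Bool.toNat).comp (measurable_pi_apply _)
    exact (measurable_const.mul ih).add h1

/-- Some assignment of the `b` bits produces `v`, and the cylinder it defines has measure `2 ^
(-b)`. The lower bound is all that is needed. -/
theorem coins_bitVal_ge (s b v : ℕ) (hv : v < 2 ^ b) :
    ((2 : ℝ≥0∞) ^ b)⁻¹ ≤ coins {ω | bitVal ω s b = v} := by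
  obtain ⟨ω₀, h₀⟩ := exists_bitVal s b v hv
  calc ((2 : ℝ≥0∞) ^ b)⁻¹
      = coins (Set.pi (Finset.Ico s (s + b) : Finset ℕ) fun i => {ω₀ i}) := by
        rw [coins, Measure.infinitePi_pi _ fun i _ => measurableSet_singleton _]
        simp [ENNReal.inv_pow]
    _ ≤ _ := by
        refine measure_mono fun ω hω => ?_
        show bitVal ω s b = v
        rw [← h₀]
        refine bitVal_congr fun i h1 h2 => ?_
        exact hω i (Finset.mem_coe.2 (Finset.mem_Ico.2 ⟨h1, h2⟩))

theorem coins_bitVal_notMem (s b : ℕ) (A : Finset ℕ) (hA : ∀ v ∈ A, v < 2 ^ b) :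
    coins.real {ω | bitVal ω s b ∉ A} ≤ 1 - A.card / 2 ^ b := by
  have h1 : coins.real {ω | bitVal ω s b ∉ A} = 1 - coins.real {ω | bitVal ω s b ∈ A} := by
    rw [← probReal_compl_eq_one_sub]
    · rfl
    · exact measurable_bitVal s b (Finset.measurableSet A)
  have h2 : {ω : ℕ → Bool | bitVal ω s b ∈ A} = ⋃ v ∈ A, {ω | bitVal ω s b = v} := by
    ext ω; simp
  rw [h1, h2, measureReal_biUnion_finset (fun v _ w _ hvw => Set.disjoint_left.2 fun ω h3 h4 =>
    hvw (h3.symm.trans h4)) fun v _ =>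
      show MeasurableSet {ω | bitVal ω s b = v} from
        measurable_bitVal s b (measurableSet_singleton v)]
  have h3 : ∀ v ∈ A, ((2 : ℝ) ^ b)⁻¹ ≤ coins.real {ω | bitVal ω s b = v} := fun v hv => by
    have := ENNReal.toReal_mono (measure_ne_top _ _) (coins_bitVal_ge s b v (hA v hv))
    simpa [measureReal_def] using this
  have h4 := Finset.sum_le_sum h3
  rw [Finset.sum_const, nsmul_eq_mul] at h4
  rw [div_eq_mul_inv]
  linarith

/-- Random bits with different positions are independent. -/
theorem coins_inter (N b : ℕ) {A B : Set (ℕ → Bool)}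
    (hA : ∀ ω ω' : ℕ → Bool, (∀ i < N, ω i = ω' i) → ω ∈ A → ω' ∈ A)
    (hB : ∀ ω ω' : ℕ → Bool, (∀ i, N ≤ i → i < N + b → ω i = ω' i) → ω ∈ B → ω' ∈ B) :
    coins.real (A ∩ B) = coins.real A * coins.real B := by
  have hind : iIndepFun (fun (i : ℕ) (ω : ℕ → Bool) => ω i) coins :=
    iIndepFun_infinitePi (X := fun _ => id) fun _ => measurable_id
  have hdisj : Disjoint (Finset.range N) (Finset.Ico N (N + b)) := by
    rw [Finset.disjoint_left]; intro i; simp; omega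
  have hfun := hind.indepFun_finset _ _ hdisj fun i => measurable_pi_apply i
  -- Each event depends on finitely many coordinates, so it is the preimage of a set of finite bit
  -- strings; this also supplies measurability.
  let ext (s : Finset ℕ) (g : s → Bool) : ℕ → Bool := fun i => if h : i ∈ s then g ⟨i, h⟩ else false
  have eA : A = (fun (ω : ℕ → Bool) (i : Finset.range N) => ω i) ⁻¹'
      {g | ext (Finset.range N) g ∈ A} := by
    ext ω
    constructor
    · exact hA _ _ fun i hi => by simp [ext, hi]
    · exact hA _ _ fun i hi => by simp [ext, hi]
  have eB : B = (fun (ω : ℕ → Bool) (i : Finset.Ico N (N + b)) => ω i) ⁻¹'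
      {g | ext (Finset.Ico N (N + b)) g ∈ B} := by
    ext ω
    constructor
    · exact hB _ _ fun i hi hi' => by simp [ext, hi, hi']
    · exact hB _ _ fun i hi hi' => by simp [ext, hi, hi']
  have := hfun.measure_inter_preimage_eq_mul _ _ (Set.toFinite {g | ext (Finset.range N) g ∈ A}).measurableSet
    (Set.toFinite {g | ext (Finset.Ico N (N + b)) g ∈ B}).measurableSet
  rw [← eA, ← eB] at this
  simp [measureReal_def, this]

/-- The draws are not uniform because of the reduction modulo `m`, but already the unreduced value
lies in `A` with probability at least `|A| / 2 ^ β`, and `2 ^ β < 2 m`. Disjoint blocks of bits are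
independent. -/
theorem coins_miss (m a K : ℕ) (hm : 1 ≤ m) (A : Finset ℕ) (hA : ∀ v ∈ A, v < m) :
    coins.real {ω | Disjoint (A : Set ℕ) (drawn ω m a (a + K))} ≤
      Real.exp (-(K * A.card / (2 * m))) := by
  set β := Nat.clog 2 m with hβ
  have hmβ : m ≤ 2 ^ β := Nat.le_pow_clog (by norm_num) m
  have hβm := two_pow_clog_lt hm
  let F : ℕ → Set (ℕ → Bool) := fun K => {ω | ∀ q, a ≤ q → q < a + K → bitVal ω (q * β) β ∉ A}
  have hstep : ∀ K, coins.real (F (K + 1)) ≤ coins.real (F K) * (1 - A.card / 2 ^ β) := by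
    intro K
    have : F (K + 1) = F K ∩ {ω | bitVal ω ((a + K) * β) β ∉ A} := by
      ext ω
      constructor
      · exact fun h => ⟨fun q h1 h2 => h q h1 (by omega), h _ (by omega) (by omega)⟩
      · rintro ⟨h1, h2⟩ q h3 h4
        rcases (show q ≤ a + K by omega).lt_or_eq with h | rfl
        · exact h1 q h3 h
        · exact h2
    rw [this, coins_inter ((a + K) * β) β]
    · exact mul_le_mul_of_nonneg_left
        (coins_bitVal_notMem _ _ A fun v hv => (hA v hv).trans_le hmβ) measureReal_nonneg
    · intro ω ω' hω h q h1 h2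
      have h3 : (q + 1) * β ≤ (a + K) * β := Nat.mul_le_mul_right _ h2
      rw [Nat.succ_mul] at h3
      rw [← bitVal_congr (ω := ω) fun i _ h5 => hω i (by omega)]
      exact h q h1 h2
    · intro ω ω' hω h
      show bitVal ω' _ _ ∉ A
      rw [← bitVal_congr (ω := ω) fun i h4 h5 => hω i h4 h5]
      exact h
  have hc0 : (0 : ℝ) ≤ 1 - A.card / 2 ^ β := by
    rw [sub_nonneg, div_le_one (by positivity)]
    have h1 : A.card ≤ m := by
      have : A ⊆ Finset.range m := fun v hv => Finset.mem_range.2 (hA v hv)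
      simpa using Finset.card_le_card this
    exact_mod_cast h1.trans hmβ
  have hpow : ∀ K, coins.real (F K) ≤ (1 - A.card / 2 ^ β) ^ K := by
    intro K
    induction K with
    | zero => simp
    | succ K ih =>
      refine (hstep K).trans ?_
      rw [pow_succ]
      exact mul_le_mul_of_nonneg_right ih hc0
  have hsub : {ω | Disjoint (A : Set ℕ) (drawn ω m a (a + K))} ⊆ F K := by
    intro ω hω q h1 h2 h3
    refine Set.disjoint_left.1 hω (Finset.mem_coe.2 h3) ⟨q, h1, h2, ?_⟩
    unfold sampleAt
    exact Nat.mod_eq_of_lt (hA _ h3)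
  calc _ ≤ coins.real (F K) := measureReal_mono hsub
    _ ≤ (1 - A.card / 2 ^ β) ^ K := hpow K
    _ ≤ (Real.exp (-(A.card / 2 ^ β))) ^ K :=
        pow_le_pow_left₀ hc0 (by linarith [Real.add_one_le_exp (-((A.card : ℝ) / 2 ^ β))]) K
    _ = Real.exp (-(K * (A.card / 2 ^ β))) := by rw [← Real.exp_nat_mul]; ring_nf
    _ ≤ _ := by
        rw [Real.exp_le_exp, neg_le_neg_iff, mul_div_assoc]
        have : ((2 : ℝ) ^ β) ≤ 2 * m := by exact_mod_cast hβm.le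
        gcongr

/-- Some large set of edges on cheap walks contains none of the edges drawn. -/
def Missed (G : WDigraph) (L b a a' : ℕ) : Set (ℕ → Bool) :=
  {ω | ∃ s t c, G.m < b * (G.cheap L s t c).ncard ∧
    Disjoint (G.cheap L s t c) (drawn ω G.m a a')}

/-- For each pair `s`, `t` there is at most one set of each cardinality, so the infinitely many
thresholds `c` reduce to `m + 1` events. Each is missed by `K b` draws with probability at most `exp
(-K / 2)`, as the set has more than `m / b` elements. -/
theorem coins_missed_le {G : WDigraph} (hm : 1 ≤ G.m) (L b a K : ℕ) :
    coins (Missed G L b a (a + K * b)) ≤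
      ENNReal.ofReal (G.n ^ 2 * (G.m + 1) * Real.exp (-(K / 2))) := by
  let E : Fin G.n × Fin G.n × Fin (G.m + 1) → Set (ℕ → Bool) := fun x =>
    {ω | ∃ c, (G.cheap L x.1 x.2.1 c).ncard = x.2.2 ∧ G.m < b * (G.cheap L x.1 x.2.1 c).ncard ∧
      Disjoint (G.cheap L x.1 x.2.1 c) (drawn ω G.m a (a + K * b))}
  have hsub : Missed G L b a (a + K * b) ⊆ ⋃ x, E x := by
    rintro ω ⟨s, t, c, h1, h2⟩
    have hle : (G.cheap L s t c).ncard ≤ G.m := by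
      have := Set.ncard_le_ncard (WDigraph.cheap_subset (G := G) L s t c) (Finset.finite_toSet _)
      rwa [Set.ncard_coe_finset, Finset.card_range] at this
    exact Set.mem_iUnion.2 ⟨(s, t, ⟨_, Nat.lt_succ_of_le hle⟩), c, rfl, h1, h2⟩
  have hE : ∀ x, coins (E x) ≤ ENNReal.ofReal (Real.exp (-(K / 2))) := by
    rintro ⟨s, t, k⟩
    by_cases hne : ∃ c, (G.cheap L s t c).ncard = k ∧ G.m < b * (G.cheap L s t c).ncard
    · obtain ⟨c₀, h1, h2⟩ := hne
      have hfin := WDigraph.cheap_finite (G := G) L s t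
      have hsub : E (s, t, k) ⊆ {ω | Disjoint ((hfin c₀).toFinset : Set ℕ)
          (drawn ω G.m a (a + K * b))} := by
        rintro ω ⟨c, h3, h4, h5⟩
        -- Two members of a chain of finite sets with the same cardinality coincide.
        have heq : G.cheap L s t c = G.cheap L s t c₀ := by
          rcases le_total c c₀ with hc | hc
          · exact Set.eq_of_subset_of_ncard_le (WDigraph.cheap_mono hc)
              (by rw [h1]; exact h3.ge) (hfin _)
          · exact (Set.eq_of_subset_of_ncard_le (WDigraph.cheap_mono hc)
              (by rw [h1]; exact h3.le) (hfin _)).symm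
        show Disjoint _ _
        rw [Set.Finite.coe_toFinset, ← heq]; exact h5
      refine (measure_mono hsub).trans ?_
      rw [← ofReal_measureReal]
      refine ENNReal.ofReal_le_ofReal ((coins_miss G.m a (K * b) hm _ fun v hv => ?_).trans ?_)
      · have := WDigraph.cheap_subset (G := G) L s t c₀ ((hfin c₀).mem_toFinset.1 hv)
        simpa using this
      · rw [Real.exp_le_exp, neg_le_neg_iff, ← Set.ncard_eq_toFinset_card _ (hfin c₀)]
        have hm' : (0 : ℝ) < G.m := by exact_mod_cast hm
        rw [div_le_div_iff₀ (by norm_num) (by positivity)]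
        have h3 : (G.m : ℝ) ≤ b * (G.cheap L s t c₀).ncard := by exact_mod_cast h2.le
        push_cast
        have h4 := mul_le_mul_of_nonneg_left h3 (Nat.cast_nonneg (α := ℝ) K)
        nlinarith
    · have : E (s, t, k) = ∅ := by
        ext ω
        simp only [Set.mem_empty_iff_false, iff_false]
        rintro ⟨c, h1, h2, -⟩
        exact hne ⟨c, h1, h2⟩
      rw [this]; simp
  calc coins (Missed G L b a (a + K * b)) ≤ coins (⋃ x, E x) := measure_mono hsub
    _ ≤ ∑ x, coins (E x) := by
        rw [← tsum_fintype (L := .unconditional _)]; exact measure_iUnion_le _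
    _ ≤ ∑ x : Fin G.n × Fin G.n × Fin (G.m + 1), ENNReal.ofReal (Real.exp (-(K / 2))) :=
        Finset.sum_le_sum fun x _ => hE x
    _ = _ := by
        rw [Finset.sum_const, nsmul_eq_mul, Finset.card_univ, Fintype.card_prod, Fintype.card_prod,
          Fintype.card_fin, Fintype.card_fin, ENNReal.ofReal_mul (by positivity)]
        congr 1
        rw [← ENNReal.ofReal_natCast]
        push_cast; ring_nf

end

/-! ### The program -/

/-- The parameters are computed before the first coin flip. This lemma makes them, in particular the
number of draws, the same for all `ω`. -/
theorem Run.change_bits {O : Oracle} {ω ω' : ℕ → Bool} {W : ℕ} {c : Cmd} {σ τ : State} {t : ℕ}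
    (h : Run O ω W c σ τ t) (hc : c.noFlip = true) : Run O ω' W c σ τ t := by
  induction h with
  | skip σ => exact .skip σ
  | iset σ x e he => exact .iset σ x e he
  | istore σ a i e hi he => exact .istore σ a i e hi he
  | rset σ x e => exact .rset σ x e
  | rstore σ a i e hi => exact .rstore σ a i e hi
  | flip σ x => simp [Cmd.noFlip] at hc
  | call σ H s hq => exact .call σ H s hq
  | seq _ _ ih ih' =>
    simp only [Cmd.noFlip, Bool.and_eq_true] at hc
    exact .seq (ih hc.1) (ih' hc.2)
  | condTrue hb _ ih =>
    simp only [Cmd.noFlip, Bool.and_eq_true] at hc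
    exact .condTrue hb (ih hc.1)
  | condFalse hb _ ih =>
    simp only [Cmd.noFlip, Bool.and_eq_true] at hc
    exact .condFalse hb (ih hc.2)
  | loopTrue hb _ _ ih ih' => exact .loopTrue hb (ih hc) (ih' hc)
  | loopFalse hb => exact .loopFalse hb

/-- Add all edges of the input to the constraint graph. -/
def addAll : Cmd :=
  .iset 29 (.const 0) ⨾
  .loop (.and (.ilt (.reg 8) (.const 1)) (.ilt (.reg 29) (.reg 1)))
    ((.iset 23 (.load 0 (.reg 29)) ⨾ .iset 24 (.load 1 (.reg 29)) ⨾ .rset 1 (.load 0 (.reg 29))) ⨾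
      addEdge ⨾ .iset 29 (.add (.reg 29) (.const 1)))

/-- The parameters for the algorithm with scales. -/
def setup (κ : ℕ) : Cmd :=
  setBits ⨾ setBase ⨾ .iset 13 (.mul (.const κ) (.reg 9))

/-- The algorithm. -/
def algorithm (κ : ℕ) : Cmd :=
  (setLength ⨾ setTreeSize) ⨾
  .cond (.ilt (.reg 3) (.reg 1)) (setup κ ⨾ allScales) addAll

/-- The state in which the constraint graph has no edges yet. -/
structure Fresh (G : WDigraph) (h₀ h : ℕ) (α : ℝ) (P : ℕ) (σ : State) : Prop where
  inp : Inp G h₀ h α σ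
  r8 : σ.ireg 8 = 0
  r9 : σ.ireg 9 = G.n.size
  r10 : σ.ireg 10 = P
  r11 : σ.ireg 11 = 0
  a7 : σ.imem 7 = fun _ => 0
  a8 : σ.imem 8 = fun _ => 0
  b2 : σ.rmem 2 = fun _ => 0
  b3 : σ.rmem 3 = fun _ => 0
  b5 : σ.rmem 5 = fun _ => 0
  pos : σ.pos = 0
  calls : σ.calls = []

theorem Fresh.graph {G : WDigraph} {h₀ h : ℕ} {α : ℝ} {P : ℕ} {σ : State}
    (hσ : Fresh G h₀ h α P σ) : Graph P σ := by
  refine ⟨hσ.r10, ?_⟩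
  rw [hσ.r11, hσ.a7]
  exact ⟨fun u => rfl, by simp, by simp, by simp⟩

theorem Fresh.idle {G : WDigraph} {h₀ h : ℕ} {α : ℝ} {P : ℕ} {σ : State}
    (hσ : Fresh G h₀ h α P σ) : Idle P σ := by
  unfold Idle IsTree
  rw [hσ.b5]
  simp

/-- What is known after all edges have been added. -/
structure Direct (G : WDigraph) (τ : State) : Prop where
  calls : τ.calls = []
  sound : τ.ireg 8 ≠ 0 → G.HasNegCycle
  feas : τ.ireg 8 = 0 → G.IsPotential (τ.potential G)

section
variable {O : Oracle} {ω : ℕ → Bool} {W P p : ℕ} {G : WDigraph} {h₀ h : ℕ} {α : ℝ} {κ : ℕ}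

theorem start_spec (hW : 2 * 2 ^ (20 * G.n.size) ≤ W) :
    Spec O ω W (setLength ⨾ setTreeSize) (input G h₀ h α) (63 * G.n.size + 6)
      (Fresh G h₀ h α (2 ^ (20 * G.n.size))) := by
  have h1 : G.n < 2 ^ G.n.size := Nat.lt_size_self _
  have h2 : 2 ^ G.n.size ≤ 2 ^ (20 * G.n.size) := Nat.pow_le_pow_right (by norm_num) (by omega)
  refine (Spec.seq (setLength_spec _ G.n rfl (by omega)) ?_).mono
    (show 3 * G.n.size + 3 + (60 * G.n.size + 3) ≤ _ by omega) fun _ h => h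
  intro τ hτ hf
  refine (setTreeSize_spec τ _ hτ (by omega)).conseq le_rfl fun ρ hρ hf' => ?_
  have hz : ∀ a, a ≠ 0 → (input G h₀ h α).rmem a = fun _ => 0 := fun a ha => by
    funext i; simp [input, ha]
  have hz' : ∀ a, a ≠ 0 → a ≠ 1 → (input G h₀ h α).imem a = fun _ => 0 := fun a ha ha' => by
    funext i; simp [input, ha, ha']
  refine ⟨((inp_input G h₀ h α).frame hf).frame hf', ?_, ?_, hρ, ?_, ?_, ?_, ?_, ?_, ?_, ?_, ?_⟩
  · rw [hf'.ireg 8 rfl, hf.ireg 8 rfl]; rfl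
  · rw [hf'.ireg 9 rfl, hτ]
  · rw [hf'.ireg 11 rfl, hf.ireg 11 rfl]; rfl
  · rw [hf'.imem 7 rfl, hf.imem 7 rfl, hz' 7 (by norm_num) (by norm_num)]
  · rw [hf'.imem 8 rfl, hf.imem 8 rfl, hz' 8 (by norm_num) (by norm_num)]
  · rw [hf'.rmem 2 rfl, hf.rmem 2 rfl, hz 2 (by norm_num)]
  · rw [hf'.rmem 3 rfl, hf.rmem 3 rfl, hz 3 (by norm_num)]
  · rw [hf'.rmem 5 rfl, hf.rmem 5 rfl, hz 5 (by norm_num)]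
  · rw [hf'.pos rfl, hf.pos rfl]; rfl
  · rw [hf'.calls rfl, hf.calls rfl]; rfl

theorem setup_spec (σ : State) (hσ : Fresh G h₀ h α P σ) (hm : 1 ≤ G.m) (hh₀ : 1 ≤ h₀)
    (hh : h₀ ≤ h) (hα : 0 < α) (hhm : h < G.m) (hW : 4 * (G.m * h) ≤ W)
    (hκ : κ * G.n.size ≤ W) :
    Spec O ω W (setup κ) σ (3 * Nat.clog 2 G.m + (6 * h₀ * G.n.size + 24 * G.n.size + 54))
      fun τ => ∃ B, Ready G h₀ h α P (κ * G.n.size) B τ ∧ B ≤ G.m + 1 ∧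
        (B : ℝ) ≤ 4 * ((h : ℝ) / h₀) ^ (1 / α) ∧
        (((h : ℝ) / h₀) ^ (1 / α) ≤ B ∨ G.m < B) := by
  have hmh : G.m ≤ G.m * h := Nat.le_mul_of_pos_right _ (by omega)
  refine (Spec.seq (setBits_spec σ G.m hσ.inp.r1 hm (by omega)) ?_).mono
    (show 3 * Nat.clog 2 G.m + 3 + (6 * h₀ * G.n.size + 24 * G.n.size + 50 + 1) ≤ _ by omega)
    fun _ h => h
  intro τ₁ h12 hf₁
  have hI₁ := hσ.inp.frame hf₁
  refine Spec.seq (setBase_spec τ₁ hI₁ hm hh₀ hh hα hhm hW) ?_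
  rintro τ₂ ⟨-, hB1, hB2, hB3⟩ hf₂
  have h9 : τ₂.ireg 9 = G.n.size := by rw [hf₂.ireg 9 rfl, hf₁.ireg 9 rfl, hσ.r9]
  refine Spec.conseq (Q := fun τ => τ.ireg 13 = κ * G.n.size) (Spec.of_wp' ?_ le_rfl) le_rfl ?_
  · simp [wp, h9, hκ]
  intro τ h13 hf₃
  refine ⟨τ₂.ireg 14, ⟨(hI₁.frame hf₂).frame hf₃,
    ((hσ.graph.frame hf₁).frame hf₂).frame hf₃, ((hσ.idle.frame hf₁).frame hf₂).frame hf₃,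
    ?_, ?_, ?_, h13, hf₃.ireg 14 rfl, ?_, ?_, ?_, ?_, ?_⟩, hB1, hB2, hB3⟩
  · rw [hf₃.ireg 8 rfl, hf₂.ireg 8 rfl, hf₁.ireg 8 rfl, hσ.r8]
  · rw [hf₃.ireg 11 rfl, hf₂.ireg 11 rfl, hf₁.ireg 11 rfl, hσ.r11]
  · rw [hf₃.ireg 12 rfl, hf₂.ireg 12 rfl, h12]
  · rw [hf₃.imem 8 rfl, hf₂.imem 8 rfl, hf₁.imem 8 rfl, hσ.a8]
  · rw [hf₃.rmem 2 rfl, hf₂.rmem 2 rfl, hf₁.rmem 2 rfl, hσ.b2]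
  · rw [hf₃.rmem 3 rfl, hf₂.rmem 3 rfl, hf₁.rmem 3 rfl, hσ.b3]
  · rw [hf₃.pos rfl, hf₂.pos rfl, hf₁.pos rfl, hσ.pos]
  · rw [hf₃.calls rfl, hf₂.calls rfl, hf₁.calls rfl, hσ.calls]

/-- For `h ≥ m` the budget allows one repair per edge of `G`, each on at most `m` edges. This
decides the existence of a negative cycle and yields a potential without negative edges, with
neither oracle nor random bits. -/
theorem addAll_spec (hP : P = 2 ^ p) (hPW : 2 * P ≤ W) (σ : State) (hσ : Fresh G h₀ h α P σ)
    (hn : 0 < G.n) (hnP : G.n ≤ P) (hm : G.m + 1 ≤ W) :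
    Spec O ω W addAll σ (G.m * (dijkstraCost p G.m + 4 * p + 21) + 2) (Direct G) := by
  set T := dijkstraCost p G.m + 4 * p + 20 with hT
  refine (Spec.seq (T := 1) (U := G.m * (T + 1) + 1) (Q := fun τ => τ = σ.setIReg 29 0)
    (Spec.of_wp' ?_ le_rfl) ?_).mono (by
      have : G.m * (T + 1) = G.m * (dijkstraCost p G.m + 4 * p + 21) := by rw [hT]
      omega) fun _ h => h
  · simp [wp]
  rintro τ rfl hf₀
  let J : ℕ → State → Prop := fun i τ => Inp G h₀ h α τ ∧ Graph P τ ∧ Idle P τ ∧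
    τ.ireg 29 = i ∧ τ.ireg 11 = i ∧ τ.calls = [] ∧ SoundBelow G G.n τ ∧
    (∀ e < i, Has τ (G.srcN e) (G.dstN e) (G.wtN e)) ∧
    (Infeas τ ∨ (τ.ireg 8 = 0 ∧ Feas τ (τ.rmem 3)))
  refine Spec.loop (fun b τ => ∃ i ≤ G.m, J i τ ∧ b = (G.m - i) * (T + 1) + 1) ?_ ?_ _ _
    ⟨0, Nat.zero_le _, ?_, by simp⟩
  · rintro b τ ⟨i, hi, ⟨h1, h2, h3, h4, h5, hc, h6, h7, h9⟩, rfl⟩ hb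
    simp only [BExpr.eval, IExpr.eval, h4, h1.r1] at hb
    obtain ⟨hb8, him⟩ := hb
    obtain ⟨h10, h11⟩ := h9.resolve_left fun hcon => hcon.1 (by omega)
    have hs := WDigraph.srcN_lt him
    have hd := WDigraph.dstN_lt him
    refine ⟨T, Spec.mono (Q := J (i + 1)) (R := fun ρ => ∃ B',
      T + B' + 1 ≤ (G.m - i) * (T + 1) + 1 ∧ ∃ i ≤ G.m, J i ρ ∧ B' = (G.m - i) * (T + 1) + 1)
      ?_ le_rfl fun ρ hρ => ⟨_, ?_, i + 1, him, hρ, rfl⟩⟩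
    swap
    · obtain ⟨k, hk⟩ : ∃ k, G.m = i + 1 + k := ⟨G.m - (i + 1), by omega⟩
      have e1 : G.m - i = k + 1 := by omega
      have e2 : G.m - (i + 1) = k := by omega
      rw [e1, e2, Nat.succ_mul]; omega
    refine (Spec.seq (T := 3) (U := dijkstraCost p G.m + 4 * p + 16 + 1)
      (Q := fun ρ => ρ.ireg 23 = G.srcN i ∧ ρ.ireg 24 = G.dstN i ∧ ρ.rreg 1 = G.wtN i)
      (Spec.of_wp' ?_ le_rfl) ?_).mono (by omega) fun _ h => h
    · simp [wp, h4, h1.a0, h1.a1, h1.b0]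
      omega
    rintro τ₁ ⟨k1, k2, k3⟩ hf
    have e11 := (hf.ireg 11 rfl).trans h5
    have hH : Has τ₁ = Has τ := has_frame hf
    have hF : Feas τ₁ (τ₁.rmem 3) := by
      unfold Feas; rw [hH, hf.rmem 3 rfl]; exact h11
    refine Spec.seq ((addEdge_spec hP hPW τ₁ (h2.frame hf) (by omega) (by omega) (by omega)
      (h3.frame hf) hF ((hf.ireg 8 rfl).trans h10)).mono (by
        have := dijkstraCost_mono (p := p) (show τ₁.ireg 11 ≤ G.m by omega); omega)
      fun _ h => h) ?_
    rintro τ₂ ⟨l1, l2, l3, l4, l5⟩ hf'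
    rw [hH, k1, k2, k3] at l3
    refine Spec.conseq (Q := fun ρ => ρ = τ₂.setIReg 29 (i + 1)) (Spec.of_wp' ?_ le_rfl) le_rfl ?_
    · simp only [wp, IExpr.eval, hf'.ireg 29 rfl, hf.ireg 29 rfl, h4]
      exact ⟨by omega, trivial⟩
    rintro _ rfl hf₃
    have nH : Has (τ₂.setIReg 29 (i + 1)) = Has τ₂ := has_frame hf₃
    refine ⟨((h1.frame hf).frame hf').frame hf₃, l1.frame hf₃, l4.frame hf₃, by simp, ?_, ?_, ?_,
      fun e he => ?_, ?_⟩
    · rw [hf₃.ireg 11 rfl, l2, e11]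
    · rw [hf₃.calls rfl, hf'.calls rfl, hf.calls rfl, hc]
    · unfold SoundBelow; rw [nH]
      intro u v w huv
      rcases (l3 u v w).1 huv with huv | ⟨rfl, rfl, rfl⟩
      · exact h6 u v w huv
      · refine ⟨hs, hd, fun ψ hψ => ?_⟩
        rw [Nat.mod_eq_of_lt hs, Nat.mod_eq_of_lt hd]
        exact hψ i him
    · rw [nH, l3]
      rcases (show e ≤ i by omega).lt_or_eq with he | rfl
      · exact .inl (h7 e he)
      · exact .inr ⟨rfl, rfl, rfl⟩
    · rcases l5 with ⟨l6, l7⟩ | ⟨l6, l7⟩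
      · refine .inr ⟨(hf₃.ireg 8 rfl).trans l6, ?_⟩
        unfold Feas; rw [nH, hf₃.rmem 3 rfl]; exact l7
      · refine .inl ⟨by rw [hf₃.ireg 8 rfl]; exact l6, fun ψ hψ => l7 ψ ?_⟩
        unfold Feas at hψ; rw [nH] at hψ; exact hψ
  · rintro b τ ⟨i, hi, ⟨h1, h2, h3, h4, h5, hc, h6, h7, h9⟩, rfl⟩ hb
    simp only [BExpr.eval, IExpr.eval, h4, h1.r1, not_and] at hb
    refine ⟨by omega, hc, fun h8 => ?_, fun h8 e => ?_⟩
    · exact WDigraph.hasNegCycle_of_infeas hn h6 (h9.resolve_right fun hcon => h8 hcon.1)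
    · obtain ⟨-, hF⟩ := h9.resolve_left fun hcon => hcon.1 h8
      have him : i = G.m := by have := hb (by omega); omega
      have := hF _ _ _ (h7 e (by rw [him]; exact e.2))
      simpa [State.potential, WDigraph.srcN, WDigraph.dstN, WDigraph.wtN] using this
  · have hno : ∀ u v w, ¬ Has (σ.setIReg 29 0) u v w := by
      rintro u v w ⟨e, he, -⟩
      rw [hf₀.ireg 11 rfl, hσ.r11] at he
      omega
    exact ⟨hσ.inp.frame hf₀, hσ.graph.frame hf₀, hσ.idle.frame hf₀, by simp,
      (hf₀.ireg 11 rfl).trans hσ.r11, (hf₀.calls rfl).trans hσ.calls,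
      fun u v w h => absurd h (hno u v w), by simp,
      .inr ⟨(hf₀.ireg 8 rfl).trans hσ.r8, fun u v w h => absurd h (hno u v w)⟩⟩

end

/-! ### Betweenness of the output -/

theorem lowBetweenness_of_isPotential {G : WDigraph} {h₀ h : ℕ} {α : ℝ} {φ : Fin G.n → ℝ}
    (hφ : G.IsPotential φ) : G.LowBetweenness h₀ h α φ := by
  have hv : G.Valid φ := fun e _ => hφ e
  have h0 : ∀ j s t, G.degBetweenness φ j s t = 0 := fun j s t => by
    have h1 := WDigraph.degBetweenness_le hv j s t
    have h2 : G.cheap j s t (φ t - φ s) = ∅ := by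
      ext e
      simp only [Set.mem_empty_iff_false, iff_false]
      rintro ⟨he, p, q, hp, hq, -, -, hlt⟩
      have := hφ.walk hp
      have := hφ.walk hq
      linarith
    rw [h2, Set.ncard_empty] at h1
    omega
  constructor
  · intro s t; rw [h0]; push_cast; positivity
  · intro s t η _ _; rw [h0]; push_cast; positivity

/-- The number of samples on scale `i`, divided by `K`. -/
def rate (B h h₀ i : ℕ) : ℕ := if i = 0 then B else 4 * h / (2 * h₀ * 2 ^ i) + 1

theorem blocks_succ (K B h h₀ i : ℕ) :
    blocks K B h h₀ (i + 1) = blocks K B h h₀ i + K * rate B h h₀ i := by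
  cases i with
  | zero => simp [blocks, rate]
  | succ i => simp [blocks, rate]

theorem Outcome.valid {ω : ℕ → Bool} {G : WDigraph} {h₀ h K B : ℕ} {τ : State}
    (hτ : Outcome ω G h₀ h K B τ) (h8 : τ.ireg 8 = 0) : G.Valid (τ.potential G) := by
  intro e he
  obtain ⟨hF, ⟨off, hc⟩, -⟩ := hτ.feas h8
  have := hc.valid hF e.2 (by simpa [WDigraph.wtN] using he)
  simpa [WDigraph.rewt, State.potential, WDigraph.srcN, WDigraph.dstN, WDigraph.wtN] using this

/-- On every completed scale the cheap sets avoid the drawn edges, so outside the bad events they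
have at most `m / rate` elements. It remains to choose for each `η` a scale with `L ≥ η + h₀` and
rate at least `h / η`. -/
theorem Outcome.lowBetweenness {ω : ℕ → Bool} {G : WDigraph} {h₀ h K B N : ℕ} {α : ℝ} {τ : State}
    (hτ : Outcome ω G h₀ h K B τ) (h8 : τ.ireg 8 = 0) (hh₀ : 1 ≤ h₀) (hh : h₀ ≤ h) (hα : 0 < α)
    (hα1 : α ≤ 1)
    (hB : ((h : ℝ) / h₀) ^ (1 / α) ≤ B ∨ G.m < B) (hN0 : 0 < N)
    (hN : ∀ i, 2 * h₀ * 2 ^ i < 4 * h → i < N)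
    (hω : ∀ i < N, ω ∉ Missed G (2 * h₀ * 2 ^ i) (rate B h h₀ i) (blocks K B h h₀ i)
      (blocks K B h h₀ i + K * rate B h h₀ i)) :
    G.LowBetweenness h₀ h α (τ.potential G) := by
  obtain ⟨hF, hc0, hc⟩ := hτ.feas h8
  have hv := hτ.valid h8
  have key : ∀ i < N, Covered ω G K B h h₀ i τ → ∀ s t, ∀ j ≤ 2 * h₀ * 2 ^ i,
      rate B h h₀ i * G.degBetweenness (τ.potential G) j s t ≤ G.m := by
    rintro i hi ⟨off, hcopy⟩ s t j hj
    rw [blocks_succ] at hcopy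
    have h1 := hcopy.cheap_disjoint hF s t
    by_contra hlt
    refine hω i hi ⟨s, t, _, ?_, h1⟩
    refine (not_le.1 hlt).trans_le (Nat.mul_le_mul_left _ ?_)
    exact (WDigraph.degBetweenness_le hv j s t).trans (Set.ncard_le_ncard
      (WDigraph.cheap_mono_hops hj) (WDigraph.cheap_finite _ _ _ _))
  have hh₀' : (0 : ℝ) < h₀ := by exact_mod_cast hh₀
  have hx1 : (1 : ℝ) ≤ (h : ℝ) / h₀ := by rw [one_le_div hh₀']; exact_mod_cast hh
  have hX : (h : ℝ) / h₀ ≤ ((h : ℝ) / h₀) ^ (1 / α) := by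
    calc (h : ℝ) / h₀ = ((h : ℝ) / h₀) ^ (1 : ℝ) := (Real.rpow_one _).symm
      _ ≤ _ := Real.rpow_le_rpow_of_exponent_le hx1 (by rw [le_div_iff₀ hα]; linarith)
  have first : ∀ s t, ∀ j ≤ 2 * h₀, (G.degBetweenness (τ.potential G) j s t : ℝ) ≤
      G.m / ((h : ℝ) / h₀) ^ (1 / α) := by
    intro s t j hj
    have h1 := key 0 hN0 hc0 s t j (by simpa using hj)
    simp only [rate, if_true] at h1
    have hpos : 0 < ((h : ℝ) / h₀) ^ (1 / α) := by linarith
    rw [le_div_iff₀ hpos]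
    -- If the number of samples was cut off at `m + 1`, then `B` times the betweenness is at most `m
    -- < B`, so the betweenness is zero.
    rcases hB with hB | hB
    · calc (G.degBetweenness (τ.potential G) j s t : ℝ) * ((h : ℝ) / h₀) ^ (1 / α)
          ≤ G.degBetweenness (τ.potential G) j s t * B := by gcongr
        _ ≤ G.m := by rw [mul_comm]; exact_mod_cast h1
    · have : G.degBetweenness (τ.potential G) j s t = 0 := by
        by_contra hne
        have := Nat.le_mul_of_pos_right B (Nat.pos_of_ne_zero hne)
        omega
      rw [this]; simp
  refine ⟨fun s t => first s t _ le_rfl, fun s t η hη hηh => ?_⟩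
  have hη0 : (0 : ℝ) < η := by exact_mod_cast (by omega : 0 < η)
  have hh0 : (0 : ℝ) < h := by exact_mod_cast (by omega : 0 < h)
  -- For `η = h₀` the first scale suffices because `1 / α ≥ 1`; this is where `α ≤ 1` enters.
  rcases hη.eq_or_lt with rfl | hlt
  · refine (first s t _ (by omega)).trans ?_
    exact div_le_div_of_nonneg_left (by positivity) (by positivity) hX
  · have hex : ∃ i, 2 * η ≤ 2 * h₀ * 2 ^ i := by
      refine ⟨η, ?_⟩
      have := (Nat.lt_two_pow_self (n := η)).le
      calc 2 * η ≤ 2 * 1 * 2 ^ η := by omega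
        _ ≤ _ := by gcongr
    classical
    -- The least scale with `L ≥ 2 η ≥ η + h₀`; by minimality also `L < 4 η ≤ 4 h`, so this scale
    -- has been processed.
    obtain ⟨i, hi, hmin⟩ : ∃ i, 2 * η ≤ 2 * h₀ * 2 ^ i ∧ ∀ j < i, ¬ 2 * η ≤ 2 * h₀ * 2 ^ j :=
      ⟨Nat.find hex, Nat.find_spec hex, fun j hj => Nat.find_min hex hj⟩
    have hi0 : i ≠ 0 := by
      rintro rfl
      rw [pow_zero, mul_one] at hi; omega
    obtain ⟨k, rfl⟩ : ∃ k, i = k + 1 := ⟨i - 1, by omega⟩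
    have h1 := hmin k (by omega)
    have hpow : 2 * h₀ * 2 ^ (k + 1) = 2 * (2 * h₀ * 2 ^ k) := by ring
    have h4 : 2 * h₀ * 2 ^ (k + 1) < 4 * η := by omega
    have h4h : 2 * h₀ * 2 ^ (k + 1) < 4 * h := by omega
    have h5 := key (k + 1) (hN _ h4h) (hc _ h4h) s t (η + h₀) (by omega)
    simp only [rate, Nat.succ_ne_zero, if_false] at h5
    set L := 2 * h₀ * 2 ^ (k + 1) with hL
    have hL0 : 0 < L := by omega
    -- The added one compensates the rounding of the quotient: the rate exceeds `4 h / L`, which is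
    -- at least `h / η`.
    have h6 : 4 * h < (4 * h / L + 1) * L := Nat.lt_mul_of_div_lt (Nat.lt_succ_self _) hL0
    have h7 : (h : ℝ) / η ≤ ((4 * h / L + 1 : ℕ) : ℝ) := by
      rw [div_le_iff₀ hη0]
      have h8 : (4 * h : ℝ) < ((4 * h / L + 1 : ℕ) : ℝ) * L := by exact_mod_cast h6
      have h9 : (L : ℝ) ≤ 4 * η := by exact_mod_cast h4.le
      have h10 := mul_le_mul_of_nonneg_left h9 (Nat.cast_nonneg (α := ℝ) (4 * h / L + 1))
      linarith
    rw [le_div_iff₀ (by positivity)]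
    calc (G.degBetweenness (τ.potential G) (η + h₀) s t : ℝ) * ((h : ℝ) / η)
        ≤ G.degBetweenness (τ.potential G) (η + h₀) s t * ((4 * h / L + 1 : ℕ) : ℝ) := by gcongr
      _ ≤ G.m := by rw [mul_comm]; exact_mod_cast h5

/-! ### Resource bounds -/

section
variable {n m h h₀ : ℕ}

theorem two_pow_size_le (hn : 1 ≤ n) : 2 ^ n.size ≤ 2 * n := by
  obtain ⟨k, hk⟩ : ∃ k, n.size = k + 1 :=
    ⟨n.size - 1, by have := Nat.size_pos.2 hn; omega⟩
  have : 2 ^ k ≤ n := Nat.lt_size.1 (by omega)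
  rw [hk, pow_succ]; omega

theorem size_le_self : n.size ≤ n := Nat.size_le.2 Nat.lt_two_pow_self

theorem two_le_size (hn : 2 ≤ n) : 2 ≤ n.size := Nat.lt_size.2 (by simpa using hn)

/-- From `2 ^ size ≤ 2 n ≤ n ^ 2` the length is at most `2 log n / log 2`, and `log 2 > 2 / 3`. -/
theorem size_le_log (hn : 2 ≤ n) : (n.size : ℝ) ≤ 3 * Real.log n := by
  have h1 : (2 : ℝ) ^ n.size ≤ 2 * n := by exact_mod_cast two_pow_size_le (by omega : 1 ≤ n)
  have hn0 : (0 : ℝ) < n := by exact_mod_cast (by omega : 0 < n)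
  have h2 := Real.log_le_log (by positivity) h1
  rw [Real.log_pow, Real.log_mul (by norm_num) hn0.ne'] at h2
  have h3 : Real.log 2 ≤ Real.log n := Real.log_le_log (by norm_num) (by exact_mod_cast hn)
  have h4 := Real.log_two_gt_d9
  nlinarith

theorem tree_words (hn : 2 ≤ n) : 2 * 2 ^ (20 * n.size) ≤ n ^ 41 := by
  calc 2 * 2 ^ (20 * n.size) = 2 * (2 ^ n.size) ^ 20 := by rw [mul_comm 20, pow_mul]
    _ ≤ n * (n * n) ^ 20 := by
      gcongr
      exact (two_pow_size_le (by omega)).trans (Nat.mul_le_mul_right _ hn)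
    _ = n ^ 41 := by ring

theorem mark_words (κ : ℕ) (hn : 2 ≤ n) (hm : m ≤ n ^ 2) (hh : h < m) :
    (16 + κ * n.size) * (m * (8 * h)) + 1 ≤ n ^ (9 * (8 + κ) + 5) := by
  have h1 : 16 + κ * n.size ≤ (8 + κ) * n := by
    have := Nat.mul_le_mul_left κ (size_le_self (n := n))
    nlinarith
  have h2 : m * h ≤ n ^ 4 := by
    calc m * h ≤ n ^ 2 * n ^ 2 := Nat.mul_le_mul hm (by omega)
      _ = n ^ 4 := by ring
  have h3 : 1 ≤ n ^ 4 * ((8 + κ) * n) := Nat.mul_pos (by positivity) (Nat.mul_pos (by omega) (by omega))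
  calc (16 + κ * n.size) * (m * (8 * h)) + 1
      ≤ ((8 + κ) * n) * (8 * n ^ 4) + n ^ 4 * ((8 + κ) * n) :=
        Nat.add_le_add (Nat.mul_le_mul h1 (by linarith)) h3
    _ = (9 * (8 + κ)) * n ^ 5 := by ring
    _ ≤ n ^ (9 * (8 + κ)) * n ^ 5 := by
      gcongr
      exact (Nat.lt_two_pow_self).le.trans (Nat.pow_le_pow_left hn _)
    _ = _ := by rw [pow_add]

/-- This shows that the tree has a leaf for every vertex number of every copy: as `h < m ≤ n ^ 2`,
these numbers are at most `64 n ^ 5`. -/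
theorem hub_words (hn : 2 ≤ n) (hm : m ≤ n ^ 2) (hh₀ : h₀ ≤ h) (hh : h < m) :
    n * (n + (2 * (2 * h₀) + 2) * n + 1 + m * (4 * h₀ + 1)) + 32 * (n * h) ≤
      2 ^ (20 * n.size) := by
  have hQ : n < 2 ^ n.size := Nat.lt_size_self _
  have hQ4 : 4 ≤ 2 ^ n.size := by
    calc 4 = 2 ^ 2 := rfl
      _ ≤ _ := Nat.pow_le_pow_right (by norm_num) (two_le_size hn)
  have e : ∀ i ≤ 5, n ^ i ≤ n ^ 5 := fun i hi => Nat.pow_le_pow_right (by omega) hi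
  have hh1 : h ≤ n ^ 2 := by omega
  calc n * (n + (2 * (2 * h₀) + 2) * n + 1 + m * (4 * h₀ + 1)) + 32 * (n * h)
      ≤ n * (n + (2 * (2 * n ^ 2) + 2) * n + 1 + n ^ 2 * (4 * n ^ 2 + 1)) + 32 * (n * n ^ 2) := by
        have : h₀ ≤ n ^ 2 := by omega
        gcongr
    _ = 4 * n ^ 5 + 4 * n ^ 4 + 33 * n ^ 3 + 3 * n ^ 2 + n ^ 1 := by ring
    _ ≤ 64 * n ^ 5 := by
        have := e 4 (by norm_num); have := e 3 (by norm_num)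
        have := e 2 (by norm_num); have := e 1 (by norm_num)
        omega
    _ ≤ (2 ^ n.size) ^ 3 * (2 ^ n.size) ^ 5 := by
        refine Nat.mul_le_mul ?_ (Nat.pow_le_pow_left hQ.le 5)
        calc 64 = 4 ^ 3 := rfl
          _ ≤ _ := Nat.pow_le_pow_left hQ4 3
    _ = 2 ^ (n.size * 8) := by rw [← pow_add, ← pow_mul]
    _ ≤ _ := Nat.pow_le_pow_right (by norm_num) (by omega)

theorem clog_le_size (hm : m ≤ n ^ 2) : Nat.clog 2 m ≤ 2 * n.size := by
  refine Nat.clog_le_of_le_pow (hm.trans ?_)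
  rw [mul_comm, pow_mul]
  exact Nat.pow_le_pow_left (Nat.lt_size_self _).le 2

/-- Bounds the number of scales: `L` doubles and stays below `4 h < 4 n ^ 2`. -/
theorem scale_lt (hm : m ≤ n ^ 2) (hh₀ : 1 ≤ h₀) (hh : h < m) {i : ℕ}
    (hi : 2 * h₀ * 2 ^ i < 4 * h) : i < 2 * n.size + 1 := by
  have h1 : n ^ 2 ≤ 2 ^ (2 * n.size) := by
    rw [mul_comm, pow_mul]
    exact Nat.pow_le_pow_left (Nat.lt_size_self _).le 2
  have h2 : 2 * 1 * 2 ^ i ≤ 2 * h₀ * 2 ^ i := by gcongr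
  refine (Nat.pow_lt_pow_iff_right (a := 2) (by norm_num)).1 ?_
  rw [pow_succ]; omega

/-- The constant in the bound on the number of steps, divided by 81. -/
def stepConst (κ : ℕ) : ℕ :=
  (174 * κ + 830) + 3 * (640 + 48 * 152 * (κ * (16 + κ)) + 370 * κ + 1) + 1000

theorem direct_steps (hn : 2 ≤ n) (hm : 1 ≤ m) (hh : m ≤ h) (κ : ℕ) :
    63 * n.size + 6 +
      (m * (dijkstraCost (20 * n.size) m + 4 * (20 * n.size) + 21) + 2 + 1) ≤
      stepConst κ * (n.size ^ 4 * (m * h)) := by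
  have hl := two_le_size hn
  set ℓ := n.size
  have hmh : m * m ≤ m * h := Nat.mul_le_mul_left _ hh
  have hmm : 1 ≤ m * m := Nat.mul_pos hm hm
  have h1 : dijkstraCost (20 * ℓ) m + 4 * (20 * ℓ) + 21 ≤ 600 * (ℓ * m) := by
    unfold dijkstraCost
    have : ℓ ≤ ℓ * m := Nat.le_mul_of_pos_right _ hm
    have : m ≤ ℓ * m := Nat.le_mul_of_pos_left _ (by omega)
    nlinarith
  calc _ ≤ 63 * ℓ + 6 + (m * (600 * (ℓ * m)) + 2 + 1) := by gcongr
    _ = 600 * (ℓ * (m * m)) + (63 * ℓ + 9) := by ring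
    _ ≤ 1000 * (ℓ * (m * m)) := by
      have : ℓ ≤ ℓ * (m * m) := Nat.le_mul_of_pos_right _ hmm
      omega
    _ ≤ stepConst κ * (ℓ ^ 4 * (m * h)) := by
      refine Nat.mul_le_mul (by unfold stepConst; omega) (Nat.mul_le_mul ?_ hmh)
      exact Nat.le_self_pow (by norm_num) ℓ

theorem scale_steps (hn : 2 ≤ n) (κ : ℕ) :
    scaleCost (κ * n.size) (20 * n.size) m h ≤
      (640 + 48 * 152 * (κ * (16 + κ)) + 370 * κ) * (n.size ^ 3 * (m * h)) := by
  have hl := two_le_size hn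
  set ℓ := n.size
  rw [scaleCost, ← mul_assoc _ (ℓ ^ 3)]
  refine Nat.mul_le_mul_right _ ?_
  have a1 : 16 + κ * ℓ ≤ (16 + κ) * ℓ := by nlinarith
  have a2 : 7 * (20 * ℓ) + 12 ≤ 152 * ℓ := by omega
  have a3 : 16 * (20 * ℓ) + 50 ≤ 370 * ℓ := by omega
  have a4 : 1 ≤ ℓ ^ 3 := Nat.one_le_pow _ _ (by omega)
  have a5 : ℓ * ℓ ≤ ℓ ^ 3 := by
    rw [← pow_two]; exact Nat.pow_le_pow_right (by omega) (by norm_num)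
  calc 640 + 48 * (κ * ℓ) * (16 + κ * ℓ) * (7 * (20 * ℓ) + 12) + κ * ℓ * (16 * (20 * ℓ) + 50)
      ≤ 640 * 1 + 48 * (κ * ℓ) * ((16 + κ) * ℓ) * (152 * ℓ) + κ * ℓ * (370 * ℓ) := by gcongr
    _ = 640 * 1 + 48 * 152 * (κ * (16 + κ)) * ℓ ^ 3 + 370 * κ * (ℓ * ℓ) := by ring
    _ ≤ 640 * ℓ ^ 3 + 48 * 152 * (κ * (16 + κ)) * ℓ ^ 3 + 370 * κ * ℓ ^ 3 := by gcongr
    _ = _ := by ring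

/-- The four logarithmic factors are: the number of scales, the factor `K` in the number of repairs,
the factor `K` in the number of edges, and the height of the tree. -/
theorem total_steps (hn : 2 ≤ n) (hm : m ≤ n ^ 2) (hh₀ : 1 ≤ h₀) (hh : h₀ ≤ h) (hhm : h < m)
    (κ : ℕ) :
    63 * n.size + 6 +
      ((3 * Nat.clog 2 m + (6 * h₀ * n.size + 24 * n.size + 54)) +
        totalCost (κ * n.size) (20 * n.size) m h (2 * n.size + 1) + 1) ≤
      stepConst κ * (n.size ^ 4 * (m * h)) := by
  have hl := two_le_size hn
  have hc := clog_le_size (n := n) hm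
  have hs := scale_steps (m := m) (h := h) hn κ
  set ℓ := n.size
  set S := 640 + 48 * 152 * (κ * (16 + κ)) + 370 * κ with hS
  have hM : 1 ≤ m * h := Nat.mul_pos (by omega) (by omega)
  have hhM : h₀ ≤ m * h := hh.trans (Nat.le_mul_of_pos_left _ (by omega))
  rw [totalCost]
  set M := m * h
  have p2 : ℓ ^ 2 ≤ ℓ ^ 4 := Nat.pow_le_pow_right (by omega) (by norm_num)
  have p1 : ℓ ≤ ℓ ^ 4 := Nat.le_self_pow (by norm_num) ℓ
  have p3 : 1 ≤ ℓ ^ 3 * M := Nat.mul_pos (by positivity) hM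
  have p4 : ℓ ≤ ℓ ^ 4 * M := p1.trans (Nat.le_mul_of_pos_right _ hM)
  have p5 : h₀ * ℓ ≤ ℓ ^ 4 * M := by
    rw [mul_comm]; exact Nat.mul_le_mul p1 hhM
  have q1 : (κ * ℓ * (8 * (20 * ℓ) + 14) + 830) * M ≤ (174 * κ + 830) * (ℓ ^ 4 * M) := by
    rw [← mul_assoc _ (ℓ ^ 4)]
    refine Nat.mul_le_mul_right _ ?_
    calc κ * ℓ * (8 * (20 * ℓ) + 14) + 830
        ≤ κ * ℓ * (174 * ℓ) + 830 * 1 := by gcongr; omega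
      _ = 174 * κ * ℓ ^ 2 + 830 * 1 := by ring
      _ ≤ 174 * κ * ℓ ^ 4 + 830 * ℓ ^ 4 := by
        gcongr; exact Nat.one_le_pow _ _ (by omega)
      _ = _ := by ring
  have q2 : (2 * ℓ + 1) * (scaleCost (κ * ℓ) (20 * ℓ) m h + 1) ≤ 3 * (S + 1) * (ℓ ^ 4 * M) := by
    calc _ ≤ (3 * ℓ) * (S * (ℓ ^ 3 * M) + ℓ ^ 3 * M) := by gcongr; omega
      _ = _ := by ring
  have q3 : stepConst κ * (ℓ ^ 4 * M) = (174 * κ + 830) * (ℓ ^ 4 * M) +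
      3 * (S + 1) * (ℓ ^ 4 * M) + 1000 * (ℓ ^ 4 * M) := by
    rw [stepConst, hS]; ring
  have q4 : 6 * h₀ * ℓ = 6 * (h₀ * ℓ) := by ring
  rw [q3, q4]
  omega

theorem steps_le_log {κ t : ℕ} (hn : 2 ≤ n) (ht : t ≤ stepConst κ * (n.size ^ 4 * (m * h))) :
    (t : ℝ) ≤ ((81 * stepConst κ : ℕ) : ℝ) * (m * h) * Real.log n ^ 4 := by
  have h1 : (t : ℝ) ≤ stepConst κ * ((n.size : ℝ) ^ 4 * (m * h)) := by exact_mod_cast ht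
  have h2 : (n.size : ℝ) ^ 4 ≤ (3 * Real.log n) ^ 4 := by gcongr; exact size_le_log hn
  calc (t : ℝ) ≤ stepConst κ * ((n.size : ℝ) ^ 4 * (m * h)) := h1
    _ ≤ stepConst κ * ((3 * Real.log n) ^ 4 * (m * h)) := by gcongr
    _ = _ := by push_cast; ring

/-- Half of `K` is `(c + 8) size n`, and `exp (size n) ≥ 2 ^ size n ≥ n`. The surplus `8 = 3 + 2 +
3` pays for the scales, the pairs of vertices and the cardinalities. -/
theorem failure_le (c : ℕ) (hn : 2 ≤ n) (hm : m ≤ n ^ 2) :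
    ((2 * n.size + 1 : ℕ) : ℝ) * ((n : ℝ) ^ 2 * (m + 1) *
      Real.exp (-(((2 * (c + 8) * n.size : ℕ) : ℝ) / 2))) ≤ ((n : ℝ) ^ c)⁻¹ := by
  have hn0 : (0 : ℝ) < n := by exact_mod_cast (by omega : 0 < n)
  have h1 : ((2 * n.size + 1 : ℕ) : ℝ) ≤ (n : ℝ) ^ 3 := by
    have := size_le_self (n := n)
    have : 2 * n + 1 ≤ n ^ 3 := by
      calc 2 * n + 1 ≤ 4 * n := by omega
        _ ≤ (n * n) * n := Nat.mul_le_mul_right _ (Nat.mul_le_mul hn hn)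
        _ = n ^ 3 := by ring
    exact_mod_cast (by omega : 2 * n.size + 1 ≤ n ^ 3)
  have h2 : (m + 1 : ℝ) ≤ (n : ℝ) ^ 3 := by
    have : n ^ 2 + 1 ≤ n ^ 3 := by nlinarith [Nat.pow_le_pow_left hn 2]
    exact_mod_cast (by omega : m + 1 ≤ n ^ 3)
  have h3 : Real.exp (-(((2 * (c + 8) * n.size : ℕ) : ℝ) / 2)) ≤ ((n : ℝ) ^ (c + 8))⁻¹ := by
    rw [Real.exp_neg]
    refine inv_anti₀ (by positivity) ?_
    have e1 : (((2 * (c + 8) * n.size : ℕ) : ℝ) / 2) = ((c + 8 : ℕ) : ℝ) * n.size := by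
      push_cast; ring
    rw [e1, Real.exp_nat_mul]
    refine pow_le_pow_left₀ hn0.le ?_ _
    calc (n : ℝ) ≤ (2 : ℝ) ^ n.size := by exact_mod_cast (Nat.lt_size_self n).le
      _ ≤ Real.exp 1 ^ n.size := by
        gcongr
        have := Real.add_one_le_exp (1 : ℝ); linarith
      _ = Real.exp n.size := by rw [← Real.exp_nat_mul, mul_one]
  calc _ ≤ (n : ℝ) ^ 3 * ((n : ℝ) ^ 2 * (n : ℝ) ^ 3 * ((n : ℝ) ^ (c + 8))⁻¹) := by gcongr
    _ = _ := by rw [pow_add]; field_simp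

end

/-! ### The algorithm as a whole -/

section
variable {O : Oracle} {G : WDigraph} {h₀ h W : ℕ} {α : ℝ}

theorem algorithm_direct (κ : ℕ) (hn : 2 ≤ G.n) (hm : 1 ≤ G.m) (hhm : ¬ h < G.m)
    (hW : G.n ^ 41 ≤ W) (ω : ℕ → Bool) :
    Spec O ω W (algorithm κ) (input G h₀ h α) (stepConst κ * (G.n.size ^ 4 * (G.m * h)))
      (Direct G) := by
  have hP := (tree_words hn).trans hW
  have h1 : G.n < 2 ^ G.n.size := Nat.lt_size_self _
  have h2 : 2 ^ G.n.size ≤ 2 ^ (20 * G.n.size) := Nat.pow_le_pow_right (by norm_num) (by omega)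
  refine (Spec.seq (start_spec hP) (U := G.m * (dijkstraCost (20 * G.n.size) G.m +
    4 * (20 * G.n.size) + 21) + 2 + 1) fun τ hτ _ => Spec.cond (fun hb => ?_) fun _ => ?_).mono
    (direct_steps hn hm (not_lt.1 hhm) κ) fun _ h => h
  · simp only [BExpr.eval, IExpr.eval, hτ.inp.r3, hτ.inp.r1] at hb
    exact absurd hb hhm
  · refine addAll_spec rfl hP τ hτ (by omega) (by omega) ?_
    calc G.m + 1 ≤ G.n ^ 2 + 1 := Nat.succ_le_succ G.m_le
      _ ≤ G.n ^ 3 := by nlinarith [Nat.pow_le_pow_left hn 2]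
      _ ≤ G.n ^ 41 := Nat.pow_le_pow_right (by omega) (by norm_num)
      _ ≤ W := hW

theorem algorithm_scales (κ : ℕ) (hO : O.Correct) (hn : 2 ≤ G.n) (hh₀ : 1 ≤ h₀) (hh : h₀ ≤ h)
    (hα : 0 < α) (hhm : h < G.m) (hW : G.n ^ (9 * (8 + κ) + 46) ≤ W) :
    ∃ B : ℕ, (B : ℝ) ≤ 4 * ((h : ℝ) / h₀) ^ (1 / α) ∧
      (((h : ℝ) / h₀) ^ (1 / α) ≤ B ∨ G.m < B) ∧
      ∀ ω, Spec O ω W (algorithm κ) (input G h₀ h α)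
        (stepConst κ * (G.n.size ^ 4 * (G.m * h))) (Outcome ω G h₀ h (κ * G.n.size) B) := by
  have hP := (tree_words hn).trans ((Nat.pow_le_pow_right (by omega)
    (by omega : 41 ≤ 9 * (8 + κ) + 46)).trans hW)
  have hM := (mark_words κ hn G.m_le hhm).trans ((Nat.pow_le_pow_right (by omega)
    (by omega : 9 * (8 + κ) + 5 ≤ 9 * (8 + κ) + 46)).trans hW)
  have hmh : 1 ≤ G.m * h := Nat.mul_pos (by omega) (by omega)
  have e : (16 + κ * G.n.size) * (G.m * (8 * h)) = 128 * (G.m * h) +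
      8 * (κ * G.n.size * (G.m * h)) := by ring
  have hκ : κ * G.n.size ≤ κ * G.n.size * (G.m * h) := Nat.le_mul_of_pos_right _ hmh
  -- The deterministic prefix is run once with arbitrary bits, so that `B` is fixed before `ω` is
  -- chosen.
  obtain ⟨τ₁, t₁, r₁, ht₁, hτ₁⟩ :=
    start_spec (O := O) (ω := fun _ => false) (G := G) (h₀ := h₀) (h := h) (α := α) hP
  obtain ⟨τ₂, t₂, r₂, ht₂, B, hR, hB1, hB2, hB3⟩ := setup_spec (O := O) (ω := fun _ => false)
    (W := W) (κ := κ) τ₁ hτ₁ (by omega) hh₀ hh hα hhm (by omega) (by omega)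
  refine ⟨B, hB2, hB3, fun ω => (Spec.after_run (r₁.change_bits rfl) ht₁ (Spec.cond (fun _ =>
    Spec.after_run (r₂.change_bits rfl) ht₂ (allScales_spec hO rfl hP τ₂ hR hn hh₀ hh hhm hB1
      (hub_words hn G.m_le hh hhm) hM
      ((clog_le_size G.m_le).trans (by omega)) fun i => scale_lt G.m_le hh₀ hhm))
    fun hb => ?_)).mono (total_steps hn G.m_le hh₀ hh hhm κ) fun _ h => h⟩
  simp only [BExpr.eval, IExpr.eval, hτ₁.inp.r3, hτ₁.inp.r1] at hb
  exact absurd hhm hb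

theorem Outcome.query_size {κ B : ℕ} {ω : ℕ → Bool} {τ : State} {H : WDigraph}
    (hτ : Outcome ω G h₀ h (κ * G.n.size) B τ) (hH : H ∈ τ.calls) (hn : 2 ≤ G.n) (hh₀ : 1 ≤ h₀)
    (hB : (B : ℝ) ≤ 4 * ((h : ℝ) / h₀) ^ (1 / α)) :
    H.m ≤ 81 * stepConst κ * (G.m * h₀) ∧ (H.numNeg : ℝ) ≤
      ((81 * stepConst κ : ℕ) : ℝ) * (((h : ℝ) / h₀) ^ (1 / α) * Real.log G.n) := by
  obtain ⟨h1, h2⟩ := hτ.size H hH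
  have hA : 1000 + κ ≤ stepConst κ := by unfold stepConst; omega
  constructor
  · calc H.m = G.m * (16 * h₀ + 4) := by rw [h1]; ring
      _ ≤ G.m * (20 * h₀) := by gcongr; omega
      _ = 20 * (G.m * h₀) := by ring
      _ ≤ _ := Nat.mul_le_mul_right _ (by omega)
  · have h3 : (H.numNeg : ℝ) ≤ κ * G.n.size * B := by exact_mod_cast h2
    have h4 := size_le_log hn
    have hX : 0 ≤ ((h : ℝ) / h₀) ^ (1 / α) := by positivity
    have hL : 0 ≤ Real.log G.n := Real.log_natCast_nonneg _
    calc (H.numNeg : ℝ) ≤ κ * G.n.size * B := h3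
      _ ≤ κ * (3 * Real.log G.n) * (4 * ((h : ℝ) / h₀) ^ (1 / α)) := by gcongr
      _ = ((12 * κ : ℕ) : ℝ) * (((h : ℝ) / h₀) ^ (1 / α) * Real.log G.n) := by push_cast; ring
      _ ≤ _ := by gcongr <;> omega

theorem coins_failure_le {c B : ℕ} {P : Cmd} {T : ℕ} {σ : State} (hn : 2 ≤ G.n) (hm : 1 ≤ G.m)
    (hh₀ : 1 ≤ h₀) (hh : h₀ ≤ h) (hα : 0 < α) (hα1 : α ≤ 1) (hhm : h < G.m)
    (hB : ((h : ℝ) / h₀) ^ (1 / α) ≤ B ∨ G.m < B)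
    (hP : ∀ ω, Spec O ω W P σ T (Outcome ω G h₀ h (2 * (c + 8) * G.n.size) B)) :
    coins {ω | ∃ (τ : State) (t : ℕ), Run O ω W P σ τ t ∧
      ¬ τ.Declares ∧ ¬ G.LowBetweenness h₀ h α (τ.potential G)} ≤ ((G.n : ℝ≥0∞) ^ c)⁻¹ := by
  set K := 2 * (c + 8) * G.n.size with hK
  set N := 2 * G.n.size + 1 with hN
  let F : ℕ → Set (ℕ → Bool) := fun i => Missed G (2 * h₀ * 2 ^ i) (rate B h h₀ i)
    (blocks K B h h₀ i) (blocks K B h h₀ i + K * rate B h h₀ i)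
  have hsub : {ω | ∃ (τ : State) (t : ℕ), Run O ω W P σ τ t ∧
      ¬ τ.Declares ∧ ¬ G.LowBetweenness h₀ h α (τ.potential G)} ⊆ ⋃ i ∈ Finset.range N, F i := by
    rintro ω ⟨τ, t, hr, hd, hlow⟩
    by_contra hω
    obtain ⟨τ', t', hr', -, hτ⟩ := hP ω
    obtain ⟨rfl, -⟩ := hr'.unique hr
    refine hlow (hτ.lowBetweenness (not_not.1 hd) hh₀ hh hα hα1 hB (Nat.succ_pos _)
      (fun i => scale_lt G.m_le hh₀ hhm) fun i hi hmem => hω ?_)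
    exact Set.mem_biUnion (Finset.mem_coe.2 (Finset.mem_range.2 hi)) hmem
  calc _ ≤ coins (⋃ i ∈ Finset.range N, F i) := MeasureTheory.measure_mono hsub
    _ ≤ ∑ i ∈ Finset.range N, coins (F i) := MeasureTheory.measure_biUnion_finset_le _ _
    _ ≤ ∑ i ∈ Finset.range N,
        ENNReal.ofReal (G.n ^ 2 * (G.m + 1) * Real.exp (-((K : ℝ) / 2))) :=
      Finset.sum_le_sum fun i _ => coins_missed_le hm _ _ _ _
    _ = ENNReal.ofReal (N * (G.n ^ 2 * (G.m + 1) * Real.exp (-((K : ℝ) / 2)))) := by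
      rw [Finset.sum_const, Finset.card_range, nsmul_eq_mul,
        ENNReal.ofReal_mul (Nat.cast_nonneg _), ENNReal.ofReal_natCast]
    _ ≤ ENNReal.ofReal (((G.n : ℝ) ^ c)⁻¹) := ENNReal.ofReal_le_ofReal (failure_le c hn G.m_le)
    _ = _ := by
      have : (0 : ℝ) < G.n := by exact_mod_cast (by omega : 0 < G.n)
      rw [ENNReal.ofReal_inv_of_pos (by positivity), ENNReal.ofReal_pow this.le,
        ENNReal.ofReal_natCast]

end

end HopBw

end

/-- For every exponent `c` (failure probability `n ^ (-c)`) there is a program `P`.  Words have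
`O(log (n + h))` bits; the resource bounds, the soundness of a declared negative cycle and the
validity of the potential hold for all random bits, the betweenness guarantees with high
probability. -/
theorem lemmaA1 (c : ℕ) :
    ∃ (P : Cmd) (C k κ : ℕ), ∀ (G : WDigraph) (h₀ h : ℕ) (α : ℝ) (O : Oracle),
      2 ≤ G.n → 1 ≤ G.m → 1 ≤ h₀ → h₀ ≤ h → 0 < α → α ≤ 1 → O.Correct →
      (∀ ω : ℕ → Bool, ∃ (σ : State) (t : ℕ),
        Run O ω ((G.n + h) ^ κ) P (input G h₀ h α) σ t ∧
        (t : ℝ) ≤ C * (G.m * h) * Real.log G.n ^ k ∧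
        σ.calls.length ≤ 1 ∧
        (∀ H ∈ σ.calls,
          H.m ≤ C * (G.m * h₀) ∧
          (H.numNeg : ℝ) ≤ C * (((h : ℝ) / h₀) ^ (1 / α) * Real.log G.n)) ∧
        (σ.Declares → G.HasNegCycle) ∧
        (¬ σ.Declares → G.Valid (σ.potential G))) ∧
      coins {ω | ∃ (σ : State) (t : ℕ),
        Run O ω ((G.n + h) ^ κ) P (input G h₀ h α) σ t ∧
        ¬ σ.Declares ∧ ¬ G.LowBetweenness h₀ h α (σ.potential G)} ≤ ((G.n : ℝ≥0∞) ^ c)⁻¹ := by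
  -- The number of draws per unit of rate is `K` times the binary length of `n`; the value is the
  -- one required by `failure_le`.
  set K := 2 * (c + 8)
  refine ⟨algorithm K, 81 * stepConst K, 4, 9 * (8 + K) + 46,
    fun G h₀ h α O hn hm hh₀ hh hα hα1 hO => ?_⟩
  have hW : G.n ^ (9 * (8 + K) + 46) ≤ (G.n + h) ^ (9 * (8 + K) + 46) :=
    Nat.pow_le_pow_left (Nat.le_add_right _ _) _
  by_cases hhm : h < G.m
  · obtain ⟨B, hB1, hB2, hP⟩ := algorithm_scales K hO hn hh₀ hh hα hhm hW
    refine ⟨fun ω => ?_, coins_failure_le hn hm hh₀ hh hα hα1 hhm hB2 hP⟩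
    obtain ⟨τ, t, hr, ht, hτ⟩ := hP ω
    exact ⟨τ, t, hr, steps_le_log hn ht, hτ.calls, fun H hH => hτ.query_size hH hn hh₀ hB1,
      hτ.sound, fun hd => hτ.valid (not_not.1 hd)⟩
  · have hP := algorithm_direct (O := O) (h₀ := h₀) (α := α) K hn hm hhm
      ((Nat.pow_le_pow_right (by omega) (by omega : 41 ≤ 9 * (8 + K) + 46)).trans hW)
    refine ⟨fun ω => ?_, ?_⟩
    · obtain ⟨τ, t, hr, ht, hτ⟩ := hP ω
      refine ⟨τ, t, hr, steps_le_log hn ht, by simp [hτ.calls], by simp [hτ.calls],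
        hτ.sound, fun hd e _ => hτ.feas (not_not.1 hd) e⟩
    · have : {ω | ∃ (σ : State) (t : ℕ),
          Run O ω ((G.n + h) ^ (9 * (8 + K) + 46)) (algorithm K) (input G h₀ h α) σ t ∧
          -- For `h ≥ m` the output has no negative edge at all, so the algorithm never fails.
          ¬ σ.Declares ∧ ¬ G.LowBetweenness h₀ h α (σ.potential G)} = ∅ := by
        refine Set.eq_empty_of_forall_notMem ?_
        rintro ω ⟨τ, t, hr, hd, hlow⟩
        obtain ⟨τ', t', hr', -, hτ⟩ := hP ω
        obtain ⟨rfl, -⟩ := hr'.unique hr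
        exact hlow (lowBetweenness_of_isPotential (hτ.feas (not_not.1 hd)))
      rw [this, MeasureTheory.measure_empty]
      exact zero_le
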